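/- **Theorem (Alexander type theorem for singular twisted links).** Every oriented singular twisted link is represented by the closure of a singular twisted virtual braid diagram. Here an *oriented singular twisted link diagram* consists of finitely many oriented closed polygonal curves in $\mathbb{R}^2$ in general position (the only multiple points are finitely many transverse double points, interior to edges), where each double point is marked as a positive, negative, virtual or singular crossing, and where finitely many points of the curves other than double points (taken to be vertices; a vertex may be a straight angle) carry a *bar*. Two diagrams are *equivalent* if they are related by a finite sequence of planar isotopies and the following moves and their inverses, performed in a disk that meets nothing else of the diagram, for all orientations of the strands: * the first, second and third Reidemeister moves with classical crossings only, and those with virtual crossings only; * the third Reidemeister moves in which a strand with two virtual crossings is moved past a classical or a singular crossing of two other strands, and those in which a strand lying over both, or under both, of two other strands is moved past their singular crossing; * interchanging a singular crossing and a classical crossing that are consecutive on the same two strands ($\tau\sigma^{\pm1}\leftrightarrow\sigma^{\pm1}\tau$); * sliding a bar through a virtual crossing; creating or cancelling two consecutive bars on a strand; and replacing a classical or singular crossing with bars on all its four ends by the sequence of a virtual crossing, a crossing of the same kind (positive, negative or singular) and a virtual crossing of the same two strands, without bars ($\gamma\gamma\,\sigma^{\pm1}\gamma\gamma\leftrightarrow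 v\sigma^{\pm1}v$, $\gamma\gamma\,\tau\,\gamma\gamma\leftrightarrow v\tau v$). An *oriented singular twisted link* is an equivalence class of such diagrams (the empty link is allowed, and is the closure of the braid on $0$ strands). A *singular twisted virtual braid diagram on $n$ strands* is a union of $n$ polygonal curves in general position, oriented downwards and strictly monotone in the second coordinate, that join the points $(1,1),\dots,(n,1)$ to the points $(1,0),\dots,(n,0)$ in some order, with each double point marked as a positive, negative, virtual or singular crossing, and with bars at finitely many points other than the endpoints and the double points. Its *closure* is the link diagram obtained by joining $(i,0)$ to $(i,1)$, for $i=1,\dots,n$, by parallel (nested, pairwise disjoint) arcs without crossings and bars that pass to the right of the braid. The theorem says: for every oriented singular twisted link $L$ there are $n$ and a singular twisted virtual braid diagram $b$ on $n$ strands such that the closure of $b$ represents $L$. -/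

import Mathlib

/-! Oriented singular twisted link diagrams and singular twisted virtual braid diagrams, drawn as
polygonal curves in the plane.

A diagram is given by the finite set of its oriented straight edges.  A vertex may be a straight
angle, so that a bar can always be taken to sit at a vertex of the polygon. -/

namespace STLink

/-- Points of the plane. -/
abbrev Pt := ℝ × ℝ

/-- An oriented straight edge, from its first to its second endpoint. -/
abbrev Edge := Pt × Pt

/-- The closed segment of an edge. -/
def seg (e : Edge) : Set Pt := segment ℝ e.1 e.2

/-- The edge without its endpoints. -/
def openSeg (e : Edge) : Set Pt := openSegment ℝ e.1 e.2

/-- The direction of an oriented edge. -/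
def dir (e : Edge) : Pt := e.2 - e.1

/-- The determinant of two plane vectors: positive if `v` points to the left of `u`. -/
def det (u v : Pt) : ℝ := u.1 * v.2 - u.2 * v.1

/-- The information carried by a double point of oriented curves. -/
inductive Kind where
  | positive
  | negative
  | virtual
  | singular

/-- Classical crossings are the positive and the negative ones. -/
def Kind.Classical (k : Kind) : Prop := k = .positive ∨ k = .negative

/-- At a crossing of kind `k` of strands with directions `u` and `v`, the crossing is classical and
the strand with direction `u` passes over the other one.  At a positive crossing, the under-strand
runs from right to left as seen from the over-strand. -/
def Over (k : Kind) (u v : Pt) : Prop :=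
  (k = .positive ∧ 0 < det u v) ∨ (k = .negative ∧ det u v < 0)

/-- `x` is a common interior point of the two distinct edges `e` and `f` of `E`. -/
def CrossAt (E : Set Edge) (e f : Edge) (x : Pt) : Prop :=
  e ∈ E ∧ f ∈ E ∧ e ≠ f ∧ x ∈ openSeg e ∧ x ∈ openSeg f

/-- General position: no edge is traversed back, no vertex lies on an edge of which it is not an
endpoint, and there are no triple points.  Together with the condition that every vertex has at most
one incoming and at most one outgoing edge, this says that the curves meet in transverse double
points only, which are interior to edges. -/
structure Generic (E : Set Edge) : Prop where
  no_reverse : ∀ a b, (a, b) ∈ E → (b, a) ∉ E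
  start_off : ∀ e ∈ E, ∀ f ∈ E, e.1 ∈ seg f → e.1 = f.1 ∨ e.1 = f.2
  end_off : ∀ e ∈ E, ∀ f ∈ E, e.2 ∈ seg f → e.2 = f.1 ∨ e.2 = f.2
  no_triple : ∀ e f g x, CrossAt E e f x → CrossAt E e g x → f = g

/-- An oriented singular twisted link diagram: finitely many oriented closed polygons in general
position, with bars at some vertices, and a kind for each double point (the values of `kind` at the
other points of the plane are irrelevant). -/
structure Diagram where
  E : Set Edge
  finite : E.Finite
  next : ∀ e ∈ E, ∃! f, f ∈ E ∧ f.1 = e.2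
  prev : ∀ e ∈ E, ∃! f, f ∈ E ∧ f.2 = e.1
  generic : Generic E
  bars : Set Pt
  bars_vertex : ∀ v ∈ bars, ∃ e ∈ E, e.1 = v
  kind : Pt → Kind

/-- The crossings between edges common to both diagrams have the same kind in both. -/
def KeepsKinds (D D' : Diagram) : Prop :=
  ∀ e f x, CrossAt D.E e f x → CrossAt D'.E e f x → D'.kind x = D.kind x

/-- No crossing lies on the edge `e`. -/
def Free (D : Diagram) (e : Edge) : Prop := ∀ f x, ¬ CrossAt D.E e f x

/-- `D'` arises from `D` by replacing the edge from `a` to `b` by the edges from `a` to `c` and from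
`c` to `b`, where `a b c` is a genuine triangle, and apart from the edges in `S` no other edge meets
the closed triangle except at `a` and `b`.  The bars and the kinds of all crossings away from the
replaced edge stay. -/
structure TriangleMove (D D' : Diagram) (a b c : Pt) (S : Set Edge) : Prop where
  mem : (a, b) ∈ D.E
  nondegenerate : det (b - a) (c - a) ≠ 0
  edges : D'.E = (D.E \ {(a, b)}) ∪ {(a, c), (c, b)}
  bars : D'.bars = D.bars
  kinds : KeepsKinds D D'
  others : ∀ g ∈ D.E, g ≠ (a, b) → g ∉ S → seg g ∩ convexHull ℝ {a, b, c} ⊆ {a, b}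

/-- A strand with direction `u` can be moved past the crossing, of kind `kvw`, of strands with
directions `v` and `w`: it crosses both virtually, or the crossing of the two is classical or
singular, and the strand is over both or under both. -/
def Passes (u v w : Pt) (kuv kuw kvw : Kind) : Prop :=
  (kuv = .virtual ∧ kuw = .virtual) ∨
  (kvw ≠ .virtual ∧
    ((Over kuv u v ∧ Over kuw u w) ∨ (Over kuv v u ∧ Over kuw w u)))

/-- The triangles of crossings at which a third Reidemeister move (classical, virtual, or with a
singular crossing) is allowed: one of the three strands can be moved past the crossing of the other
two. -/
def ThirdMoveAllowed (u v w : Pt) (kuv kuw kvw : Kind) : Prop :=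
  Passes u v w kuv kuw kvw ∨ Passes v u w kuv kvw kuw ∨ Passes w u v kuw kvw kuv

/-- One elementary move of oriented singular twisted link diagrams: an elementary planar isotopy, or
one of the extended Reidemeister moves. -/
inductive Move : Diagram → Diagram → Prop
  /-- The diagrams coincide (the values of `kind` away from the double points do not matter). -/
  | same (D D' : Diagram) (hE : D'.E = D.E) (hB : D'.bars = D.bars) (hK : KeepsKinds D D') :
      Move D D'
  /-- Planar isotopy: a new vertex on an edge. -/
  | subdivide (D D' : Diagram) (a b c : Pt) (hab : (a, b) ∈ D.E) (hc : c ∈ openSeg (a, b))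
      (hE : D'.E = (D.E \ {(a, b)}) ∪ {(a, c), (c, b)}) (hB : D'.bars = D.bars)
      (hK : ∀ e f x, CrossAt D.E e f x → D'.kind x = D.kind x) :
      Move D D'
  /-- Planar isotopy: an edge is pushed across an empty triangle. -/
  | push (D D' : Diagram) (a b c : Pt) (h : TriangleMove D D' a b c ∅) :
      Move D D'
  /-- Planar isotopy: an edge is pushed across a triangle, and its crossing with another edge, which
  runs straight through the triangle, slides along this other edge. -/
  | pushCrossing (D D' : Diagram) (a b c : Pt) (e : Edge) (x x' : Pt)
      (h : TriangleMove D D' a b c {e})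
      (hx : CrossAt D.E (a, b) e x)
      (hx' : CrossAt D'.E (a, c) e x' ∨ CrossAt D'.E (c, b) e x')
      (hk : D'.kind x' = D.kind x) :
      Move D D'
  /-- Planar isotopy: a bar slides along an edge without crossings. -/
  | slideBar (D D' : Diagram) (v w : Pt) (hvw : (v, w) ∈ D.E) (hfree : Free D (v, w))
      (hv : v ∈ D.bars) (hw : w ∉ D.bars)
      (hE : D'.E = D.E) (hB : D'.bars = (D.bars \ {v}) ∪ {w}) (hK : KeepsKinds D D') :
      Move D D'
  /-- First Reidemeister moves, classical and virtual: a kink is added, whose loop is crossed by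
  nothing else and carries no bar. -/
  | kink (D D' : Diagram) (a b c d x : Pt)
      (h : TriangleMove D D' a b c {(b, d)})
      (hb : b ∉ D.bars)
      (hx : CrossAt D'.E (a, c) (b, d) x)
      (hk : D'.kind x ≠ .singular) :
      Move D D'
  /-- Second Reidemeister moves, classical and virtual: the moved strand gets two new crossings with
  an edge running straight through the triangle.  The new crossings are both virtual, or of opposite
  signs (which says that the same strand is over at both). -/
  | bigon (D D' : Diagram) (a b c : Pt) (e : Edge) (x y : Pt)
      (h : TriangleMove D D' a b c {e})
      (hx : CrossAt D'.E (a, c) e x) (hy : CrossAt D'.E (c, b) e y)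
      (hk : (D'.kind x = .virtual ∧ D'.kind y = .virtual) ∨
        (D'.kind x = .positive ∧ D'.kind y = .negative) ∨
        (D'.kind x = .negative ∧ D'.kind y = .positive)) :
      Move D D'
  /-- Third Reidemeister moves, classical, virtual, mixed and singular: a strand crossing the edges
  `e` and `f` is moved past the crossing of `e` and `f`, which lies in the triangle. -/
  | third (D D' : Diagram) (a b c : Pt) (e f : Edge) (x y z x' y' : Pt)
      (h : TriangleMove D D' a b c {e, f})
      (hx : CrossAt D.E (a, b) e x) (hy : CrossAt D.E (a, b) f y)
      (hz : CrossAt D.E e f z) (hzT : z ∈ convexHull ℝ {a, b, c})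
      (hx' : CrossAt D'.E (a, c) e x' ∨ CrossAt D'.E (c, b) e x')
      (hy' : CrossAt D'.E (a, c) f y' ∨ CrossAt D'.E (c, b) f y')
      (hkx : D'.kind x' = D.kind x) (hky : D'.kind y' = D.kind y)
      (hk : ThirdMoveAllowed (b - a) (dir e) (dir f) (D.kind x) (D.kind y) (D.kind z)) :
      Move D D'
  /-- A singular and a classical crossing forming an empty bigon are interchanged. -/
  | singularFlip (D D' : Diagram) (e : Edge) (r u s x y : Pt)
      (hru : CrossAt D.E (r, u) e x) (hus : CrossAt D.E (u, s) e y)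
      (hu : u ∉ D.bars)
      (hempty : ∀ g ∈ D.E, g ≠ e → g ≠ (r, u) → g ≠ (u, s) →
        Disjoint (seg g) (convexHull ℝ {x, u, y}))
      (hkx : D.kind x = .singular) (hky : (D.kind y).Classical)
      (hE : D'.E = D.E) (hB : D'.bars = D.bars)
      (hkx' : D'.kind x = D.kind y) (hky' : D'.kind y = .singular)
      (hK : ∀ g g' z, CrossAt D.E g g' z → z ≠ x → z ≠ y → D'.kind z = D.kind z) :
      Move D D'
  /-- A bar slides through a virtual crossing. -/
  | barVirtual (D D' : Diagram) (v w : Pt) (f : Edge) (x : Pt)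
      (hx : CrossAt D.E (v, w) f x) (hk : D.kind x = .virtual)
      (honly : ∀ g y, CrossAt D.E (v, w) g y → y = x)
      (hv : v ∈ D.bars) (hw : w ∉ D.bars)
      (hE : D'.E = D.E) (hB : D'.bars = (D.bars \ {v}) ∪ {w}) (hK : KeepsKinds D D') :
      Move D D'
  /-- Two consecutive bars cancel. -/
  | barCancel (D D' : Diagram) (v w : Pt) (hvw : (v, w) ∈ D.E) (hfree : Free D (v, w))
      (hv : v ∈ D.bars) (hw : w ∈ D.bars)
      (hE : D'.E = D.E) (hB : D'.bars = D.bars \ {v, w}) (hK : KeepsKinds D D') :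
      Move D D'
  /-- A classical or singular crossing `x` of the edges `p q` and `r s` with bars on its four ends is
  replaced by three crossings of the same two strands, a virtual one, one of the same kind as `x`,
  and a virtual one, without the four bars.  Nothing else meets the quadrilateral. -/
  | barTwist (D D' : Diagram) (p q r s u w x x₁ x₂ x₃ : Pt)
      (hx : CrossAt D.E (p, q) (r, s) x) (hk : D.kind x ≠ .virtual)
      (hbars : {p, q, r, s} ⊆ D.bars)
      (hempty : ∀ g ∈ D.E, g ≠ (p, q) → g ≠ (r, s) →
        seg g ∩ convexHull ℝ {p, q, r, s} ⊆ {p, q, r, s})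
      (hu : u ∈ convexHull ℝ {p, q, r, s}) (hw : w ∈ convexHull ℝ {p, q, r, s})
      (hE : D'.E = (D.E \ {(r, s)}) ∪ {(r, u), (u, w), (w, s)})
      (hB : D'.bars = D.bars \ {p, q, r, s})
      (hx₁ : CrossAt D'.E (p, q) (r, u) x₁) (hx₂ : CrossAt D'.E (p, q) (u, w) x₂)
      (hx₃ : CrossAt D'.E (p, q) (w, s) x₃) (hord : x₂ ∈ openSegment ℝ x₁ x₃)
      (hk₁ : D'.kind x₁ = .virtual) (hk₂ : D'.kind x₂ = D.kind x) (hk₃ : D'.kind x₃ = .virtual)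
      (hK : KeepsKinds D D') :
      Move D D'

/-- Equivalence of diagrams: the equivalence relation generated by the moves. -/
def diagramSetoid : Setoid Diagram := Relation.EqvGen.setoid Move

/-- Oriented singular twisted links: diagrams up to equivalence. -/
def OrientedLink : Type := Quotient diagramSetoid

/-- The link represented by a diagram. -/
def Diagram.link (D : Diagram) : OrientedLink := Quotient.mk diagramSetoid D

/-- The upper endpoints `(1, 1), …, (n, 1)` of a braid. -/
def top {n : ℕ} (i : Fin n) : Pt := ((i : ℝ) + 1, 1)

/-- The lower endpoints `(1, 0), …, (n, 0)` of a braid. -/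
def bot {n : ℕ} (i : Fin n) : Pt := ((i : ℝ) + 1, 0)

/-- A singular twisted virtual braid diagram on `n` strands: polygonal curves, oriented downwards and
strictly monotone in the second coordinate, that join the upper to the lower endpoints, in general
position, with bars at some inner vertices and a kind for each double point. -/
structure BraidDiagram (n : ℕ) where
  E : Set Edge
  finite : E.Finite
  descending : ∀ e ∈ E, e.2.2 < e.1.2
  top_out : ∀ i : Fin n, ∃! e, e ∈ E ∧ e.1 = top i
  bot_in : ∀ i : Fin n, ∃! e, e ∈ E ∧ e.2 = bot i
  next : ∀ e ∈ E, (∃ i : Fin n, e.2 = bot i) ∨ ∃! f, f ∈ E ∧ f.1 = e.2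
  prev : ∀ e ∈ E, (∃ i : Fin n, e.1 = top i) ∨ ∃! f, f ∈ E ∧ f.2 = e.1
  generic : Generic E
  bars : Set Pt
  bars_vertex : ∀ v ∈ bars, ∃ e ∈ E, ∃ f ∈ E, e.2 = v ∧ f.1 = v
  kind : Pt → Kind

/-- The parallel arcs that close a braid: the arc number `i` leaves the `i`-th lower endpoint
downwards, passes the braid on the right, beyond the line with first coordinate `R`, and enters the
`i`-th upper endpoint from above.  The arcs are nested and do not cross. -/
def closingArcs (n : ℕ) (R : ℝ) : Set Edge :=
  {e | ∃ i : Fin n, ∃ d : ℝ, d = (n : ℝ) - (i : ℝ) ∧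
    (e = (bot i, ((i : ℝ) + 1, -d)) ∨
     e = (((i : ℝ) + 1, -d), (R + d, -d)) ∨
     e = ((R + d, -d), (R + d, 1 + d)) ∨
     e = ((R + d, 1 + d), ((i : ℝ) + 1, 1 + d)) ∨
     e = (((i : ℝ) + 1, 1 + d), top i))}

/-- `D` is the closure of the braid diagram `b`: it consists of `b`, with its crossings and bars, and
of the closing arcs, drawn to the right of `b`. -/
def BraidDiagram.IsClosure {n : ℕ} (b : BraidDiagram n) (D : Diagram) : Prop :=
  ∃ R : ℝ, (∀ e ∈ b.E, e.1.1 < R ∧ e.2.1 < R) ∧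
    D.E = b.E ∪ closingArcs n R ∧ D.bars = b.bars ∧ D.kind = b.kind

end STLink

namespace STLink
open Set

/-- Positive if `x` lies to the left of the line from `p` to `q`. -/
def side (p q x : Pt) : ℝ := det (q - p) (x - p)

/-- The closed triangle with corners `a`, `b`, `c`. -/
abbrev tri (a b c : Pt) : Set Pt := convexHull ℝ {a, b, c}

lemma side_eq (p q x : Pt) :
    side p q x = (q.1 - p.1) * (x.2 - p.2) - (q.2 - p.2) * (x.1 - p.1) := rfl

lemma side_cycle (p q r : Pt) : side q r p = side p q r := by simp only [side_eq]; ring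

lemma side_swap (p q r : Pt) : side q p r = - side p q r := by simp only [side_eq]; ring

lemma side_swap' (p q r : Pt) : side p r q = - side p q r := by simp only [side_eq]; ring

@[simp] lemma side_left (p q : Pt) : side p q p = 0 := by simp only [side_eq]; ring

@[simp] lemma side_right (p q : Pt) : side p q q = 0 := by simp only [side_eq]; ring

@[simp] lemma side_self (p q : Pt) : side p p q = 0 := by simp only [side_eq]; ring

lemma ne_of_side {p q r : Pt} (h : side p q r ≠ 0) : p ≠ q ∧ q ≠ r ∧ p ≠ r := by
  refine ⟨?_, ?_, ?_⟩ <;> rintro rfl <;> simp at h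

lemma mem_seg {a b x : Pt} : x ∈ seg (a, b) ↔
    ∃ t : ℝ, 0 ≤ t ∧ t ≤ 1 ∧ x = a + t • (b - a) := by
  rw [seg, segment_eq_image']
  simp only [mem_image, mem_Icc]
  constructor
  · rintro ⟨t, ⟨h0, h1⟩, rfl⟩; exact ⟨t, h0, h1, rfl⟩
  · rintro ⟨t, h0, h1, rfl⟩; exact ⟨t, ⟨h0, h1⟩, rfl⟩

lemma mem_openSeg {a b x : Pt} : x ∈ openSeg (a, b) ↔
    ∃ t : ℝ, 0 < t ∧ t < 1 ∧ x = a + t • (b - a) := by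
  rw [openSeg, openSegment_eq_image']
  simp only [mem_image, mem_Ioo]
  constructor
  · rintro ⟨t, ⟨h0, h1⟩, rfl⟩; exact ⟨t, h0, h1, rfl⟩
  · rintro ⟨t, h0, h1, rfl⟩; exact ⟨t, ⟨h0, h1⟩, rfl⟩

lemma openSeg_subset_seg (e : Edge) : openSeg e ⊆ seg e := openSegment_subset_segment ℝ _ _

lemma left_mem_seg (e : Edge) : e.1 ∈ seg e := left_mem_segment ℝ _ _

lemma right_mem_seg (e : Edge) : e.2 ∈ seg e := right_mem_segment ℝ _ _

lemma seg_swap (a b : Pt) : seg (a, b) = seg (b, a) := segment_symm ℝ a b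

lemma openSeg_swap (a b : Pt) : openSeg (a, b) = openSeg (b, a) := openSegment_symm ℝ a b

lemma isCompact_seg (e : Edge) : IsCompact (seg e) := by
  rw [seg, segment_eq_image']
  exact isCompact_Icc.image (by fun_prop)

lemma convex_seg (e : Edge) : Convex ℝ (seg e) := convex_segment _ _

lemma isCompact_tri (a b c : Pt) : IsCompact (tri a b c) :=
  (Set.toFinite {a, b, c}).isCompact_convexHull ℝ

lemma mem_openSeg_of_mem_seg {e : Edge} {x : Pt} (h : x ∈ seg e) (h1 : x ≠ e.1) (h2 : x ≠ e.2) :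
    x ∈ openSeg e := by
  obtain ⟨t, h0, h1', rfl⟩ := mem_seg.1 h
  refine mem_openSeg.2 ⟨t, lt_of_le_of_ne h0 ?_, lt_of_le_of_ne h1' ?_, rfl⟩
  · rintro rfl; simp at h1
  · rintro rfl; simp at h2

lemma ne_of_mem_openSeg {a b x : Pt} (hab : a ≠ b) (h : x ∈ openSeg (a, b)) : x ≠ a ∧ x ≠ b := by
  obtain ⟨t, h0, h1, rfl⟩ := mem_openSeg.1 h
  have hb : b - a ≠ 0 := sub_ne_zero.2 hab.symm
  constructor
  · intro h
    rw [add_eq_left, smul_eq_zero] at h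
    rcases h with h | h
    · exact h0.ne' h
    · exact hb h
  · intro h
    have : (t - 1) • (b - a) = 0 := by
      rw [sub_smul, one_smul, sub_eq_zero, eq_sub_iff_add_eq, add_comm]; exact h
    rcases smul_eq_zero.1 this with h | h
    · linarith
    · exact hb h

lemma side_add_smul (p q a v : Pt) (t : ℝ) :
    side p q (a + t • (v - a)) = (1 - t) * side p q a + t * side p q v := by
  simp only [side_eq, Prod.fst_add, Prod.snd_add, Prod.smul_fst, Prod.smul_snd, Prod.fst_sub,
    Prod.snd_sub, smul_eq_mul]; ring

lemma side_of_mem_seg {p q x : Pt} (h : x ∈ seg (p, q)) : side p q x = 0 := by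
  obtain ⟨t, h0, h1, rfl⟩ := mem_seg.1 h
  simp [side_add_smul]

lemma convex_side_pos (p q : Pt) (k : ℝ) : Convex ℝ {x | 0 < k * side p q x} := by
  intro x hx y hy s t hs ht hst
  simp only [mem_ofPred_eq] at *
  have : k * side p q (s • x + t • y) = s * (k * side p q x) + t * (k * side p q y) := by
    obtain rfl : s = 1 - t := by linarith
    simp only [side_eq, Prod.fst_add, Prod.snd_add, Prod.smul_fst, Prod.smul_snd, smul_eq_mul]
    ring
  rw [this]
  rcases hs.eq_or_lt with rfl | hs
  · obtain rfl : t = 1 := by linarith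
    simpa using hy
  · have := mul_pos hs hx
    have := mul_nonneg ht hy.le
    linarith

lemma convex_side_mul_nonneg (p q : Pt) (k : ℝ) : Convex ℝ {x | 0 ≤ k * side p q x} := by
  intro x hx y hy s t hs ht hst
  simp only [mem_ofPred_eq] at *
  have : k * side p q (s • x + t • y) = s * (k * side p q x) + t * (k * side p q y) := by
    obtain rfl : s = 1 - t := by linarith
    simp only [side_eq, Prod.fst_add, Prod.snd_add, Prod.smul_fst, Prod.smul_snd, smul_eq_mul]
    ring
  rw [this]
  positivity

lemma tri_left (a b c : Pt) : a ∈ tri a b c := subset_convexHull ℝ _ (by simp)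
lemma tri_mid (a b c : Pt) : b ∈ tri a b c := subset_convexHull ℝ _ (by simp)
lemma tri_right (a b c : Pt) : c ∈ tri a b c := subset_convexHull ℝ _ (by simp)

lemma tri_subset {a b c : Pt} {K : Set Pt} (hK : Convex ℝ K) (ha : a ∈ K) (hb : b ∈ K)
    (hc : c ∈ K) : tri a b c ⊆ K :=
  convexHull_min (by rintro x (rfl | rfl | rfl) <;> assumption) hK

lemma convex_tri (a b c : Pt) : Convex ℝ (tri a b c) := convex_convexHull ℝ _

lemma seg_subset {a b : Pt} {K : Set Pt} (hK : Convex ℝ K) (ha : a ∈ K) (hb : b ∈ K) :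
    seg (a, b) ⊆ K := hK.segment_subset ha hb

lemma tri_swap12 (a b c : Pt) : tri b a c = tri a b c := by
  unfold tri; congr 1; ext x; simp; tauto
lemma tri_swap23 (a b c : Pt) : tri a c b = tri a b c := by
  unfold tri; congr 1; ext x; simp; tauto

lemma mem_tri_add {a b c x : Pt} (h : x ∈ tri a b c) :
    ∃ s t : ℝ, 0 ≤ s ∧ 0 ≤ t ∧ s + t ≤ 1 ∧ x = a + s • (b - a) + t • (c - a) := by
  have : Convex ℝ {x : Pt | ∃ s t : ℝ, 0 ≤ s ∧ 0 ≤ t ∧ s + t ≤ 1 ∧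
      x = a + s • (b - a) + t • (c - a)} := by
    rintro _ ⟨s, t, hs, ht, hst, rfl⟩ _ ⟨s', t', hs', ht', hst', rfl⟩ m n hm hn hmn
    refine ⟨m * s + n * s', m * t + n * t', by positivity, by positivity, ?_, ?_⟩
    · nlinarith
    · obtain rfl : m = 1 - n := by linarith
      ext <;> simp <;> ring
  refine tri_subset this ⟨0, 0, ?_⟩ ⟨1, 0, ?_⟩ ⟨0, 1, ?_⟩ h <;> simp

/-- A convex set that a segment leaves at both ends contains no point of its line beyond. -/
lemma chord_mem {K : Set Pt} (hK : Convex ℝ K) {g : Edge} (hne : g.1 ≠ g.2) (h1 : g.1 ∉ K)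
    (h2 : g.2 ∉ K) {w y : Pt} (hw : w ∈ seg g) (hwK : w ∈ K) (hy : y ∈ K)
    (hl : side g.1 g.2 y = 0) : y ∈ openSeg g := by
  obtain ⟨p, q⟩ := g
  obtain ⟨s, hs0, hs1, rfl⟩ := mem_seg.1 hw
  simp only at *
  obtain ⟨t, rfl⟩ : ∃ t : ℝ, y = p + t • (q - p) := by
    rw [side_eq] at hl
    by_cases hx : q.1 - p.1 = 0
    · have hx2 : q.2 - p.2 ≠ 0 := by
        intro h; apply hne; ext <;> linarith
      refine ⟨(y.2 - p.2) / (q.2 - p.2), ?_⟩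
      rw [hx] at hl
      have : y.1 - p.1 = 0 := by
        rcases mul_eq_zero.1 (by linarith : (q.2 - p.2) * (y.1 - p.1) = 0) with h | h
        · exact absurd h hx2
        · exact h
      ext
      · simp [hx]; linarith
      · simp; field_simp; ring
    · refine ⟨(y.1 - p.1) / (q.1 - p.1), ?_⟩
      ext
      · simp; field_simp; ring
      · simp; field_simp; linarith
  have key : ∀ u : ℝ, (s ≤ u ∧ u ≤ t) ∨ (t ≤ u ∧ u ≤ s) → p + u • (q - p) ∈ K := by
    intro u hu
    have hmem : p + u • (q - p) ∈ seg (p + s • (q - p), p + t • (q - p)) := by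
      by_cases hst : s = t
      · subst hst
        obtain rfl : u = s := by rcases hu with ⟨_, _⟩ | ⟨_, _⟩ <;> linarith
        exact left_mem_seg (_, _)
      · have hts : t - s ≠ 0 := fun h => hst (by linarith)
        refine mem_seg.2 ⟨(u - s) / (t - s), ?_, ?_, ?_⟩
        · rcases hu with ⟨_, _⟩ | ⟨_, _⟩
          · exact div_nonneg (by linarith) (by linarith)
          · exact div_nonneg_of_nonpos (by linarith) (by linarith)
        · rcases hu with ⟨_, _⟩ | ⟨_, _⟩
          · exact div_le_one_of_le₀ (by linarith) (by linarith)
          · rw [← neg_div_neg_eq]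
            exact div_le_one_of_le₀ (by linarith) (by linarith)
        · ext <;> simp <;> field_simp <;> ring
    exact seg_subset hK hwK hy hmem
  refine mem_openSeg.2 ⟨t, ?_, ?_, rfl⟩
  · by_contra h
    apply h1
    have := key 0 (Or.inr ⟨by linarith, hs0⟩)
    simpa using this
  · by_contra h
    apply h2
    have := key 1 (Or.inl ⟨hs1, by linarith⟩)
    simpa using this

lemma exists_openSeg_of_opp {g : Edge} {p q : Pt}
    (h : side g.1 g.2 p * side g.1 g.2 q < 0) : ∃ x ∈ openSeg (p, q), side g.1 g.2 x = 0 := by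
  set A := side g.1 g.2 p
  set B := side g.1 g.2 q
  have hAB : A - B ≠ 0 := by
    intro h0
    have : A = B := by linarith
    rw [this] at h; nlinarith [mul_self_nonneg B]
  refine ⟨p + (A / (A - B)) • (q - p), mem_openSeg.2 ⟨_, ?_, ?_, rfl⟩, ?_⟩
  · rcases mul_neg_iff.1 h with ⟨h1, h2⟩ | ⟨h1, h2⟩
    · exact div_pos h1 (by linarith)
    · exact div_pos_of_neg_of_neg h1 (by linarith)
  · rcases mul_neg_iff.1 h with ⟨h1, h2⟩ | ⟨h1, h2⟩
    · rw [div_lt_one (by linarith)]; linarith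
    · rw [← neg_div_neg_eq, div_lt_one (by linarith)]; linarith
  · rw [side_add_smul]
    change (1 - A / (A - B)) * A + A / (A - B) * B = 0
    field_simp; ring

lemma openSeg_of_opp {g : Edge} {p q : Pt} (h : side g.1 g.2 p * side g.1 g.2 q < 0)
    (h' : side p q g.1 * side p q g.2 < 0) : ∃ x, x ∈ openSeg (p, q) ∧ x ∈ openSeg g := by
  obtain ⟨x, hx, hx0⟩ := exists_openSeg_of_opp h
  obtain ⟨y, hy, hy0⟩ := exists_openSeg_of_opp (g := (p, q)) (p := g.1) (q := g.2) h'
  refine ⟨x, hx, ?_⟩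
  have hxy : x = y := by
    obtain ⟨s, hs0, hs1, rfl⟩ := mem_openSeg.1 hx
    have hx1 := side_of_mem_seg (openSeg_subset_seg _ hx)
    have hy1 := side_of_mem_seg (openSeg_subset_seg _ hy)
    simp only at hy0
    generalize p + s • (q - p) = x at *
    simp only [side_eq] at *
    have hdet : (q.1 - p.1) * (g.2.2 - g.1.2) - (q.2 - p.2) * (g.2.1 - g.1.1) ≠ 0 := by
      intro h0
      have e1 : (q.1 - p.1) * (g.2.2 - p.2) - (q.2 - p.2) * (g.2.1 - p.1) =
        (q.1 - p.1) * (g.1.2 - p.2) - (q.2 - p.2) * (g.1.1 - p.1) := by linarith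
      rw [e1] at h'
      nlinarith [mul_self_nonneg ((q.1 - p.1) * (g.1.2 - p.2) - (q.2 - p.2) * (g.1.1 - p.1))]
    have a1 : (q.1 - p.1) * (x.2 - y.2) - (q.2 - p.2) * (x.1 - y.1) = 0 := by linarith
    have a2 : (g.2.1 - g.1.1) * (x.2 - y.2) - (g.2.2 - g.1.2) * (x.1 - y.1) = 0 := by linarith
    have b1 : ((q.1 - p.1) * (g.2.2 - g.1.2) - (q.2 - p.2) * (g.2.1 - g.1.1)) * (x.1 - y.1) = 0 := by
      linear_combination (g.2.1 - g.1.1) * a1 - (q.1 - p.1) * a2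
    have b2 : ((q.1 - p.1) * (g.2.2 - g.1.2) - (q.2 - p.2) * (g.2.1 - g.1.1)) * (x.2 - y.2) = 0 := by
      linear_combination (g.2.2 - g.1.2) * a1 - (q.2 - p.2) * a2
    ext
    · rcases mul_eq_zero.1 b1 with h | h
      · exact absurd h hdet
      · linarith
    · rcases mul_eq_zero.1 b2 with h | h
      · exact absurd h hdet
      · linarith
  rw [hxy]; exact hy

end STLink

namespace STLink
open Set

/-- Oriented polygonal arcs and curves in general position. -/
structure Poly (E : Set Edge) : Prop where
  finite : E.Finite
  injFst : ∀ e ∈ E, ∀ f ∈ E, e.1 = f.1 → e = f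
  injSnd : ∀ e ∈ E, ∀ f ∈ E, e.2 = f.2 → e = f
  generic : Generic E

lemma CrossAt.symm {E : Set Edge} {e f : Edge} {x : Pt} (h : CrossAt E e f x) : CrossAt E f e x :=
  ⟨h.2.1, h.1, h.2.2.1.symm, h.2.2.2.2, h.2.2.2.1⟩

lemma CrossAt.mono {E F : Set Edge} {e f : Edge} {x : Pt} (h : CrossAt E e f x) (he : e ∈ F)
    (hf : f ∈ F) : CrossAt F e f x := ⟨he, hf, h.2.2⟩

namespace Poly
variable {E F : Set Edge}

lemma mono (h : Poly E) (hF : F ⊆ E) : Poly F where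
  finite := h.finite.subset hF
  injFst e he f hf := h.injFst e (hF he) f (hF hf)
  injSnd e he f hf := h.injSnd e (hF he) f (hF hf)
  generic :=
    { no_reverse := fun a b hab hba => h.generic.no_reverse a b (hF hab) (hF hba)
      start_off := fun e he f hf => h.generic.start_off e (hF he) f (hF hf)
      end_off := fun e he f hf => h.generic.end_off e (hF he) f (hF hf)
      no_triple := fun e f g x h1 h2 => h.generic.no_triple e f g x
        (h1.mono (hF h1.1) (hF h1.2.1)) (h2.mono (hF h2.1) (hF h2.2.1)) }

lemma ne (h : Poly E) {e : Edge} (he : e ∈ E) : e.1 ≠ e.2 := by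
  intro h1
  obtain ⟨a, b⟩ := e
  simp only at h1
  subst h1
  exact h.generic.no_reverse a a he he

lemma start (h : Poly E) {e f : Edge} (he : e ∈ E) (hf : f ∈ E) (hne : e ≠ f) (hs : e.1 ∈ seg f) :
    e.1 = f.2 :=
  (h.generic.start_off e he f hf hs).resolve_left fun h1 => hne (h.injFst e he f hf h1)

lemma finish (h : Poly E) {e f : Edge} (he : e ∈ E) (hf : f ∈ E) (hne : e ≠ f) (hs : e.2 ∈ seg f) :
    e.2 = f.1 :=
  (h.generic.end_off e he f hf hs).resolve_right fun h1 => hne (h.injSnd e he f hf h1)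

lemma left_notMem (h : Poly E) {e f : Edge} (he : e ∈ E) (hf : f ∈ E) : e.1 ∉ openSeg f := by
  intro hx
  have := ne_of_mem_openSeg (h.ne hf) hx
  rcases h.generic.start_off e he f hf (openSeg_subset_seg _ hx) with h1 | h1
  · exact this.1 h1
  · exact this.2 h1

lemma right_notMem (h : Poly E) {e f : Edge} (he : e ∈ E) (hf : f ∈ E) : e.2 ∉ openSeg f := by
  intro hx
  have := ne_of_mem_openSeg (h.ne hf) hx
  rcases h.generic.end_off e he f hf (openSeg_subset_seg _ hx) with h1 | h1
  · exact this.1 h1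
  · exact this.2 h1

lemma transverse (h : Poly E) {e f : Edge} (he : e ∈ E) (hf : f ∈ E) (hne : e ≠ f) {x : Pt}
    (hx : x ∈ openSeg e) (hx' : x ∈ openSeg f) : det (dir e) (dir f) ≠ 0 := by
  intro hdet
  obtain ⟨a, b⟩ := e
  obtain ⟨c, d⟩ := f
  have hab : a ≠ b := h.ne he
  have hcd : c ≠ d := h.ne hf
  obtain ⟨t, ht0, ht1, rfl⟩ := mem_openSeg.1 hx
  obtain ⟨u, hu0, hu1, hu⟩ := mem_openSeg.1 hx'
  have hba : b - a ≠ 0 := sub_ne_zero.2 hab.symm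
  obtain ⟨k, hk⟩ : ∃ k : ℝ, d - c = k • (b - a) := by
    simp only [det, dir] at hdet
    by_cases h1 : (b - a).1 = 0
    · have h2 : (b - a).2 ≠ 0 := by
        intro h2; exact hba (Prod.ext h1 h2)
      refine ⟨(d - c).2 / (b - a).2, Prod.ext ?_ ?_⟩
      · rw [h1] at hdet
        have : (d - c).1 = 0 := by
          rcases mul_eq_zero.1 (by linarith : (b - a).2 * (d - c).1 = 0) with h | h
          · exact absurd h h2
          · exact h
        rw [Prod.smul_fst, smul_eq_mul, h1, this]; simp
      · rw [Prod.smul_snd, smul_eq_mul, div_mul_cancel₀ _ h2]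
    · refine ⟨(d - c).1 / (b - a).1, Prod.ext ?_ ?_⟩
      · rw [Prod.smul_fst, smul_eq_mul, div_mul_cancel₀ _ h1]
      · rw [Prod.smul_snd, smul_eq_mul]; field_simp; linarith
  have hk0 : k ≠ 0 := by
    rintro rfl
    rw [zero_smul] at hk
    exact hcd (sub_eq_zero.1 hk).symm
  have hc : c = a + (t - u * k) • (b - a) := by
    rw [hk, smul_smul] at hu
    rw [sub_smul, ← add_sub_assoc, hu]; abel
  have hd : d = a + (t + (1 - u) * k) • (b - a) := by
    have : d = c + k • (b - a) := by rw [← hk]; abel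
    rw [this, hc, add_assoc, ← add_smul]; congr 2; ring
  have inj : ∀ s s' : ℝ, a + s • (b - a) = a + s' • (b - a) → s = s' := by
    intro s s' hs
    have : (s - s') • (b - a) = 0 := by
      rw [sub_smul, sub_eq_zero]; exact add_left_cancel hs
    rcases smul_eq_zero.1 this with h | h
    · linarith
    · exact absurd h hba
  have hmemE : ∀ s : ℝ, 0 < s → s < 1 → a + s • (b - a) ∈ openSeg (a, b) := fun s h0 h1 =>
    mem_openSeg.2 ⟨s, h0, h1, rfl⟩
  have hc1 : ¬ (0 < t - u * k ∧ t - u * k < 1) := fun ⟨h0, h1⟩ =>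
    h.left_notMem hf he (show c ∈ _ by rw [hc]; exact hmemE _ h0 h1)
  have hd1 : ¬ (0 < t + (1 - u) * k ∧ t + (1 - u) * k < 1) := fun ⟨h0, h1⟩ =>
    h.right_notMem hf he (show d ∈ _ by rw [hd]; exact hmemE _ h0 h1)
  have hmemF : ∀ s : ℝ, 0 < (s - t + u * k) / k → (s - t + u * k) / k < 1 →
      a + s • (b - a) ∈ openSeg (c, d) := fun s h0 h1 => by
    refine mem_openSeg.2 ⟨_, h0, h1, ?_⟩
    rw [hk, smul_smul, div_mul_cancel₀ _ hk0]
    have : c + (s - t + u * k) • (b - a) =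
        a + (t - u * k) • (b - a) + (s - t + u * k) • (b - a) := by rw [← hc]
    rw [this, add_assoc, ← add_smul]; congr 2; ring
  have ha1 : ¬ (0 < (0 - t + u * k) / k ∧ (0 - t + u * k) / k < 1) := fun ⟨h0, h1⟩ =>
    h.left_notMem he hf (show a ∈ _ by simpa using hmemF 0 h0 h1)
  have hb1 : ¬ (0 < (1 - t + u * k) / k ∧ (1 - t + u * k) / k < 1) := fun ⟨h0, h1⟩ =>
    h.right_notMem he hf (show b ∈ _ by simpa using hmemF 1 h0 h1)
  have hca : t - u * k ≠ 0 := fun h0 => hne (h.injFst _ he _ hf (by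
    change a = c; rw [hc, h0]; simp))
  have hdb : t + (1 - u) * k ≠ 1 := fun h0 => hne (h.injSnd _ he _ hf (by
    change b = d; rw [hd, h0]; simp))
  have hrev : ¬ (t - u * k = 1 ∧ t + (1 - u) * k = 0) := fun ⟨h0, h1⟩ => by
    have e1 : c = b := by rw [hc, h0]; simp
    have e2 : d = a := by rw [hd, h1]; simp
    rw [e1, e2] at hf
    exact h.generic.no_reverse a b he hf
  rcases lt_or_gt_of_ne hk0 with hk | hk
  · have hdp : ∀ y : ℝ, 0 < y / k ↔ y < 0 := fun y => by
      rw [div_pos_iff]; constructor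
      · rintro (⟨_, h⟩ | ⟨h, _⟩)
        · linarith
        · exact h
      · exact fun h => Or.inr ⟨h, hk⟩
    rw [hdp, div_lt_one_of_neg hk] at ha1 hb1
    have n1 : u * k < 0 := mul_neg_of_pos_of_neg hu0 hk
    have n2 : (1 - u) * k < 0 := mul_neg_of_pos_of_neg (by linarith) hk
    have c1 : 1 ≤ t - u * k := by by_contra hcon; exact hc1 ⟨by linarith, by linarith⟩
    have c2 : t + (1 - u) * k ≤ 0 := by by_contra hcon; exact hd1 ⟨by linarith, by linarith⟩
    rcases c1.eq_or_lt with c1 | c1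
    · rcases c2.eq_or_lt with c2 | c2
      · exact hrev ⟨c1.symm, c2⟩
      · exact ha1 ⟨by linarith, by linarith⟩
    · exact hb1 ⟨by linarith, by linarith⟩
  · rw [div_pos_iff_of_pos_right hk, div_lt_one hk] at ha1 hb1
    have n1 : 0 < u * k := mul_pos hu0 hk
    have n2 : 0 < (1 - u) * k := mul_pos (by linarith) hk
    have c1 : t - u * k ≤ 0 := by by_contra hcon; exact hc1 ⟨by linarith, by linarith⟩
    rcases c1.eq_or_lt with c1 | c1
    · exact hca c1
    · exact ha1 ⟨by linarith, by linarith⟩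

lemma _root_.STLink.midpoint_mem_openSeg {e : Edge} {x y : Pt} (hx : x ∈ seg e) (hy : y ∈ seg e)
    (hxy : x ≠ y) : x + (1 / 2 : ℝ) • (y - x) ∈ openSeg e := by
  obtain ⟨a, b⟩ := e
  obtain ⟨s, hs0, hs1, rfl⟩ := mem_seg.1 hx
  obtain ⟨t, ht0, ht1, rfl⟩ := mem_seg.1 hy
  have hst : s ≠ t := by rintro rfl; exact hxy rfl
  refine mem_openSeg.2 ⟨(s + t) / 2, ?_, ?_, ?_⟩
  · rcases lt_or_gt_of_ne hst with h | h <;> linarith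
  · rcases lt_or_gt_of_ne hst with h | h <;> linarith
  · ext <;> simp <;> ring

lemma inter_unique (h : Poly E) {e f : Edge} (he : e ∈ E) (hf : f ∈ E) (hne : e ≠ f) {x y : Pt}
    (hx : x ∈ seg e) (hx' : x ∈ seg f) (hy : y ∈ seg e) (hy' : y ∈ seg f) : x = y := by
  by_contra hxy
  refine h.transverse he hf hne (midpoint_mem_openSeg hx hy hxy) (midpoint_mem_openSeg hx' hy' hxy) ?_
  obtain ⟨a, b⟩ := e
  obtain ⟨c, d⟩ := f
  obtain ⟨s, hs0, hs1, rfl⟩ := mem_seg.1 hx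
  obtain ⟨t, ht0, ht1, rfl⟩ := mem_seg.1 hy
  obtain ⟨s', hs0', hs1', hs'⟩ := mem_seg.1 hx'
  obtain ⟨t', ht0', ht1', ht'⟩ := mem_seg.1 hy'
  have hst : t - s ≠ 0 := by
    intro h0
    exact hxy (by rw [show t = s by linarith])
  have hst' : t' - s' ≠ 0 := by
    intro h0
    exact hxy (by rw [hs', ht', show t' = s' by linarith])
  have e1 : (t - s) • (b - a) = (t' - s') • (d - c) := by
    rw [sub_smul, sub_smul]
    have := congrArg₂ (· - ·) ht' hs'
    simpa using this
  have h1 := congrArg Prod.fst e1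
  have h2 := congrArg Prod.snd e1
  simp only [Prod.smul_fst, Prod.smul_snd, smul_eq_mul] at h1 h2
  simp only [det, dir]
  have : (t - s) * ((b - a).1 * (d - c).2 - (b - a).2 * (d - c).1) = 0 := by
    linear_combination (d - c).2 * h1 - (d - c).1 * h2
  exact (mul_eq_zero.1 this).resolve_left hst

lemma cross_unique (h : Poly E) {e f : Edge} {x y : Pt} (hx : CrossAt E e f x)
    (hy : CrossAt E e f y) : x = y :=
  h.inter_unique hx.1 hx.2.1 hx.2.2.1 (openSeg_subset_seg _ hx.2.2.2.1)
    (openSeg_subset_seg _ hx.2.2.2.2) (openSeg_subset_seg _ hy.2.2.2.1)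
    (openSeg_subset_seg _ hy.2.2.2.2)

lemma mem_both (h : Poly E) {e f : Edge} (he : e ∈ E) (hf : f ∈ E) (hne : e ≠ f) {x : Pt}
    (hx : x ∈ seg e) (hx' : x ∈ seg f) :
    CrossAt E e f x ∨ (x = e.1 ∧ x = f.2) ∨ (x = e.2 ∧ x = f.1) := by
  by_cases h1 : x = e.1
  · subst h1; exact Or.inr (Or.inl ⟨rfl, h.start he hf hne hx'⟩)
  by_cases h2 : x = e.2
  · subst h2; exact Or.inr (Or.inr ⟨rfl, h.finish he hf hne hx'⟩)
  by_cases h3 : x = f.1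
  · subst h3; exact absurd (h.start hf he hne.symm hx) h2
  by_cases h4 : x = f.2
  · subst h4; exact absurd (h.finish hf he hne.symm hx) h1
  exact Or.inl ⟨he, hf, hne, mem_openSeg_of_mem_seg hx h1 h2, mem_openSeg_of_mem_seg hx' h3 h4⟩

lemma triple (h : Poly E) {e f g : Edge} (he : e ∈ E) (hf : f ∈ E) (hg : g ∈ E) (hef : e ≠ f)
    (heg : e ≠ g) (hfg : f ≠ g) {x : Pt} (hxe : x ∈ seg e) (hxf : x ∈ seg f) (hxg : x ∈ seg g) :
    False := by
  rcases h.mem_both he hf hef hxe hxf with h1 | ⟨h1, h2⟩ | ⟨h1, h2⟩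
  · rcases h.mem_both he hg heg hxe hxg with h3 | ⟨h3, -⟩ | ⟨h3, -⟩
    · exact hfg (h.generic.no_triple _ _ _ _ h1 h3)
    · subst h3; exact h.left_notMem he hf h1.2.2.2.2
    · subst h3; exact h.right_notMem he hf h1.2.2.2.2
  · rcases h.mem_both he hg heg hxe hxg with h3 | ⟨h3, h4⟩ | ⟨h3, h4⟩
    · subst h1; exact h.left_notMem he hg h3.2.2.2.2
    · exact hfg (h.injSnd _ hf _ hg (h2.symm.trans h4))
    · exact h.ne he (h1.symm.trans h3)
  · rcases h.mem_both he hg heg hxe hxg with h3 | ⟨h3, h4⟩ | ⟨h3, h4⟩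
    · subst h1; exact h.right_notMem he hg h3.2.2.2.2
    · exact h.ne he (h3.symm.trans h1)
    · exact hfg (h.injFst _ hf _ hg (h2.symm.trans h4))

lemma insert (h : Poly E) {e : Edge} (hne : e.1 ≠ e.2)
    (h1 : ∀ f ∈ E, f.1 ≠ e.1) (h2 : ∀ f ∈ E, f.2 ≠ e.2) (h3 : (e.2, e.1) ∉ E)
    (h4 : ∀ f ∈ E, e.1 ∈ seg f → e.1 = f.2) (h5 : ∀ f ∈ E, e.2 ∈ seg f → e.2 = f.1)
    (h6 : ∀ f ∈ E, f.1 ∈ seg e → f.1 = e.2) (h7 : ∀ f ∈ E, f.2 ∈ seg e → f.2 = e.1)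
    (h8 : ∀ f g x, CrossAt E f g x → x ∉ openSeg e) : Poly (insert e E) where
  finite := h.finite.insert e
  injFst := by
    rintro f (rfl | hf) g (rfl | hg) hfg
    · rfl
    · exact absurd hfg.symm (h1 g hg)
    · exact absurd hfg (h1 f hf)
    · exact h.injFst f hf g hg hfg
  injSnd := by
    rintro f (rfl | hf) g (rfl | hg) hfg
    · rfl
    · exact absurd hfg.symm (h2 g hg)
    · exact absurd hfg (h2 f hf)
    · exact h.injSnd f hf g hg hfg
  generic :=
    { no_reverse := by
        rintro a b (rfl | hf) (hg | hg)
        · exact hne (Prod.ext_iff.1 hg).2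
        · exact h3 hg
        · subst hg; exact h3 hf
        · exact h.generic.no_reverse a b hf hg
      start_off := by
        rintro f (rfl | hf) g (rfl | hg) hfg
        · exact Or.inl rfl
        · exact Or.inr (h4 g hg hfg)
        · exact Or.inr (h6 f hf hfg)
        · exact h.generic.start_off f hf g hg hfg
      end_off := by
        rintro f (rfl | hf) g (rfl | hg) hfg
        · exact Or.inr rfl
        · exact Or.inl (h5 g hg hfg)
        · exact Or.inl (h7 f hf hfg)
        · exact h.generic.end_off f hf g hg hfg
      no_triple := by
        rintro f g k x ⟨hf, hg, hfg, xf, xg⟩ ⟨-, hk, hfk, -, xk⟩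
        rcases hf with rfl | hf
        · by_contra hgk
          exact h8 g k x ⟨hg.resolve_left hfg.symm, hk.resolve_left hfk.symm, hgk, xg, xk⟩ xf
        · rcases hg with rfl | hg
          · rcases hk with rfl | hk
            · rfl
            · exact absurd xg (h8 f k x ⟨hf, hk, hfk, xf, xk⟩)
          · rcases hk with rfl | hk
            · exact absurd xk (h8 f g x ⟨hf, hg, hfg, xf, xg⟩)
            · exact h.generic.no_triple f g k x ⟨hf, hg, hfg, xf, xg⟩ ⟨hf, hk, hfk, xf, xk⟩ }

end Poly

lemma Diagram.poly (D : Diagram) : Poly D.E where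
  finite := D.finite
  injFst e he f hf hef := by
    obtain ⟨g, ⟨hg, hge⟩, -⟩ := D.prev e he
    obtain ⟨k, -, hk⟩ := D.next g hg
    rw [hk e ⟨he, hge.symm⟩, hk f ⟨hf, by rw [hge, hef]⟩]
  injSnd e he f hf hef := by
    obtain ⟨g, ⟨hg, hge⟩, -⟩ := D.next e he
    obtain ⟨k, -, hk⟩ := D.prev g hg
    rw [hk e ⟨he, hge.symm⟩, hk f ⟨hf, by rw [hge, hef]⟩]
  generic := D.generic

/-- Every point is the start of an edge if and only if it is the end of one. -/
def Closed (E : Set Edge) : Prop := ∀ p, (∃ e ∈ E, e.1 = p) ↔ ∃ e ∈ E, e.2 = p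

lemma Diagram.closed (D : Diagram) : Closed D.E := by
  intro p
  constructor
  · rintro ⟨e, he, rfl⟩
    obtain ⟨g, hg, -⟩ := D.prev e he
    exact ⟨g, hg⟩
  · rintro ⟨e, he, rfl⟩
    obtain ⟨g, hg, -⟩ := D.next e he
    exact ⟨g, hg⟩

/-- The diagram with given edges, bars and kinds. -/
def Diagram.mk' (E : Set Edge) (h : Poly E) (hc : Closed E) (bars : Set Pt)
    (hb : ∀ v ∈ bars, ∃ e ∈ E, e.1 = v) (kind : Pt → Kind) : Diagram where
  E := E
  finite := h.finite
  next e he := by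
    obtain ⟨f, hf, hfe⟩ := (hc e.2).2 ⟨e, he, rfl⟩
    exact ⟨f, ⟨hf, hfe⟩, fun g hg => h.injFst g hg.1 f hf (hg.2.trans hfe.symm)⟩
  prev e he := by
    obtain ⟨f, hf, hfe⟩ := (hc e.1).1 ⟨e, he, rfl⟩
    exact ⟨f, ⟨hf, hfe⟩, fun g hg => h.injSnd g hg.1 f hf (hg.2.trans hfe.symm)⟩
  generic := h.generic
  bars := bars
  bars_vertex := hb
  kind := kind

/-- The edge from `a` to `b` is replaced by the edges from `a` to `c` and from `c` to `b`. -/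
def rep (E : Set Edge) (a b c : Pt) : Set Edge := (E \ {(a, b)}) ∪ {(a, c), (c, b)}

lemma mem_rep {E : Set Edge} {a b c : Pt} {g : Edge} :
    g ∈ rep E a b c ↔ (g ∈ E ∧ g ≠ (a, b)) ∨ g = (a, c) ∨ g = (c, b) := by
  simp [rep]; tauto

lemma Closed.rep {E : Set Edge} (h : Closed E) {a b : Pt} (hab : (a, b) ∈ E) (c : Pt) :
    Closed (rep E a b c) := by
  intro p
  have hp := h p
  constructor
  · rintro ⟨e, he, rfl⟩
    rcases mem_rep.1 he with ⟨he, hne⟩ | rfl | rfl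
    · obtain ⟨f, hf, hfe⟩ := hp.1 ⟨e, he, rfl⟩
      by_cases hf' : f = (a, b)
      · subst hf'; exact ⟨(c, b), mem_rep.2 (by simp), hfe⟩
      · exact ⟨f, mem_rep.2 (Or.inl ⟨hf, hf'⟩), hfe⟩
    · obtain ⟨f, hf, hfe⟩ := hp.1 ⟨_, hab, rfl⟩
      by_cases hf' : f = (a, b)
      · subst hf'; exact ⟨(c, b), mem_rep.2 (by simp), hfe⟩
      · exact ⟨f, mem_rep.2 (Or.inl ⟨hf, hf'⟩), hfe⟩
    · exact ⟨(a, c), mem_rep.2 (by simp), rfl⟩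
  · rintro ⟨e, he, rfl⟩
    rcases mem_rep.1 he with ⟨he, hne⟩ | rfl | rfl
    · obtain ⟨f, hf, hfe⟩ := hp.2 ⟨e, he, rfl⟩
      by_cases hf' : f = (a, b)
      · subst hf'; exact ⟨(a, c), mem_rep.2 (by simp), hfe⟩
      · exact ⟨f, mem_rep.2 (Or.inl ⟨hf, hf'⟩), hfe⟩
    · exact ⟨(c, b), mem_rep.2 (by simp), rfl⟩
    · obtain ⟨f, hf, hfe⟩ := hp.2 ⟨_, hab, rfl⟩
      by_cases hf' : f = (a, b)
      · subst hf'; exact ⟨(a, c), mem_rep.2 (by simp), hfe⟩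
      · exact ⟨f, mem_rep.2 (Or.inl ⟨hf, hf'⟩), hfe⟩

/-- The segment from `p` to `d` meets the vertices and crossings of `E` at most in `p`, and `d` lies
on no edge. -/
structure Clear (E : Set Edge) (p d : Pt) : Prop where
  off : ∀ f ∈ E, d ∉ seg f
  fst : ∀ f ∈ E, f.1 ∈ seg (p, d) → f.1 = p
  snd : ∀ f ∈ E, f.2 ∈ seg (p, d) → f.2 = p
  cross : ∀ f g x, CrossAt E f g x → x ∉ openSeg (p, d)

lemma Clear.mono {E F : Set Edge} {p d : Pt} (h : Clear E p d) (hF : F ⊆ E) : Clear F p d where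
  off f hf := h.off f (hF hf)
  fst f hf := h.fst f (hF hf)
  snd f hf := h.snd f (hF hf)
  cross f g x hx := h.cross f g x (hx.mono (hF hx.1) (hF hx.2.1))

lemma Clear.insert {E : Set Edge} {p d : Pt} (h : Clear E p d) {e : Edge} (h1 : d ∉ seg e)
    (h2 : e.1 ∈ seg (p, d) → e.1 = p) (h3 : e.2 ∈ seg (p, d) → e.2 = p)
    (h4 : ∀ x ∈ openSeg e, x ∉ openSeg (p, d)) : Clear (insert e E) p d where
  off := by rintro f (rfl | hf); exacts [h1, h.off f hf]
  fst := by rintro f (rfl | hf); exacts [h2, h.fst f hf]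
  snd := by rintro f (rfl | hf); exacts [h3, h.snd f hf]
  cross := by
    rintro f g x ⟨hf, hg, hne, xf, xg⟩
    rcases hf with rfl | hf
    · exact h4 x xf
    rcases hg with rfl | hg
    · exact h4 x xg
    exact h.cross f g x ⟨hf, hg, hne, xf, xg⟩

/-- An edge from a new vertex. -/
lemma Poly.insert_in {E : Set Edge} (h : Poly E) {p d : Pt} (hc : Clear E p d) (hpd : p ≠ d)
    (h1 : ∀ f ∈ E, f.2 ≠ p) (h2 : ∀ f ∈ E, p ∈ seg f → p = f.1) : Poly (Insert.insert (d, p) E) := by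
  have e1 : seg (d, p) = seg (p, d) := seg_swap d p
  have e2 : openSeg (d, p) = openSeg (p, d) := openSeg_swap d p
  refine h.insert hpd.symm ?_ h1 ?_ ?_ h2 ?_ ?_ ?_
  · rintro f hf rfl; exact hc.off f hf (left_mem_seg f)
  · intro hf; exact hc.off _ hf (right_mem_seg _)
  · intro f hf hd; exact absurd hd (hc.off f hf)
  · rw [e1]; exact hc.fst
  · rw [e1]; intro f hf hd; exact absurd (hc.snd f hf hd) (h1 f hf)
  · rw [e2]; exact hc.cross

lemma side_ne_zero_seg {a b c x : Pt} (h : side a b c ≠ 0) (hx : x ∈ seg (a, c)) (hx' : x ∈ seg (c, b)) :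
    x = c := by
  have h1 := side_of_mem_seg hx
  obtain ⟨t, ht0, ht1, rfl⟩ := mem_seg.1 hx'
  rw [side_add_smul, side_right, side_swap'] at h1
  have : t = 0 := by
    rcases mul_eq_zero.1 (by linarith : t * side a b c = 0) with h2 | h2
    · exact h2
    · exact absurd h2 h
  subst this; simp

/-- A path of two edges through a new vertex. -/
lemma Poly.insert_path {F : Set Edge} (h : Poly F) {a b c : Pt} (ha : Clear F a c) (hb : Clear F b c)
    (hne1 : a ≠ b) (hne2 : b ≠ c) (hne3 : a ≠ c) (hacb : ∀ x ∈ seg (a, c), x ∈ seg (c, b) → x = c)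
    (oa : ∀ f ∈ F, f.1 ≠ a) (ib : ∀ f ∈ F, f.2 ≠ b) (sa : ∀ f ∈ F, a ∈ seg f → a = f.2)
    (sb : ∀ f ∈ F, b ∈ seg f → b = f.1) : Poly (Insert.insert (a, c) (Insert.insert (c, b) F)) := by
  refine (h.insert_in hb hne2 ib sb).insert hne3 ?_ ?_ ?_ ?_ ?_ ?_ ?_ ?_
  · rintro f (rfl | hf) hfb
    · exact hne3 hfb.symm
    · exact oa f hf hfb
  · rintro f (rfl | hf) hfb
    · exact hne2 hfb
    · exact ha.off f hf (show (a, c).2 ∈ seg f by rw [← hfb]; exact right_mem_seg f)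
  · rintro (hf | hf)
    · exact hne1 (Prod.ext_iff.1 hf).2
    · exact ha.off _ hf (left_mem_seg _)
  · rintro f (rfl | hf) hfb
    · exact absurd (hacb _ (left_mem_seg _) hfb) hne3
    · exact sa f hf hfb
  · rintro f (rfl | hf) hfb
    · rfl
    · exact absurd hfb (ha.off f hf)
  · rintro f (rfl | hf) hfb
    · rfl
    · exact absurd (ha.fst f hf hfb) (oa f hf)
  · rintro f (rfl | hf) hfb
    · exact absurd (hacb _ hfb (right_mem_seg _)) hne2
    · exact ha.snd f hf hfb
  · rintro f g x ⟨hf, hg, hfg, xf, xg⟩ hx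
    have key : x ∉ openSeg (c, b) := by
      intro hx'
      have := hacb x (openSeg_subset_seg _ hx) (openSeg_subset_seg _ hx')
      exact (ne_of_mem_openSeg hne3 hx).2 this
    rcases hf with rfl | hf
    · exact key xf
    rcases hg with rfl | hg
    · exact key xg
    exact ha.cross f g x ⟨hf, hg, hfg, xf, xg⟩ hx

lemma Poly.rep' {E : Set Edge} (h : Poly E) {a b c : Pt} (hab : (a, b) ∈ E)
    (ha : Clear (E \ {(a, b)}) a c) (hb : Clear (E \ {(a, b)}) b c) (hne1 : a ≠ b) (hne2 : b ≠ c)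
    (hne3 : a ≠ c) (hacb : ∀ x ∈ seg (a, c), x ∈ seg (c, b) → x = c) :
    Poly (rep E a b c) := by
  refine ((h.mono (sdiff_subset (s := E) (t := {(a, b)}))).insert_path ha hb hne1 hne2 hne3 hacb
    (fun f hf he => hf.2 (h.injFst f hf.1 _ hab he)) (fun f hf he => hf.2 (h.injSnd f hf.1 _ hab he))
    (fun f hf hs => h.start hab hf.1 (Ne.symm hf.2) hs)
    (fun f hf hs => h.finish hab hf.1 (Ne.symm hf.2) hs)).mono ?_
  intro g hg
  rcases mem_rep.1 hg with ⟨h3, h4⟩ | rfl | rfl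
  · exact Or.inr (Or.inr ⟨h3, h4⟩)
  · exact Or.inl rfl
  · exact Or.inr (Or.inl rfl)

lemma Poly.rep_of_side {E : Set Edge} (h : Poly E) {a b c : Pt} (hab : (a, b) ∈ E)
    (ha : Clear (E \ {(a, b)}) a c) (hb : Clear (E \ {(a, b)}) b c) (hs : side a b c ≠ 0) :
    Poly (rep E a b c) := by
  obtain ⟨hne1, hne2, hne3⟩ := ne_of_side hs
  exact h.rep' hab ha hb hne1 hne2 hne3 fun x => side_ne_zero_seg hs

lemma Poly.clear_of_mem {F E : Set Edge} (h : Poly F) {p q d : Pt} (hpq : (p, q) ∈ F)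
    (hE : E ⊆ F) (hE' : (p, q) ∉ E) (hd : d ∈ openSeg (p, q)) (hoff : ∀ f ∈ E, d ∉ seg f) :
    Clear E p d ∧ Clear E q d := by
  have hne : p ≠ q := h.ne hpq
  have hdpq := ne_of_mem_openSeg hne hd
  have sub1 : seg (p, d) ⊆ seg (p, q) :=
    seg_subset (convex_seg _) (left_mem_seg _) (openSeg_subset_seg _ hd)
  have sub2 : seg (q, d) ⊆ seg (p, q) :=
    seg_subset (convex_seg _) (right_mem_seg (p, q)) (openSeg_subset_seg _ hd)
  obtain ⟨t, ht0, ht1, rfl⟩ := mem_openSeg.1 hd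
  have hqp : q - p ≠ 0 := sub_ne_zero.2 hne.symm
  have aux : ∀ s : ℝ, s • (q - p) = 0 → s = 0 := fun s hs =>
    (smul_eq_zero.1 hs).resolve_right hqp
  have nq : q ∉ seg (p, p + t • (q - p)) := by
    intro hq
    obtain ⟨s, hs0, hs1, hs⟩ := mem_seg.1 hq
    have := aux (1 - s * t) (by
      rw [sub_smul, one_smul, sub_eq_zero, ← smul_smul]
      rw [add_sub_cancel_left] at hs
      rw [sub_eq_iff_eq_add, add_comm]; exact hs)
    nlinarith
  have np : p ∉ seg (q, p + t • (q - p)) := by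
    intro hq
    obtain ⟨s, hs0, hs1, hs⟩ := mem_seg.1 hq
    have := aux ((1 - s) * (1 - t) + t - t) (by
      have e : p + t • (q - p) - q = (t - 1) • (q - p) := by rw [sub_smul, one_smul]; abel
      rw [e, smul_smul] at hs
      have e2 : q - p + (s * (t - 1)) • (q - p) = 0 := by
        rw [sub_add_eq_add_sub, ← hs, sub_self]
      have e3 : (1 + s * (t - 1)) • (q - p) = 0 := by rw [add_smul, one_smul]; exact e2
      have e4 := aux _ e3
      nlinarith)
    have hs1' : s = 1 := by nlinarith
    subst hs1'
    rw [one_smul] at hs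
    simp only [add_sub_cancel] at hs
    exact hdpq.1 hs.symm
  have osub1 : openSeg (p, p + t • (q - p)) ⊆ openSeg (p, q) := by
    intro x hx
    have h1 := ne_of_mem_openSeg hdpq.1.symm hx
    refine mem_openSeg_of_mem_seg (sub1 (openSeg_subset_seg _ hx)) h1.1 ?_
    rintro rfl; exact nq (openSeg_subset_seg _ hx)
  have osub2 : openSeg (q, p + t • (q - p)) ⊆ openSeg (p, q) := by
    intro x hx
    have h1 := ne_of_mem_openSeg hdpq.2.symm hx
    refine mem_openSeg_of_mem_seg (sub2 (openSeg_subset_seg _ hx)) ?_ h1.1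
    rintro rfl; exact np (openSeg_subset_seg _ hx)
  have key : ∀ f g x, CrossAt E f g x → x ∉ openSeg (p, q) := by
    intro f g x hx hx'
    refine hE' ?_
    have hf : f ≠ (p, q) := by rintro rfl; exact hE' hx.1
    have := h.generic.no_triple f g (p, q) x (hx.mono (hE hx.1) (hE hx.2.1))
      ⟨hE hx.1, hpq, hf, hx.2.2.2.1, hx'⟩
    exact this ▸ hx.2.1
  have hne' : ∀ f ∈ E, f ≠ (p, q) := by rintro f hf rfl; exact hE' hf
  constructor
  · refine ⟨hoff, ?_, ?_, fun f g x hx hx' => key f g x hx (osub1 hx')⟩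
    · intro f hf hfs
      have := h.start (hE hf) hpq (hne' f hf) (sub1 hfs)
      exact absurd (show (p, q).2 ∈ _ by rw [← this]; exact hfs) nq
    · intro f hf hfs
      exact h.finish (hE hf) hpq (hne' f hf) (sub1 hfs)
  · refine ⟨hoff, ?_, ?_, fun f g x hx hx' => key f g x hx (osub2 hx')⟩
    · intro f hf hfs
      exact h.start (hE hf) hpq (hne' f hf) (sub2 hfs)
    · intro f hf hfs
      have := h.finish (hE hf) hpq (hne' f hf) (sub2 hfs)
      exact absurd (show (p, q).1 ∈ _ by rw [← this]; exact hfs) np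

lemma seg_inter_of_mem_openSeg {a b c x : Pt} (hab : a ≠ b) (hc : c ∈ openSeg (a, b))
    (h1 : x ∈ seg (a, c)) (h2 : x ∈ seg (c, b)) : x = c := by
  obtain ⟨t, ht0, ht1, rfl⟩ := mem_openSeg.1 hc
  obtain ⟨s, hs0, hs1, hs⟩ := mem_seg.1 h1
  obtain ⟨u, hu0, hu1, rfl⟩ := mem_seg.1 h2
  have e : (t + u * (1 - t) - s * t) • (b - a) = 0 := by
    have h1 := congrArg Prod.fst hs
    have h2 := congrArg Prod.snd hs
    simp at h1 h2
    ext
    · simp only [Prod.smul_fst, Prod.fst_sub, smul_eq_mul, Prod.fst_zero]; linear_combination h1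
    · simp only [Prod.smul_snd, Prod.snd_sub, smul_eq_mul, Prod.snd_zero]; linear_combination h2
  have := (smul_eq_zero.1 e).resolve_right (sub_ne_zero.2 hab.symm)
  have hu : u = 0 := by
    have h3 : 0 ≤ u * (1 - t) := mul_nonneg hu0 (by linarith)
    have h4 : 0 ≤ (1 - s) * t := mul_nonneg (by linarith) ht0.le
    have h5 : u * (1 - t) = 0 := by nlinarith
    exact (mul_eq_zero.1 h5).resolve_right (by linarith)
  subst hu; simp

lemma Poly.subdivide {E : Set Edge} (h : Poly E) {a b c : Pt} (hab : (a, b) ∈ E)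
    (hc : c ∈ openSeg (a, b)) (hoff : ∀ f ∈ E, f ≠ (a, b) → c ∉ seg f) : Poly (rep E a b c) := by
  have hne : a ≠ b := h.ne hab
  have hn := ne_of_mem_openSeg hne hc
  obtain ⟨h1, h2⟩ := h.clear_of_mem (E := E \ {(a, b)}) hab sdiff_subset (by simp) hc
    (fun f hf => hoff f hf.1 hf.2)
  exact h.rep' hab h1 h2 hne hn.2.symm hn.1.symm fun x => seg_inter_of_mem_openSeg hne hc

end STLink

namespace STLink
open Set

/-- Equivalence of diagrams. -/
abbrev Eqv (D D' : Diagram) : Prop := Relation.EqvGen Move D D'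

lemma Eqv.trans {D D' D'' : Diagram} (h : Eqv D D') (h' : Eqv D' D'') : Eqv D D'' :=
  Relation.EqvGen.trans _ _ _ h h'
lemma Eqv.symm {D D' : Diagram} (h : Eqv D D') : Eqv D' D := Relation.EqvGen.symm _ _ h
lemma Eqv.refl (D : Diagram) : Eqv D D := Relation.EqvGen.refl _
lemma Move.eqv {D D' : Diagram} (h : Move D D') : Eqv D D' := Relation.EqvGen.rel _ _ h

/-- The diagram `D` with an edge replaced by two edges. -/
def Diagram.ins (D : Diagram) {a b c : Pt} (hab : (a, b) ∈ D.E) (hP : Poly (rep D.E a b c))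
    (kind : Pt → Kind) : Diagram :=
  Diagram.mk' (rep D.E a b c) hP (D.closed.rep hab c) D.bars (by
    intro v hv
    obtain ⟨e, he, rfl⟩ := D.bars_vertex v hv
    by_cases h : e = (a, b)
    · exact ⟨(a, c), mem_rep.2 (by simp), by rw [h]⟩
    · exact ⟨e, mem_rep.2 (Or.inl ⟨he, h⟩), rfl⟩) kind

/-- Two edges through `c` are replaced by the edge from `a` to `b`. -/
def unrep (E : Set Edge) (a b c : Pt) : Set Edge := insert (a, b) (E \ {(a, c), (c, b)})

lemma mem_unrep {E : Set Edge} {a b c : Pt} {g : Edge} :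
    g ∈ unrep E a b c ↔ (g ∈ E ∧ g ≠ (a, c) ∧ g ≠ (c, b)) ∨ g = (a, b) := by
  simp [unrep]; tauto

lemma rep_unrep {E : Set Edge} {a b c : Pt} (h1 : (a, c) ∈ E) (h2 : (c, b) ∈ E)
    (h : (a, b) ∉ E) : rep (unrep E a b c) a b c = E := by
  ext g
  rw [mem_rep, mem_unrep]
  constructor
  · rintro (⟨⟨hg, _⟩ | hg, hne⟩ | rfl | rfl)
    · exact hg
    · exact absurd hg hne
    · exact h1
    · exact h2
  · intro hg
    by_cases h3 : g = (a, c)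
    · exact Or.inr (Or.inl h3)
    by_cases h4 : g = (c, b)
    · exact Or.inr (Or.inr h4)
    exact Or.inl ⟨Or.inl ⟨hg, h3, h4⟩, fun h5 => h (h5 ▸ hg)⟩

lemma Closed.unrep {E : Set Edge} (hE : Closed E) (hP : Poly E) {a b c : Pt} (h1 : (a, c) ∈ E)
    (h2 : (c, b) ∈ E) : Closed (unrep E a b c) := by
  have hca : c ≠ a := (hP.ne h1).symm
  have hcb : c ≠ b := hP.ne h2
  intro p
  have hp := hE p
  constructor
  · rintro ⟨e, he, rfl⟩
    have : ∃ f ∈ E, f.2 = e.1 ∧ e.1 ≠ c := by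
      rcases mem_unrep.1 he with ⟨he, n1, n2⟩ | rfl
      · obtain ⟨f, hf, hfe⟩ := hp.1 ⟨e, he, rfl⟩
        exact ⟨f, hf, hfe, fun h => n2 (hP.injFst e he _ h2 h)⟩
      · obtain ⟨f, hf, hfe⟩ := hp.1 ⟨_, h1, rfl⟩
        exact ⟨f, hf, hfe, hca.symm⟩
    obtain ⟨f, hf, hfe, hec⟩ := this
    by_cases h3 : f = (c, b)
    · exact ⟨(a, b), mem_unrep.2 (Or.inr rfl), by rw [← hfe, h3]⟩
    · refine ⟨f, mem_unrep.2 (Or.inl ⟨hf, ?_, h3⟩), hfe⟩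
      rintro rfl; exact hec hfe.symm
  · rintro ⟨e, he, rfl⟩
    have : ∃ f ∈ E, f.1 = e.2 ∧ e.2 ≠ c := by
      rcases mem_unrep.1 he with ⟨he, n1, n2⟩ | rfl
      · obtain ⟨f, hf, hfe⟩ := hp.2 ⟨e, he, rfl⟩
        exact ⟨f, hf, hfe, fun h => n1 (hP.injSnd e he _ h1 h)⟩
      · obtain ⟨f, hf, hfe⟩ := hp.2 ⟨_, h2, rfl⟩
        exact ⟨f, hf, hfe, hcb.symm⟩
    obtain ⟨f, hf, hfe, hec⟩ := this
    by_cases h3 : f = (a, c)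
    · exact ⟨(a, b), mem_unrep.2 (Or.inr rfl), by rw [← hfe, h3]⟩
    · refine ⟨f, mem_unrep.2 (Or.inl ⟨hf, h3, ?_⟩), hfe⟩
      rintro rfl; exact hec hfe.symm

/-- The diagram `D` with two edges replaced by one edge. -/
def Diagram.del (D : Diagram) {a b c : Pt} (h1 : (a, c) ∈ D.E) (h2 : (c, b) ∈ D.E)
    (hP : Poly (unrep D.E a b c)) (hc : c ∉ D.bars) (kind : Pt → Kind) : Diagram :=
  Diagram.mk' (unrep D.E a b c) hP (D.closed.unrep D.poly h1 h2) D.bars (by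
    intro v hv
    obtain ⟨e, he, rfl⟩ := D.bars_vertex v hv
    by_cases h : e = (a, c)
    · exact ⟨(a, b), mem_unrep.2 (by simp), by rw [h]⟩
    · refine ⟨e, mem_unrep.2 (Or.inl ⟨he, h, ?_⟩), rfl⟩
      rintro rfl; exact hc hv) kind

/-- Cutting a corner whose triangle contains no vertices and no crossings. -/
lemma Poly.unrep {E : Set Edge} (h : Poly E) {p q v : Pt} (h1 : (p, v) ∈ E) (h2 : (v, q) ∈ E)
    (hpq : p ≠ q) (hrev : (q, p) ∉ E)
    (hf : ∀ f ∈ E, f ≠ (p, v) → f ≠ (v, q) → f.1 ∈ tri p q v → f.1 = q)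
    (hs : ∀ f ∈ E, f ≠ (p, v) → f ≠ (v, q) → f.2 ∈ tri p q v → f.2 = p)
    (hx : ∀ f g x, CrossAt E f g x → f ≠ (p, v) → f ≠ (v, q) → g ≠ (p, v) → g ≠ (v, q) →
      x ∉ tri p q v) : Poly (unrep E p q v) := by
  have hsub : seg (p, q) ⊆ tri p q v := seg_subset (convex_tri _ _ _) (tri_left _ _ _) (tri_mid _ _ _)
  have hE0 : Poly (E \ {(p, v), (v, q)}) := h.mono sdiff_subset
  have hm : ∀ f, f ∈ E \ {(p, v), (v, q)} → f ∈ E ∧ f ≠ (p, v) ∧ f ≠ (v, q) := by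
    rintro f ⟨h1, h2⟩
    simp only [mem_insert_iff, mem_singleton_iff, not_or] at h2
    exact ⟨h1, h2⟩
  refine hE0.insert hpq ?_ ?_ ?_ ?_ ?_ ?_ ?_ ?_
  · intro f hf' he
    obtain ⟨m1, m2, m3⟩ := hm f hf'
    exact m2 (h.injFst _ m1 _ h1 he)
  · intro f hf' he
    obtain ⟨m1, m2, m3⟩ := hm f hf'
    exact m3 (h.injSnd _ m1 _ h2 he)
  · intro hf'; exact hrev hf'.1
  · intro f hf' he
    obtain ⟨m1, m2, m3⟩ := hm f hf'
    have := h.start h1 m1 m2.symm he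
    exact this
  · intro f hf' he
    obtain ⟨m1, m2, m3⟩ := hm f hf'
    have := h.finish h2 m1 m3.symm he
    exact this
  · intro f hf' he
    obtain ⟨m1, m2, m3⟩ := hm f hf'
    exact hf f m1 m2 m3 (hsub he)
  · intro f hf' he
    obtain ⟨m1, m2, m3⟩ := hm f hf'
    exact hs f m1 m2 m3 (hsub he)
  · intro f g x hfg hx'
    obtain ⟨m1, m2, m3⟩ := hm f hfg.1
    obtain ⟨n1, n2, n3⟩ := hm g hfg.2.1
    exact hx f g x (hfg.mono m1 n1) m2 m3 n2 n3 (hsub (openSeg_subset_seg _ hx'))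

open Classical in
/-- The kind of the crossings of a moved strand with the edge `g`: all are virtual, except perhaps
those with one given edge. -/
noncomputable def moverKind (e₀ : Edge) (k₀ : Kind) (g : Edge) : Kind :=
  if g = e₀ then k₀ else .virtual

/-- The edge from `a` to `b` of `D` is pushed across a triangle, with any other edges in it.  The
crossings of the moved strand are virtual, except perhaps those with one edge `e₀` which runs
straight through the triangle. -/
structure Tri (e₀ : Edge) (k₀ : Kind) (D D' : Diagram) (a b c : Pt) : Prop where
  mem : (a, b) ∈ D.E
  nondeg : side a b c ≠ 0
  edges : D'.E = rep D.E a b c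
  bars : D'.bars = D.bars
  keeps : KeepsKinds D D'
  bar_a : a ∉ D.bars
  bar_b : b ∉ D.bars
  old : ∀ g x, CrossAt D.E (a, b) g x → D.kind x = moverKind e₀ k₀ g
  new₁ : ∀ g x, CrossAt D'.E (a, c) g x → D'.kind x = moverKind e₀ k₀ g
  new₂ : ∀ g x, CrossAt D'.E (c, b) g x → D'.kind x = moverKind e₀ k₀ g
  real : k₀ ≠ .virtual → e₀ ∈ D.E
  ends : k₀ ≠ .virtual → e₀.1 ∉ tri a b c ∧ e₀.2 ∉ tri a b c
  through : k₀ ≠ .virtual → (seg e₀ ∩ tri a b c).Nonempty →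
    side e₀.1 e₀.2 a * side e₀.1 e₀.2 b < 0
  others : k₀ ≠ .virtual → ∀ g z, CrossAt D.E e₀ g z → g ≠ (a, b) → z ∈ tri a b c →
    D.kind z = .virtual

/-- The edges that meet a triangle on the edge from `a` to `b`, not only in `a` or `b`. -/
def touch (D : Diagram) (a b c : Pt) : Set Edge :=
  {g | g ∈ D.E ∧ g ≠ (a, b) ∧ ¬ (seg g ∩ tri a b c ⊆ {a, b})}

lemma exit_openSeg {b p q d w : Pt} (hs : side b p q ≠ 0) (hd : d ∉ tri b p q)
    (hw : w ∈ seg (b, d)) (hwT : w ∈ tri b p q) (hwp : w ∉ seg (b, p)) (hwq : w ∉ seg (b, q)) :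
    ∃ x, x ∈ openSeg (p, q) ∧ x ∈ openSeg (b, d) := by
  obtain ⟨s, hs0, hs1, rfl⟩ := mem_seg.1 hw
  obtain ⟨σ, τ, hσ, hτ, hστ, he⟩ := mem_tri_add hwT
  have hσ0 : σ ≠ 0 := by
    rintro rfl
    apply hwq
    rw [he]
    exact mem_seg.2 ⟨τ, hτ, by linarith, by simp⟩
  have hτ0 : τ ≠ 0 := by
    rintro rfl
    apply hwp
    rw [he]
    exact mem_seg.2 ⟨σ, hσ, by linarith, by simp⟩
  have hσp : 0 < σ := lt_of_le_of_ne hσ hσ0.symm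
  have hτp : 0 < τ := lt_of_le_of_ne hτ hτ0.symm
  have hs0' : s ≠ 0 := by
    rintro rfl
    apply hwp
    simpa using left_mem_seg (b, p)
  have hsp : 0 < s := lt_of_le_of_ne hs0 hs0'.symm
  have hdd : d = b + (σ / s) • (p - b) + (τ / s) • (q - b) := by
    have h1 := congrArg Prod.fst he
    have h2 := congrArg Prod.snd he
    simp only [Prod.fst_add, Prod.snd_add, Prod.smul_fst, Prod.smul_snd, Prod.fst_sub, Prod.snd_sub,
      smul_eq_mul] at h1 h2
    ext
    · simp; field_simp; linarith
    · simp; field_simp; linarith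
  have hgt : s < σ + τ := by
    by_contra hcon
    apply hd
    rw [hdd]
    have hm : ∀ (u v : ℝ), 0 ≤ u → 0 ≤ v → u + v ≤ 1 → b + u • (p - b) + v • (q - b) ∈ tri b p q := by
      intro u v hu hv huv
      have := (convex_tri b p q).sum_mem (t := Finset.univ) (w := ![1 - u - v, u, v]) (z := ![b, p, q])
        (by intro i _; fin_cases i <;> simp <;> linarith) (by simp [Fin.sum_univ_three]; ring)
        (by intro i _; fin_cases i; exacts [tri_left _ _ _, tri_mid _ _ _, tri_right _ _ _])
      simp only [Fin.sum_univ_three, Matrix.cons_val_zero, Matrix.cons_val_one,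
        Matrix.cons_val_two, Matrix.tail_cons, Matrix.head_cons] at this
      convert this using 1
      ext <;> simp <;> ring
    refine hm _ _ (by positivity) (by positivity) ?_
    rw [← add_div, div_le_one hsp]; linarith
  refine openSeg_of_opp (g := (b, d)) ?_ ?_
  · have e1 : side b d p = - (τ / s) * side b p q := by
      rw [hdd]; simp only [side_eq]; simp; ring
    have e2 : side b d q = (σ / s) * side b p q := by
      rw [hdd]; simp only [side_eq]; simp; ring
    simp only [e1, e2]
    have : 0 < (τ / s) * (σ / s) * (side b p q) ^ 2 := by positivity
    linarith
  · have e1 : side p q d = (1 - (σ + τ) / s) * side b p q := by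
      rw [hdd]; simp only [side_eq]; simp; ring
    have e2 : side p q b = side b p q := by simp only [side_eq]; ring
    simp only [e1, e2]
    have h1 : 1 - (σ + τ) / s < 0 := by
      rw [sub_neg, lt_div_iff₀ hsp]; linarith
    have := mul_self_pos.2 hs
    nlinarith

namespace Tri
variable {e₀ : Edge} {k₀ : Kind} {D D' : Diagram} {a b c : Pt}

lemma mem₁ (h : Tri e₀ k₀ D D' a b c) : (a, c) ∈ D'.E := by
  rw [h.edges, mem_rep]; simp
lemma mem₂ (h : Tri e₀ k₀ D D' a b c) : (c, b) ∈ D'.E := by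
  rw [h.edges, mem_rep]; simp
lemma mem_of (h : Tri e₀ k₀ D D' a b c) {g : Edge} (hg : g ∈ D.E) (hne : g ≠ (a, b)) : g ∈ D'.E := by
  rw [h.edges, mem_rep]; exact Or.inl ⟨hg, hne⟩
lemma apex (h : Tri e₀ k₀ D D' a b c) {g : Edge} (hg : g ∈ D.E) : g.1 ≠ c ∧ g.2 ≠ c := by
  obtain ⟨n1, n2, n3⟩ := ne_of_side h.nondeg
  constructor
  · intro h1
    have hne : g ≠ (a, b) := by rintro rfl; exact n3 h1
    have := D'.poly.injFst g (h.mem_of hg hne) _ h.mem₂ h1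
    subst this
    exact hne (D.poly.injSnd _ hg _ h.mem rfl)
  · intro h1
    have hne : g ≠ (a, b) := by rintro rfl; exact n2 h1
    have := D'.poly.injSnd g (h.mem_of hg hne) _ h.mem₁ h1
    subst this
    exact hne (D.poly.injFst _ hg _ h.mem rfl)
lemma bar_c (h : Tri e₀ k₀ D D' a b c) : c ∉ D.bars := by
  intro hc
  obtain ⟨e, he, hec⟩ := D.bars_vertex c hc
  exact (h.apex he).1 hec

lemma off_c (h : Tri e₀ k₀ D D' a b c) {g : Edge} (hg : g ∈ D.E) (hne : g ≠ (a, b)) :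
    c ∉ seg g := by
  intro hc
  have h3 := D'.poly.finish h.mem₁ (h.mem_of hg hne) (by
    rintro rfl; exact (h.apex hg).2 rfl) hc
  exact (h.apex hg).1 h3.symm

lemma triangleMove (h : Tri e₀ k₀ D D' a b c) {S : Set Edge} (hS : touch D a b c ⊆ S) :
    TriangleMove D D' a b c S where
  mem := h.mem
  nondegenerate := h.nondeg
  edges := h.edges
  bars := h.bars
  kinds := h.keeps
  others g hg hne hgS := by
    by_contra hcon
    exact hgS (hS ⟨hg, hne, hcon⟩)

lemma eqv_of_empty (h : Tri e₀ k₀ D D' a b c) (hS : touch D a b c = ∅) : Eqv D D' :=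
  (Move.push D D' a b c (h.triangleMove hS.subset)).eqv

/-- Signs at the corners for an edge running straight through the triangle. -/
lemma chord_sides (h : Tri e₀ k₀ D D' a b c) {g : Edge} (hg : g ∈ D.E) (hne : g ≠ (a, b))
    (h1 : g.1 ∉ tri a b c) (h2 : g.2 ∉ tri a b c) {w : Pt} (hw : w ∈ seg g) (hwT : w ∈ tri a b c) :
    (side g.1 g.2 a ≠ 0 ∧ side g.1 g.2 b ≠ 0 ∧ side g.1 g.2 c ≠ 0) ∧
    ∀ p ∈ tri a b c, side g.1 g.2 p = 0 → p ∈ openSeg g := by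
  have key : ∀ p ∈ tri a b c, side g.1 g.2 p = 0 → p ∈ openSeg g := fun p hp hp0 =>
    chord_mem (convex_tri a b c) (D.poly.ne hg) h1 h2 hw hwT hp hp0
  refine ⟨⟨fun h0 => ?_, fun h0 => ?_, fun h0 => ?_⟩, key⟩
  · exact D.poly.left_notMem h.mem hg (key a (tri_left _ _ _) h0)
  · exact D.poly.right_notMem h.mem hg (key b (tri_mid _ _ _) h0)
  · exact h.off_c hg hne (openSeg_subset_seg _ (key c (tri_right _ _ _) h0))

lemma cross_of_opp {E : Set Edge} {g : Edge} {p q : Pt} {K : Set Pt} (hK : Convex ℝ K)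
    (hp : p ∈ K) (hq : q ∈ K)
    (hg : g ∈ E) (hpq : (p, q) ∈ E) (hne : (p, q) ≠ g)
    (key : ∀ p ∈ K, side g.1 g.2 p = 0 → p ∈ openSeg g)
    (h : side g.1 g.2 p * side g.1 g.2 q < 0) : ∃ x ∈ K, CrossAt E (p, q) g x := by
  obtain ⟨x, hx, hx0⟩ := exists_openSeg_of_opp h
  have hxK := seg_subset hK hp hq (openSeg_subset_seg _ hx)
  exact ⟨x, hxK, hpq, hg, hne, hx, key x hxK hx0⟩

lemma not_all_pos {g : Edge} {w : Pt} (hw : side g.1 g.2 w = 0) (hwT : w ∈ tri a b c)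
    (hab : 0 < side g.1 g.2 a * side g.1 g.2 b) (hac : 0 < side g.1 g.2 a * side g.1 g.2 c) :
    False := by
  have := tri_subset (convex_side_pos g.1 g.2 (side g.1 g.2 a)) (a := a) (b := b) (c := c)
    (by
      change 0 < side g.1 g.2 a * side g.1 g.2 a
      have : side g.1 g.2 a ≠ 0 := by intro h; simp [h] at hab
      exact mul_self_pos.2 this) hab hac hwT
  change 0 < side g.1 g.2 a * side g.1 g.2 w at this
  rw [hw] at this; simp at this

lemma eqv_of_chord (h : Tri e₀ k₀ D D' a b c) {g : Edge} (hS : touch D a b c ⊆ {g}) (hg : g ∈ D.E)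
    (hne : g ≠ (a, b)) (h1 : g.1 ∉ tri a b c) (h2 : g.2 ∉ tri a b c) {w : Pt} (hw : w ∈ seg g)
    (hwT : w ∈ tri a b c) : Eqv D D' := by
  obtain ⟨⟨ha, hb, hc⟩, key⟩ := h.chord_sides hg hne h1 h2 hw hwT
  have hgD := h.mem_of hg hne
  have n1 : (a, c) ≠ g := by rintro rfl; exact h1 (tri_left _ _ _)
  have n2 : (c, b) ≠ g := by rintro rfl; exact h1 (tri_right _ _ _)
  have hK := convex_tri a b c
  have ma := tri_left a b c
  have mb := tri_mid a b c
  have mc := tri_right a b c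
  have cab := cross_of_opp hK ma mb hg h.mem hne.symm key
  have cac := cross_of_opp hK ma mc hgD h.mem₁ n1 key
  have ccb := cross_of_opp hK mc mb hgD h.mem₂ n2 key
  have hT := h.triangleMove hS
  rcases lt_or_gt_of_ne (mul_ne_zero ha hb) with hab | hab
  · obtain ⟨x, -, hx⟩ := cab hab
    rcases lt_or_gt_of_ne (mul_ne_zero ha hc) with hac | hac
    · obtain ⟨x', -, hx'⟩ := cac hac
      exact (Move.pushCrossing D D' a b c g x x' hT hx (Or.inl hx')
        ((h.new₁ _ _ hx').trans (h.old _ _ hx).symm)).eqv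
    · have hcb : side g.1 g.2 c * side g.1 g.2 b < 0 := by
        rcases mul_pos_iff.1 hac with ⟨u1, u2⟩ | ⟨u1, u2⟩
        · exact mul_neg_of_pos_of_neg u2 (by nlinarith)
        · exact mul_neg_of_neg_of_pos u2 (by nlinarith)
      obtain ⟨x', -, hx'⟩ := ccb hcb
      exact (Move.pushCrossing D D' a b c g x x' hT hx (Or.inr hx')
        ((h.new₂ _ _ hx').trans (h.old _ _ hx).symm)).eqv
  · have hac : side g.1 g.2 a * side g.1 g.2 c < 0 := by
      by_contra hcon
      have hac : 0 < side g.1 g.2 a * side g.1 g.2 c :=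
        lt_of_le_of_ne (not_lt.1 hcon) (mul_ne_zero ha hc).symm
      exact not_all_pos (side_of_mem_seg hw) hwT hab hac
    have hcb : side g.1 g.2 c * side g.1 g.2 b < 0 := by
      rcases mul_pos_iff.1 hab with ⟨u1, u2⟩ | ⟨u1, u2⟩
      · exact mul_neg_of_neg_of_pos (by nlinarith) u2
      · exact mul_neg_of_pos_of_neg (by nlinarith) u2
    obtain ⟨x, -, hx⟩ := cac hac
    obtain ⟨y, -, hy⟩ := ccb hcb
    have hv : moverKind e₀ k₀ g = .virtual := by
      unfold moverKind
      split_ifs with hge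
      · subst hge
        by_contra hk
        exact absurd (h.through hk ⟨w, hw, hwT⟩) (not_lt.2 hab.le)
      · rfl
    exact (Move.bigon D D' a b c g x y hT hx hy
      (Or.inl ⟨(h.new₁ _ _ hx).trans hv, (h.new₂ _ _ hy).trans hv⟩)).eqv

/-- An edge starting at `b` and leaving the triangle crosses the opposite side. -/
lemma exit_b (h : Tri e₀ k₀ D D' a b c) {d : Pt} (hg : (b, d) ∈ touch D a b c)
    (hd : d ∉ tri a b c) : ∃ x, CrossAt D'.E (a, c) (b, d) x := by
  obtain ⟨hgD, hne, hns⟩ := hg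
  obtain ⟨w, ⟨hw, hwT⟩, hwn⟩ := not_subset.1 hns
  simp only [mem_insert_iff, mem_singleton_iff, not_or] at hwn
  have hgD' := h.mem_of hgD hne
  have hbc : b ≠ c := (ne_of_side h.nondeg).2.1
  have e1 : tri b a c = tri a b c := tri_swap12 a b c
  obtain ⟨x, hx1, hx2⟩ := exit_openSeg (b := b) (p := a) (q := c) (d := d) (w := w)
    (by rw [side_swap]; simpa using h.nondeg) (by rwa [e1]) hw (by rwa [e1])
    (fun hc => hwn.2 (D.poly.inter_unique hgD h.mem hne hw (by rwa [seg_swap]) (left_mem_seg _)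
      (right_mem_seg (a, b))))
    (fun hc => hwn.2 (D'.poly.inter_unique hgD' h.mem₂ (fun h' => hbc (Prod.ext_iff.1 h').1)
      hw (by rwa [seg_swap]) (left_mem_seg _) (right_mem_seg (c, b))))
  refine ⟨x, h.mem₁, hgD', ?_, hx1, hx2⟩
  intro h'; exact (ne_of_side h.nondeg).1 (Prod.ext_iff.1 h').1

/-- An edge ending at `a` and leaving the triangle crosses the opposite side. -/
lemma exit_a (h : Tri e₀ k₀ D D' a b c) {d : Pt} (hg : (d, a) ∈ touch D a b c)
    (hd : d ∉ tri a b c) : ∃ x, CrossAt D'.E (c, b) (d, a) x := by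
  obtain ⟨hgD, hne, hns⟩ := hg
  obtain ⟨w, ⟨hw, hwT⟩, hwn⟩ := not_subset.1 hns
  simp only [mem_insert_iff, mem_singleton_iff, not_or] at hwn
  have hgD' := h.mem_of hgD hne
  have hac : a ≠ c := (ne_of_side h.nondeg).2.2
  obtain ⟨x, hx1, hx2⟩ := exit_openSeg (b := a) (p := c) (q := b) (d := d) (w := w)
    (by rw [side_swap']; simpa using h.nondeg) (by rwa [tri_swap23]) (by rwa [seg_swap])
    (by rwa [tri_swap23])
    (fun hc => hwn.1 (D'.poly.inter_unique hgD' h.mem₁ (fun h' => hac (Prod.ext_iff.1 h').2)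
      hw hc (right_mem_seg (d, a)) (left_mem_seg (a, c))))
    (fun hc => hwn.1 (D.poly.inter_unique hgD h.mem hne hw hc (right_mem_seg (d, a))
      (left_mem_seg (a, b))))
  refine ⟨x, h.mem₂, hgD', ?_, hx1, by rwa [openSeg_swap]⟩
  intro h'; exact (ne_of_side h.nondeg).1 (Prod.ext_iff.1 h').2.symm

lemma moverKind_virtual (h : Tri e₀ k₀ D D' a b c) {g : Edge} (hg : g.1 ∈ tri a b c ∨ g.2 ∈ tri a b c) :
    moverKind e₀ k₀ g = .virtual := by
  unfold moverKind
  split_ifs with h1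
  · subst h1
    by_contra hk
    exact hg.elim (h.ends hk).1 (h.ends hk).2
  · rfl

lemma eqv_of_kink (h : Tri e₀ k₀ D D' a b c) {d : Pt} (hS : touch D a b c ⊆ {(b, d)})
    (hg : (b, d) ∈ touch D a b c) (hd : d ∉ tri a b c) : Eqv D D' := by
  obtain ⟨x, hx⟩ := h.exit_b hg hd
  refine (Move.kink D D' a b c d x (h.triangleMove hS) h.bar_b hx ?_).eqv
  rw [h.new₁ _ _ hx, h.moverKind_virtual (Or.inl (tri_mid _ _ _))]
  simp

end Tri

/-- A compact set away from a triangle is away from all nearby triangles. -/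
lemma exists_tri_disjoint {F : Set Pt} (hF : IsCompact F) {p q r : Pt} (h : Disjoint (tri p q r) F) :
    ∃ ε > 0, ∀ p' q' r', dist p' p < ε → dist q' q < ε → dist r' r < ε → Disjoint (tri p' q' r') F := by
  obtain ⟨δ, hδ, hd⟩ := h.exists_thickenings (isCompact_tri p q r) hF.isClosed
  refine ⟨δ, hδ, fun p' q' r' hp hq hr => ?_⟩
  have hd' : Disjoint (Metric.thickening δ (tri p q r)) F :=
    hd.mono_right (Metric.self_subset_thickening hδ _)
  refine hd'.mono_left (tri_subset ((convex_tri p q r).thickening δ) ?_ ?_ ?_)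
  · exact Metric.mem_thickening_iff.2 ⟨p, tri_left _ _ _, hp⟩
  · exact Metric.mem_thickening_iff.2 ⟨q, tri_mid _ _ _, hq⟩
  · exact Metric.mem_thickening_iff.2 ⟨r, tri_right _ _ _, hr⟩

end STLink

namespace STLink
open Set Filter Topology

lemma Diagram.exists_subdivide (D : Diagram) {a b c : Pt} (hab : (a, b) ∈ D.E)
    (hc : c ∈ openSeg (a, b)) (hoff : ∀ f ∈ D.E, f ≠ (a, b) → c ∉ seg f) :
    ∃ D₁ : Diagram, D₁.E = rep D.E a b c ∧ D₁.bars = D.bars ∧ D₁.kind = D.kind ∧ Eqv D D₁ := by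
  refine ⟨D.ins hab (D.poly.subdivide hab hc hoff) D.kind, rfl, rfl, rfl, ?_⟩
  exact (Move.subdivide D (D.ins hab (D.poly.subdivide hab hc hoff) D.kind) a b c hab hc rfl rfl
    fun _ _ _ _ => rfl).eqv

lemma convex_le_side (p q : Pt) (k m : ℝ) : Convex ℝ {x | k ≤ m * side p q x} := by
  intro x hx y hy s t hs ht hst
  simp only [mem_ofPred_eq] at *
  have : m * side p q (s • x + t • y) = s * (m * side p q x) + t * (m * side p q y) := by
    obtain rfl : s = 1 - t := by linarith
    simp only [side_eq, Prod.fst_add, Prod.snd_add, Prod.smul_fst, Prod.smul_snd, smul_eq_mul]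
    ring
  rw [this]
  obtain rfl : s = 1 - t := by linarith
  nlinarith [mul_le_mul_of_nonneg_left hx hs, mul_le_mul_of_nonneg_left hy ht]

lemma side_add_smul₂ (p a v x : Pt) (t : ℝ) :
    side p (a + t • (v - a)) x = (1 - t) * side p a x + t * side p v x := by
  simp only [side_eq, Prod.fst_add, Prod.snd_add, Prod.smul_fst, Prod.smul_snd, Prod.fst_sub,
    Prod.snd_sub, smul_eq_mul]; ring

/-- An edge from a corner `b` that does not enter the triangle stays away from a slightly enlarged
triangle. -/
lemma exists_separating {a b c d x y : Pt} (hs : side a b c ≠ 0) (hx : x ∈ openSeg (c, b))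
    (hxy : x ∈ openSeg (y, a)) (hd : seg (b, d) ∩ tri a b c ⊆ {b}) (hbd : b ≠ d) :
    ∀ᶠ η : ℝ in 𝓝[>] 0, ∃ p q : Pt, ∃ m : ℝ, 0 ≤ m * side p q a ∧ 0 ≤ m * side p q b ∧
      0 ≤ m * side p q c ∧ 0 ≤ m * side p q (x + η • (y - x)) ∧ side p q b = 0 ∧
      m * side p q d < 0 := by
  obtain ⟨hne1, hne2, hne3⟩ := ne_of_side hs
  obtain ⟨t, ht0, ht1, hxt⟩ := mem_openSeg.1 hxy
  obtain ⟨u, hu0, hu1, hxu⟩ := mem_openSeg.1 hx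
  have hx1 : side b a x = (1 - t) * side b a y := by rw [hxt, side_add_smul]; simp
  have hx2 : side b a x = (1 - u) * side b a c := by rw [hxu, side_add_smul]; simp
  have hbac : side b a c ≠ 0 := by rw [side_swap]; simpa using hs
  have hbay : 0 < side b a c * side b a y := by
    have h1 : (1 - t) * (side b a c * side b a y) = (1 - u) * (side b a c * side b a c) := by
      linear_combination side b a c * hx2 - side b a c * hx1
    have h2 : 0 < (1 - u) * (side b a c * side b a c) :=
      mul_pos (by linarith) (mul_self_pos.2 hbac)
    rw [← h1] at h2
    exact (mul_pos_iff_of_pos_left (by linarith)).1 h2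
  by_cases hcase : side b a d * side b a c < 0
  · filter_upwards [self_mem_nhdsWithin] with η hη
    refine ⟨b, a, side b a c, by simp, by simp, mul_self_nonneg _, ?_, by simp, by linarith⟩
    rw [side_add_smul, hx2]
    have hη' : (0 : ℝ) < η := hη
    -- `y` and `x` lie on the same side of the line
    have e : side b a c * ((1 - η) * ((1 - u) * side b a c) + η * side b a y) =
      (1 - u) * (side b a c * side b a c) + η * (side b a c * side b a y
        - (1 - u) * (side b a c * side b a c)) := by ring
    have e2 : side b a c * side b a y - (1 - u) * (side b a c * side b a c) =
        t * (side b a c * side b a y) := by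
      linear_combination side b a c * hx2 - side b a c * hx1
    rw [e, e2]
    have := mul_self_nonneg (side b a c)
    have : 0 ≤ (1 - u) * (side b a c * side b a c) := mul_nonneg (by linarith) this
    have : 0 ≤ η * (t * (side b a c * side b a y)) := by positivity
    linarith
  · have hcase := not_lt.1 hcase
    have hbca : side b c a = - side b a c := side_swap' b a c
    have hdneg : side b c d * side b c a < 0 := by
      by_contra hcon
      have hcon := not_lt.1 hcon
      have hσ : 0 ≤ side b c d / side b c a := by
        rw [hbca] at *
        rcases lt_or_gt_of_ne hbac with h | h
        · exact div_nonneg (by nlinarith) (by linarith)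
        · exact div_nonneg_of_nonpos (by nlinarith) (by linarith)
      have hτ : 0 ≤ side b a d / side b a c := by
        rcases lt_or_gt_of_ne hbac with h | h
        · exact div_nonneg_of_nonpos (by nlinarith) h.le
        · exact div_nonneg (by nlinarith) h.le
      set σ := side b c d / side b c a
      set τ := side b a d / side b a c
      have hdd : d = b + σ • (a - b) + τ • (c - b) := by
        have h1 : side b a c * σ = - side b c d := by
          simp only [σ]; rw [hbca]; field_simp
        have h2 : side b a c * τ = side b a d := by
          simp only [τ]; field_simp
        clear_value σ τ
        simp only [side_eq] at h1 h2
        rw [side_eq] at hbac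
        ext
        · apply mul_left_cancel₀ hbac
          simp only [Prod.fst_add, Prod.smul_fst, Prod.fst_sub, smul_eq_mul]
          linear_combination (-(a.1 - b.1)) * h1 - (c.1 - b.1) * h2
        · apply mul_left_cancel₀ hbac
          simp only [Prod.snd_add, Prod.smul_snd, Prod.snd_sub, smul_eq_mul]
          linear_combination (-(a.2 - b.2)) * h1 - (c.2 - b.2) * h2
      set s := 1 / (1 + σ + τ)
      have hs0 : 0 < s := by positivity
      have hs1 : s ≤ 1 := by
        rw [div_le_one (by positivity)]; linarith
      have hsst : s * σ + s * τ ≤ 1 := by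
        have : s * (1 + σ + τ) = 1 := by simp only [s]; field_simp
        nlinarith
      have hmem : b + s • (d - b) ∈ tri a b c := by
        have : b + s • (d - b) = (1 - s * σ - s * τ) • b + (s * σ) • a + (s * τ) • c := by
          rw [hdd]; ext <;> simp <;> ring
        rw [this]
        have hm := (convex_tri a b c).sum_mem (t := Finset.univ)
          (w := ![1 - s * σ - s * τ, s * σ, s * τ]) (z := ![b, a, c])
          (by intro i _; fin_cases i <;> simp <;> first | linarith | positivity)
          (by simp [Fin.sum_univ_three]; ring)
          (by intro i _; fin_cases i; exacts [tri_mid _ _ _, tri_left _ _ _, tri_right _ _ _])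
        simpa [Fin.sum_univ_three] using hm
      have := hd ⟨mem_seg.2 ⟨s, hs0.le, hs1, rfl⟩, hmem⟩
      rw [mem_singleton_iff, add_eq_left, smul_eq_zero] at this
      rcases this with h | h
      · exact hs0.ne' h
      · exact hbd (sub_eq_zero.1 h).symm
    have hxd : ∀ z, side b x z = (1 - u) * side b c z := by
      intro z; rw [hxu, side_add_smul₂]; simp
    have hlim : Tendsto (fun η : ℝ => side b x a * side b (x + η • (y - x)) d) (𝓝[>] 0)
        (𝓝 (side b x a * side b x d)) := by
      have : Continuous fun η : ℝ => side b x a * side b (x + η • (y - x)) d := by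
        simp only [side_add_smul₂]; fun_prop
      have h2 := this.tendsto 0
      simp only [zero_smul, add_zero] at h2
      exact h2.mono_left nhdsWithin_le_nhds
    have hneg : side b x a * side b x d < 0 := by
      rw [hxd, hxd]
      have : 0 < (1 - u) * (1 - u) := by nlinarith
      nlinarith
    have hev1 := hlim.eventually (gt_mem_nhds hneg)
    have hev2 : ∀ᶠ η : ℝ in 𝓝[>] 0, η < 1 := nhdsWithin_le_nhds (gt_mem_nhds one_pos)
    filter_upwards [hev1, self_mem_nhdsWithin, hev2] with η h1 h2 h3
    have h2 : 0 < η := h2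
    have hya : side b y a * side b x a = side b a y * side b a x := by
      rw [side_swap' b a y, side_swap' b a x]; ring
    have hxx : 0 < side b a y * side b a x := by
      rw [hx1]
      have : side b a y ≠ 0 := by intro h; simp [h] at hbay
      have := mul_self_pos.2 this
      nlinarith
    refine ⟨b, x + η • (y - x), side b x a, ?_, by simp, ?_, by simp, by simp, h1⟩
    · rw [side_add_smul₂]
      nlinarith [mul_self_nonneg (side b x a)]
    · rw [side_add_smul₂, hxd c, side_right, hxd a, hbca]
      -- `y` lies beyond the line through `b` and `c`
      have hy : (1 - t) * side b c y + t * side b c a = 0 := by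
        have : side b c x = 0 := by rw [hxu, side_add_smul]; simp
        rw [hxt, side_add_smul] at this; exact this
      have hyc : side b y c = - side b c y := side_swap' b c y
      rw [hyc]
      have h4 : 0 ≤ side b a c * side b a c := mul_self_nonneg _
      have h5 : (1 - t) * (side b a c * side b c y) = t * (side b a c * side b a c) := by
        rw [hbca] at hy; linear_combination side b a c * hy
      have h6 : 0 ≤ side b a c * side b c y := by
        have : 0 ≤ (1 - t) * (side b a c * side b c y) := by rw [h5]; positivity
        exact (mul_nonneg_iff_of_pos_left (by linarith)).1 this
      have h7 : 0 ≤ (1 - u) * η * (side b a c * side b c y) :=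
        mul_nonneg (mul_nonneg (by linarith) h2.le) h6
      nlinarith

lemma exists_thickening_disjoint {K : Set Pt} (hK : IsCompact K) {O : Set Edge} (hO : O.Finite)
    (h : ∀ f ∈ O, Disjoint K (seg f)) : ∃ δ > 0, ∀ f ∈ O, Disjoint (Metric.thickening δ K) (seg f) := by
  have hc : IsClosed (⋃ f ∈ O, seg f) := hO.isClosed_biUnion fun f _ => (isCompact_seg f).isClosed
  have hd : Disjoint K (⋃ f ∈ O, seg f) := by
    simp only [disjoint_iUnion_right]; exact h
  obtain ⟨δ, hδ, hd⟩ := hd.exists_thickenings hK hc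
  refine ⟨δ, hδ, fun f hf => hd.mono_right ?_⟩
  exact (subset_biUnion_of_mem (u := fun f => seg f) hf).trans (Metric.self_subset_thickening hδ _)

namespace Tri
variable {e₀ : Edge} {k₀ : Kind} {D D' : Diagram} {a b c : Pt}

lemma eqv_of_kink' (h : Tri e₀ k₀ D D' a b c) {y : Pt} (hS : touch D a b c ⊆ {(y, a)})
    (hg : (y, a) ∈ touch D a b c) (hy : y ∉ tri a b c) : Eqv D D' := by
  obtain ⟨x, hx⟩ := h.exit_a hg hy
  obtain ⟨hne1, hne2, hne3⟩ := ne_of_side h.nondeg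
  have hya : (y, a) ∈ D.E := hg.1
  have hya' : (y, a) ∈ D'.E := h.mem_of hya hg.2.1
  have hyne : y ≠ a := D.poly.ne hya
  have hxo : x ∈ openSeg (y, a) := hx.2.2.2.2
  have hxcb : x ∈ openSeg (c, b) := hx.2.2.2.1
  -- the other edges
  set O : Set Edge := {f | f ∈ D.E ∧ f ≠ (a, b) ∧ f ≠ (y, a)} with hO
  have hOa : ∀ f ∈ O, a ∉ seg f := by
    rintro f ⟨hf, n1, n2⟩ ha
    have h1 := D.poly.start h.mem hf n1.symm ha
    exact n2 (D.poly.injSnd f hf _ hya h1.symm)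
  have hOT : ∀ f ∈ O, seg f ∩ tri a b c ⊆ {b} := by
    rintro f hf z hz
    have : f ∉ touch D a b c := fun hft => hf.2.2 (hS hft)
    have h2 : seg f ∩ tri a b c ⊆ {a, b} := by
      by_contra hcon; exact this ⟨hf.1, hf.2.1, hcon⟩
    rcases h2 hz with rfl | h3
    · exact absurd hz.1 (hOa f hf)
    · exact h3
  have hOb : ∀ f ∈ O, b ∈ seg f → f.1 = b := by
    intro f hf hb
    have := D.poly.finish h.mem hf.1 hf.2.1.symm hb
    exact this.symm
  obtain ⟨⟨b', d⟩, ⟨hbd, hb'⟩, -⟩ := D.next _ h.mem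
  simp only at hb'
  subst hb'
  have hbdne : b' ≠ d := D.poly.ne hbd
  have hbdO : (b', d) ∈ O := ⟨hbd, fun h' => hne1 (Prod.ext_iff.1 h').1.symm, by
    intro h'
    rw [Prod.ext_iff] at h'
    obtain ⟨h1, h2⟩ := h'
    simp only at h1 h2
    subst h2
    exact D.poly.generic.no_reverse _ _ h.mem hbd⟩
  obtain ⟨δ, hδ, hdis⟩ := exists_thickening_disjoint (isCompact_tri a b' c)
    (O := {f | f ∈ O ∧ f.1 ≠ b'}) (D.finite.subset fun f hf => hf.1.1) (by
      rintro f ⟨hf, hfb⟩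
      rw [disjoint_left]
      intro z hz hzf
      have := hOT f hf ⟨hzf, hz⟩
      rw [mem_singleton_iff] at this
      subst this
      exact hfb (hOb f hf hzf))
  have hev1 := exists_separating h.nondeg hxcb hxo (hOT _ hbdO) hbdne
  have hxT : x ∈ tri a b' c := seg_subset (convex_tri _ _ _) (tri_right _ _ _) (tri_mid _ _ _)
    (openSeg_subset_seg _ hxcb)
  have hev2 : ∀ᶠ η : ℝ in 𝓝[>] 0, x + η • (y - x) ∈ Metric.thickening δ (tri a b' c) := by
    have hcont : Continuous fun η : ℝ => x + η • (y - x) := by fun_prop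
    have h2 := hcont.tendsto 0
    simp only [zero_smul, add_zero] at h2
    exact (h2.mono_left nhdsWithin_le_nhds).eventually
      (Metric.isOpen_thickening.mem_nhds (Metric.self_subset_thickening hδ _ hxT))
  have hev3 : ∀ᶠ η : ℝ in 𝓝[>] 0, η < 1 := nhdsWithin_le_nhds (gt_mem_nhds one_pos)
  obtain ⟨η, ⟨p, q, m, hpa, hpb, hpc, hpy, hpb0, hpd⟩, hηT, hη1, hη0⟩ :=
    (hev1.and (hev2.and (hev3.and self_mem_nhdsWithin))).exists
  have hη0 : 0 < η := hη0
  set y' := x + η • (y - x) with hy'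
  obtain ⟨t, ht0, ht1, hxt⟩ := mem_openSeg.1 hxo
  have hy'o : y' ∈ openSeg (y, a) := by
    refine mem_openSeg.2 ⟨(1 - η) * t, by nlinarith, by nlinarith, ?_⟩
    rw [hy', hxt]; ext <;> simp <;> ring
  have hy'ne := ne_of_mem_openSeg hyne hy'o
  -- `y'` lies beyond the line through `b'` and `c`
  set ψ : Pt → ℝ := fun v => side c b' a * side c b' v with hψ
  have hcba : side c b' a ≠ 0 := by
    have := h.nondeg
    rw [show side c b' a = - side a b' c by simp only [side_eq]; ring]; simpa using this
  have hψa : 0 < ψ a := mul_self_pos.2 hcba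
  have hψx : ψ x = 0 := by
    simp only [hψ]; rw [side_of_mem_seg (openSeg_subset_seg _ hxcb)]; simp
  have hψlin : ∀ (v w : Pt) (s : ℝ), ψ (v + s • (w - v)) = (1 - s) * ψ v + s * ψ w := by
    intro v w s; simp only [hψ]; rw [side_add_smul]; ring
  have hψy : ψ y < 0 := by
    have : (1 - t) * ψ y + t * ψ a = 0 := by rw [← hψlin, ← hxt]; exact hψx
    by_contra hcon
    nlinarith
  have hψy' : ψ y' = η * ψ y := by rw [hy', hψlin, hψx]; ring
  have hψy'0 : ψ y' < 0 := by rw [hψy']; nlinarith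
  have hψb : ψ b' = 0 := by simp [hψ]
  have hψc : ψ c = 0 := by simp [hψ]
  -- a convex neighbourhood of all moves
  set W : Set Pt := convexHull ℝ {a, b', c, y'} with hW
  have hWc : Convex ℝ W := convex_convexHull ℝ _
  have hWa : a ∈ W := subset_convexHull ℝ _ (by simp)
  have hWb : b' ∈ W := subset_convexHull ℝ _ (by simp)
  have hWcc : c ∈ W := subset_convexHull ℝ _ (by simp)
  have hWy : y' ∈ W := subset_convexHull ℝ _ (by simp)
  have hWsub : ∀ K : Set Pt, Convex ℝ K → a ∈ K → b' ∈ K → c ∈ K → y' ∈ K → W ⊆ K := by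
    intro K hK k1 k2 k3 k4
    exact convexHull_min (by rintro z (rfl | rfl | rfl | rfl) <;> assumption) hK
  have hWth : W ⊆ Metric.thickening δ (tri a b' c) := by
    have hs := Metric.self_subset_thickening hδ (tri a b' c)
    exact hWsub _ ((convex_tri _ _ _).thickening δ) (hs (tri_left _ _ _)) (hs (tri_mid _ _ _))
      (hs (tri_right _ _ _)) hηT
  have hWsep : W ⊆ {v | 0 ≤ m * side p q v} :=
    hWsub _ (convex_side_mul_nonneg p q m) hpa hpb hpc hpy
  have hWψ : W ⊆ {v | ψ y' ≤ ψ v} :=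
    hWsub _ (convex_le_side c b' _ _) (by change ψ y' ≤ ψ a; linarith)
      (by change ψ y' ≤ ψ b'; linarith) (by change ψ y' ≤ ψ c; linarith) (le_refl (ψ y'))
  have hOW : ∀ f ∈ O, seg f ∩ W ⊆ {b'} := by
    rintro f hf z ⟨hzf, hzW⟩
    by_cases hfb : f.1 = b'
    · have : f = (b', d) := D.poly.injFst f hf.1 _ hbd hfb
      subst this
      obtain ⟨s, hs0, hs1, rfl⟩ := mem_seg.1 hzf
      have h1 : 0 ≤ m * side p q (b' + s • (d - b')) := hWsep hzW
      rw [side_add_smul, hpb0] at h1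
      have : s = 0 := by
        by_contra hs
        have : 0 < s := lt_of_le_of_ne hs0 (Ne.symm hs)
        nlinarith
      subst this; simp
    · exact absurd hzf (disjoint_left.1 (hdis f ⟨hf, hfb⟩) (hWth hzW))
  have hyW : seg (y, y') ∩ W ⊆ {y'} := by
    rintro z ⟨hz, hzW⟩
    obtain ⟨s, hs0, hs1, rfl⟩ := mem_seg.1 hz
    have h1 : ψ y' ≤ ψ (y + s • (y' - y)) := hWψ hzW
    have e := hψlin y y' s
    rw [e] at h1
    have : s = 1 := by
      by_contra hs
      have hs1 : s < 1 := lt_of_le_of_ne hs1 hs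
      have h2 : ψ y < ψ y' := by rw [hψy']; nlinarith
      nlinarith
    subst this; simp
  have hy'b : y' ≠ b' := by
    intro h'; rw [h'] at hψy'0; linarith
  have hy'c : y' ≠ c := by
    intro h'; rw [h'] at hψy'0; linarith
  have hy'O : ∀ f ∈ O, y' ∉ seg f := fun f hf hyf => hy'b (hOW f hf ⟨hyf, hWy⟩)
  -- subdivision
  have hoff : ∀ f ∈ D.E, f ≠ (y, a) → y' ∉ seg f := by
    intro f hf hne
    by_cases hfab : f = (a, b')
    · subst hfab
      intro hyf
      exact hy'ne.2 (D.poly.inter_unique hya hf hne.symm (openSeg_subset_seg _ hy'o) hyf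
        (right_mem_seg _) (left_mem_seg (a, b')))
    · exact hy'O f ⟨hf, hfab, hne⟩
  have hoff' : ∀ f ∈ D'.E, f ≠ (y, a) → y' ∉ seg f := by
    intro f hf hne
    rw [h.edges, mem_rep] at hf
    rcases hf with ⟨hf, -⟩ | rfl | rfl
    · exact hoff f hf hne
    · intro hyf
      exact hy'ne.2 (D'.poly.inter_unique hya' h.mem₁ hne.symm (openSeg_subset_seg _ hy'o) hyf
        (right_mem_seg _) (left_mem_seg (a, c)))
    · intro hyf
      have : side c b' y' = 0 := side_of_mem_seg hyf
      simp only [hψ, this] at hψy'0; simp at hψy'0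
  obtain ⟨D₁, hE₁, hB₁, hK₁, hD₁⟩ := D.exists_subdivide hya hy'o hoff
  obtain ⟨D₂, hE₂, hB₂, hK₂, hD₂⟩ := D'.exists_subdivide hya' hy'o hoff'
  have mem₁ : ∀ f, f ∈ D₁.E ↔ f ∈ O ∨ f = (a, b') ∨ f = (y, y') ∨ f = (y', a) := by
    intro f
    rw [hE₁, mem_rep]
    constructor
    · rintro (⟨hf, hne⟩ | h1 | h1)
      · by_cases hfab : f = (a, b')
        · exact Or.inr (Or.inl hfab)
        · exact Or.inl ⟨hf, hfab, hne⟩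
      · exact Or.inr (Or.inr (Or.inl h1))
      · exact Or.inr (Or.inr (Or.inr h1))
    · rintro (hf | rfl | h1 | h1)
      · exact Or.inl ⟨hf.1, hf.2.2⟩
      · exact Or.inl ⟨h.mem, hg.2.1.symm⟩
      · exact Or.inr (Or.inl h1)
      · exact Or.inr (Or.inr h1)
  have hac_ne : (a, c) ≠ (y, a) := fun h' => hne3 (Prod.ext_iff.1 h').2.symm
  have hcb_ne : (c, b') ≠ (y, a) := fun h' => hne1 (Prod.ext_iff.1 h').2.symm
  have mem₂ : ∀ f, f ∈ D₂.E ↔ f ∈ O ∨ f = (a, c) ∨ f = (c, b') ∨ f = (y, y') ∨ f = (y', a) := by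
    intro f
    rw [hE₂, mem_rep, h.edges, mem_rep]
    constructor
    · rintro (⟨⟨hf, hne⟩ | h1 | h1, hne'⟩ | h1 | h1)
      · exact Or.inl ⟨hf, hne, hne'⟩
      · exact Or.inr (Or.inl h1)
      · exact Or.inr (Or.inr (Or.inl h1))
      · exact Or.inr (Or.inr (Or.inr (Or.inl h1)))
      · exact Or.inr (Or.inr (Or.inr (Or.inr h1)))
    · rintro (hf | rfl | rfl | h1 | h1)
      · exact Or.inl ⟨Or.inl ⟨hf.1, hf.2.1⟩, hf.2.2⟩
      · exact Or.inl ⟨Or.inr (Or.inl rfl), hac_ne⟩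
      · exact Or.inl ⟨Or.inr (Or.inr rfl), hcb_ne⟩
      · exact Or.inr (Or.inl h1)
      · exact Or.inr (Or.inr h1)
  have hyy' : y ≠ y' := hy'ne.1.symm
  have hyb : y ≠ b' := by rintro rfl; exact D.poly.generic.no_reverse _ _ h.mem hya
  have hOy : ∀ f ∈ O, f.1 ∈ W → f.1 = b' := fun f hf hfW => hOW f hf ⟨left_mem_seg f, hfW⟩
  have hOy2 : ∀ f ∈ O, f.2 ∉ W := by
    intro f hf hfW
    have h1 : f.2 = b' := hOW f hf ⟨right_mem_seg f, hfW⟩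
    exact hf.2.1 (D.poly.injSnd f hf.1 _ h.mem h1)
  have hOo : ∀ f ∈ O, ∀ z ∈ openSeg f, z ∉ W := by
    intro f hf z hz hzW
    have h1 : z = b' := hOW f hf ⟨openSeg_subset_seg _ hz, hzW⟩
    subst h1
    have := hOb f hf (openSeg_subset_seg _ hz)
    exact (ne_of_mem_openSeg (D.poly.ne hf.1) hz).1 this.symm
  have hyW1 : y ∉ W := fun hyW' => hyy' (hyW ⟨left_mem_seg (y, y'), hyW'⟩)
  have hyo : ∀ z ∈ openSeg (y, y'), z ∉ W := by
    intro z hz hzW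
    exact (ne_of_mem_openSeg hyy' hz).2 (hyW ⟨openSeg_subset_seg _ hz, hzW⟩)
  have triW : ∀ u v w : Pt, u ∈ W → v ∈ W → w ∈ W → tri u v w ⊆ W := fun u v w hu hv hw =>
    tri_subset hWc hu hv hw
  have hbya : tri y' b' a ⊆ W := triW _ _ _ hWy hWb hWa
  have hyca : tri y' c a ⊆ W := triW _ _ _ hWy hWcc hWa
  have hybc : tri y' b' c ⊆ W := triW _ _ _ hWy hWb hWcc
  have hm1 : (y', a) ∈ D₁.E := (mem₁ _).2 (by simp)
  have hm2 : (a, b') ∈ D₁.E := (mem₁ _).2 (by simp)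
  have hm3 : (y', a) ∈ D₂.E := (mem₂ _).2 (by simp)
  have hm4 : (a, c) ∈ D₂.E := (mem₂ _).2 (by simp)
  have hm5 : (c, b') ∈ D₂.E := (mem₂ _).2 (by simp)
  have cases₁ : ∀ f ∈ D₁.E, f ≠ (y', a) → f ≠ (a, b') → f ∈ O ∨ f = (y, y') := by
    intro f hf n1 n2
    rcases (mem₁ f).1 hf with h1 | h1 | h1 | h1
    · exact Or.inl h1
    · exact absurd h1 n2
    · exact Or.inr h1
    · exact absurd h1 n1
  have cases₂ : ∀ f ∈ D₂.E, f ≠ (y', a) → f ≠ (a, c) → f ∈ O ∨ f = (c, b') ∨ f = (y, y') := by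
    intro f hf n1 n2
    rcases (mem₂ f).1 hf with h1 | h1 | h1 | h1 | h1
    · exact Or.inl h1
    · exact absurd h1 n2
    · exact Or.inr (Or.inl h1)
    · exact Or.inr (Or.inr h1)
    · exact absurd h1 n1
  have hP₄ : Poly (unrep D₁.E y' b' a) := by
    refine D₁.poly.unrep hm1 hm2 hy'b ?_ ?_ ?_ ?_
    · intro hf
      rcases (mem₁ _).1 hf with h1 | h1 | h1 | h1
      · exact hOy2 _ h1 hWy
      · exact hne1 (Prod.ext_iff.1 h1).1.symm
      · exact hyb (Prod.ext_iff.1 h1).1.symm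
      · exact hy'b (Prod.ext_iff.1 h1).1.symm
    · intro f hf n1 n2 hfT
      rcases cases₁ f hf n1 n2 with h1 | rfl
      · exact hOy f h1 (hbya hfT)
      · exact absurd (hbya hfT) hyW1
    · intro f hf n1 n2 hfT
      rcases cases₁ f hf n1 n2 with h1 | rfl
      · exact absurd (hbya hfT) (hOy2 f h1)
      · rfl
    · intro f g z hfg n1 n2 n3 n4 hz
      rcases cases₁ f hfg.1 n1 n2 with h1 | rfl
      · exact hOo f h1 z hfg.2.2.2.1 (hbya hz)
      · exact hyo z hfg.2.2.2.1 (hbya hz)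
  -- `b'` is on the other side of the line through `y` and `a`
  have hcross_c : side y a c * side y a b' < 0 := by
    obtain ⟨u, hu0, hu1, hu⟩ := mem_openSeg.1 hxcb
    have h1 : side y a x = 0 := side_of_mem_seg (openSeg_subset_seg _ hxo)
    rw [hu, side_add_smul] at h1
    have h2 : side y a b' ≠ 0 := by
      intro h2
      refine D'.poly.transverse hx.1 hx.2.1 hx.2.2.1 hxcb hxo ?_
      rw [h2] at h1
      have h3 : side y a c = 0 := by
        rcases mul_eq_zero.1 (by linarith : (1 - u) * side y a c = 0) with h | h
        · linarith
        · exact h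
      simp only [side_eq] at h2 h3
      simp only [det, dir, Prod.fst_sub, Prod.snd_sub]
      linarith
    have h3 := mul_self_pos.2 h2
    have h4 : (1 - u) * (side y a c * side y a b') = - (u * (side y a b' * side y a b')) := by
      linear_combination side y a b' * h1
    nlinarith
  have hyay' : side y a y' = 0 := side_of_mem_seg (openSeg_subset_seg _ hy'o)
  have hbT : b' ∉ tri y' c a := by
    intro hb
    have : tri y' c a ⊆ {v | 0 ≤ side y a c * side y a v} :=
      tri_subset (convex_side_mul_nonneg y a _) (by change 0 ≤ _ * side y a y'; rw [hyay']; simp)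
        (show 0 ≤ side y a c * side y a c from mul_self_nonneg _)
        (by change 0 ≤ _ * side y a a; simp)
    have := this hb
    change 0 ≤ side y a c * side y a b' at this
    linarith
  have hxy'a : x ∈ openSeg (y', a) := by
    have h0 : 0 < 1 - (1 - η) * t := by nlinarith
    obtain ⟨κ, hκ⟩ : ∃ κ : ℝ, κ * (1 - (1 - η) * t) = η * t :=
      ⟨η * t / (1 - (1 - η) * t), div_mul_cancel₀ _ h0.ne'⟩
    have e1 : y' = y + ((1 - η) * t) • (a - y) := by
      rw [hy', hxt]; ext <;> simp <;> ring
    refine mem_openSeg.2 ⟨κ, ?_, ?_, ?_⟩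
    · have : 0 < η * t := by positivity
      rw [← hκ] at this
      exact (mul_pos_iff_of_pos_right h0).1 this
    · by_contra hcon
      have : 1 * (1 - (1 - η) * t) ≤ κ * (1 - (1 - η) * t) :=
        mul_le_mul_of_nonneg_right (not_lt.1 hcon) h0.le
      nlinarith
    · rw [e1, hxt]
      ext
      · simp only [Prod.fst_add, Prod.smul_fst, Prod.fst_sub, smul_eq_mul]
        linear_combination (-(a.1 - y.1)) * hκ
      · simp only [Prod.snd_add, Prod.smul_snd, Prod.snd_sub, smul_eq_mul]
        linear_combination (-(a.2 - y.2)) * hκ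
  have hcbx : ∀ f ∈ O, ∀ z, z ∈ openSeg f → z ∉ seg (c, b') := fun f hf z hz hz' =>
    hOo f hf z hz (seg_subset hWc hWcc hWb hz')
  have hcbT : seg (c, b') ∩ tri y' c a ⊆ W := fun z hz => hyca hz.2
  have hP₃ : Poly (unrep D₂.E y' c a) := by
    refine D₂.poly.unrep hm3 hm4 hy'c ?_ ?_ ?_ ?_
    · intro hf
      rcases (mem₂ _).1 hf with h1 | h1 | h1 | h1 | h1
      · exact hOy2 _ h1 hWy
      · exact hne3 (Prod.ext_iff.1 h1).1.symm
      · exact hy'b (Prod.ext_iff.1 h1).2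
      · exact hyW1 (show (y, y').1 ∈ W by rw [← (Prod.ext_iff.1 h1).1]; exact hWcc)
      · exact hy'c (Prod.ext_iff.1 h1).1.symm
    · intro f hf n1 n2 hfT
      rcases cases₂ f hf n1 n2 with h1 | rfl | rfl
      · have := hOy f h1 (hyca hfT)
        rw [this] at hfT
        exact absurd hfT hbT
      · rfl
      · exact absurd (hyca hfT) hyW1
    · intro f hf n1 n2 hfT
      rcases cases₂ f hf n1 n2 with h1 | rfl | rfl
      · exact absurd (hyca hfT) (hOy2 f h1)
      · exact absurd hfT hbT
      · rfl
    · intro f g z hfg n1 n2 n3 n4 hz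
      rcases cases₂ f hfg.1 n1 n2 with h1 | rfl | rfl
      · exact hOo f h1 z hfg.2.2.2.1 (hyca hz)
      · rcases cases₂ g hfg.2.1 n3 n4 with h1 | rfl | rfl
        · exact hOo g h1 z hfg.2.2.2.2 (hyca hz)
        · exact hfg.2.2.1 rfl
        · exact hyo z hfg.2.2.2.2 (hyca hz)
      · exact hyo z hfg.2.2.2.1 (hyca hz)
  have hba : a ∉ D₁.bars := by rw [hB₁]; exact h.bar_a
  have hba' : a ∉ D₂.bars := by rw [hB₂, h.bars]; exact h.bar_a
  set D₄ : Diagram := D₁.del hm1 hm2 hP₄ hba D.kind with hD₄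
  set D₃ : Diagram := D₂.del hm3 hm4 hP₃ hba' D.kind with hD₃
  have hE₄ : D₄.E = unrep D₁.E y' b' a := rfl
  have hE₃ : D₃.E = unrep D₂.E y' c a := rfl
  have mem₄ : ∀ f, f ∈ D₄.E ↔ f ∈ O ∨ f = (y, y') ∨ f = (y', b') := by
    intro f
    rw [hE₄, mem_unrep]
    constructor
    · rintro (⟨hf, n1, n2⟩ | h1)
      · rcases cases₁ f hf n1 n2 with h1 | h1
        · exact Or.inl h1
        · exact Or.inr (Or.inl h1)
      · exact Or.inr (Or.inr h1)
    · rintro (hf | rfl | h1)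
      · refine Or.inl ⟨(mem₁ f).2 (Or.inl hf), ?_, hf.2.1⟩
        rintro rfl; exact hOy2 _ hf hWa
      · refine Or.inl ⟨(mem₁ _).2 (by simp), fun h' => hyy' (Prod.ext_iff.1 h').1,
          fun h' => hy'b (Prod.ext_iff.1 h').2⟩
      · exact Or.inr h1
  have mem₃ : ∀ f, f ∈ D₃.E ↔ f ∈ O ∨ f = (c, b') ∨ f = (y, y') ∨ f = (y', c) := by
    intro f
    rw [hE₃, mem_unrep]
    constructor
    · rintro (⟨hf, n1, n2⟩ | h1)
      · rcases cases₂ f hf n1 n2 with h1 | h1 | h1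
        · exact Or.inl h1
        · exact Or.inr (Or.inl h1)
        · exact Or.inr (Or.inr (Or.inl h1))
      · exact Or.inr (Or.inr (Or.inr h1))
    · rintro (hf | rfl | rfl | h1)
      · refine Or.inl ⟨(mem₂ f).2 (Or.inl hf), ?_, ?_⟩
        · rintro rfl; exact hOy2 _ hf hWa
        · rintro rfl; exact hOy2 _ hf hWcc
      · exact Or.inl ⟨hm5, fun h' => hy'c (Prod.ext_iff.1 h').1.symm,
          fun h' => hne3 (Prod.ext_iff.1 h').1.symm⟩
      · exact Or.inl ⟨(mem₂ _).2 (by simp), fun h' => hyy' (Prod.ext_iff.1 h').1,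
          fun h' => hy'c (Prod.ext_iff.1 h').2⟩
      · exact Or.inr h1
  have hy'1 : ∀ z ∈ openSeg (y, y'), z ∈ openSeg (y, a) := by
    intro z hz
    have h1 := seg_subset (convex_seg (y, a)) (left_mem_seg _) (openSeg_subset_seg _ hy'o)
      (openSeg_subset_seg _ hz)
    refine mem_openSeg_of_mem_seg h1 (ne_of_mem_openSeg hyy' hz).1 ?_
    intro h2
    exact hyo z hz (by rw [h2]; exact hWa)
  have common : ∀ f g z, (f ∈ O ∨ f = (y, y')) → (g ∈ O ∨ g = (y, y')) → f ≠ g → z ∈ openSeg f →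
      z ∈ openSeg g → D'.kind z = D.kind z := by
    intro f g z hf hg' hfg hz1 hz2
    have lift : ∀ f, (f ∈ O ∨ f = (y, y')) → z ∈ openSeg f → ∃ f', f' ∈ D.E ∧ f' ∈ D'.E ∧
        z ∈ openSeg f' ∧ (f' = f ∨ (f = (y, y') ∧ f' = (y, a))) := by
      rintro f (hf | rfl) hz
      · exact ⟨f, hf.1, h.mem_of hf.1 hf.2.1, hz, Or.inl rfl⟩
      · exact ⟨_, hya, hya', hy'1 z hz, Or.inr ⟨rfl, rfl⟩⟩
    obtain ⟨f', m1, m2, m3, m4⟩ := lift f hf hz1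
    obtain ⟨g', n1, n2, n3, n4⟩ := lift g hg' hz2
    have hne : f' ≠ g' := by
      rintro rfl
      rcases m4 with rfl | ⟨rfl, rfl⟩
      · rcases n4 with rfl | ⟨rfl, rfl⟩
        · exact hfg rfl
        · rcases hf with hf | hf
          · exact hf.2.2 rfl
          · exact hfg hf
      · rcases n4 with h' | ⟨rfl, h'⟩
        · subst h'
          rcases hg' with hf | hf
          · exact hf.2.2 rfl
          · exact hfg hf.symm
        · exact hfg rfl
    exact h.keeps f' g' z ⟨m1, n1, hne, m3, n3⟩ ⟨m2, n2, hne, m3, n3⟩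
  have s1 : side y' b' a ≠ 0 := by
    intro h0
    have e : side y a b' = 0 := by
      have h1 : y' = a + (1 - (1 - η) * t) • (y - a) := by
        rw [hy', hxt]; ext <;> simp <;> ring
      have h2 : side y' b' a = - ((1 - (1 - η) * t) * side y a b') := by
        rw [h1]; simp only [side_eq]; simp; ring
      rw [h2, neg_eq_zero] at h0
      exact (mul_eq_zero.1 h0).resolve_left (by nlinarith)
    rw [e] at hcross_c; simp at hcross_c
  have s2 : side y' c a ≠ 0 := by
    intro h0
    have e : side y a c = 0 := by
      have h1 : y' = a + (1 - (1 - η) * t) • (y - a) := by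
        rw [hy', hxt]; ext <;> simp <;> ring
      have h2 : side y' c a = - ((1 - (1 - η) * t) * side y a c) := by
        rw [h1]; simp only [side_eq]; simp; ring
      rw [h2, neg_eq_zero] at h0
      exact (mul_eq_zero.1 h0).resolve_left (by nlinarith)
    rw [e] at hcross_c; simp at hcross_c
  have s3 : side y' b' c ≠ 0 := by
    intro h0
    have e : side c b' y' = 0 := by
      rw [show side c b' y' = - side y' b' c by simp only [side_eq]; ring, h0]; simp
    simp only [hψ, e] at hψy'0; simp at hψy'0
  have E41 : D₁.E = rep D₄.E y' b' a := by
    rw [hE₄, rep_unrep hm1 hm2]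
    intro hf
    rcases (mem₁ _).1 hf with h1 | h1 | h1 | h1
    · exact hy'O _ h1 (left_mem_seg _)
    · exact hy'ne.2 (Prod.ext_iff.1 h1).1
    · exact hyy' (Prod.ext_iff.1 h1).1.symm
    · exact hne1 (Prod.ext_iff.1 h1).2.symm
  have E32 : D₂.E = rep D₃.E y' c a := by
    rw [hE₃, rep_unrep hm3 hm4]
    intro hf
    rcases (mem₂ _).1 hf with h1 | h1 | h1 | h1 | h1
    · exact hy'O _ h1 (left_mem_seg _)
    · exact hy'ne.2 (Prod.ext_iff.1 h1).1
    · exact hy'c (Prod.ext_iff.1 h1).1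
    · exact hyy' (Prod.ext_iff.1 h1).1.symm
    · exact hne3 (Prod.ext_iff.1 h1).2.symm
  have E43 : D₃.E = rep D₄.E y' b' c := by
    ext f
    rw [mem₃, mem_rep, mem₄]
    constructor
    · rintro (h1 | h1 | rfl | h1)
      · refine Or.inl ⟨Or.inl h1, ?_⟩
        rintro rfl; exact hy'O _ h1 (left_mem_seg _)
      · exact Or.inr (Or.inr h1)
      · exact Or.inl ⟨Or.inr (Or.inl rfl), fun h' => hyy' (Prod.ext_iff.1 h').1⟩
      · exact Or.inr (Or.inl h1)
    · rintro (⟨h1 | h1 | h1, hne⟩ | h1 | h1)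
      · exact Or.inl h1
      · exact Or.inr (Or.inr (Or.inl h1))
      · exact absurd h1 hne
      · exact Or.inr (Or.inr (Or.inr h1))
      · exact Or.inr (Or.inl h1)
  have hoth : ∀ (K : Set Pt), K ⊆ W → ∀ g, (g ∈ O ∨ g = (y, y')) → seg g ∩ K ⊆ {y', b'} := by
    rintro K hK g (h1 | rfl) z ⟨hz, hzK⟩
    · exact Or.inr (hOW g h1 ⟨hz, hK hzK⟩)
    · exact Or.inl (hyW ⟨hz, hK hzK⟩)
  have hmove41 : Eqv D₄ D₁ := by
    refine (Move.push D₄ D₁ y' b' a ⟨(mem₄ _).2 (by simp), s1, E41, rfl, ?_, ?_⟩).eqv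
    · intro f g z _ _; rw [hK₁]; rfl
    · intro g hg' hne _
      refine hoth _ hbya g ?_
      rcases (mem₄ g).1 hg' with h1 | h1 | h1
      · exact Or.inl h1
      · exact Or.inr h1
      · exact absurd h1 hne
  have hmove43 : Eqv D₄ D₃ := by
    refine (Move.push D₄ D₃ y' b' c ⟨(mem₄ _).2 (by simp), s3, E43, ?_, ?_, ?_⟩).eqv
    · change D₂.bars = D₁.bars; rw [hB₁, hB₂, h.bars]
    · intro f g z _ _; rfl
    · intro g hg' hne _
      refine hoth _ hybc g ?_
      rcases (mem₄ g).1 hg' with h1 | h1 | h1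
      · exact Or.inl h1
      · exact Or.inr h1
      · exact absurd h1 hne
  have hxD₂ : CrossAt D₂.E (y', a) (c, b') x := by
    refine ⟨hm3, hm5, fun h' => hy'c (Prod.ext_iff.1 h').1, hxy'a, hxcb⟩
  have hmove32 : Eqv D₃ D₂ := by
    refine (Move.kink D₃ D₂ y' c a b' x ⟨(mem₃ _).2 (by simp), s2, E32, rfl, ?_, ?_⟩ ?_ hxD₂ ?_).eqv
    · intro f g z hfg hfg'
      rw [hK₂]
      change D'.kind z = D.kind z
      have excl : ∀ f g, CrossAt D₃.E f g z → CrossAt D₂.E f g z → f ≠ (c, b') ∧ f ≠ (y', c) := by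
        intro f g hfg hfg'
        refine ⟨?_, ?_⟩
        · rintro rfl
          have hz := openSeg_subset_seg _ hfg.2.2.2.1
          have hzW := seg_subset hWc hWcc hWb hz
          rcases (mem₃ g).1 hfg.2.1 with h1 | rfl | rfl | rfl
          · exact hOo g h1 z hfg.2.2.2.2 hzW
          · exact hfg.2.2.1 rfl
          · exact hyo z hfg.2.2.2.2 hzW
          · have h1 : side c b' z = 0 := side_of_mem_seg hz
            have h2 := side_ne_zero_seg (a := y') (b := b') (c := c) s3
              (openSeg_subset_seg _ hfg.2.2.2.2) hz
            exact (ne_of_mem_openSeg hne2.symm hfg.2.2.2.1).1 h2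
        · rintro rfl
          have hz := openSeg_subset_seg _ hfg.2.2.2.1
          rcases (mem₂ _).1 hfg'.1 with h1 | h1 | h1 | h1 | h1
          · exact hy'O _ h1 (left_mem_seg _)
          · exact hy'ne.2 (Prod.ext_iff.1 h1).1
          · exact hy'c (Prod.ext_iff.1 h1).1
          · exact hyy' (Prod.ext_iff.1 h1).1.symm
          · exact hne3 (Prod.ext_iff.1 h1).2.symm
      have cl : ∀ f, f ∈ D₃.E → f ≠ (c, b') → f ≠ (y', c) → f ∈ O ∨ f = (y, y') := by
        intro f hf n1 n2
        rcases (mem₃ f).1 hf with h1 | h1 | h1 | h1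
        · exact Or.inl h1
        · exact absurd h1 n1
        · exact Or.inr h1
        · exact absurd h1 n2
      obtain ⟨f1, f2⟩ := excl f g hfg hfg'
      obtain ⟨g1, g2⟩ := excl g f hfg.symm hfg'.symm
      exact common f g z (cl f hfg.1 f1 f2) (cl g hfg.2.1 g1 g2) hfg.2.2.1 hfg.2.2.2.1 hfg.2.2.2.2
    · intro g hg' hne hgS z hz
      rcases (mem₃ g).1 hg' with h1 | h1 | rfl | h1
      · have : z = b' := hOW g h1 ⟨hz.1, hyca hz.2⟩
        rw [this] at hz
        exact absurd hz.2 hbT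
      · exact absurd h1 hgS
      · exact Or.inl (hyW ⟨hz.1, hyca hz.2⟩)
      · exact absurd h1 hne
    · change c ∉ D₂.bars
      rw [hB₂, h.bars]; exact h.bar_c
    · rw [hK₂, h.new₂ _ _ hx, h.moverKind_virtual (Or.inr (tri_left _ _ _))]
      simp
  exact hD₁.trans (hmove41.symm.trans (hmove43.trans (hmove32.trans hD₂.symm)))

/-- A triangle met by at most one edge. -/
lemma eqv_of_subsingleton (h : Tri e₀ k₀ D D' a b c) (hS : (touch D a b c).Subsingleton) :
    Eqv D D' := by
  rcases hS.eq_empty_or_singleton with h0 | ⟨g, hgS⟩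
  · exact h.eqv_of_empty h0
  have hg : g ∈ touch D a b c := by rw [hgS]; rfl
  have huniq : ∀ f ∈ touch D a b c, f = g := fun f hf => hS hf hg
  obtain ⟨hgD, hne, hns⟩ := id hg
  -- a vertex in the triangle belongs to two edges
  have hvert1 : g.1 ∈ tri a b c → g.1 = b := by
    intro hT
    by_contra hb
    have ha : g.1 ≠ a := fun h' => hne (D.poly.injFst g hgD _ h.mem h')
    obtain ⟨f, ⟨hf, hfe⟩, -⟩ := D.prev g hgD
    have hfT : f ∈ touch D a b c := by
      refine ⟨hf, ?_, ?_⟩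
      · rintro rfl; exact hb hfe.symm
      · intro hsub
        rcases hsub ⟨show g.1 ∈ seg f by rw [← hfe]; exact right_mem_seg f, hT⟩ with h1 | h1
        · exact ha h1
        · exact hb h1
    have := huniq f hfT
    subst this
    exact D.poly.ne hf hfe.symm
  have hvert2 : g.2 ∈ tri a b c → g.2 = a := by
    intro hT
    by_contra ha
    have hb : g.2 ≠ b := fun h' => hne (D.poly.injSnd g hgD _ h.mem h')
    obtain ⟨f, ⟨hf, hfe⟩, -⟩ := D.next g hgD
    have hfT : f ∈ touch D a b c := by
      refine ⟨hf, ?_, ?_⟩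
      · rintro rfl; exact ha hfe.symm
      · intro hsub
        rcases hsub ⟨show g.2 ∈ seg f by rw [← hfe]; exact left_mem_seg f, hT⟩ with h1 | h1
        · exact ha h1
        · exact hb h1
    have := huniq f hfT
    subst this
    exact D.poly.ne hf hfe
  obtain ⟨g1, g2⟩ := g
  by_cases h1 : g1 ∈ tri a b c
  · obtain rfl : g1 = b := hvert1 h1
    by_cases h2 : g2 ∈ tri a g1 c
    · obtain rfl : g2 = a := hvert2 h2
      exact absurd hgD (D.generic.no_reverse _ _ h.mem)
    · exact h.eqv_of_kink hgS.subset hg h2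
  · by_cases h2 : g2 ∈ tri a b c
    · obtain rfl : g2 = a := hvert2 h2
      exact h.eqv_of_kink' hgS.subset hg h1
    · obtain ⟨w, hw, -⟩ := not_subset.1 hns
      exact h.eqv_of_chord hgS.subset hgD hne h1 h2 hw.1 hw.2

end Tri
end STLink

namespace STLink
open Set Filter Topology

/-- The diagram `D` consists of edges in `E₀` and of further edges that do not cross each other. Its
crossings have the kinds given by `k` in `E₀`; the crossings of the further edges are virtual, except
perhaps those with `e₀`. -/
structure Canon (E₀ : Set Edge) (k : Pt → Kind) (e₀ : Edge) (k₀ : Kind) (D : Diagram) : Prop where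
  env : ∀ e f x, CrossAt D.E e f x → e ∈ E₀ → f ∈ E₀ → D.kind x = k x
  mover : ∀ e f x, CrossAt D.E e f x → e ∉ E₀ → f ∈ E₀ ∧ D.kind x = moverKind e₀ k₀ f

section
variable {E₀ : Set Edge} {k : Pt → Kind} {e₀ : Edge} {k₀ : Kind} {D D' : Diagram} {a b c d : Pt}

lemma Canon.keeps (h : Canon E₀ k e₀ k₀ D) (h' : Canon E₀ k e₀ k₀ D') : KeepsKinds D D' := by
  intro e f x hx hx'
  by_cases he : e ∈ E₀
  · by_cases hf : f ∈ E₀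
    · rw [h.env e f x hx he hf, h'.env e f x hx' he hf]
    · rw [(h.mover f e x hx.symm hf).2, (h'.mover f e x hx'.symm hf).2]
  · rw [(h.mover e f x hx he).2, (h'.mover e f x hx' he).2]

lemma Tri.of_canon (h : Canon E₀ k e₀ k₀ D) (h' : Canon E₀ k e₀ k₀ D') (hab : (a, b) ∈ D.E)
    (n1 : (a, b) ∉ E₀) (n2 : (a, c) ∉ E₀) (n3 : (c, b) ∉ E₀) (hs : side a b c ≠ 0)
    (hE : D'.E = rep D.E a b c) (hB : D'.bars = D.bars) (ha : a ∉ D.bars) (hb : b ∉ D.bars)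
    (hm : ∀ g ∈ D.E, g ∉ E₀ → g ≠ (a, b) → seg g ∩ tri a b c ⊆ {a, b})
    (hr : k₀ ≠ .virtual → e₀ ∈ D.E ∧ e₀ ∈ E₀ ∧ e₀.1 ∉ tri a b c ∧ e₀.2 ∉ tri a b c ∧
      ((seg e₀ ∩ tri a b c).Nonempty → side e₀.1 e₀.2 a * side e₀.1 e₀.2 b < 0) ∧
      ∀ g z, CrossAt D.E e₀ g z → g ∈ E₀ → z ∈ tri a b c → k z = .virtual) :
    Tri e₀ k₀ D D' a b c where
  mem := hab
  nondeg := hs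
  edges := hE
  bars := hB
  keeps := h.keeps h'
  bar_a := ha
  bar_b := hb
  old g x hx := (h.mover _ _ _ hx n1).2
  new₁ g x hx := (h'.mover _ _ _ hx n2).2
  new₂ g x hx := (h'.mover _ _ _ hx n3).2
  real hk := (hr hk).1
  ends hk := ⟨(hr hk).2.2.1, (hr hk).2.2.2.1⟩
  through hk := (hr hk).2.2.2.2.1
  others hk g z hz hg hzT := by
    obtain ⟨h1, h2, -, -, -, h6⟩ := hr hk
    by_cases hgE : g ∈ E₀
    · rw [h.env e₀ g z hz h2 hgE]
      exact h6 g z hz hgE hzT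
    · exfalso
      rcases hm g hz.2.1 hgE hg ⟨openSeg_subset_seg _ hz.2.2.2.2, hzT⟩ with h3 | h3
      · exact D.poly.left_notMem hab hz.2.1 (show (a, b).1 ∈ _ by rw [← h3]; exact hz.2.2.2.2)
      · exact D.poly.right_notMem hab hz.2.1
          (show (a, b).2 ∈ _ by rw [← h3]; exact hz.2.2.2.2)

lemma Tri.canon_left (h : Tri e₀ k₀ D D' a b c) : Canon (D.E \ {(a, b)}) D.kind e₀ k₀ D where
  env e f x _ _ _ := rfl
  mover e f x hx he := by
    have : e = (a, b) := by
      by_contra hne; exact he ⟨hx.1, hne⟩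
    subst this
    exact ⟨⟨hx.2.1, hx.2.2.1.symm⟩, h.old f x hx⟩

lemma openSeg_disjoint_of_side {x : Pt} (hs : side a b c ≠ 0) (h1 : x ∈ openSeg (a, c)) :
    x ∉ openSeg (c, b) := by
  intro h2
  have := side_ne_zero_seg hs (openSeg_subset_seg _ h1) (openSeg_subset_seg _ h2)
  exact (ne_of_mem_openSeg (ne_of_side hs).2.2 h1).2 this

lemma Tri.canon_right (h : Tri e₀ k₀ D D' a b c) : Canon (D.E \ {(a, b)}) D.kind e₀ k₀ D' where
  env e f x hx he hf := h.keeps e f x (hx.mono he.1 hf.1) hx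
  mover e f x hx he := by
    have hmem : ∀ f, f ∈ D'.E → f ∈ D.E \ {(a, b)} ∨ f = (a, c) ∨ f = (c, b) := by
      intro f hf; rw [h.edges, mem_rep] at hf; exact hf
    have h1 := openSeg_disjoint_of_side (x := x) h.nondeg
    rcases hmem e hx.1 with h2 | rfl | rfl
    · exact absurd h2 he
    · refine ⟨?_, h.new₁ f x hx⟩
      rcases hmem f hx.2.1 with h3 | rfl | rfl
      · exact h3
      · exact absurd rfl hx.2.2.1
      · exact absurd hx.2.2.2.2 (h1 hx.2.2.2.1)
    · refine ⟨?_, h.new₂ f x hx⟩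
      rcases hmem f hx.2.1 with h3 | rfl | rfl
      · exact h3
      · exact absurd hx.2.2.2.1 (h1 hx.2.2.2.2)
      · exact absurd rfl hx.2.2.1

lemma openSeg_subset_of_mem (_hab : a ≠ b) (hd : d ∈ openSeg (a, b)) :
    openSeg (a, d) ⊆ openSeg (a, b) ∧ openSeg (d, b) ⊆ openSeg (a, b) := by
  obtain ⟨t, ht0, ht1, rfl⟩ := mem_openSeg.1 hd
  constructor
  · intro x hx
    obtain ⟨s, hs0, hs1, rfl⟩ := mem_openSeg.1 hx
    exact mem_openSeg.2 ⟨s * t, by positivity, by nlinarith, by ext <;> simp <;> ring⟩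
  · intro x hx
    obtain ⟨s, hs0, hs1, rfl⟩ := mem_openSeg.1 hx
    refine mem_openSeg.2 ⟨t + s * (1 - t), ?_, ?_, by ext <;> simp <;> ring⟩
    · have : 0 < s * (1 - t) := mul_pos hs0 (by linarith)
      linarith
    · nlinarith

lemma Canon.subdivide (h : Canon E₀ k e₀ k₀ D) {D₁ : Diagram} (hab : (a, b) ∈ D.E)
    (n : (a, b) ∉ E₀) (hd : d ∈ openSeg (a, b)) (hdE : ∀ f ∈ E₀, d ∉ seg f)
    (hE : D₁.E = rep D.E a b d) (hK : D₁.kind = D.kind) : Canon E₀ k e₀ k₀ D₁ := by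
  have hne := D.poly.ne hab
  obtain ⟨s1, s2⟩ := openSeg_subset_of_mem hne hd
  have hmem : ∀ f, f ∈ D₁.E → (f ∈ D.E ∧ f ≠ (a, b)) ∨ f = (a, d) ∨ f = (d, b) := by
    intro f hf; rw [hE, mem_rep] at hf; exact hf
  have hdis : ∀ x, x ∈ openSeg (a, d) → x ∉ openSeg (d, b) := by
    intro x h1 h2
    have := seg_inter_of_mem_openSeg hne hd (openSeg_subset_seg _ h1) (openSeg_subset_seg _ h2)
    exact (ne_of_mem_openSeg (ne_of_mem_openSeg hne hd).1.symm h1).2 this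
  have hnew1 : (a, d) ∉ E₀ := fun h' => hdE _ h' (right_mem_seg _)
  have hnew2 : (d, b) ∉ E₀ := fun h' => hdE _ h' (left_mem_seg _)
  constructor
  · intro e f x hx he hf
    rw [hK]
    rcases hmem e hx.1 with h1 | rfl | rfl
    · rcases hmem f hx.2.1 with h2 | rfl | rfl
      · exact h.env e f x (hx.mono h1.1 h2.1) he hf
      · exact absurd hf hnew1
      · exact absurd hf hnew2
    · exact absurd he hnew1
    · exact absurd he hnew2
  · intro e f x hx he
    rw [hK]
    rcases hmem e hx.1 with h1 | rfl | rfl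
    · rcases hmem f hx.2.1 with h2 | rfl | rfl
      · exact h.mover e f x (hx.mono h1.1 h2.1) he
      · exact absurd (h.mover e (a, b) x ⟨h1.1, hab, h1.2, hx.2.2.2.1, s1 hx.2.2.2.2⟩ he).1 n
      · exact absurd (h.mover e (a, b) x ⟨h1.1, hab, h1.2, hx.2.2.2.1, s2 hx.2.2.2.2⟩ he).1 n
    · rcases hmem f hx.2.1 with h2 | rfl | rfl
      · exact h.mover (a, b) f x ⟨hab, h2.1, h2.2.symm, s1 hx.2.2.2.1, hx.2.2.2.2⟩ n
      · exact absurd rfl hx.2.2.1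
      · exact absurd hx.2.2.2.2 (hdis x hx.2.2.2.1)
    · rcases hmem f hx.2.1 with h2 | rfl | rfl
      · exact h.mover (a, b) f x ⟨hab, h2.1, h2.2.symm, s2 hx.2.2.2.1, hx.2.2.2.2⟩ n
      · exact absurd hx.2.2.2.1 (hdis x hx.2.2.2.2)
      · exact absurd rfl hx.2.2.1

open Classical in
/-- The kinds after a strand has been moved to the edges `m` and `m'`. -/
noncomputable def moveKind (e₀ : Edge) (k₀ : Kind) (m m' : Edge) (k : Pt → Kind) (x : Pt) : Kind :=
  if x ∈ openSeg m ∨ x ∈ openSeg m' then (if x ∈ openSeg e₀ then k₀ else .virtual) else k x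

lemma Canon.exists_rep (h : Canon E₀ k e₀ k₀ D) (hab : (a, b) ∈ D.E) (n : (a, b) ∉ E₀)
    (hP : Poly (rep D.E a b d)) (hs : side a b d ≠ 0) (hd : ∀ f ∈ D.E, f.1 ≠ d ∧ f.2 ≠ d)
    (hdE : ∀ f ∈ E₀, f.1 ≠ d ∧ f.2 ≠ d)
    (hm : ∀ g ∈ D.E, g ∉ E₀ → g ≠ (a, b) → ∀ x ∈ openSeg g, x ∉ openSeg (a, d) ∧ x ∉ openSeg (d, b))
    (hr : k₀ ≠ .virtual → e₀ ∈ D.E ∧ e₀ ∈ E₀) :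
    ∃ D' : Diagram, D'.E = rep D.E a b d ∧ D'.bars = D.bars ∧ Canon E₀ k e₀ k₀ D' := by
  refine ⟨D.ins hab hP (moveKind e₀ k₀ (a, d) (d, b) D.kind), rfl, rfl, ?_⟩
  have m1 : (a, d) ∈ rep D.E a b d := mem_rep.2 (by simp)
  have m2 : (d, b) ∈ rep D.E a b d := mem_rep.2 (by simp)
  have old : ∀ e f x, CrossAt (rep D.E a b d) e f x → e ∈ D.E → f ∈ D.E →
      x ∉ openSeg (a, d) ∧ x ∉ openSeg (d, b) := by
    intro e f x hx he hf
    have hed : e ≠ (a, d) := by rintro rfl; exact (hd _ he).2 rfl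
    have hed' : e ≠ (d, b) := by rintro rfl; exact (hd _ he).1 rfl
    constructor
    · intro hx'
      have := hP.generic.no_triple e f (a, d) x hx ⟨hx.1, m1, hed, hx.2.2.2.1, hx'⟩
      subst this
      exact (hd _ hf).2 rfl
    · intro hx'
      have := hP.generic.no_triple e f (d, b) x hx ⟨hx.1, m2, hed', hx.2.2.2.1, hx'⟩
      subst this
      exact (hd _ hf).1 rfl
  have oldk : ∀ e f x, CrossAt (rep D.E a b d) e f x → e ∈ D.E → f ∈ D.E →
      moveKind e₀ k₀ (a, d) (d, b) D.kind x = D.kind x := by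
    intro e f x hx he hf
    obtain ⟨h1, h2⟩ := old e f x hx he hf
    simp [moveKind, h1, h2]
  have newk : ∀ e f x, CrossAt (rep D.E a b d) e f x → (e = (a, d) ∨ e = (d, b)) →
      moveKind e₀ k₀ (a, d) (d, b) D.kind x = moverKind e₀ k₀ f := by
    intro e f x hx he
    have h1 : x ∈ openSeg (a, d) ∨ x ∈ openSeg (d, b) := by
      rcases he with rfl | rfl
      · exact Or.inl hx.2.2.2.1
      · exact Or.inr hx.2.2.2.1
    unfold moveKind moverKind
    rw [if_pos h1]
    by_cases hk : k₀ = .virtual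
    · simp [hk]
    obtain ⟨hr1, hr2⟩ := hr hk
    have hab0 : e₀ ≠ (a, b) := by rintro rfl; exact n hr2
    by_cases hxe : x ∈ openSeg e₀
    · have hne : e ≠ e₀ := by
        rintro rfl
        rcases he with rfl | rfl
        · exact (hd _ hr1).2 rfl
        · exact (hd _ hr1).1 rfl
      have := hP.generic.no_triple e f e₀ x hx
        ⟨hx.1, mem_rep.2 (Or.inl ⟨hr1, hab0⟩), hne, hx.2.2.2.1, hxe⟩
      simp [this, hxe]
    · have : f ≠ e₀ := by rintro rfl; exact hxe hx.2.2.2.2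
      simp [hxe, this]
  have hnew1 : (a, d) ∉ E₀ := fun h' => (hdE _ h').2 rfl
  have hnew2 : (d, b) ∉ E₀ := fun h' => (hdE _ h').1 rfl
  have hdis := fun x => openSeg_disjoint_of_side (x := x) hs
  constructor
  · intro e f x hx he hf
    rcases mem_rep.1 hx.1 with h1 | rfl | rfl
    · rcases mem_rep.1 hx.2.1 with h2 | rfl | rfl
      · exact (oldk e f x hx h1.1 h2.1).trans (h.env e f x (hx.mono h1.1 h2.1) he hf)
      · exact absurd hf hnew1
      · exact absurd hf hnew2
    · exact absurd he hnew1
    · exact absurd he hnew2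
  · intro e f x hx he
    rcases mem_rep.1 hx.1 with h1 | he' | he'
    · rcases mem_rep.1 hx.2.1 with h2 | rfl | rfl
      · have := h.mover e f x (hx.mono h1.1 h2.1) he
        exact ⟨this.1, (oldk e f x hx h1.1 h2.1).trans this.2⟩
      · exact absurd hx.2.2.2.2 (hm e h1.1 he h1.2 x hx.2.2.2.1).1
      · exact absurd hx.2.2.2.2 (hm e h1.1 he h1.2 x hx.2.2.2.1).2
    all_goals
      refine ⟨?_, newk e f x hx (by simp [he'])⟩
      subst he'
      rcases mem_rep.1 hx.2.1 with h2 | rfl | rfl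
      · by_contra hf
        have := hm f h2.1 hf h2.2 x hx.2.2.2.2
        first | exact this.1 hx.2.2.2.1 | exact this.2 hx.2.2.2.1
      · first | exact absurd rfl hx.2.2.1 | exact absurd hx.2.2.2.1 (hdis x hx.2.2.2.2)
      · first | exact absurd hx.2.2.2.2 (hdis x hx.2.2.2.1) | exact absurd rfl hx.2.2.1

end

lemma cevian_inter {p q r d : Pt} (hs : side p q r ≠ 0) (hd : d ∈ openSeg (q, r)) :
    seg (q, d) ∩ tri p d r ⊆ {d} := by
  obtain ⟨t, ht0, ht1, rfl⟩ := mem_openSeg.1 hd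
  set d := q + t • (r - q)
  have e1 : side p d q = - t * side p q r := by
    simp only [d, side_eq, Prod.fst_add, Prod.snd_add, Prod.smul_fst, Prod.smul_snd, Prod.fst_sub,
      Prod.snd_sub, smul_eq_mul]; ring
  have e2 : side p d r = (1 - t) * side p q r := by
    simp only [d, side_eq, Prod.fst_add, Prod.snd_add, Prod.smul_fst, Prod.smul_snd, Prod.fst_sub,
      Prod.snd_sub, smul_eq_mul]; ring
  have hpos := mul_self_pos.2 hs
  rintro x ⟨hx, hxT⟩
  have h1 : tri p d r ⊆ {x | 0 ≤ side p q r * side p d x} :=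
    tri_subset (convex_side_mul_nonneg p d _) (by change 0 ≤ _ * side p d p; simp)
      (by change 0 ≤ _ * side p d d; simp) (by
        change 0 ≤ _ * side p d r
        rw [e2]
        have : 0 ≤ (1 - t) * (side p q r * side p q r) := mul_nonneg (by linarith) hpos.le
        linarith)
  have h2 := h1 hxT
  obtain ⟨s, hs0, hs1, rfl⟩ := mem_seg.1 hx
  change 0 ≤ side p q r * side p d (q + s • (d - q)) at h2
  rw [side_add_smul, side_right, e1] at h2
  have : s = 1 := by
    by_contra hne
    have h3 : 0 < (1 - s) * t := mul_pos (by have := lt_of_le_of_ne hs1 hne; linarith) ht0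
    nlinarith
  subst this
  simp

lemma cevian_notMem {p q r d : Pt} (hs : side p q r ≠ 0) (hd : d ∈ openSeg (q, r)) :
    q ∉ tri p d r := fun h =>
  (ne_of_mem_openSeg (ne_of_side hs).2.1 hd).1 (cevian_inter hs hd ⟨left_mem_seg (q, d), h⟩).symm

/-- Almost all segments from a point to the points of a segment are clear. -/
lemma finite_not_clear {E : Set Edge} (hE : Poly E) {p q r : Pt} (hs : side p q r ≠ 0)
    (hsub : ∀ f ∈ E, (seg f ∩ openSeg (q, r)).Subsingleton) :
    {d | d ∈ openSeg (q, r) ∧ ¬ Clear E p d}.Finite := by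
  have hray : ∀ z, z ≠ p → {d | d ∈ openSeg (q, r) ∧ z ∈ seg (p, d)}.Subsingleton := by
    rintro z hz d ⟨hd, hzd⟩ d' ⟨hd', hzd'⟩
    obtain ⟨s, hs0, hs1, rfl⟩ := mem_openSeg.1 hd
    obtain ⟨s', hs0', hs1', rfl⟩ := mem_openSeg.1 hd'
    have h1 := side_of_mem_seg hzd
    have h2 := side_of_mem_seg hzd'
    by_contra hne
    have hss : s ≠ s' := by rintro rfl; exact hne rfl
    apply hz
    set u := z.1 - p.1
    set v := z.2 - p.2
    simp only [side_eq, Prod.fst_add, Prod.snd_add, Prod.smul_fst, Prod.smul_snd, Prod.fst_sub,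
      Prod.snd_sub, smul_eq_mul] at h1 h2 hs
    have a1 : (r.1 - q.1) * v - (r.2 - q.2) * u = 0 := by
      have : (s - s') * ((r.1 - q.1) * v - (r.2 - q.2) * u) = 0 := by linear_combination h1 - h2
      exact (mul_eq_zero.1 this).resolve_left (sub_ne_zero.2 hss)
    have a2 : (q.1 - p.1) * v - (q.2 - p.2) * u = 0 := by linear_combination h1 - s * a1
    have b1 : ((q.1 - p.1) * (r.2 - p.2) - (q.2 - p.2) * (r.1 - p.1)) * u = 0 := by
      linear_combination (q.1 - p.1) * (-a1) + (r.1 - q.1) * a2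
    have b2 : ((q.1 - p.1) * (r.2 - p.2) - (q.2 - p.2) * (r.1 - p.1)) * v = 0 := by
      linear_combination (q.2 - p.2) * (-a1) + (r.2 - q.2) * a2
    have c1 := (mul_eq_zero.1 b1).resolve_left hs
    have c2 := (mul_eq_zero.1 b2).resolve_left hs
    ext <;> linarith
  have hfin : ((⋃ f ∈ E, (seg f ∩ openSeg (q, r))) ∪
      ((⋃ f ∈ E, {d | d ∈ openSeg (q, r) ∧ f.1 ≠ p ∧ f.1 ∈ seg (p, d)}) ∪
       ((⋃ f ∈ E, {d | d ∈ openSeg (q, r) ∧ f.2 ≠ p ∧ f.2 ∈ seg (p, d)}) ∪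
        (⋃ f ∈ E, ⋃ g ∈ E, {d | d ∈ openSeg (q, r) ∧ ∃ x, CrossAt E f g x ∧ x ∈ openSeg (p, d)})))).Finite := by
    refine Finite.union (hE.finite.biUnion fun f hf => (hsub f hf).finite) (Finite.union
      (hE.finite.biUnion fun f hf => ?_) (Finite.union (hE.finite.biUnion fun f hf => ?_)
      (hE.finite.biUnion fun f hf => hE.finite.biUnion fun g hg => ?_)))
    · by_cases h : f.1 = p
      · simp [h]
      · exact ((hray f.1 h).anti fun d hd => ⟨hd.1, hd.2.2⟩).finite
    · by_cases h : f.2 = p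
      · simp [h]
      · exact ((hray f.2 h).anti fun d hd => ⟨hd.1, hd.2.2⟩).finite
    · refine Set.Subsingleton.finite ?_
      rintro d ⟨hd, x, hx, hxd⟩ d' ⟨hd', x', hx', hxd'⟩
      obtain rfl := hE.cross_unique hx hx'
      have hpd : p ≠ d := by
        rintro rfl
        exact hs ((side_cycle p q r).symm.trans (side_of_mem_seg (openSeg_subset_seg _ hd)))
      exact hray x (ne_of_mem_openSeg hpd hxd).1 ⟨hd, openSeg_subset_seg _ hxd⟩
        ⟨hd', openSeg_subset_seg _ hxd'⟩
  refine hfin.subset ?_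
  rintro d ⟨hd, hnc⟩
  by_contra hcon
  simp only [mem_union, mem_iUnion, not_or, not_exists] at hcon
  obtain ⟨h1, h2, h3, h4⟩ := hcon
  apply hnc
  refine ⟨fun f hf hdf => h1 f hf ⟨hdf, hd⟩, fun f hf hfs => ?_, fun f hf hfs => ?_, fun f g x hx hxd => ?_⟩
  · by_contra hne; exact h2 f hf ⟨hd, hne, hfs⟩
  · by_contra hne; exact h3 f hf ⟨hd, hne, hfs⟩
  · exact h4 f hx.1 g hx.2.1 ⟨hd, x, hx, hxd⟩

end STLink

namespace STLink
open Set Filter Topology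

lemma cevian_side_inter {p q r d : Pt} (hs : side p q r ≠ 0) (hd : d ∈ openSeg (q, r)) :
    seg (p, r) ∩ tri p q d ⊆ {p} := by
  obtain ⟨t, ht0, ht1, rfl⟩ := mem_openSeg.1 hd
  set d := q + t • (r - q)
  have e1 : side p d q = - t * side p q r := by
    simp only [d, side_eq, Prod.fst_add, Prod.snd_add, Prod.smul_fst, Prod.smul_snd, Prod.fst_sub,
      Prod.snd_sub, smul_eq_mul]; ring
  have e2 : side p d r = (1 - t) * side p q r := by
    simp only [d, side_eq, Prod.fst_add, Prod.snd_add, Prod.smul_fst, Prod.smul_snd, Prod.fst_sub,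
      Prod.snd_sub, smul_eq_mul]; ring
  have hpos := mul_self_pos.2 hs
  rintro x ⟨hx, hxT⟩
  have h1 : tri p q d ⊆ {x | 0 ≤ - side p q r * side p d x} :=
    tri_subset (convex_side_mul_nonneg p d _) (by change 0 ≤ _ * side p d p; simp)
      (by
        change 0 ≤ _ * side p d q
        rw [e1]
        nlinarith)
      (by change 0 ≤ _ * side p d d; simp)
  have h2 := h1 hxT
  obtain ⟨s, hs0, hs1, rfl⟩ := mem_seg.1 hx
  change 0 ≤ - side p q r * side p d (p + s • (r - p)) at h2
  rw [side_add_smul, side_left, e2] at h2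
  have : s = 0 := by
    by_contra hne
    have h3 : 0 < s * (1 - t) := mul_pos (lt_of_le_of_ne hs0 (Ne.symm hne)) (by linarith)
    nlinarith
  subst this
  simp

section
variable {e₀ : Edge} {k₀ : Kind} {D D' D₁ D₁' : Diagram} {a b c d a₁ b₁ c₁ : Pt}

lemma Tri.mem_env (h : Tri e₀ k₀ D D' a b c) (hk : k₀ ≠ .virtual) : e₀ ∈ D.E \ {(a, b)} := by
  refine ⟨h.real hk, ?_⟩
  rintro rfl
  exact (h.ends hk).1 (tri_left _ _ _)

/-- Pushing a strand across a part of the triangle. -/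
lemma Tri.sub (h : Tri e₀ k₀ D D' a b c) (h₁ : Canon (D.E \ {(a, b)}) D.kind e₀ k₀ D₁)
    (h₁' : Canon (D.E \ {(a, b)}) D.kind e₀ k₀ D₁') (hE₀ : D.E \ {(a, b)} ⊆ D₁.E)
    (hab : (a₁, b₁) ∈ D₁.E)
    (n1 : (a₁, b₁) ∉ D.E \ {(a, b)}) (n2 : (a₁, c₁) ∉ D.E \ {(a, b)})
    (n3 : (c₁, b₁) ∉ D.E \ {(a, b)}) (hs : side a₁ b₁ c₁ ≠ 0)
    (hE : D₁'.E = rep D₁.E a₁ b₁ c₁) (hB : D₁.bars = D.bars) (hB' : D₁'.bars = D.bars)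
    (ha : a₁ ∉ D.bars) (hb : b₁ ∉ D.bars)
    (hm : ∀ g ∈ D₁.E, g ∉ D.E \ {(a, b)} → g ≠ (a₁, b₁) → seg g ∩ tri a₁ b₁ c₁ ⊆ {a₁, b₁})
    (hT : tri a₁ b₁ c₁ ⊆ tri a b c) (hx : ∀ x ∈ ({a, b} : Set Pt), x ∈ tri a₁ b₁ c₁ → x ∈ ({a₁, b₁} : Set Pt))
    (hthr : k₀ ≠ .virtual → (seg e₀ ∩ tri a₁ b₁ c₁).Nonempty →
      side e₀.1 e₀.2 a₁ * side e₀.1 e₀.2 b₁ < 0) :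
    Tri e₀ k₀ D₁ D₁' a₁ b₁ c₁ ∧ touch D₁ a₁ b₁ c₁ ⊆ touch D a b c := by
  refine ⟨Tri.of_canon h₁ h₁' hab n1 n2 n3 hs hE (hB'.trans hB.symm) (hB ▸ ha) (hB ▸ hb) hm ?_, ?_⟩
  · intro hk
    refine ⟨hE₀ (h.mem_env hk), h.mem_env hk, fun h1 => (h.ends hk).1 (hT h1),
      fun h1 => (h.ends hk).2 (hT h1), hthr hk, fun g z hz hg hzT => ?_⟩
    exact h.others hk g z (hz.mono (h.real hk) hg.1) hg.2 (hT hzT)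
  · rintro g ⟨hg, hne, hsub⟩
    have hgE : g ∈ D.E \ {(a, b)} := by
      by_contra hg'
      exact hsub (hm g hg hg' hne)
    refine ⟨hgE.1, hgE.2, fun hsub' => hsub fun x hx' => ?_⟩
    exact hx x (hsub' ⟨hx'.1, hT hx'.2⟩) hx'.2

/-- The sum of the squared side lengths of a triangle. -/
def quad (a b c : Pt) : ℝ :=
  ((b.1 - a.1) ^ 2 + (b.2 - a.2) ^ 2) + ((c.1 - b.1) ^ 2 + (c.2 - b.2) ^ 2)
    + ((a.1 - c.1) ^ 2 + (a.2 - c.2) ^ 2)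

/-- Pushing an edge across the triangle `p q r` is reduced to two pushes across the triangles
`p q d` and `p d r`. -/
def Splits (e₀ : Edge) (k₀ : Kind) (D D' : Diagram) (H : Set Edge) (p q r d : Pt) : Prop :=
  ∃ D₁ D₁' : Diagram, ∃ a₁ b₁ c₁ : Pt, ∃ D₂ D₂' : Diagram, ∃ a₂ b₂ c₂ : Pt,
    (Tri e₀ k₀ D₁ D₁' a₁ b₁ c₁ ∧ touch D₁ a₁ b₁ c₁ ⊆ H) ∧
    (Tri e₀ k₀ D₂ D₂' a₂ b₂ c₂ ∧ touch D₂ a₂ b₂ c₂ ⊆ H) ∧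
    (({a₁, b₁, c₁} : Set Pt) = {p, q, d} ∧ quad a₁ b₁ c₁ = quad p q d) ∧
    (({a₂, b₂, c₂} : Set Pt) = {p, d, r} ∧ quad a₂ b₂ c₂ = quad p d r) ∧
    (Eqv D₁ D₁' → Eqv D₂ D₂' → Eqv D D')

lemma Tri.notMem_new (_h : Tri e₀ k₀ D D' a b c) (p : Pt) (hp : ∀ f ∈ D.E \ {(a, b)}, p ∉ seg f)
    (q : Pt) : (p, q) ∉ D.E \ {(a, b)} ∧ (q, p) ∉ D.E \ {(a, b)} :=
  ⟨fun h' => hp _ h' (left_mem_seg _), fun h' => hp _ h' (right_mem_seg _)⟩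

lemma tri_perm {a b c p q r : Pt} (h : ({a, b, c} : Set Pt) = {p, q, r}) : tri a b c = tri p q r := by
  unfold tri; rw [h]

lemma Tri.c_notMem (h : Tri e₀ k₀ D D' a b c) : ∀ f ∈ D.E \ {(a, b)}, c ∉ seg f :=
  fun _ hf => h.off_c hf.1 hf.2

lemma sides_cevian {p q r d : Pt} (hs : side p q r ≠ 0) (hd : d ∈ openSeg (q, r)) :
    side p q d ≠ 0 ∧ side p d r ≠ 0 := by
  obtain ⟨t, ht0, ht1, rfl⟩ := mem_openSeg.1 hd
  have e1 : side p q (q + t • (r - q)) = t * side p q r := by rw [side_add_smul]; simp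
  have e2 : side p (q + t • (r - q)) r = (1 - t) * side p q r := by
    simp only [side_eq, Prod.fst_add, Prod.snd_add, Prod.smul_fst, Prod.smul_snd, Prod.fst_sub,
      Prod.snd_sub, smul_eq_mul]; ring
  rw [e1, e2]
  exact ⟨mul_ne_zero ht0.ne' hs, mul_ne_zero (by linarith : (1:ℝ) - t ≠ 0) hs⟩

set_option maxHeartbeats 1000000 in
/-- Splitting along a segment from `a`. -/
lemma Tri.split_a (h : Tri e₀ k₀ D D' a b c) (hd : d ∈ openSeg (b, c))
    (hc : Clear (D.E \ {(a, b)}) a d) : Splits e₀ k₀ D D' (touch D a b c) a b c d := by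
  have hs := h.nondeg
  obtain ⟨nab, nbc, nac⟩ := ne_of_side hs
  obtain ⟨s1, s2⟩ := sides_cevian hs hd
  have hd' : d ∈ openSeg (c, b) := by rwa [openSeg_swap]
  have ndbc := ne_of_mem_openSeg nbc hd
  have cb_mem : (c, b) ∈ D'.E := by rw [h.edges]; exact mem_rep.2 (by simp)
  have hE' : ∀ g ∈ D'.E, g ∈ D.E \ {(a, b)} ∨ g = (a, c) ∨ g = (c, b) := fun g hg => by
    rw [h.edges] at hg; exact mem_rep.1 hg
  have hsub : D.E \ {(a, b)} ⊆ D'.E := fun g hg => by rw [h.edges]; exact Or.inl hg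
  have hdT : d ∈ tri a b c :=
    seg_subset (convex_tri _ _ _) (tri_mid _ _ _) (tri_right _ _ _) (openSeg_subset_seg _ hd)
  have ncb := (h.notMem_new c h.c_notMem b).1
  have nacE := (h.notMem_new c h.c_notMem a).2
  have nd := h.notMem_new d hc.off
  have hcb := (D'.poly.clear_of_mem cb_mem hsub ncb hd' hc.off).2
  have hP := D.poly.rep_of_side h.mem hc hcb s1
  have hdab : d ∉ seg (a, b) := fun h' => s1 (side_of_mem_seg h')
  have hdac : d ∉ seg (a, c) := fun h' => s2 (by rw [side_swap', side_of_mem_seg h', neg_zero])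
  have hdv : ∀ f ∈ D.E, f.1 ≠ d ∧ f.2 ≠ d := by
    intro f hf
    by_cases hfab : f = (a, b)
    · subst hfab
      exact ⟨fun h' => hdab (h' ▸ left_mem_seg _), fun h' => hdab (h' ▸ right_mem_seg _)⟩
    · exact ⟨fun h' => hc.off f ⟨hf, hfab⟩ (h' ▸ left_mem_seg _),
        fun h' => hc.off f ⟨hf, hfab⟩ (h' ▸ right_mem_seg _)⟩
  have hdbar : d ∉ D.bars := fun h' => by
    obtain ⟨e, he, h1⟩ := D.bars_vertex d h'; exact (hdv e he).1 h1
  obtain ⟨D₁, hE₁, hB₁, hC₁⟩ := h.canon_left.exists_rep h.mem (by simp) hP s1 hdv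
    (fun f hf => hdv f hf.1) (fun g hg hg' hne => absurd ⟨hg, hne⟩ hg')
    (fun hk => ⟨h.real hk, h.mem_env hk⟩)
  obtain ⟨D₂, hE₂, hB₂, hK₂, hD₂⟩ := D'.exists_subdivide cb_mem hd' (by
    intro f hf hne
    rcases hE' f hf with h1 | rfl | rfl
    · exact hc.off f h1
    · exact hdac
    · exact absurd rfl hne)
  have hC₂ := h.canon_right.subdivide cb_mem ncb hd' hc.off hE₂ hK₂
  have hE₁' : ∀ g ∈ D₁.E, g ∈ D.E \ {(a, b)} ∨ g = (a, d) ∨ g = (d, b) := fun g hg => by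
    rw [hE₁] at hg; exact mem_rep.1 hg
  have sT1 : tri a b d ⊆ tri a b c := tri_subset (convex_tri _ _ _) (tri_left _ _ _)
    (tri_mid _ _ _) hdT
  have sT2 : tri a d c ⊆ tri a b c := tri_subset (convex_tri _ _ _) (tri_left _ _ _)
    hdT (tri_right _ _ _)
  have t1 := h.sub (a₁ := a) (b₁ := b) (c₁ := d) h.canon_left hC₁ sdiff_subset h.mem
    (by simp) (nd a).2 (nd b).1 s1 hE₁ rfl hB₁ h.bar_a h.bar_b
    (fun g hg hg' hne => absurd ⟨hg, hne⟩ hg') sT1 (fun x hx _ => hx)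
    (fun hk hne => h.through hk (hne.mono (inter_subset_inter_right _ sT1)))
  have t2 := h.sub (a₁ := a) (b₁ := d) (c₁ := c) hC₁ hC₂
    (by rw [hE₁]; exact fun g hg => Or.inl hg) (by rw [hE₁]; exact mem_rep.2 (by simp))
    (nd a).2 nacE (nd c).2 s2 (by
      rw [hE₁, hE₂, h.edges]
      ext g
      have x1 : g = (a, d) → ¬ (g ∈ D.E ∧ g ≠ (a, b)) := by rintro rfl; exact (nd a).2
      have x2 : g = (c, b) → ¬ (g ∈ D.E ∧ g ≠ (a, b)) := by rintro rfl; exact ncb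
      have x3 : g = (a, c) → g ≠ (c, b) := by rintro rfl; simp [nac]
      have x4 : g = (d, b) → g ≠ (a, d) := by rintro rfl; simp [ndbc.1.symm]
      simp only [mem_rep]
      grind) hB₁ (hB₂.trans h.bars) h.bar_a hdbar
    (by
      intro g hg hg' hne
      rcases hE₁' g hg with h1 | rfl | rfl
      · exact absurd h1 hg'
      · exact absurd rfl hne
      · rw [seg_swap]
        exact (cevian_inter hs hd).trans (by simp)) sT2
    (by
      rintro x (rfl | rfl) hx
      · simp
      · exact absurd hx (cevian_notMem hs hd))
    (by
      intro hk ⟨w, hw, hwT⟩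
      have hthr := h.through hk ⟨w, hw, sT2 hwT⟩
      have hch := h.chord_sides (h.real hk) (h.mem_env hk).2 (h.ends hk).1 (h.ends hk).2 hw (sT2 hwT)
      have hdn : side e₀.1 e₀.2 d ≠ 0 := fun h0 =>
        hc.off e₀ (h.mem_env hk) (openSeg_subset_seg _ (hch.2 d hdT h0))
      by_contra hcon
      have hpos : 0 < side e₀.1 e₀.2 a * side e₀.1 e₀.2 d :=
        lt_of_le_of_ne (not_lt.1 hcon) (mul_ne_zero hch.1.1 hdn).symm
      obtain ⟨t, ht0, ht1, hdt⟩ := mem_openSeg.1 hd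
      have e : side e₀.1 e₀.2 d = (1 - t) * side e₀.1 e₀.2 b + t * side e₀.1 e₀.2 c := by
        rw [hdt, side_add_smul]
      refine Tri.not_all_pos (side_of_mem_seg (p := e₀.1) (q := e₀.2) hw) hwT hpos ?_
      rw [e] at hpos
      by_contra hneg
      nlinarith [mul_pos (show 0 < 1 - t by linarith) (neg_pos.2 hthr), mul_nonneg ht0.le (neg_nonneg.2 (not_lt.1 hneg))])
  refine ⟨D, D₁, a, b, d, D₁, D₂, a, d, c, t1, t2, ⟨rfl, rfl⟩, ⟨rfl, rfl⟩, fun h1 h2 => ?_⟩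
  exact (h1.trans h2).trans hD₂.symm

set_option maxHeartbeats 1000000 in
/-- Splitting along a segment from `b`. -/
lemma Tri.split_b (h : Tri e₀ k₀ D D' a b c) (hd : d ∈ openSeg (a, c))
    (hc : Clear (D.E \ {(a, b)}) b d) : Splits e₀ k₀ D D' (touch D a b c) b a c d := by
  have hs := h.nondeg
  have hs' : side b a c ≠ 0 := by rw [side_swap]; exact neg_ne_zero.2 hs
  obtain ⟨nab, nbc, nac⟩ := ne_of_side hs
  obtain ⟨s1', s2'⟩ := sides_cevian hs' hd
  have s1 : side a b d ≠ 0 := by rw [side_swap]; exact neg_ne_zero.2 s1'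
  have s2 : side d b c ≠ 0 := by rw [side_swap]; exact neg_ne_zero.2 s2'
  have ndac := ne_of_mem_openSeg nac hd
  have ac_mem : (a, c) ∈ D'.E := by rw [h.edges]; exact mem_rep.2 (by simp)
  have hE' : ∀ g ∈ D'.E, g ∈ D.E \ {(a, b)} ∨ g = (a, c) ∨ g = (c, b) := fun g hg => by
    rw [h.edges] at hg; exact mem_rep.1 hg
  have hsub : D.E \ {(a, b)} ⊆ D'.E := fun g hg => by rw [h.edges]; exact Or.inl hg
  have hdT : d ∈ tri a b c :=
    seg_subset (convex_tri _ _ _) (tri_left _ _ _) (tri_right _ _ _) (openSeg_subset_seg _ hd)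
  have ncb := (h.notMem_new c h.c_notMem b).1
  have nacE := (h.notMem_new c h.c_notMem a).2
  have nd := h.notMem_new d hc.off
  have hca := (D'.poly.clear_of_mem ac_mem hsub nacE hd hc.off).1
  have hP := D.poly.rep_of_side h.mem hca hc s1
  have hdab : d ∉ seg (a, b) := fun h' => s1 (side_of_mem_seg h')
  have hdcb : d ∉ seg (c, b) := fun h' => s2 (by
    rw [← side_cycle, side_swap', side_swap, side_cycle, side_swap, neg_neg,  side_swap']
    have := side_of_mem_seg h'
    simp only [side_eq] at this ⊢; linarith)
  have hdv : ∀ f ∈ D.E, f.1 ≠ d ∧ f.2 ≠ d := by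
    intro f hf
    by_cases hfab : f = (a, b)
    · subst hfab
      exact ⟨fun h' => hdab (h' ▸ left_mem_seg _), fun h' => hdab (h' ▸ right_mem_seg _)⟩
    · exact ⟨fun h' => hc.off f ⟨hf, hfab⟩ (h' ▸ left_mem_seg _),
        fun h' => hc.off f ⟨hf, hfab⟩ (h' ▸ right_mem_seg _)⟩
  have hdbar : d ∉ D.bars := fun h' => by
    obtain ⟨e, he, h1⟩ := D.bars_vertex d h'; exact (hdv e he).1 h1
  obtain ⟨D₁, hE₁, hB₁, hC₁⟩ := h.canon_left.exists_rep h.mem (by simp) hP s1 hdv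
    (fun f hf => hdv f hf.1) (fun g hg hg' hne => absurd ⟨hg, hne⟩ hg')
    (fun hk => ⟨h.real hk, h.mem_env hk⟩)
  obtain ⟨D₂, hE₂, hB₂, hK₂, hD₂⟩ := D'.exists_subdivide ac_mem hd (by
    intro f hf hne
    rcases hE' f hf with h1 | rfl | rfl
    · exact hc.off f h1
    · exact absurd rfl hne
    · exact hdcb)
  have hC₂ := h.canon_right.subdivide ac_mem nacE hd hc.off hE₂ hK₂
  have hE₁' : ∀ g ∈ D₁.E, g ∈ D.E \ {(a, b)} ∨ g = (a, d) ∨ g = (d, b) := fun g hg => by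
    rw [hE₁] at hg; exact mem_rep.1 hg
  have sT1 : tri a b d ⊆ tri a b c := tri_subset (convex_tri _ _ _) (tri_left _ _ _)
    (tri_mid _ _ _) hdT
  have sT2 : tri d b c ⊆ tri a b c := tri_subset (convex_tri _ _ _) hdT
    (tri_mid _ _ _) (tri_right _ _ _)
  have p2 : tri d b c = tri b d c := tri_perm (by grind)
  have t1 := h.sub (a₁ := a) (b₁ := b) (c₁ := d) h.canon_left hC₁ sdiff_subset h.mem
    (by simp) (nd a).2 (nd b).1 s1 hE₁ rfl hB₁ h.bar_a h.bar_b
    (fun g hg hg' hne => absurd ⟨hg, hne⟩ hg') sT1 (fun x hx _ => hx)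
    (fun hk hne => h.through hk (hne.mono (inter_subset_inter_right _ sT1)))
  have t2 := h.sub (a₁ := d) (b₁ := b) (c₁ := c) hC₁ hC₂
    (by rw [hE₁]; exact fun g hg => Or.inl hg) (by rw [hE₁]; exact mem_rep.2 (by simp))
    (nd b).1 (nd c).1 ncb s2 (by
      rw [hE₁, hE₂, h.edges]
      ext g
      have x1 : g = (d, b) → ¬ (g ∈ D.E ∧ g ≠ (a, b)) := by rintro rfl; exact (nd b).1
      have x2 : g = (a, c) → ¬ (g ∈ D.E ∧ g ≠ (a, b)) := by rintro rfl; exact nacE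
      have x3 : g = (a, c) → g ≠ (c, b) := by rintro rfl; simp [nac]
      have x4 : g = (d, b) → g ≠ (a, d) := by rintro rfl; simp [ndac.1]
      simp only [mem_rep]
      grind) hB₁ (hB₂.trans h.bars) hdbar h.bar_b
    (by
      intro g hg hg' hne
      rcases hE₁' g hg with h1 | rfl | rfl
      · exact absurd h1 hg'
      · rw [p2]
        exact (cevian_inter hs' hd).trans (by simp)
      · exact absurd rfl hne) sT2
    (by
      rintro x (rfl | rfl) hx
      · exact absurd (p2 ▸ hx) (cevian_notMem hs' hd)
      · simp)
    (by
      intro hk ⟨w, hw, hwT⟩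
      have hthr := h.through hk ⟨w, hw, sT2 hwT⟩
      have hch := h.chord_sides (h.real hk) (h.mem_env hk).2 (h.ends hk).1 (h.ends hk).2 hw (sT2 hwT)
      have hdn : side e₀.1 e₀.2 d ≠ 0 := fun h0 =>
        hc.off e₀ (h.mem_env hk) (openSeg_subset_seg _ (hch.2 d hdT h0))
      by_contra hcon
      have hpos : 0 < side e₀.1 e₀.2 b * side e₀.1 e₀.2 d := by
        rw [mul_comm]
        exact lt_of_le_of_ne (not_lt.1 hcon) (mul_ne_zero hdn hch.1.2.1).symm
      obtain ⟨t, ht0, ht1, hdt⟩ := mem_openSeg.1 hd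
      have e : side e₀.1 e₀.2 d = (1 - t) * side e₀.1 e₀.2 a + t * side e₀.1 e₀.2 c := by
        rw [hdt, side_add_smul]
      refine Tri.not_all_pos (side_of_mem_seg (p := e₀.1) (q := e₀.2) hw) (p2 ▸ hwT) hpos ?_
      rw [e] at hpos
      by_contra hneg
      nlinarith [mul_pos (show 0 < 1 - t by linarith) (neg_pos.2 hthr), mul_nonneg ht0.le (neg_nonneg.2 (not_lt.1 hneg))])
  refine ⟨D, D₁, a, b, d, D₁, D₂, d, b, c, t1, t2, ⟨by grind, ?_⟩, ⟨by grind, ?_⟩, fun h1 h2 => ?_⟩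
  · unfold quad; ring
  · unfold quad; ring
  exact (h1.trans h2).trans hD₂.symm

end
end STLink

namespace STLink
open Set Filter Topology

section
variable {e₀ : Edge} {k₀ : Kind} {D D' D₁ D₁' : Diagram} {a b c d a₁ b₁ c₁ : Pt}

/-- The common data for splitting along a segment from `c`. -/
structure Tri.Foot (D D' : Diagram) (a b c d : Pt) : Prop where
  s1 : side c a d ≠ 0
  s2 : side c d b ≠ 0
  dT : d ∈ tri a b c
  vert : ∀ f ∈ D.E, f.1 ≠ d ∧ f.2 ≠ d
  vert' : ∀ f ∈ D'.E, f.1 ≠ d ∧ f.2 ≠ d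
  bar : d ∉ D.bars
  dac : d ∉ seg (a, c)
  dcb : d ∉ seg (c, b)
  Ca : Clear (D.E \ {(a, b)}) a d
  Cb : Clear (D.E \ {(a, b)}) b d

lemma Tri.foot (h : Tri e₀ k₀ D D' a b c) (hd : d ∈ openSeg (a, b))
    (hc : Clear (D.E \ {(a, b)}) c d) : Tri.Foot D D' a b c d := by
  have hs : side c a b ≠ 0 := by rw [← side_cycle]; exact h.nondeg
  obtain ⟨nca, nab, ncb⟩ := ne_of_side hs
  obtain ⟨s1, s2⟩ := sides_cevian hs hd
  have hab := D.poly.clear_of_mem h.mem sdiff_subset (by simp) hd hc.off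
  have dac : d ∉ seg (a, c) := fun h' => s1 (by
    have := side_of_mem_seg h'; simp only [side_eq] at this ⊢; linarith)
  have dcb : d ∉ seg (c, b) := fun h' => s2 (by
    have := side_of_mem_seg h'; simp only [side_eq] at this ⊢; linarith)
  have hdn := ne_of_mem_openSeg nab hd
  have hv : ∀ f ∈ D.E, f.1 ≠ d ∧ f.2 ≠ d := by
    intro f hf
    by_cases hfab : f = (a, b)
    · subst hfab
      exact ⟨hdn.1.symm, hdn.2.symm⟩
    · exact ⟨fun h' => hc.off f ⟨hf, hfab⟩ (h' ▸ left_mem_seg _),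
        fun h' => hc.off f ⟨hf, hfab⟩ (h' ▸ right_mem_seg _)⟩
  refine ⟨s1, s2, ?_, hv, ?_, ?_, dac, dcb, hab.1, hab.2⟩
  · exact seg_subset (convex_tri _ _ _) (tri_left _ _ _) (tri_mid _ _ _) (openSeg_subset_seg _ hd)
  · intro f hf
    rw [h.edges] at hf
    rcases mem_rep.1 hf with h1 | rfl | rfl
    · exact hv f h1.1
    · exact ⟨hdn.1.symm, fun h' => dac (h' ▸ right_mem_seg _)⟩
    · exact ⟨fun h' => dac (h' ▸ right_mem_seg _), hdn.2.symm⟩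
  · intro h'
    obtain ⟨e, he, h1⟩ := D.bars_vertex d h'; exact (hv e he).1 h1

set_option maxHeartbeats 1000000 in
/-- Splitting along a segment from `c`, where the part at `a` is moved first. -/
lemma Tri.split_c (h : Tri e₀ k₀ D D' a b c) (hd : d ∈ openSeg (a, b))
    (hc : Clear (D.E \ {(a, b)}) c d) (hord : k₀ ≠ .virtual → (seg e₀ ∩ tri a b c).Nonempty →
      side e₀.1 e₀.2 a * side e₀.1 e₀.2 c < 0) :
    ∃ D₁ D₂ : Diagram, Eqv D D₁ ∧ (Tri e₀ k₀ D' D₂ a c d ∧ touch D' a c d ⊆ touch D a b c) ∧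
      (Tri e₀ k₀ D₁ D₂ d b c ∧ touch D₁ d b c ⊆ touch D a b c) := by
  have hs := h.nondeg
  have hs' : side c a b ≠ 0 := by rw [← side_cycle]; exact h.nondeg
  obtain ⟨nab, nbc, nac⟩ := ne_of_side hs
  have F := h.foot hd hc
  have s1 : side a c d ≠ 0 := by rw [side_swap]; exact neg_ne_zero.2 F.s1
  have s2 : side d b c ≠ 0 := by rw [side_cycle]; exact F.s2
  have p1 : tri a c d = tri c a d := tri_perm (by grind)
  have p2 : tri d b c = tri c d b := tri_perm (by grind)
  have ndab := ne_of_mem_openSeg nab hd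
  have hdc : d ≠ c := fun h' => F.dac (h' ▸ right_mem_seg _)
  have ac_mem : (a, c) ∈ D'.E := by rw [h.edges]; exact mem_rep.2 (by simp)
  have hE' : ∀ g ∈ D'.E, g ∈ D.E \ {(a, b)} ∨ g = (a, c) ∨ g = (c, b) := fun g hg => by
    rw [h.edges] at hg; exact mem_rep.1 hg
  have hsub : D.E \ {(a, b)} ⊆ D'.E := fun g hg => by rw [h.edges]; exact Or.inl hg
  have ncb := (h.notMem_new c h.c_notMem b).1
  have nacE := (h.notMem_new c h.c_notMem a).2
  have nd := h.notMem_new d hc.off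
  obtain ⟨D₁, hE₁, hB₁, hK₁, hD₁⟩ := D.exists_subdivide h.mem hd (fun f hf hne => hc.off f ⟨hf, hne⟩)
  have hC₁ := h.canon_left.subdivide h.mem (by simp) hd hc.off hE₁ hK₁
  have hE'sub : D'.E \ {(a, c)} ⊆ insert (c, b) (D.E \ {(a, b)}) := by
    rintro g ⟨hg, hne⟩
    rcases hE' g hg with h1 | rfl | rfl
    · exact Or.inr h1
    · exact absurd rfl hne
    · exact Or.inl rfl
  have hcbad : ∀ x ∈ seg (c, b), x ∈ seg (a, d) → False := by
    intro x hx hx'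
    have h1 := side_of_mem_seg hx
    obtain ⟨t, ht0, ht1, rfl⟩ := mem_openSeg.1 hd
    obtain ⟨s, hs0, hs1, rfl⟩ := mem_seg.1 hx'
    have h2 : side c b (a + s • (a + t • (b - a) - a)) = (1 - s * t) * side c b a := by
      simp only [side_eq, Prod.fst_add, Prod.snd_add, Prod.smul_fst, Prod.smul_snd, Prod.fst_sub,
        Prod.snd_sub, smul_eq_mul]; ring
    rw [h2] at h1
    rcases mul_eq_zero.1 h1 with h3 | h3
    · nlinarith
    · exact hs' (by rw [side_swap', h3, neg_zero])
  have hcbcd : ∀ x ∈ seg (c, b), x ∈ seg (c, d) → x = c := by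
    intro x hx hx'
    refine side_ne_zero_seg (a := b) (b := d) (c := c) ?_ (by rwa [seg_swap]) hx'
    rw [side_swap, side_cycle]
    intro h0; exact F.s2 (by simp only [side_eq] at h0 ⊢; linarith)
  have cl1 : Clear (D'.E \ {(a, c)}) a d :=
    (F.Ca.insert (e := (c, b)) F.dcb (fun h' => absurd (hcbad _ (left_mem_seg _) h') not_false)
      (fun h' => absurd (hcbad _ (right_mem_seg _) h') not_false)
      (fun x hx hx' => hcbad x (openSeg_subset_seg _ hx) (openSeg_subset_seg _ hx'))).mono hE'sub
  have cl2 : Clear (D'.E \ {(a, c)}) c d :=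
    (hc.insert (e := (c, b)) F.dcb (fun _ => rfl)
      (fun h' => hcbcd _ (right_mem_seg (c, b)) h')
      (fun x hx hx' => (ne_of_mem_openSeg hdc.symm hx').1 (hcbcd x (openSeg_subset_seg _ hx)
        (openSeg_subset_seg _ hx')))).mono hE'sub
  have hP := D'.poly.rep_of_side ac_mem cl1 cl2 s1
  obtain ⟨D₂, hE₂, hB₂, hC₂⟩ := h.canon_right.exists_rep ac_mem nacE hP s1 F.vert'
    (fun f hf => F.vert f hf.1) (by
      intro g hg hg' hne x hx
      rcases hE' g hg with h1 | rfl | rfl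
      · exact absurd h1 hg'
      · exact absurd rfl hne
      · refine ⟨fun hx' => hcbad x (openSeg_subset_seg _ hx) (openSeg_subset_seg _ hx'), fun hx' => ?_⟩
        exact (ne_of_mem_openSeg hdc hx').2 (hcbcd x (openSeg_subset_seg _ hx)
          (by rw [seg_swap]; exact openSeg_subset_seg _ hx')))
    (fun hk => ⟨hsub (h.mem_env hk), h.mem_env hk⟩)
  have hE₁' : ∀ g ∈ D₁.E, g ∈ D.E \ {(a, b)} ∨ g = (a, d) ∨ g = (d, b) := fun g hg => by
    rw [hE₁] at hg; exact mem_rep.1 hg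
  have sT1 : tri a c d ⊆ tri a b c := tri_subset (convex_tri _ _ _) (tri_left _ _ _)
    (tri_right _ _ _) F.dT
  have sT2 : tri d b c ⊆ tri a b c := tri_subset (convex_tri _ _ _) F.dT
    (tri_mid _ _ _) (tri_right _ _ _)
  have t1 := h.sub (a₁ := a) (b₁ := c) (c₁ := d) h.canon_right hC₂ hsub ac_mem
    nacE (nd a).2 (nd c).1 s1 hE₂ h.bars (hB₂.trans h.bars) h.bar_a h.bar_c
    (by
      intro g hg hg' hne
      rcases hE' g hg with h1 | rfl | rfl
      · exact absurd h1 hg'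
      · exact absurd rfl hne
      · rw [p1]; exact (cevian_side_inter hs' hd).trans (by simp)) sT1
    (by
      rintro x (rfl | rfl) hx
      · simp
      · exfalso
        refine cevian_notMem (p := c) (q := x) (r := a) (d := d) ?_ (by rwa [openSeg_swap]) ?_
        · rw [side_swap']; exact neg_ne_zero.2 hs'
        · rwa [show tri c d a = tri a c d from tri_perm (by grind)])
    (fun hk hne => hord hk (hne.mono (inter_subset_inter_right _ sT1)))
  have t2 := h.sub (a₁ := d) (b₁ := b) (c₁ := c) hC₁ hC₂
    (by rw [hE₁]; exact fun g hg => Or.inl hg) (by rw [hE₁]; exact mem_rep.2 (by simp))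
    (nd b).1 (nd c).1 ncb s2 (by
      rw [hE₁, hE₂, h.edges]
      ext g
      have x1 : g = (d, b) → ¬ (g ∈ D.E ∧ g ≠ (a, b)) := by rintro rfl; exact (nd b).1
      have x2 : g = (a, c) → ¬ (g ∈ D.E ∧ g ≠ (a, b)) := by rintro rfl; exact nacE
      have x3 : g = (a, c) → g ≠ (c, b) := by rintro rfl; simp [nac]
      have x4 : g = (d, b) → g ≠ (a, d) := by rintro rfl; simp [ndab.1]
      simp only [mem_rep]
      grind) hB₁ (hB₂.trans h.bars) F.bar h.bar_b
    (by
      intro g hg hg' hne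
      rcases hE₁' g hg with h1 | rfl | rfl
      · exact absurd h1 hg'
      · rw [p2]
        exact (cevian_inter hs' hd).trans (by simp)
      · exact absurd rfl hne) sT2
    (by
      rintro x (rfl | rfl) hx
      · exact absurd (p2 ▸ hx) (cevian_notMem hs' hd)
      · simp)
    (by
      intro hk ⟨w, hw, hwT⟩
      have hthr := h.through hk ⟨w, hw, sT2 hwT⟩
      have hac := hord hk ⟨w, hw, sT2 hwT⟩
      have hch := h.chord_sides (h.real hk) (h.mem_env hk).2 (h.ends hk).1 (h.ends hk).2 hw (sT2 hwT)
      have hdn : side e₀.1 e₀.2 d ≠ 0 := fun h0 =>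
        hc.off e₀ (h.mem_env hk) (openSeg_subset_seg _ (hch.2 d F.dT h0))
      by_contra hcon
      have hpos : 0 < side e₀.1 e₀.2 b * side e₀.1 e₀.2 d := by
        rw [mul_comm]
        exact lt_of_le_of_ne (not_lt.1 hcon) (mul_ne_zero hdn hch.1.2.1).symm
      refine Tri.not_all_pos (side_of_mem_seg (p := e₀.1) (q := e₀.2) hw)
        (show w ∈ tri b d c from by rwa [tri_perm (p := d) (q := b) (r := c) (by grind)]) hpos ?_
      have := mul_pos_of_neg_of_neg hthr hac
      by_contra hneg
      have h5 : side e₀.1 e₀.2 a * side e₀.1 e₀.2 b * (side e₀.1 e₀.2 a * side e₀.1 e₀.2 c)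
        = side e₀.1 e₀.2 a ^ 2 * (side e₀.1 e₀.2 b * side e₀.1 e₀.2 c) := by ring
      rw [h5] at this
      nlinarith [sq_nonneg (side e₀.1 e₀.2 a), mul_nonneg (sq_nonneg (side e₀.1 e₀.2 a)) (neg_nonneg.2 (not_lt.1 hneg))])
  exact ⟨D₁, D₂, hD₁, t1, t2⟩

set_option maxHeartbeats 1000000 in
/-- Splitting along a segment from `c`, where the part at `b` is moved first. -/
lemma Tri.split_c' (h : Tri e₀ k₀ D D' a b c) (hd : d ∈ openSeg (a, b))
    (hc : Clear (D.E \ {(a, b)}) c d) (hord : k₀ ≠ .virtual → (seg e₀ ∩ tri a b c).Nonempty →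
      side e₀.1 e₀.2 b * side e₀.1 e₀.2 c < 0) :
    ∃ D₁ D₂ : Diagram, Eqv D D₁ ∧ (Tri e₀ k₀ D' D₂ c b d ∧ touch D' c b d ⊆ touch D a b c) ∧
      (Tri e₀ k₀ D₁ D₂ a d c ∧ touch D₁ a d c ⊆ touch D a b c) := by
  have hs := h.nondeg
  have hs' : side c a b ≠ 0 := by rw [← side_cycle]; exact h.nondeg
  have hs'' : side c b a ≠ 0 := by rw [side_swap']; exact neg_ne_zero.2 hs'
  have hd' : d ∈ openSeg (b, a) := by rwa [openSeg_swap]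
  obtain ⟨nab, nbc, nac⟩ := ne_of_side hs
  have F := h.foot hd hc
  have s1 : side c b d ≠ 0 := by rw [side_swap']; exact neg_ne_zero.2 F.s2
  have s2 : side a d c ≠ 0 := by rw [side_cycle]; exact F.s1
  have p2 : tri a d c = tri c d a := tri_perm (by grind)
  have ndab := ne_of_mem_openSeg nab hd
  have hdc : d ≠ c := fun h' => F.dac (h' ▸ right_mem_seg _)
  have cb_mem : (c, b) ∈ D'.E := by rw [h.edges]; exact mem_rep.2 (by simp)
  have hE' : ∀ g ∈ D'.E, g ∈ D.E \ {(a, b)} ∨ g = (a, c) ∨ g = (c, b) := fun g hg => by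
    rw [h.edges] at hg; exact mem_rep.1 hg
  have hsub : D.E \ {(a, b)} ⊆ D'.E := fun g hg => by rw [h.edges]; exact Or.inl hg
  have ncb := (h.notMem_new c h.c_notMem b).1
  have nacE := (h.notMem_new c h.c_notMem a).2
  have nd := h.notMem_new d hc.off
  obtain ⟨D₁, hE₁, hB₁, hK₁, hD₁⟩ := D.exists_subdivide h.mem hd (fun f hf hne => hc.off f ⟨hf, hne⟩)
  have hC₁ := h.canon_left.subdivide h.mem (by simp) hd hc.off hE₁ hK₁
  have hE'sub : D'.E \ {(c, b)} ⊆ insert (a, c) (D.E \ {(a, b)}) := by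
    rintro g ⟨hg, hne⟩
    rcases hE' g hg with h1 | rfl | rfl
    · exact Or.inr h1
    · exact Or.inl rfl
    · exact absurd rfl hne
  have hcabd : ∀ x ∈ seg (a, c), x ∈ seg (b, d) → False := by
    intro x hx hx'
    have h1 := side_of_mem_seg hx
    obtain ⟨t, ht0, ht1, rfl⟩ := mem_openSeg.1 hd'
    obtain ⟨s, hs0, hs1, rfl⟩ := mem_seg.1 hx'
    have h2 : side a c (b + s • (b + t • (a - b) - b)) = (1 - s * t) * side a c b := by
      simp only [side_eq, Prod.fst_add, Prod.snd_add, Prod.smul_fst, Prod.smul_snd, Prod.fst_sub,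
        Prod.snd_sub, smul_eq_mul]; ring
    rw [h2] at h1
    rcases mul_eq_zero.1 h1 with h3 | h3
    · nlinarith
    · exact hs (by rw [side_swap', h3, neg_zero])
  have hcacd : ∀ x ∈ seg (a, c), x ∈ seg (c, d) → x = c := by
    intro x hx hx'
    refine side_ne_zero_seg (a := a) (b := d) (c := c) s2 hx hx'
  have cl1 : Clear (D'.E \ {(c, b)}) b d :=
    (F.Cb.insert (e := (a, c)) F.dac (fun h' => absurd (hcabd _ (left_mem_seg _) h') not_false)
      (fun h' => absurd (hcabd _ (right_mem_seg _) h') not_false)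
      (fun x hx hx' => hcabd x (openSeg_subset_seg _ hx) (openSeg_subset_seg _ hx'))).mono hE'sub
  have cl2 : Clear (D'.E \ {(c, b)}) c d :=
    (hc.insert (e := (a, c)) F.dac
      (fun h' => hcacd _ (left_mem_seg (a, c)) h') (fun _ => rfl)
      (fun x hx hx' => (ne_of_mem_openSeg hdc.symm hx').1 (hcacd x (openSeg_subset_seg _ hx)
        (openSeg_subset_seg _ hx')))).mono hE'sub
  have hP := D'.poly.rep_of_side cb_mem cl2 cl1 s1
  obtain ⟨D₂, hE₂, hB₂, hC₂⟩ := h.canon_right.exists_rep cb_mem ncb hP s1 F.vert'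
    (fun f hf => F.vert f hf.1) (by
      intro g hg hg' hne x hx
      rcases hE' g hg with h1 | rfl | rfl
      · exact absurd h1 hg'
      · refine ⟨fun hx' => ?_, fun hx' => hcabd x (openSeg_subset_seg _ hx)
          (by rw [seg_swap]; exact openSeg_subset_seg _ hx')⟩
        exact (ne_of_mem_openSeg hdc.symm hx').1 (hcacd x (openSeg_subset_seg _ hx)
          (openSeg_subset_seg _ hx'))
      · exact absurd rfl hne)
    (fun hk => ⟨hsub (h.mem_env hk), h.mem_env hk⟩)
  have hE₁' : ∀ g ∈ D₁.E, g ∈ D.E \ {(a, b)} ∨ g = (a, d) ∨ g = (d, b) := fun g hg => by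
    rw [hE₁] at hg; exact mem_rep.1 hg
  have sT1 : tri c b d ⊆ tri a b c := tri_subset (convex_tri _ _ _) (tri_right _ _ _)
    (tri_mid _ _ _) F.dT
  have sT2 : tri a d c ⊆ tri a b c := tri_subset (convex_tri _ _ _) (tri_left _ _ _) F.dT
    (tri_right _ _ _)
  have t1 := h.sub (a₁ := c) (b₁ := b) (c₁ := d) h.canon_right hC₂ hsub cb_mem
    ncb (nd c).2 (nd b).1 s1 hE₂ h.bars (hB₂.trans h.bars) h.bar_c h.bar_b
    (by
      intro g hg hg' hne
      rcases hE' g hg with h1 | rfl | rfl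
      · exact absurd h1 hg'
      · rw [seg_swap]; exact (cevian_side_inter hs'' hd').trans (by simp)
      · exact absurd rfl hne) sT1
    (by
      rintro x (rfl | rfl) hx
      · exfalso
        refine cevian_notMem (p := c) (q := x) (r := b) (d := d) hs' hd ?_
        · rwa [show tri c d b = tri c b d from tri_perm (by grind)]
      · simp)
    (fun hk hne => by rw [mul_comm]; exact hord hk (hne.mono (inter_subset_inter_right _ sT1)))
  have t2 := h.sub (a₁ := a) (b₁ := d) (c₁ := c) hC₁ hC₂
    (by rw [hE₁]; exact fun g hg => Or.inl hg) (by rw [hE₁]; exact mem_rep.2 (by simp))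
    (nd a).2 nacE (nd c).2 s2 (by
      rw [hE₁, hE₂, h.edges]
      ext g
      have x1 : g = (a, d) → ¬ (g ∈ D.E ∧ g ≠ (a, b)) := by rintro rfl; exact (nd a).2
      have x2 : g = (c, b) → ¬ (g ∈ D.E ∧ g ≠ (a, b)) := by rintro rfl; exact ncb
      have x3 : g = (a, c) → g ≠ (c, b) := by rintro rfl; simp [nac]
      have x4 : g = (d, b) → g ≠ (a, d) := by rintro rfl; simp [ndab.1]
      simp only [mem_rep]
      grind) hB₁ (hB₂.trans h.bars) h.bar_a F.bar
    (by
      intro g hg hg' hne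
      rcases hE₁' g hg with h1 | rfl | rfl
      · exact absurd h1 hg'
      · exact absurd rfl hne
      · rw [p2, seg_swap]
        exact (cevian_inter hs'' hd').trans (by simp)) sT2
    (by
      rintro x (rfl | rfl) hx
      · simp
      · exact absurd (p2 ▸ hx) (cevian_notMem hs'' hd'))
    (by
      intro hk ⟨w, hw, hwT⟩
      have hthr := h.through hk ⟨w, hw, sT2 hwT⟩
      have hac := hord hk ⟨w, hw, sT2 hwT⟩
      have hch := h.chord_sides (h.real hk) (h.mem_env hk).2 (h.ends hk).1 (h.ends hk).2 hw (sT2 hwT)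
      have hdn : side e₀.1 e₀.2 d ≠ 0 := fun h0 =>
        hc.off e₀ (h.mem_env hk) (openSeg_subset_seg _ (hch.2 d F.dT h0))
      by_contra hcon
      have hpos : 0 < side e₀.1 e₀.2 a * side e₀.1 e₀.2 d :=
        lt_of_le_of_ne (not_lt.1 hcon) (mul_ne_zero hch.1.1 hdn).symm
      refine Tri.not_all_pos (side_of_mem_seg (p := e₀.1) (q := e₀.2) hw) hwT hpos ?_
      have := mul_pos_of_neg_of_neg hthr hac
      by_contra hneg
      have h5 : side e₀.1 e₀.2 a * side e₀.1 e₀.2 b * (side e₀.1 e₀.2 b * side e₀.1 e₀.2 c)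
        = side e₀.1 e₀.2 b ^ 2 * (side e₀.1 e₀.2 a * side e₀.1 e₀.2 c) := by ring
      rw [h5] at this
      nlinarith [sq_nonneg (side e₀.1 e₀.2 b), mul_nonneg (sq_nonneg (side e₀.1 e₀.2 b)) (neg_nonneg.2 (not_lt.1 hneg))])
  exact ⟨D₁, D₂, hD₁, t1, t2⟩

end
end STLink

namespace STLink
open Set Filter Topology

section
variable {e₀ : Edge} {k₀ : Kind} {D D' D₁ D₁' : Diagram} {a b c d a₁ b₁ c₁ : Pt}

lemma Tri.splits_c (h : Tri e₀ k₀ D D' a b c) (hd : d ∈ openSeg (a, b))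
    (hc : Clear (D.E \ {(a, b)}) c d) : Splits e₀ k₀ D D' (touch D a b c) c a b d := by
  by_cases hord : k₀ ≠ .virtual → (seg e₀ ∩ tri a b c).Nonempty →
      side e₀.1 e₀.2 a * side e₀.1 e₀.2 c < 0
  · obtain ⟨D₁, D₂, h1, t1, t2⟩ := h.split_c hd hc hord
    refine ⟨D', D₂, a, c, d, D₁, D₂, d, b, c, t1, t2, ⟨by grind, ?_⟩,
      ⟨by grind, ?_⟩, fun h2 h3 => h1.trans (h3.trans h2.symm)⟩ <;> (unfold quad; ring)
  · have hord' : k₀ ≠ .virtual → (seg e₀ ∩ tri a b c).Nonempty →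
        side e₀.1 e₀.2 b * side e₀.1 e₀.2 c < 0 := by
      intro hk hne
      obtain ⟨w, hw, hwT⟩ := hne
      by_contra hcon
      apply hord
      intro _ _
      have hthr := h.through hk ⟨w, hw, hwT⟩
      have hch := h.chord_sides (h.real hk) (h.mem_env hk).2 (h.ends hk).1 (h.ends hk).2 hw hwT
      have hpos : 0 < side e₀.1 e₀.2 b * side e₀.1 e₀.2 c :=
        lt_of_le_of_ne (not_lt.1 hcon) (mul_ne_zero hch.1.2.1 hch.1.2.2).symm
      have h5 : side e₀.1 e₀.2 a * side e₀.1 e₀.2 b * (side e₀.1 e₀.2 b * side e₀.1 e₀.2 c)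
        = side e₀.1 e₀.2 b ^ 2 * (side e₀.1 e₀.2 a * side e₀.1 e₀.2 c) := by ring
      have h6 := mul_neg_of_neg_of_pos hthr hpos
      rw [h5] at h6
      by_contra hneg
      have := mul_nonneg (sq_nonneg (side e₀.1 e₀.2 b)) (not_lt.1 hneg)
      linarith
    obtain ⟨D₁, D₂, h1, t1, t2⟩ := h.split_c' hd hc hord'
    refine ⟨D₁, D₂, a, d, c, D', D₂, c, b, d, t2, t1, ⟨by grind, ?_⟩,
      ⟨by grind, ?_⟩, fun h3 h2 => h1.trans (h3.trans h2.symm)⟩ <;> (unfold quad; ring)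

lemma Poly.subsingleton_inter {E : Set Edge} (hE : Poly E) {e f : Edge} (he : e ∈ E) (hf : f ∈ E)
    (hne : e ≠ f) : (seg f ∩ openSeg e).Subsingleton := fun _ hx _ hy =>
  hE.inter_unique he hf hne (openSeg_subset_seg _ hx.2) hx.1 (openSeg_subset_seg _ hy.2) hy.1

lemma Tri.finite_not_splits_a (h : Tri e₀ k₀ D D' a b c) :
    {d | d ∈ openSeg (b, c) ∧ ¬ Splits e₀ k₀ D D' (touch D a b c) a b c d}.Finite := by
  refine (finite_not_clear (E := D.E \ {(a, b)}) (D.poly.mono sdiff_subset) h.nondeg ?_).subset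
    fun d hd => ⟨hd.1, fun hc => hd.2 (h.split_a hd.1 hc)⟩
  intro f hf
  rw [openSeg_swap]
  refine D'.poly.subsingleton_inter (by rw [h.edges]; exact mem_rep.2 (by simp))
    (by rw [h.edges]; exact Or.inl hf) ?_
  rintro rfl
  exact h.c_notMem _ hf (left_mem_seg _)

lemma Tri.finite_not_splits_b (h : Tri e₀ k₀ D D' a b c) :
    {d | d ∈ openSeg (a, c) ∧ ¬ Splits e₀ k₀ D D' (touch D a b c) b a c d}.Finite := by
  refine (finite_not_clear (E := D.E \ {(a, b)}) (D.poly.mono sdiff_subset)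
    (by rw [side_swap]; exact neg_ne_zero.2 h.nondeg) ?_).subset
    fun d hd => ⟨hd.1, fun hc => hd.2 (h.split_b hd.1 hc)⟩
  intro f hf
  refine D'.poly.subsingleton_inter (by rw [h.edges]; exact mem_rep.2 (by simp))
    (by rw [h.edges]; exact Or.inl hf) ?_
  rintro rfl
  exact h.c_notMem _ hf (right_mem_seg _)

lemma Tri.finite_not_splits_c (h : Tri e₀ k₀ D D' a b c) :
    {d | d ∈ openSeg (a, b) ∧ ¬ Splits e₀ k₀ D D' (touch D a b c) c a b d}.Finite := by
  refine (finite_not_clear (E := D.E \ {(a, b)}) (D.poly.mono sdiff_subset)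
    (by rw [← side_cycle]; exact h.nondeg) ?_).subset
    fun d hd => ⟨hd.1, fun hc => hd.2 (h.splits_c hd.1 hc)⟩
  intro f hf
  exact D.poly.subsingleton_inter h.mem hf.1 (Ne.symm hf.2)

lemma exists_middle {q r : Pt} (hqr : q ≠ r) {P : Pt → Prop}
    (h : {d | d ∈ openSeg (q, r) ∧ ¬ P d}.Finite) :
    ∃ t : ℝ, 9 / 20 < t ∧ t < 11 / 20 ∧ P (q + t • (r - q)) := by
  have hinj : Function.Injective fun t : ℝ => q + t • (r - q) := by
    intro s t hst
    have : (s - t) • (r - q) = 0 := by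
      have := add_left_cancel hst
      rw [sub_smul, this, sub_self]
    exact sub_eq_zero.1 ((smul_eq_zero.1 this).resolve_right (sub_ne_zero.2 hqr.symm))
  have hf := h.preimage hinj.injOn
  have hi : (Ioo (9 / 20 : ℝ) (11 / 20)).Infinite := Ioo_infinite (by norm_num)
  obtain ⟨t, ht, hnt⟩ := hi.exists_notMem_finite hf
  refine ⟨t, ht.1, ht.2, ?_⟩
  by_contra hP
  exact hnt ⟨mem_openSeg.2 ⟨t, by linarith [ht.1], by linarith [ht.2], rfl⟩, hP⟩

lemma quad_middle {p q r : Pt} {t : ℝ} (h1 : 9 / 20 < t) (h2 : t < 11 / 20)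
    (hq : (p.1 - q.1) ^ 2 + (p.2 - q.2) ^ 2 ≤ (r.1 - q.1) ^ 2 + (r.2 - q.2) ^ 2)
    (hr : (p.1 - r.1) ^ 2 + (p.2 - r.2) ^ 2 ≤ (r.1 - q.1) ^ 2 + (r.2 - q.2) ^ 2) :
    quad p q (q + t • (r - q)) ≤ 9 / 10 * quad p q r ∧
      quad p (q + t • (r - q)) r ≤ 9 / 10 * quad p q r := by
  set x := (p.1 - q.1) ^ 2 + (p.2 - q.2) ^ 2 with hx
  set y := (p.1 - r.1) ^ 2 + (p.2 - r.2) ^ 2 with hy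
  set L := (r.1 - q.1) ^ 2 + (r.2 - q.2) ^ 2 with hL
  have x0 : 0 ≤ x := by positivity
  have y0 : 0 ≤ y := by positivity
  have L0 : 0 ≤ L := by positivity
  have e0 : quad p q r = x + y + L := by unfold quad; rw [hx, hy, hL]; ring
  have e1 : quad p q (q + t • (r - q)) = (2 - t) * x + t * y + (2 * t ^ 2 - t) * L := by
    unfold quad; rw [hx, hy, hL]
    simp only [Prod.fst_add, Prod.snd_add, Prod.smul_fst, Prod.smul_snd, Prod.fst_sub,
      Prod.snd_sub, smul_eq_mul]; ring
  have e2 : quad p (q + t • (r - q)) r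
      = (1 - t) * x + (1 + t) * y + (2 * (1 - t) ^ 2 - (1 - t)) * L := by
    unfold quad; rw [hx, hy, hL]
    simp only [Prod.fst_add, Prod.snd_add, Prod.smul_fst, Prod.smul_snd, Prod.fst_sub,
      Prod.snd_sub, smul_eq_mul]; ring
  rw [e0, e1, e2]
  have k1 : 0 ≤ (t - 9 / 20) * (11 / 20 - t) := mul_nonneg (by linarith) (by linarith)
  have k2 := mul_nonneg k1 L0
  constructor
  · nlinarith [mul_nonneg (show 0 ≤ 11 / 10 - t by linarith) (sub_nonneg.2 hq),
      mul_nonneg (show 0 ≤ 9 / 10 - t by linarith) y0]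
  · nlinarith [mul_nonneg (show 0 ≤ 1 / 10 + t by linarith) (sub_nonneg.2 hr),
      mul_nonneg (show 0 ≤ t - 1 / 10 by linarith) x0]

/-- Every push of an edge across a triangle is reduced to two pushes across smaller triangles. -/
lemma Tri.exists_splits (h : Tri e₀ k₀ D D' a b c) : ∃ p q r d,
    Splits e₀ k₀ D D' (touch D a b c) p q r d ∧ tri p q d ⊆ tri a b c ∧ tri p d r ⊆ tri a b c ∧
      quad p q d ≤ 9 / 10 * quad a b c ∧ quad p d r ≤ 9 / 10 * quad a b c := by
  obtain ⟨nab, nbc, nac⟩ := ne_of_side h.nondeg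
  have main : ∀ p q r, q ≠ r → tri p q r = tri a b c → quad p q r = quad a b c →
      {d | d ∈ openSeg (q, r) ∧ ¬ Splits e₀ k₀ D D' (touch D a b c) p q r d}.Finite →
      (p.1 - q.1) ^ 2 + (p.2 - q.2) ^ 2 ≤ (r.1 - q.1) ^ 2 + (r.2 - q.2) ^ 2 →
      (p.1 - r.1) ^ 2 + (p.2 - r.2) ^ 2 ≤ (r.1 - q.1) ^ 2 + (r.2 - q.2) ^ 2 →
      ∃ p q r d,
        Splits e₀ k₀ D D' (touch D a b c) p q r d ∧ tri p q d ⊆ tri a b c ∧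
        tri p d r ⊆ tri a b c ∧
        quad p q d ≤ 9 / 10 * quad a b c ∧ quad p d r ≤ 9 / 10 * quad a b c := by
    intro p q r hqr hT hQ hfin h1 h2
    obtain ⟨t, ht1, ht2, hsp⟩ := exists_middle hqr hfin
    have hd : q + t • (r - q) ∈ tri p q r := seg_subset (convex_tri _ _ _) (tri_mid _ _ _)
      (tri_right _ _ _) (mem_seg.2 ⟨t, by linarith, by linarith, rfl⟩)
    have := quad_middle ht1 ht2 h1 h2
    rw [hQ] at this
    exact ⟨p, q, r, _, hsp,
      hT ▸ tri_subset (convex_tri _ _ _) (tri_left _ _ _) (tri_mid _ _ _) hd,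
      hT ▸ tri_subset (convex_tri _ _ _) (tri_left _ _ _) hd (tri_right _ _ _), this⟩
  by_cases h1 : (a.1 - b.1) ^ 2 + (a.2 - b.2) ^ 2 ≤ (c.1 - b.1) ^ 2 + (c.2 - b.2) ^ 2
  · by_cases h2 : (a.1 - c.1) ^ 2 + (a.2 - c.2) ^ 2 ≤ (c.1 - b.1) ^ 2 + (c.2 - b.2) ^ 2
    · exact main a b c nbc rfl rfl h.finite_not_splits_a h1 h2
    · refine main b a c nac (tri_perm (by grind)) (by unfold quad; ring) h.finite_not_splits_b ?_ ?_
        <;> nlinarith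
  · by_cases h2 : (a.1 - c.1) ^ 2 + (a.2 - c.2) ^ 2 ≤ (a.1 - b.1) ^ 2 + (a.2 - b.2) ^ 2
    · refine main c a b nab (tri_perm (by grind)) (by unfold quad; ring) h.finite_not_splits_c ?_ ?_
        <;> nlinarith
    · refine main b a c nac (tri_perm (by grind)) (by unfold quad; ring) h.finite_not_splits_b ?_ ?_
        <;> nlinarith

/-- It suffices to push edges across small triangles. -/
lemma Tri.eqv_of_small {ε : ℝ} (hε : 0 < ε) {H : Set Edge} {T : Set Pt}
    (base : ∀ D D' a b c, Tri e₀ k₀ D D' a b c → touch D a b c ⊆ H → tri a b c ⊆ T →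
      quad a b c < ε → Eqv D D')
    (h : Tri e₀ k₀ D D' a b c) (hH : touch D a b c ⊆ H) (hT : tri a b c ⊆ T) : Eqv D D' := by
  have key : ∀ n : ℕ, ∀ D D' a b c, Tri e₀ k₀ D D' a b c → touch D a b c ⊆ H → tri a b c ⊆ T →
      (9 / 10 : ℝ) ^ n * quad a b c < ε → Eqv D D' := by
    intro n
    induction n with
    | zero => intro D D' a b c h1 h2 h3 h4; exact base D D' a b c h1 h2 h3 (by simpa using h4)
    | succ n ih =>
      intro D D' a b c h1 h2 h3 h4
      obtain ⟨p, q, r, d, ⟨D₁, D₁', a₁, b₁, c₁, D₂, D₂', a₂, b₂, c₂, t1, t2, u1, u2, himp⟩, s1, s2,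
        q1, q2⟩ := h1.exists_splits
      have hp : (0 : ℝ) < (9 / 10) ^ n := by positivity
      rw [pow_succ] at h4
      refine himp (ih _ _ _ _ _ t1.1 (t1.2.trans h2) (tri_perm u1.1 ▸ s1.trans h3) ?_)
        (ih _ _ _ _ _ t2.1 (t2.2.trans h2) (tri_perm u2.1 ▸ s2.trans h3) ?_)
      · rw [u1.2]
        nlinarith [mul_le_mul_of_nonneg_left q1 hp.le]
      · rw [u2.2]
        nlinarith [mul_le_mul_of_nonneg_left q2 hp.le]
  obtain ⟨n, hn⟩ := exists_pow_lt_of_lt_one (show 0 < ε / (quad a b c + 1) by unfold quad; positivity)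
    (show (9 / 10 : ℝ) < 1 by norm_num)
  refine key n D D' a b c h hH hT ?_
  have q0 : 0 ≤ quad a b c := by unfold quad; positivity
  rw [lt_div_iff₀ (by linarith)] at hn
  nlinarith [show (0 : ℝ) < (9 / 10) ^ n by positivity]

end
end STLink

namespace STLink
open Set Filter Topology

/-- The same diagram with other bars. -/
def Diagram.withBars (D : Diagram) (B : Set Pt) (hB : ∀ v ∈ B, ∃ e ∈ D.E, e.1 = v) : Diagram :=
  { D with bars := B, bars_vertex := hB }

/-- The crossings on an edge. -/
def crossings (D : Diagram) (e : Edge) : Set Pt := {x | ∃ g, CrossAt D.E e g x}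

lemma finite_crossings (D : Diagram) (e : Edge) : (crossings D e).Finite := by
  have : crossings D e ⊆ ⋃ g ∈ D.E, {x | CrossAt D.E e g x} := by
    rintro x ⟨g, hg⟩
    simp only [mem_iUnion]
    exact ⟨g, hg.2.1, hg⟩
  exact (D.finite.biUnion fun g _ =>
    (show ({x | CrossAt D.E e g x}).Subsingleton from
      fun _ hx _ hy => D.poly.cross_unique hx hy).finite).subset this

lemma infinite_param {q r : Pt} (hqr : q ≠ r) {s t : ℝ} (hst : s < t) {S : Set Pt}
    (hS : S.Finite) : ∃ τ, s < τ ∧ τ < t ∧ q + τ • (r - q) ∉ S := by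
  have hinj : Function.Injective fun t : ℝ => q + t • (r - q) := by
    intro s t hst
    have : (s - t) • (r - q) = 0 := by
      have := add_left_cancel hst
      rw [sub_smul, this, sub_self]
    exact sub_eq_zero.1 ((smul_eq_zero.1 this).resolve_right (sub_ne_zero.2 hqr.symm))
  obtain ⟨τ, h1, h2⟩ := (Ioo_infinite hst).exists_notMem_finite (hS.preimage hinj.injOn)
  exact ⟨τ, h1.1, h1.2, h2⟩

/-- The points of an edge that lie on other edges. -/
lemma finite_on_edge {E : Set Edge} (hE : Poly E) {e : Edge} (he : e ∈ E) :
    {x | x ∈ openSeg e ∧ ∃ f ∈ E, f ≠ e ∧ x ∈ seg f}.Finite := by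
  have : {x | x ∈ openSeg e ∧ ∃ f ∈ E, f ≠ e ∧ x ∈ seg f} ⊆
      ⋃ f ∈ E, {x | f ≠ e ∧ x ∈ seg f ∩ openSeg e} := by
    rintro x ⟨h1, f, hf, hne, h2⟩
    simp only [mem_iUnion]
    exact ⟨f, hf, hne, h2, h1⟩
  refine (hE.finite.biUnion fun f hf => ?_).subset this
  by_cases hne : f = e
  · simp [hne]
  · exact ((hE.subsingleton_inter he hf (Ne.symm hne)).anti fun x hx => hx.2).finite

/-- A bar slides along an edge with virtual crossings only. -/
lemma eqv_of_slide {D D₂ : Diagram} {v w : Pt} (hvw : (v, w) ∈ D.E) (hv : v ∈ D.bars)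
    (hw : w ∉ D.bars) (hk : ∀ g x, CrossAt D.E (v, w) g x → D.kind x = .virtual)
    (hE : D₂.E = D.E) (hB : D₂.bars = (D.bars \ {v}) ∪ {w}) (hK : D₂.kind = D.kind) :
    Eqv D D₂ := by
  induction hn : (crossings D (v, w)).ncard using Nat.strong_induction_on generalizing D D₂ v w with
  | _ n ih =>
  have hne : v ≠ w := D.poly.ne hvw
  have keeps : KeepsKinds D D₂ := fun e f x _ _ => by rw [hK]
  by_cases hsub : (crossings D (v, w)).Subsingleton
  · by_cases h0 : (crossings D (v, w)) = ∅
    · refine (Move.slideBar D D₂ v w hvw (fun f x hx => ?_) hv hw hE hB keeps).eqv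
      have : x ∈ crossings D (v, w) := ⟨f, hx⟩
      rw [h0] at this; exact this
    · obtain ⟨x, f, hx⟩ := nonempty_iff_ne_empty.2 h0
      exact (Move.barVirtual D D₂ v w f x hx (hk f x hx) (fun g y hy => hsub ⟨g, hy⟩ ⟨f, hx⟩)
        hv hw hE hB keeps).eqv
  have h2 : ∃ s t : ℝ, 0 < s ∧ s < t ∧ t < 1 ∧ v + s • (w - v) ∈ crossings D (v, w) ∧
      v + t • (w - v) ∈ crossings D (v, w) := by
    rw [Set.not_subsingleton_iff] at hsub
    obtain ⟨x, ⟨f, hx⟩, y, ⟨g, hy⟩, hxy⟩ := hsub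
    obtain ⟨s, hs0, hs1, rfl⟩ := mem_openSeg.1 hx.2.2.2.1
    obtain ⟨t, ht0, ht1, rfl⟩ := mem_openSeg.1 hy.2.2.2.1
    have hst : s ≠ t := by rintro rfl; exact hxy rfl
    rcases lt_or_gt_of_ne hst with h | h
    · exact ⟨s, t, hs0, h, ht1, ⟨f, hx⟩, ⟨g, hy⟩⟩
    · exact ⟨t, s, ht0, h, hs1, ⟨g, hy⟩, ⟨f, hx⟩⟩
  obtain ⟨s, t, hs0, hst, ht1, hx, hy⟩ := h2
  obtain ⟨τ, hτ1, hτ2, hτ⟩ := infinite_param hne hst (finite_on_edge D.poly hvw)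
  set m := v + τ • (w - v) with hm
  have hmo : m ∈ openSeg (v, w) := mem_openSeg.2 ⟨τ, by linarith, by linarith, rfl⟩
  have hoff : ∀ f ∈ D.E, f ≠ (v, w) → m ∉ seg f := fun f hf hne h => hτ ⟨hmo, f, hf, hne, h⟩
  have hmn := ne_of_mem_openSeg hne hmo
  have hmv : ∀ f ∈ D.E, f.1 ≠ m := by
    intro f hf h1
    by_cases h2 : f = (v, w)
    · subst h2; exact hmn.1 h1.symm
    · exact hoff f hf h2 (h1 ▸ left_mem_seg f)
  have hmb : m ∉ D.bars := fun h => by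
    obtain ⟨e, he, h1⟩ := D.bars_vertex m h; exact hmv e he h1
  obtain ⟨D₁, hE₁, hB₁, hK₁, hD₁⟩ := D.exists_subdivide hvw hmo hoff
  have e1 : (v, m) ∈ D₁.E := by rw [hE₁]; exact mem_rep.2 (by simp)
  have e2 : (m, w) ∈ D₁.E := by rw [hE₁]; exact mem_rep.2 (by simp)
  obtain ⟨sub1, sub2⟩ := openSeg_subset_of_mem hne hmo
  have hdis : ∀ x, x ∈ openSeg (v, m) → x ∉ openSeg (m, w) := by
    intro x h1 h2
    exact (ne_of_mem_openSeg hmn.1.symm h1).2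
      (seg_inter_of_mem_openSeg hne hmo (openSeg_subset_seg _ h1) (openSeg_subset_seg _ h2))
  have lift : ∀ p q, ((p, q) = (v, m) ∨ (p, q) = (m, w)) → ∀ g x, CrossAt D₁.E (p, q) g x →
      CrossAt D.E (v, w) g x := by
    rintro p q hpq g x ⟨h1, h2, h3, h4, h5⟩
    have hxo : x ∈ openSeg (v, w) := by
      rcases hpq with h | h <;> rw [h] at h4
      · exact sub1 h4
      · exact sub2 h4
    rw [hE₁] at h2
    rcases mem_rep.1 h2 with h6 | rfl | rfl
    · exact ⟨hvw, h6.1, h6.2.symm, hxo, h5⟩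
    · rcases hpq with h | h <;> rw [h] at h4 h3
      · exact absurd rfl h3
      · exact absurd h4 (hdis _ h5)
    · rcases hpq with h | h <;> rw [h] at h4 h3
      · exact absurd h5 (hdis _ h4)
      · exact absurd rfl h3
  let D₃ := D₁.withBars ((D₁.bars \ {v}) ∪ {m}) (by
    rintro z (⟨hz, -⟩ | rfl)
    · exact D₁.bars_vertex z hz
    · exact ⟨_, e2, rfl⟩)
  let D₄ := D₁.withBars ((D.bars \ {v}) ∪ {w}) (by
    rw [← hB, hE₁]
    intro z hz
    obtain ⟨f, hf, rfl⟩ := D₂.bars_vertex z hz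
    rw [hE] at hf
    by_cases h : f = (v, w)
    · exact ⟨(v, m), mem_rep.2 (by simp), by rw [h]⟩
    · exact ⟨f, mem_rep.2 (Or.inl ⟨hf, h⟩), rfl⟩)
  have f1 : Eqv D₁ D₃ := by
    refine ih _ ?_ (v := v) (w := m) e1 (by rw [hB₁]; exact hv) (by rw [hB₁]; exact hmb) ?_ rfl rfl rfl rfl
    · rw [← hn]
      refine ncard_lt_ncard ⟨?_, fun hs => ?_⟩ (finite_crossings _ _)
      · rintro x ⟨g, hg⟩; exact ⟨g, lift _ _ (Or.inl rfl) g x hg⟩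
      · obtain ⟨g, hg⟩ := hs hy
        refine hdis _ hg.2.2.2.1 (mem_openSeg.2 ⟨(t - τ) / (1 - τ), div_pos (by linarith) (by linarith),
          (div_lt_one (by linarith)).2 (by linarith), ?_⟩)
        have : (1 : ℝ) - τ ≠ 0 := by linarith
        rw [hm]; ext <;> simp <;> field_simp <;> ring
    · intro g x hg; rw [hK₁]; exact hk g x (lift _ _ (Or.inl rfl) g x hg)
  have f2 : Eqv D₃ D₄ := by
    refine ih _ ?_ (v := m) (w := w) e2 (Or.inr rfl) ?_ ?_ rfl ?_ rfl rfl
    · rw [← hn]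
      refine ncard_lt_ncard ⟨?_, fun hs => ?_⟩ (finite_crossings _ _)
      · rintro x ⟨g, hg⟩; exact ⟨g, lift _ _ (Or.inr rfl) g x hg⟩
      · obtain ⟨g, hg⟩ := hs hx
        refine hdis _ (mem_openSeg.2 ⟨s / τ, div_pos hs0 (by linarith),
          (div_lt_one (by linarith)).2 (by linarith), ?_⟩) hg.2.2.2.1
        have : τ ≠ 0 := by linarith
        rw [hm]; ext <;> simp <;> field_simp
    · rintro (⟨h1, -⟩ | h1)
      · rw [hB₁] at h1; exact hw h1
      · exact hmn.2 h1.symm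
    · intro g x hg
      exact (congrFun hK₁ x).trans (hk g x (lift _ _ (Or.inr rfl) g x hg))
    · change (D.bars \ {v}) ∪ {w} = (((D₁.bars \ {v}) ∪ {m}) \ {m}) ∪ {w}
      rw [hB₁]
      ext z
      have : z ∈ D.bars → z ≠ m := by rintro h rfl; exact hmb h
      simp only [mem_union, Set.mem_sdiff, mem_singleton_iff]
      grind
  have f3 : Eqv D₂ D₄ := by
    refine (Move.subdivide D₂ D₄ v w m (by rw [hE]; exact hvw) hmo ?_ hB.symm ?_).eqv
    · rw [hE]; exact hE₁
    · intro e f x _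
      exact (congrFun hK₁ x).trans (congrFun hK x).symm
  exact hD₁.trans (f1.trans (f2.trans f3.symm))

lemma eventually_no_ball {A B C : Set Pt} (hA : IsCompact A) (hB : IsCompact B) (hC : IsCompact C)
    (h : ∀ x ∈ A, x ∈ B → x ∉ C) : ∀ᶠ δ : ℝ in 𝓝[>] 0, ∀ p x y z, dist x p < δ → dist y p < δ →
      dist z p < δ → x ∈ A → y ∈ B → z ∉ C := by
  by_cases hne : A.Nonempty ∧ B.Nonempty ∧ C.Nonempty
  swap
  · refine Eventually.of_forall fun δ p x y z _ _ _ hx hy hz => hne ⟨⟨x, hx⟩, ⟨y, hy⟩, ⟨z, hz⟩⟩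
  obtain ⟨hA0, hB0, hC0⟩ := hne
  obtain ⟨x₀, hx₀, hmin⟩ := hA.exists_isMinOn hA0
    (f := fun x => Metric.infDist x B + Metric.infDist x C)
    ((Metric.continuous_infDist_pt B).add (Metric.continuous_infDist_pt C)).continuousOn
  have hpos : 0 < Metric.infDist x₀ B + Metric.infDist x₀ C := by
    refine lt_of_le_of_ne (add_nonneg Metric.infDist_nonneg Metric.infDist_nonneg) fun h0 => ?_
    have hb : Metric.infDist x₀ B = 0 := by
      have := Metric.infDist_nonneg (x := x₀) (s := B)
      have := Metric.infDist_nonneg (x := x₀) (s := C)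
      linarith
    have hc : Metric.infDist x₀ C = 0 := by linarith
    exact h x₀ hx₀ ((hB.isClosed.mem_iff_infDist_zero hB0).2 hb)
      ((hC.isClosed.mem_iff_infDist_zero hC0).2 hc)
  filter_upwards [Ioo_mem_nhdsGT (show (0 : ℝ) < (Metric.infDist x₀ B + Metric.infDist x₀ C) / 4 by
    linarith)] with δ hδ p x y z hx hy hz hxA hyB hzC
  have h1 : Metric.infDist x B ≤ dist x y := Metric.infDist_le_dist_of_mem hyB
  have h2 : Metric.infDist x C ≤ dist x z := Metric.infDist_le_dist_of_mem hzC
  have h3 : Metric.infDist x₀ B + Metric.infDist x₀ C ≤ Metric.infDist x B + Metric.infDist x C :=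
    hmin hxA
  have h4 := dist_triangle_right x y p
  have h5 := dist_triangle_right x z p
  linarith [hδ.2]

lemma tri_dist_lt {a b c : Pt} {δ : ℝ} (hδ : 0 < δ) (h : quad a b c < δ ^ 2) {x : Pt}
    (hx : x ∈ tri a b c) : dist x a < δ := by
  have aux : ∀ s : ℝ, s ^ 2 < δ ^ 2 → |s| < δ := fun s hs => abs_lt_of_sq_lt_sq hs hδ.le
  have : tri a b c ⊆ Metric.ball a δ := by
    unfold quad at h
    refine tri_subset (convex_ball a δ) (by simpa using hδ) ?_ ?_
    · rw [Metric.mem_ball, Prod.dist_eq, Real.dist_eq, Real.dist_eq]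
      exact max_lt (aux _ (by nlinarith [sq_nonneg (b.2 - a.2), sq_nonneg (c.1 - b.1), sq_nonneg (c.2 - b.2), sq_nonneg (a.1 - c.1), sq_nonneg (a.2 - c.2)]))
        (aux _ (by nlinarith [sq_nonneg (b.1 - a.1), sq_nonneg (c.1 - b.1), sq_nonneg (c.2 - b.2), sq_nonneg (a.1 - c.1), sq_nonneg (a.2 - c.2)]))
    · rw [Metric.mem_ball, Prod.dist_eq, Real.dist_eq, Real.dist_eq]
      exact max_lt (aux _ (by nlinarith [sq_nonneg (b.2 - a.2), sq_nonneg (c.1 - b.1), sq_nonneg (c.2 - b.2), sq_nonneg (b.1 - a.1), sq_nonneg (a.2 - c.2)]))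
        (aux _ (by nlinarith [sq_nonneg (b.1 - a.1), sq_nonneg (c.1 - b.1), sq_nonneg (c.2 - b.2), sq_nonneg (a.1 - c.1), sq_nonneg (b.2 - a.2)]))
  exact this hx

section
variable {e₀ : Edge} {k₀ : Kind} {D D' : Diagram} {a b c : Pt}

/-- An edge is pushed across a triangle in which no two of the other edges meet. -/
lemma Tri.eqv_of_disjoint (h : Tri e₀ k₀ D D' a b c)
    (hd : ∀ g ∈ touch D a b c, ∀ g' ∈ touch D a b c, g ≠ g' → ∀ x ∈ tri a b c, x ∈ seg g →
      x ∉ seg g') : Eqv D D' := by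
  have hfin : (touch D a b c).Finite := D.finite.subset fun g hg => hg.1
  have hev : ∀ᶠ δ : ℝ in 𝓝[>] 0, ∀ g ∈ touch D a b c, ∀ g' ∈ touch D a b c, g ≠ g' →
      ∀ p x y z, dist x p < δ → dist y p < δ → dist z p < δ → x ∈ seg g ∩ tri a b c → y ∈ seg g' →
        z ∉ (seg g' : Set Pt) := by
    refine (eventually_all_finite hfin).2 fun g hg => (eventually_all_finite hfin).2 fun g' hg' => ?_
    by_cases hne : g = g'
    · exact Eventually.of_forall fun δ h => absurd hne h
    filter_upwards [eventually_no_ball ((isCompact_seg g).inter (isCompact_tri a b c))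
      (isCompact_seg g') (isCompact_seg g') (fun x hx _ => hd g hg g' hg' hne x hx.2 hx.1)] with δ hδ _
    exact hδ
  obtain ⟨δ, hδ, hδ0⟩ := (hev.and self_mem_nhdsWithin).exists
  have hδ0 : 0 < δ := hδ0
  refine h.eqv_of_small (ε := δ ^ 2) (by positivity) (H := touch D a b c) (T := tri a b c) ?_
    Subset.rfl Subset.rfl
  intro D₁ D₁' a₁ b₁ c₁ h1 hH hT hq
  refine h1.eqv_of_subsingleton ?_
  intro g hg g' hg'
  by_contra hne
  obtain ⟨x, ⟨hx, hxT⟩, -⟩ := not_subset.1 hg.2.2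
  obtain ⟨y, ⟨hy, hyT⟩, -⟩ := not_subset.1 hg'.2.2
  have dx := tri_dist_lt hδ0 hq hxT
  have dy := tri_dist_lt hδ0 hq hyT
  exact hδ g (hH hg) g' (hH hg') hne a₁ x y y dx dy dy ⟨hx, hT hxT⟩ hy hy

end
end STLink

namespace STLink
open Set Filter Topology

section
variable {e₀ : Edge} {k₀ : Kind} {D D' : Diagram} {a b c d : Pt}

lemma Tri.third_allowed (h : Tri e₀ k₀ D D' a b c) {g g' : Edge} {z : Pt} (hz : CrossAt D.E g g' z)
    (hne : g ≠ (a, b)) (hne' : g' ≠ (a, b)) (hzT : z ∈ tri a b c) (u v w : Pt) :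
    ThirdMoveAllowed u v w (moverKind e₀ k₀ g) (moverKind e₀ k₀ g') (D.kind z) := by
  by_cases hk : k₀ = .virtual
  · left; left; simp [moverKind, hk]
  by_cases h1 : g = e₀
  · subst h1
    right; right; left
    exact ⟨by simp [moverKind, hz.2.2.1.symm], h.others hk _ _ hz hne' hzT⟩
  by_cases h2 : g' = e₀
  · subst h2
    right; left; left
    exact ⟨by simp [moverKind, hz.2.2.1], h.others hk _ _ hz.symm hne hzT⟩
  · left; left; simp [moverKind, h1, h2]

/-- An edge is moved past the crossing of two edges which it crosses. -/
lemma Tri.eqv_of_both (h : Tri e₀ k₀ D D' a b c) {g g' : Edge} (hS : touch D a b c ⊆ {g, g'})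
    (hgg : g ≠ g') (hg : g ∈ D.E) (hne : g ≠ (a, b)) (g1 : g.1 ∉ tri a b c) (g2 : g.2 ∉ tri a b c)
    (hg' : g' ∈ D.E) (hne' : g' ≠ (a, b)) (g1' : g'.1 ∉ tri a b c) (g2' : g'.2 ∉ tri a b c)
    (hx : side g.1 g.2 a * side g.1 g.2 b < 0) (hx' : side g'.1 g'.2 a * side g'.1 g'.2 b < 0) :
    Eqv D D' := by
  by_cases hz : ∃ z ∈ tri a b c, z ∈ seg g ∧ z ∈ seg g'
  swap
  · refine h.eqv_of_disjoint fun f hf f' hf' hff x hxT h1 h2 => hz ⟨x, hxT, ?_⟩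
    rcases hS hf with rfl | rfl <;> rcases hS hf' with rfl | rfl
    · exact absurd rfl hff
    · exact ⟨h1, h2⟩
    · exact ⟨h2, h1⟩
    · exact absurd rfl hff
  obtain ⟨z, hzT, hzg, hzg'⟩ := hz
  have hzc : CrossAt D.E g g' z := by
    rcases D.poly.mem_both hg hg' hgg hzg hzg' with h1 | ⟨h1, -⟩ | ⟨h1, -⟩
    · exact h1
    · exact absurd (h1 ▸ hzT) g1
    · exact absurd (h1 ▸ hzT) g2
  have main : ∀ f ∈ D.E, f ≠ (a, b) → f.1 ∉ tri a b c → f.2 ∉ tri a b c → z ∈ seg f →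
      side f.1 f.2 a * side f.1 f.2 b < 0 → (∃ x, CrossAt D.E (a, b) f x) ∧
      ∃ x, CrossAt D'.E (a, c) f x ∨ CrossAt D'.E (c, b) f x := by
    intro f hf hfne f1 f2 hzf hab
    obtain ⟨⟨sa, sb, sc⟩, key⟩ := h.chord_sides hf hfne f1 f2 hzf hzT
    have hf' : f ∈ D'.E := h.mem_of hf hfne
    have nac : (a, c) ≠ f := by rintro rfl; exact f1 (tri_left _ _ _)
    have ncb : (c, b) ≠ f := by rintro rfl; exact f1 (tri_right _ _ _)
    refine ⟨?_, ?_⟩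
    · obtain ⟨x, -, hx⟩ := Tri.cross_of_opp (convex_tri a b c) (tri_left _ _ _) (tri_mid _ _ _) hf
        h.mem (Ne.symm hfne) key hab
      exact ⟨x, hx⟩
    · by_cases hac : side f.1 f.2 a * side f.1 f.2 c < 0
      · obtain ⟨x, -, hx⟩ := Tri.cross_of_opp (convex_tri a b c) (tri_left _ _ _) (tri_right _ _ _) hf'
          h.mem₁ nac key hac
        exact ⟨x, Or.inl hx⟩
      · have hcb : side f.1 f.2 c * side f.1 f.2 b < 0 := by
          have h1 : 0 < side f.1 f.2 a * side f.1 f.2 c :=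
            lt_of_le_of_ne (not_lt.1 hac) (mul_ne_zero sa sc).symm
          by_contra hcon
          have h2 : side f.1 f.2 a * side f.1 f.2 b * (side f.1 f.2 a * side f.1 f.2 c)
            = side f.1 f.2 a ^ 2 * (side f.1 f.2 c * side f.1 f.2 b) := by ring
          have h3 := mul_neg_of_neg_of_pos hab h1
          have h4 := mul_nonneg (sq_nonneg (side f.1 f.2 a)) (not_lt.1 hcon)
          linarith
        obtain ⟨x, -, hx⟩ := Tri.cross_of_opp (convex_tri a b c) (tri_right _ _ _) (tri_mid _ _ _) hf'
          h.mem₂ ncb key hcb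
        exact ⟨x, Or.inr hx⟩
  obtain ⟨⟨x, hx1⟩, x', hx2⟩ := main g hg hne g1 g2 hzg hx
  obtain ⟨⟨y, hy1⟩, y', hy2⟩ := main g' hg' hne' g1' g2' hzg' hx'
  have kx := h.old g x hx1
  have ky := h.old g' y hy1
  have kx' : D'.kind x' = moverKind e₀ k₀ g := by
    rcases hx2 with h1 | h1
    · exact h.new₁ _ _ h1
    · exact h.new₂ _ _ h1
  have ky' : D'.kind y' = moverKind e₀ k₀ g' := by
    rcases hy2 with h1 | h1
    · exact h.new₁ _ _ h1
    · exact h.new₂ _ _ h1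
  refine (Move.third D D' a b c g g' x y z x' y' (h.triangleMove hS) hx1 hy1 hzc hzT hx2 hy2
    (kx'.trans kx.symm) (ky'.trans ky.symm) ?_).eqv
  rw [kx, ky]
  exact h.third_allowed hzc hne hne' hzT _ _ _

lemma exists_param_near {q r : Pt} (hqr : q ≠ r) {S : Set Pt} (hS : S.Finite) {ε : ℝ} (hε : 0 < ε) :
    ∃ d ∈ openSeg (q, r), dist d q < ε ∧ d ∉ S := by
  have hn : 0 < ‖r - q‖ := norm_pos_iff.2 (sub_ne_zero.2 hqr.symm)
  obtain ⟨τ, h1, h2, h3⟩ := infinite_param hqr (s := 0) (t := min 1 (ε / ‖r - q‖))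
    (lt_min one_pos (div_pos hε hn)) hS
  refine ⟨_, mem_openSeg.2 ⟨τ, h1, h2.trans_le (min_le_left _ _), rfl⟩, ?_, h3⟩
  rw [dist_eq_norm, add_sub_cancel_left, norm_smul, Real.norm_eq_abs, abs_of_pos h1]
  exact (lt_div_iff₀ hn).1 (h2.trans_le (min_le_right _ _))

lemma Tri.finite_foot (h : Tri e₀ k₀ D D' a b c) :
    {d | d ∈ openSeg (a, b) ∧ ¬ Clear (D.E \ {(a, b)}) c d}.Finite := by
  refine finite_not_clear (E := D.E \ {(a, b)}) (D.poly.mono sdiff_subset)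
    (by rw [← side_cycle]; exact h.nondeg) ?_
  intro f hf
  exact D.poly.subsingleton_inter h.mem hf.1 (Ne.symm hf.2)

lemma seg_eq_tri (p q : Pt) : tri p p q = seg (p, q) := by
  refine Subset.antisymm (tri_subset (convex_seg _) (left_mem_seg (p, q)) (left_mem_seg (p, q))
    (right_mem_seg (p, q))) (seg_subset (convex_tri _ _ _) (tri_left _ _ _) (tri_right _ _ _))

/-- The part of a triangle near a side does not contain a point off the side. -/
lemma exists_foot_near {S : Set Pt} {p q r z : Pt} (hpq : p ≠ q) (hz : z ∉ seg (p, r))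
    (hS : S.Finite) : ∃ d ∈ openSeg (p, q), d ∉ S ∧ z ∉ tri p d r := by
  obtain ⟨ε, hε, hd⟩ := exists_tri_disjoint (F := {z}) isCompact_singleton (p := p) (q := p) (r := r)
    (by rw [seg_eq_tri, disjoint_singleton_right]; exact hz)
  obtain ⟨d, h1, h2, h3⟩ := exists_param_near hpq hS hε
  refine ⟨d, h1, h3, ?_⟩
  have := hd p d r (by simpa) h2 (by simpa)
  rwa [disjoint_singleton_right] at this

lemma Tri.eqv_of_cross_aux (h : Tri e₀ k₀ D D' a b c) {g g' : Edge} (hS : touch D a b c ⊆ {g, g'})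
    {z : Pt} (hz : CrossAt D.E g g' z) (hzT : z ∈ tri a b c)
    (hne : g ≠ (a, b)) (g1 : g.1 ∉ tri a b c) (g2 : g.2 ∉ tri a b c)
    (hne' : g' ≠ (a, b)) (g1' : g'.1 ∉ tri a b c) (g2' : g'.2 ∉ tri a b c)
    (hab : 0 < side g.1 g.2 a * side g.1 g.2 b) : Eqv D D' := by
  have hg := hz.1
  have hg' := hz.2.1
  obtain ⟨nab, nbc, nac⟩ := ne_of_side h.nondeg
  have hzs := openSeg_subset_seg _ hz.2.2.2.1
  have hzs' := openSeg_subset_seg _ hz.2.2.2.2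
  obtain ⟨⟨sa, sb, sc⟩, key⟩ := h.chord_sides hg hne g1 g2 hzs hzT
  obtain ⟨⟨sa', sb', sc'⟩, key'⟩ := h.chord_sides hg' hne' g1' g2' hzs' hzT
  have h0 := side_of_mem_seg (p := g.1) (q := g.2) hzs
  have h0' := side_of_mem_seg (p := g'.1) (q := g'.2) hzs'
  have hac : side g.1 g.2 a * side g.1 g.2 c < 0 := by
    by_contra hcon
    exact Tri.not_all_pos h0 hzT hab (lt_of_le_of_ne (not_lt.1 hcon) (mul_ne_zero sa sc).symm)
  have hbc : side g.1 g.2 c * side g.1 g.2 b < 0 := by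
    by_contra hcon
    refine Tri.not_all_pos (a := b) (b := a) h0 (by rwa [tri_swap12]) (by linarith)
      (lt_of_le_of_ne ?_ (mul_ne_zero sb sc).symm)
    rw [mul_comm]; exact not_lt.1 hcon
  have hgD' := h.mem_of hg hne
  have hgD'' := h.mem_of hg' hne'
  -- an edge through `z` is not the moved one
  have noz : ∀ e : Edge, e ∈ D'.E → (e = (a, c) ∨ e = (c, b)) → z ∉ seg e := by
    intro e he hec hze
    refine D'.poly.triple hgD' hgD'' he hz.2.2.1 ?_ ?_ hzs hzs' hze
    · rintro rfl
      rcases hec with rfl | rfl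
      · exact g1 (tri_left _ _ _)
      · exact g1 (tri_right _ _ _)
    · rintro rfl
      rcases hec with rfl | rfl
      · exact g1' (tri_left _ _ _)
      · exact g1' (tri_right _ _ _)
  have noe : k₀ ≠ .virtual → (seg e₀ ∩ tri a b c).Nonempty → e₀ = g' := by
    rintro hk ⟨w, hw, hwT⟩
    have hthr := h.through hk ⟨w, hw, hwT⟩
    have : e₀ ∈ touch D a b c := by
      refine ⟨h.real hk, (h.mem_env hk).2, fun hsub => ?_⟩
      have hch := h.chord_sides (h.real hk) (h.mem_env hk).2 (h.ends hk).1 (h.ends hk).2 hw hwT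
      have hl := side_of_mem_seg (p := e₀.1) (q := e₀.2) hw
      rcases hsub ⟨hw, hwT⟩ with rfl | rfl
      · exact hch.1.1 hl
      · exact hch.1.2.1 hl
    rcases hS this with h1 | h1
    · subst h1; linarith
    · exact h1
  have common : ∀ (D₁ D₂ : Diagram) (p q r : Pt), Tri e₀ k₀ D₁ D₂ p q r →
      touch D₁ p q r ⊆ touch D a b c → z ∉ tri p q r → Eqv D₁ D₂ := by
    intro D₁ D₂ p q r ht hts hzp
    refine ht.eqv_of_disjoint fun f hf f' hf' hff x hxT h1 h2 => hzp ?_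
    have : x = z := by
      rcases hS (hts hf) with rfl | rfl <;> rcases hS (hts hf') with rfl | rfl
      · exact absurd rfl hff
      · exact D.poly.inter_unique hg hg' hz.2.2.1 h1 h2 hzs hzs'
      · exact D.poly.inter_unique hg hg' hz.2.2.1 h2 h1 hzs hzs'
      · exact absurd rfl hff
    exact this ▸ hxT
  have acT : seg (a, c) ⊆ tri a b c := seg_subset (convex_tri _ _ _) (tri_left _ _ _) (tri_right _ _ _)
  by_cases hac' : side g'.1 g'.2 a * side g'.1 g'.2 c < 0
  · obtain ⟨d, hd, hdS, hzd⟩ := exists_foot_near (r := c) nab.symm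
      (by rw [seg_swap]; exact noz _ h.mem₂ (Or.inr rfl)) h.finite_foot
    rw [openSeg_swap] at hd
    have hcl : Clear (D.E \ {(a, b)}) c d := by
      by_contra hcon; exact hdS ⟨hd, hcon⟩
    obtain ⟨D₁, D₂, e1, ⟨t1, u1⟩, ⟨t2, u2⟩⟩ := h.split_c hd hcl
      (fun hk hn => by rw [noe hk hn]; exact hac')
    have sT1 : tri a c d ⊆ tri a b c := tri_subset (convex_tri _ _ _) (tri_left _ _ _)
      (tri_right _ _ _) (h.foot hd hcl).dT
    have f1 : Eqv D' D₂ := t1.eqv_of_both (u1.trans hS) hz.2.2.1 hgD'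
      (by rintro rfl; exact g1 (tri_left _ _ _)) (fun h' => g1 (sT1 h')) (fun h' => g2 (sT1 h'))
      hgD'' (by rintro rfl; exact g1' (tri_left _ _ _)) (fun h' => g1' (sT1 h'))
      (fun h' => g2' (sT1 h')) hac hac'
    have f2 : Eqv D₁ D₂ := common D₁ D₂ _ _ _ t2 u2 (by rwa [tri_swap12])
    exact e1.trans (f2.trans f1.symm)
  · have hbc' : side g'.1 g'.2 c * side g'.1 g'.2 b < 0 := by
      have hacp : 0 < side g'.1 g'.2 c * side g'.1 g'.2 a := by
        rw [mul_comm]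
        exact lt_of_le_of_ne (not_lt.1 hac') (mul_ne_zero sa' sc').symm
      by_contra hcon
      exact Tri.not_all_pos (a := c) (b := a) (c := b) h0'
        (by rwa [show tri c a b = tri a b c from tri_perm (by grind)]) hacp
        (lt_of_le_of_ne (not_lt.1 hcon) (mul_ne_zero sc' sb').symm)
    obtain ⟨d, hd, hdS, hzd⟩ := exists_foot_near (r := c) nab
      (noz _ h.mem₁ (Or.inl rfl)) h.finite_foot
    have hcl : Clear (D.E \ {(a, b)}) c d := by
      by_contra hcon; exact hdS ⟨hd, hcon⟩
    obtain ⟨D₁, D₂, e1, ⟨t1, u1⟩, ⟨t2, u2⟩⟩ := h.split_c' hd hcl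
      (fun hk hn => by rw [noe hk hn, mul_comm]; exact hbc')
    have sT1 : tri c b d ⊆ tri a b c := tri_subset (convex_tri _ _ _) (tri_right _ _ _)
      (tri_mid _ _ _) (h.foot hd hcl).dT
    have f1 : Eqv D' D₂ := t1.eqv_of_both (u1.trans hS) hz.2.2.1 hgD'
      (by rintro rfl; exact g1 (tri_right _ _ _)) (fun h' => g1 (sT1 h')) (fun h' => g2 (sT1 h'))
      hgD'' (by rintro rfl; exact g1' (tri_right _ _ _)) (fun h' => g1' (sT1 h'))
      (fun h' => g2' (sT1 h')) hbc hbc'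
    have f2 : Eqv D₁ D₂ := common D₁ D₂ _ _ _ t2 u2 hzd
    exact e1.trans (f2.trans f1.symm)

/-- An edge is moved past the crossing of two edges. -/
lemma Tri.eqv_of_cross (h : Tri e₀ k₀ D D' a b c) {g g' : Edge} (hS : touch D a b c ⊆ {g, g'})
    {z : Pt} (hz : CrossAt D.E g g' z) (hzT : z ∈ tri a b c)
    (hne : g ≠ (a, b)) (g1 : g.1 ∉ tri a b c) (g2 : g.2 ∉ tri a b c)
    (hne' : g' ≠ (a, b)) (g1' : g'.1 ∉ tri a b c) (g2' : g'.2 ∉ tri a b c) : Eqv D D' := by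
  have c1 := (h.chord_sides hz.1 hne g1 g2 (openSeg_subset_seg _ hz.2.2.2.1) hzT).1
  have c2 := (h.chord_sides hz.2.1 hne' g1' g2' (openSeg_subset_seg _ hz.2.2.2.2) hzT).1
  by_cases h1 : side g.1 g.2 a * side g.1 g.2 b < 0
  · by_cases h2 : side g'.1 g'.2 a * side g'.1 g'.2 b < 0
    · exact h.eqv_of_both hS hz.2.2.1 hz.1 hne g1 g2 hz.2.1 hne' g1' g2' h1 h2
    · exact h.eqv_of_cross_aux (by rwa [pair_comm]) hz.symm hzT hne' g1' g2' hne g1 g2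
        (lt_of_le_of_ne (not_lt.1 h2) (mul_ne_zero c2.1 c2.2.1).symm)
  · exact h.eqv_of_cross_aux hS hz hzT hne g1 g2 hne' g1' g2'
        (lt_of_le_of_ne (not_lt.1 h1) (mul_ne_zero c1.1 c1.2.1).symm)

end
end STLink

namespace STLink
open Set Filter Topology

lemma mem_openSeg_of_collinear {E : Set Edge} (hE : Poly E) {u v w u' w' : Pt} (h1 : (u, v) ∈ E)
    (h2 : (v, w) ∈ E) (hu : u' ∈ openSeg (u, v)) (hw : w' ∈ openSeg (v, w))
    (h0 : side u' w' v = 0) : v ∈ openSeg (u', w') := by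
  have huv : u ≠ v := hE.ne h1
  have hvw : v ≠ w := hE.ne h2
  have hne : (u, v) ≠ (v, w) := by simp [huv]
  have hu'v := (ne_of_mem_openSeg huv hu).2
  have hw'v := (ne_of_mem_openSeg hvw hw).1
  obtain ⟨l, hl⟩ : ∃ l : ℝ, w' - v = l • (u' - v) := by
    have hd : u' - v ≠ 0 := sub_ne_zero.2 hu'v
    simp only [side_eq] at h0
    by_cases hx : (u' - v).1 = 0
    · have hy : (u' - v).2 ≠ 0 := fun hy => hd (Prod.ext hx hy)
      refine ⟨(w' - v).2 / (u' - v).2, ?_⟩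
      simp only [Prod.fst_sub, Prod.snd_sub] at hx hy
      ext
      · simp only [Prod.fst_sub, Prod.smul_fst, smul_eq_mul, Prod.snd_sub]
        rw [hx]
        have : (w'.1 - v.1) * (u'.2 - v.2) = 0 := by linear_combination (-1 : ℝ) * h0 + (w'.2 - v.2) * hx
        have := (mul_eq_zero.1 this).resolve_right hy
        rw [this]; ring
      · simp only [Prod.snd_sub, Prod.smul_snd, smul_eq_mul]; field_simp
    · refine ⟨(w' - v).1 / (u' - v).1, ?_⟩
      simp only [Prod.fst_sub] at hx
      ext
      · simp only [Prod.fst_sub, Prod.smul_fst, smul_eq_mul]; field_simp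
      · simp only [Prod.fst_sub, Prod.snd_sub, Prod.smul_snd, smul_eq_mul]
        field_simp
        linear_combination h0
  have hl' : w' = v + l • (u' - v) := by rw [← hl]; abel
  have hlne : l ≠ 0 := by rintro rfl; apply hw'v; rw [hl']; simp
  rcases lt_or_gt_of_ne hlne with h | h
  · refine mem_openSeg.2 ⟨1 / (1 - l), by apply div_pos <;> linarith, ?_, ?_⟩
    · rw [div_lt_one (by linarith)]; linarith
    · rw [hl']
      have : (1 : ℝ) - l ≠ 0 := by linarith
      ext <;> simp <;> field_simp <;> ring
  · exfalso
    have hm0 : 0 < min 1 (1 / l) := lt_min one_pos (by positivity)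
    set p := v + (min 1 (1 / l)) • (w' - v) with hp
    have p1 : p ∈ seg (v, w) := by
      refine seg_subset (convex_seg _) (left_mem_seg (v, w)) (openSeg_subset_seg _ hw) ?_
      exact mem_seg.2 ⟨_, hm0.le, min_le_left _ _, rfl⟩
    have p2 : p ∈ seg (u, v) := by
      refine seg_subset (convex_seg _) (right_mem_seg (u, v)) (openSeg_subset_seg _ hu) ?_
      refine mem_seg.2 ⟨min 1 (1 / l) * l, by positivity, ?_, ?_⟩
      · calc min 1 (1 / l) * l ≤ 1 / l * l := by gcongr; exact min_le_right _ _
          _ = 1 := by field_simp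
      · rw [hp, hl, smul_smul]
    have : p = v := hE.inter_unique h1 h2 hne p2 p1 (right_mem_seg (u, v)) (left_mem_seg (v, w))
    rw [hp] at this
    have h3 : (min 1 (1 / l)) • (w' - v) = 0 := by simpa using this
    exact hw'v (sub_eq_zero.1 ((smul_eq_zero.1 h3).resolve_left hm0.ne'))

lemma notMem_small {E : Set Edge} (hE : Poly E) {u v w u' w' w'' : Pt} (h1 : (u, v) ∈ E)
    (h2 : (v, w) ∈ E) (hu : u' ∈ openSeg (u, v)) (hw : w' ∈ openSeg (v, w))
    (hw' : w' ∈ openSeg (v, w'')) : w'' ∉ tri u' w' v := by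
  intro hfT
  have hu'w' : u' ≠ w' := by
    rintro rfl
    exact (ne_of_mem_openSeg (hE.ne h1) hu).2 (hE.inter_unique h1 h2
      (fun h => hE.ne h1 (congrArg Prod.fst h)) (openSeg_subset_seg _ hu)
      (openSeg_subset_seg _ hw) (right_mem_seg (u, v)) (left_mem_seg (v, w)))
  by_cases h0 : side u' w' v = 0
  · have hv := mem_openSeg_of_collinear hE h1 h2 hu hw h0
    have hT' : tri u' w' v ⊆ seg (u', w') := tri_subset (convex_seg _) (left_mem_seg (u', w'))
      (right_mem_seg (u', w')) (openSeg_subset_seg _ hv)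
    obtain ⟨s, s0, s1, hs⟩ := mem_seg.1 (hT' hfT)
    obtain ⟨t, t0, t1, ht⟩ := mem_openSeg.1 hv
    obtain ⟨r, r0, r1, hr⟩ := mem_openSeg.1 hw'
    have key : (r * (s - t) - (1 - t)) • (w' - u') = 0 := by
      have q1 : w'' - v = (s - t) • (w' - u') := by
        have : w'' - v = (u' + s • (w' - u')) - (u' + t • (w' - u')) := by rw [← ht, ← hs]
        rw [this, sub_smul]; abel
      have q2 : w' - v = r • (w'' - v) := by nth_rw 1 [hr]; abel
      have q3 : w' - v = (1 - t) • (w' - u') := by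
        have : w' - v = w' - (u' + t • (w' - u')) := by rw [← ht]
        rw [this, sub_smul, one_smul]; abel
      rw [sub_smul, ← q3, mul_smul, ← q1, ← q2, sub_self]
    have := (smul_eq_zero.1 key).resolve_right (sub_ne_zero.2 hu'w'.symm)
    nlinarith
  · have h4 : side u' w'' v ≠ 0 := by
      intro h3
      apply h0
      obtain ⟨r, r0, r1, hr⟩ := mem_openSeg.1 hw'
      have : side u' w' v = r * side u' w'' v := by
        rw [hr]
        simp only [side_eq, Prod.fst_add, Prod.snd_add, Prod.smul_fst, Prod.smul_snd, Prod.fst_sub,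
          Prod.snd_sub, smul_eq_mul]; ring
      rw [this, h3, mul_zero]
    exact cevian_notMem h4 (by rw [openSeg_swap]; exact hw') hfT

lemma mem_openSeg_split {p q v x : Pt} (hv : v ∈ openSeg (p, q)) (hx : x ∈ openSeg (p, q))
    (hxv : x ≠ v) : x ∈ openSeg (p, v) ∨ x ∈ openSeg (v, q) := by
  obtain ⟨s, s0, s1, hs⟩ := mem_openSeg.1 hx
  obtain ⟨t, t0, t1, ht⟩ := mem_openSeg.1 hv
  have hst : s ≠ t := by rintro rfl; exact hxv (hs.trans ht.symm)
  rcases lt_or_gt_of_ne hst with hlt | hlt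
  · left
    refine mem_openSeg.2 ⟨s / t, by positivity, (div_lt_one t0).2 hlt, ?_⟩
    rw [hs, ht, add_sub_cancel_left, smul_smul, div_mul_cancel₀ _ t0.ne']
  · right
    refine mem_openSeg.2 ⟨(s - t) / (1 - t), div_pos (by linarith) (by linarith),
      (div_lt_one (by linarith)).2 (by linarith), ?_⟩
    have h0 : (1 : ℝ) - t ≠ 0 := by linarith
    have e3 : q - v = (1 - t) • (q - p) := by
      have : q - v = q - (p + t • (q - p)) := by rw [← ht]
      rw [this, sub_smul, one_smul]; abel
    rw [e3, smul_smul, div_mul_cancel₀ _ h0, hs, ht, sub_smul]; abel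

open Classical in
/-- The bars after a bar at `v` has been moved to `w`. -/
noncomputable def moveBar (B : Set Pt) (v w : Pt) : Set Pt := if v ∈ B then (B \ {v}) ∪ {w} else B

lemma mem_moveBar {B : Set Pt} {v w x : Pt} (h : x ∈ moveBar B v w) : (x ∈ B ∧ x ≠ v) ∨ x = w := by
  unfold moveBar at h
  split_ifs at h with hv
  · simpa [or_comm] using h
  · exact Or.inl ⟨h, by rintro rfl; exact hv h⟩

/-- The edges after a corner has been cut. -/
def cutE (E : Set Edge) (u v w u' w' w'' : Pt) : Set Edge :=
  {g | (g ∈ E ∧ g ≠ (u, v) ∧ g ≠ (v, w)) ∨ g = (u, u') ∨ g = (u', w') ∨ g = (w', w'') ∨ g = (w'', w)}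

/-- The edges in `M` cross the corner at `v` virtually; nothing else meets it. -/
structure Corner (D : Diagram) (u v w u' w' w'' : Pt) (M : Set Edge) : Prop where
  uv : (u, v) ∈ D.E
  vw : (v, w) ∈ D.E
  hu' : u' ∈ openSeg (u, v)
  hw'' : w'' ∈ openSeg (v, w)
  hw' : w' ∈ openSeg (v, w'')
  off : ∀ g ∈ D.E, g ≠ (u, v) → g ≠ (v, w) → g ∉ M → Disjoint (seg g) (tri u' w'' v)
  mem : ∀ g ∈ M, g ∈ D.E
  ne : ∀ g ∈ M, g ≠ (u, v) ∧ g ≠ (v, w)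
  ends : ∀ g ∈ M, g.1 ∉ tri u' w'' v ∧ g.2 ∉ tri u' w'' v
  away : ∀ g ∈ M, Disjoint (seg g) (seg (u, u')) ∧ Disjoint (seg g) (seg (w', w))
  disj : ∀ g ∈ M, ∀ g' ∈ M, g ≠ g' → ∀ x ∈ tri u' w'' v, x ∈ seg g → x ∉ seg g'
  u_out : u ∉ tri u' w'' v
  w_out : w ∉ tri u' w'' v
  kind : ∀ g ∈ M, ∀ x, CrossAt D.E (u, v) g x ∨ CrossAt D.E (v, w) g x → D.kind x = .virtual

set_option maxHeartbeats 1000000 in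
/-- Cutting a corner which is only crossed virtually. -/
lemma Corner.exists_cut {D : Diagram} {u v w u' w' w'' : Pt} {M : Set Edge}
    (h : Corner D u v w u' w' w'' M) :
    ∃ D₁ : Diagram, Eqv D D₁ ∧ D₁.E = cutE D.E u v w u' w' w'' ∧ D₁.bars = moveBar D.bars v w'' ∧
      (∀ g x, CrossAt D₁.E (u', w') g x → g ∈ M ∧ D₁.kind x = .virtual) ∧
      ∀ x, x ∉ openSeg (u', w') → D₁.kind x = D.kind x := by
  have hP := D.poly
  have huv : u ≠ v := hP.ne h.uv
  have hvw : v ≠ w := hP.ne h.vw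
  have hne : (u, v) ≠ (v, w) := by simp [huv]
  have hu'n := ne_of_mem_openSeg huv h.hu'
  have hw''n := ne_of_mem_openSeg hvw h.hw''
  have hw'n := ne_of_mem_openSeg hw''n.1.symm h.hw'
  have hw'vw : w' ∈ openSeg (v, w) := (openSeg_subset_of_mem hvw h.hw'').1 h.hw'
  have su'uv := openSeg_subset_seg _ h.hu'
  have sw''vw := openSeg_subset_seg _ h.hw''
  have sw'vw := openSeg_subset_seg _ hw'vw
  have sub1 : seg (u, u') ⊆ seg (u, v) := seg_subset (convex_seg _) (left_mem_seg (u, v)) su'uv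
  have sub2 : seg (u', v) ⊆ seg (u, v) := seg_subset (convex_seg _) su'uv (right_mem_seg (u, v))
  have sub3 : seg (v, w') ⊆ seg (v, w) := seg_subset (convex_seg _) (left_mem_seg (v, w)) sw'vw
  have sub4 : seg (v, w'') ⊆ seg (v, w) := seg_subset (convex_seg _) (left_mem_seg (v, w)) sw''vw
  have sub6 : seg (w', w'') ⊆ seg (v, w'') :=
    seg_subset (convex_seg _) (openSeg_subset_seg _ h.hw') (right_mem_seg (v, w''))
  have sub5 : seg (w'', w) ⊆ seg (v, w) := seg_subset (convex_seg _) sw''vw (right_mem_seg (v, w))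
  have meet : ∀ x, x ∈ seg (u, v) → x ∈ seg (v, w) → x = v := fun x h1 h2 =>
    hP.inter_unique h.uv h.vw hne h1 h2 (right_mem_seg (u, v)) (left_mem_seg (v, w))
  have Tu : u' ∈ tri u' w'' v := tri_left _ _ _
  have Tw'' : w'' ∈ tri u' w'' v := tri_mid _ _ _
  have Tv : v ∈ tri u' w'' v := tri_right _ _ _
  have Tvw : seg (v, w'') ⊆ tri u' w'' v := seg_subset (convex_tri _ _ _) Tv Tw''
  have Tuv : seg (u', v) ⊆ tri u' w'' v := seg_subset (convex_tri _ _ _) Tu Tv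
  have Tw' : w' ∈ tri u' w'' v := Tvw (openSeg_subset_seg _ h.hw')
  have Tsub : tri u' w' v ⊆ tri u' w'' v := tri_subset (convex_tri _ _ _) Tu Tw' Tv
  have s12 : seg (w', w'') ⊆ seg (w', w) := by
    refine seg_subset (convex_seg _) (left_mem_seg (w', w)) ?_
    obtain ⟨t, t0, t1, ht⟩ := mem_openSeg.1 h.hw'
    obtain ⟨s, s0, s1, hs⟩ := mem_openSeg.1 h.hw''
    refine mem_seg.2 ⟨(s - t * s) / (1 - t * s), ?_, ?_, ?_⟩
    · exact div_nonneg (by nlinarith) (by nlinarith)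
    · rw [div_le_one (by nlinarith)]; linarith
    · have hts : (1 : ℝ) - t * s ≠ 0 := by nlinarith
      have a1 : w - w' = (1 - t * s) • (w - v) := by
        rw [ht, hs]; ext <;> simp <;> ring
      change w'' = w' + _ • (w - w')
      rw [a1, smul_smul, div_mul_cancel₀ _ hts, ht, hs]
      ext <;> simp <;> ring
  have s22 : seg (w'', w) ⊆ seg (w', w) :=
    seg_subset (convex_seg _) (s12 (right_mem_seg (w', w''))) (right_mem_seg (w', w))
  have vM : ∀ g ∈ M, v ∉ seg g := by
    intro g hg hv
    rcases hP.generic.start_off _ h.vw g (h.mem g hg) hv with h1 | h1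
    · exact (h.ends g hg).1 (h1 ▸ Tv)
    · exact (h.ends g hg).2 (h1 ▸ Tv)
  have offpt : ∀ x ∈ tri u' w'' v, (∀ g ∈ M, x ∉ seg g) → ∀ f ∈ D.E, f ≠ (u, v) → f ≠ (v, w) →
      x ∉ seg f := by
    intro x hx hxM f hf n1 n2 hxf
    by_cases hfM : f ∈ M
    · exact hxM f hfM hxf
    · exact disjoint_left.1 (h.off f hf n1 n2 hfM) hxf hx
  have u'M : ∀ g ∈ M, u' ∉ seg g := fun g hg hx =>
    disjoint_left.1 (h.away g hg).1 hx (right_mem_seg (u, u'))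
  have w'M : ∀ g ∈ M, w' ∉ seg g := fun g hg hx =>
    disjoint_left.1 (h.away g hg).2 hx (left_mem_seg (w', w))
  have w''M : ∀ g ∈ M, w'' ∉ seg g := fun g hg hx =>
    disjoint_left.1 (h.away g hg).2 hx (s12 (right_mem_seg (w', w'')))
  -- the subdivisions
  obtain ⟨D₁, hE₁, hB₁, hK₁, hD₁⟩ := D.exists_subdivide h.uv h.hu' (by
    intro f hf hfn
    by_cases h2 : f = (v, w)
    · subst h2; exact fun hx => hu'n.2 (meet _ su'uv hx)
    · exact offpt u' Tu u'M f hf hfn h2)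
  have m1 : ∀ f ∈ D₁.E, (f ∈ D.E ∧ f ≠ (u, v)) ∨ f = (u, u') ∨ f = (u', v) := fun f hf => by
    rw [hE₁] at hf; exact mem_rep.1 hf
  have vw1 : (v, w) ∈ D₁.E := by rw [hE₁]; exact mem_rep.2 (Or.inl ⟨h.vw, hne.symm⟩)
  obtain ⟨D₂, hE₂, hB₂, hK₂, hD₂⟩ := D₁.exists_subdivide vw1 h.hw'' (by
    intro f hf hfn
    rcases m1 f hf with h2 | rfl | rfl
    · exact offpt w'' Tw'' w''M f h2.1 h2.2 hfn
    · exact fun hx => hw''n.1 (meet _ (sub1 hx) sw''vw)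
    · exact fun hx => hw''n.1 (meet _ (sub2 hx) sw''vw))
  have m2 : ∀ f ∈ D₂.E, (f ∈ D.E ∧ f ≠ (u, v) ∧ f ≠ (v, w)) ∨ f = (u, u') ∨ f = (u', v) ∨
      f = (v, w'') ∨ f = (w'', w) := fun f hf => by
    rw [hE₂] at hf
    rcases mem_rep.1 hf with h1 | h1 | h1
    · rcases m1 f h1.1 with h2 | h2 | h2
      · exact Or.inl ⟨h2.1, h2.2, h1.2⟩
      all_goals simp [h2]
    all_goals simp [h1]
  have vw2 : (v, w'') ∈ D₂.E := by rw [hE₂]; exact mem_rep.2 (by simp)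
  have ww2 : (w'', w) ∈ D₂.E := by rw [hE₂]; exact mem_rep.2 (by simp)
  have hK2 : D₂.kind = D.kind := hK₂.trans hK₁
  have hB2 : D₂.bars = D.bars := hB₂.trans hB₁
  have w''bar : w'' ∉ D.bars := by
    intro hb
    obtain ⟨e, he, h1⟩ := D.bars_vertex _ hb
    exact hP.left_notMem he h.vw (by rw [h1]; exact h.hw'')
  have w'bar : w' ∉ D.bars := by
    intro hb
    obtain ⟨e, he, h1⟩ := D.bars_vertex _ hb
    exact hP.left_notMem he h.vw (by rw [h1]; exact hw'vw)
  have u'bar : u' ∉ D.bars := by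
    intro hb
    obtain ⟨e, he, h1⟩ := D.bars_vertex _ hb
    exact hP.left_notMem he h.uv (by rw [h1]; exact h.hu')
  have slide : ∃ D₃ : Diagram, D₃.E = D₂.E ∧ D₃.bars = moveBar D.bars v w'' ∧ D₃.kind = D.kind ∧
      Eqv D₂ D₃ := by
    by_cases hv : v ∈ D.bars
    · let D₃ := D₂.withBars (moveBar D.bars v w'') (by
        intro z hz
        rcases mem_moveBar hz with h1 | rfl
        · exact D₂.bars_vertex z (hB2 ▸ h1.1)
        · exact ⟨_, ww2, rfl⟩)
      refine ⟨D₃, rfl, rfl, hK2, eqv_of_slide vw2 (hB2 ▸ hv) (hB2 ▸ w''bar) ?_ rfl ?_ rfl⟩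
      · rintro g x ⟨-, hg, hgn, hx1, hx2⟩
        rw [hK2]
        have hxv := (ne_of_mem_openSeg hw''n.1.symm hx1).1
        have hxs := openSeg_subset_seg _ hx1
        rcases m2 g hg with h1 | rfl | rfl | rfl | rfl
        · have hgM : g ∈ M := by
            by_contra hgM
            exact disjoint_left.1 (h.off g h1.1 h1.2.1 h1.2.2 hgM) (openSeg_subset_seg _ hx2) (Tvw hxs)
          exact h.kind g hgM x (Or.inr ⟨h.vw, h1.1, h1.2.2.symm,
            (openSeg_subset_of_mem hvw h.hw'').1 hx1, hx2⟩)
        · exact absurd (meet x (sub1 (openSeg_subset_seg _ hx2)) (sub4 hxs)) hxv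
        · exact absurd (meet x (sub2 (openSeg_subset_seg _ hx2)) (sub4 hxs)) hxv
        · exact absurd rfl hgn
        · exact absurd (seg_inter_of_mem_openSeg hvw h.hw'' hxs (openSeg_subset_seg _ hx2))
            (ne_of_mem_openSeg hw''n.1.symm hx1).2
      · change moveBar D.bars v w'' = _
        rw [hB2, moveBar, if_pos hv]
    · exact ⟨D₂, rfl, by rw [hB2, moveBar, if_neg hv], hK2, Eqv.refl _⟩
  obtain ⟨D₃, hE₃, hB₃, hK₃, hD₃⟩ := slide
  obtain ⟨D₄, hE₄, hB₄, hK₄, hD₄⟩ := D₃.exists_subdivide (hE₃ ▸ vw2) h.hw' (by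
    intro f hf hfn
    rcases m2 f (hE₃ ▸ hf) with h1 | rfl | rfl | rfl | rfl
    · exact offpt w' Tw' w'M f h1.1 h1.2.1 h1.2.2
    · exact fun hx => hw'n.1 (meet _ (sub1 hx) sw'vw)
    · exact fun hx => hw'n.1 (meet _ (sub2 hx) sw'vw)
    · exact absurd rfl hfn
    · exact fun hx => hw'n.2 (seg_inter_of_mem_openSeg hvw h.hw'' (openSeg_subset_seg _ h.hw') hx))
  have e₄ : D₄.E = {g | (g ∈ D.E ∧ g ≠ (u, v) ∧ g ≠ (v, w)) ∨ g = (u, u') ∨ g = (u', v) ∨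
      g = (v, w') ∨ g = (w', w'') ∨ g = (w'', w)} := by
    rw [hE₄, hE₃, hE₂, hE₁]
    ext g
    have x1 : g = (u, u') → g ≠ (v, w) := by rintro rfl; simp [huv]
    have x2 : g = (u', v) → g ≠ (v, w) := by rintro rfl; simp [hvw]
    have x3 : g = (u, u') → g ≠ (v, w'') := by rintro rfl; simp [huv]
    have x4 : g = (u', v) → g ≠ (v, w'') := by rintro rfl; simp [hw''n.1.symm]
    have x5 : g = (w'', w) → g ≠ (v, w'') := by rintro rfl; simp [hw''n.1]
    have x6 : g ∈ D.E → g ≠ (v, w'') := by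
      rintro hg rfl; exact hP.right_notMem hg h.vw h.hw''
    simp only [mem_rep, mem_ofPred_eq]
    grind
  have hKD : D₄.kind = D.kind := hK₄.trans hK₃
  have hBD : D₄.bars = moveBar D.bars v w'' := hB₄.trans hB₃
  have hDD₄ : Eqv D D₄ := hD₁.trans (hD₂.trans (hD₃.trans hD₄))
  have m4 : ∀ f ∈ D₄.E, (f ∈ D.E ∧ f ≠ (u, v) ∧ f ≠ (v, w)) ∨ f = (u, u') ∨ f = (u', v) ∨
      f = (v, w') ∨ f = (w', w'') ∨ f = (w'', w) := fun f hf => by rw [e₄] at hf; exact hf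
  have e1 : (u', v) ∈ D₄.E := by rw [e₄]; simp
  have e2 : (v, w') ∈ D₄.E := by rw [e₄]; simp
  have hu'w' : u' ≠ w' := by
    rintro rfl; exact hu'n.2 (meet _ su'uv sw'vw)
  have u'notw : ∀ f ∈ D.E, f.1 ≠ u' ∧ f.2 ≠ u' := fun f hf =>
    ⟨fun h1 => hP.left_notMem hf h.uv (h1 ▸ h.hu'), fun h1 => hP.right_notMem hf h.uv (h1 ▸ h.hu')⟩
  have w'notw : ∀ f ∈ D.E, f.1 ≠ w' ∧ f.2 ≠ w' := fun f hf =>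
    ⟨fun h1 => hP.left_notMem hf h.vw (h1 ▸ hw'vw), fun h1 => hP.right_notMem hf h.vw (h1 ▸ hw'vw)⟩
  have w''u : w'' ≠ u' := by
    rintro rfl; exact hu'n.2 (meet _ su'uv sw''vw)
  have nuw : (u', w') ∉ D₄.E := by
    intro hm
    rcases m4 _ hm with h1 | h1 | h1 | h1 | h1 | h1
    · exact (u'notw _ h1.1).1 rfl
    all_goals simp only [Prod.mk.injEq] at h1
    · exact hu'n.1 h1.1
    · exact hw'n.1 h1.2
    · exact hu'n.2 h1.1
    · exact hu'w' h1.1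
    · exact w''u h1.1.symm
  have nwu : (w', u') ∉ D₄.E := by
    intro hm
    rcases m4 _ hm with h1 | h1 | h1 | h1 | h1 | h1
    · exact (w'notw _ h1.1).1 rfl
    all_goals simp only [Prod.mk.injEq] at h1
    · exact (w'notw _ h.uv).1 h1.1.symm
    · exact hu'n.2 h1.2
    · exact hw'n.1 h1.1
    · exact w''u h1.2.symm
    · exact (u'notw _ h.vw).2 h1.2.symm
  -- crossings with the pieces at `v`
  have lift : ∀ g x, x ∈ tri u' w'' v → (CrossAt D₄.E (u', v) g x ∨ CrossAt D₄.E (v, w') g x) →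
      g ∈ M ∧ D₄.kind x = .virtual := by
    intro g x hxT hc
    rw [hKD]
    have hx : (x ∈ openSeg (u', v) ∧ g ≠ (u', v)) ∨ (x ∈ openSeg (v, w') ∧ g ≠ (v, w')) := by
      rcases hc with h1 | h1
      · exact Or.inl ⟨h1.2.2.2.1, h1.2.2.1.symm⟩
      · exact Or.inr ⟨h1.2.2.2.1, h1.2.2.1.symm⟩
    have hxv : x ≠ v := by
      rcases hx with h1 | h1
      · exact (ne_of_mem_openSeg hu'n.2 h1.1).2
      · exact (ne_of_mem_openSeg hw'n.1.symm h1.1).1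
    have hgx : x ∈ openSeg g := by rcases hc with h1 | h1 <;> exact h1.2.2.2.2
    have hgE : g ∈ D₄.E := by rcases hc with h1 | h1 <;> exact h1.2.1
    have hgs := openSeg_subset_seg _ hgx
    rcases m4 g hgE with h1 | rfl | rfl | rfl | rfl | rfl
    · have hgM : g ∈ M := by
        by_contra hgM
        exact disjoint_left.1 (h.off g h1.1 h1.2.1 h1.2.2 hgM) hgs hxT
      refine ⟨hgM, h.kind g hgM x ?_⟩
      rcases hx with h2 | h2
      · exact Or.inl ⟨h.uv, h1.1, h1.2.1.symm, (openSeg_subset_of_mem huv h.hu').2 h2.1, hgx⟩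
      · exact Or.inr ⟨h.vw, h1.1, h1.2.2.symm, (openSeg_subset_of_mem hvw hw'vw).1 h2.1, hgx⟩
    · exfalso
      rcases hx with h2 | h2
      · exact (ne_of_mem_openSeg hu'n.2 h2.1).1
          (seg_inter_of_mem_openSeg huv h.hu' hgs (openSeg_subset_seg _ h2.1))
      · exact hxv (meet x (sub1 hgs) (sub3 (openSeg_subset_seg _ h2.1)))
    · exfalso
      rcases hx with h2 | h2
      · exact h2.2 rfl
      · exact hxv (meet x (sub2 hgs) (sub3 (openSeg_subset_seg _ h2.1)))
    · exfalso
      rcases hx with h2 | h2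
      · exact hxv (meet x (sub2 (openSeg_subset_seg _ h2.1)) (sub3 hgs))
      · exact h2.2 rfl
    · exfalso
      rcases hx with h2 | h2
      · exact hxv (meet x (sub2 (openSeg_subset_seg _ h2.1)) (sub4 (sub6 hgs)))
      · exact (ne_of_mem_openSeg hw'n.1.symm h2.1).2
          (seg_inter_of_mem_openSeg hw''n.1.symm h.hw' (openSeg_subset_seg _ h2.1) hgs)
    · exfalso
      rcases hx with h2 | h2
      · exact hxv (meet x (sub2 (openSeg_subset_seg _ h2.1)) (sub5 hgs))
      · exact (ne_of_mem_openSeg hw'n.1.symm h2.1).2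
          (seg_inter_of_mem_openSeg hvw hw'vw (openSeg_subset_seg _ h2.1) (s22 hgs))
  have hPu : Poly (unrep D₄.E u' w' v) := by
    refine D₄.poly.unrep e1 e2 hu'w' nwu ?_ ?_ ?_
    · intro f hf n1 n2 hfT
      rcases m4 f hf with h1 | rfl | rfl | rfl | rfl | rfl
      · exfalso
        by_cases hfM : f ∈ M
        · exact (h.ends f hfM).1 (Tsub hfT)
        · exact disjoint_left.1 (h.off f h1.1 h1.2.1 h1.2.2 hfM) (left_mem_seg f) (Tsub hfT)
      · exact absurd (Tsub hfT) h.u_out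
      · exact absurd rfl n1
      · exact absurd rfl n2
      · rfl
      · exfalso
        exact notMem_small hP h.uv h.vw h.hu' hw'vw h.hw' hfT
    · intro f hf n1 n2 hfT
      rcases m4 f hf with h1 | rfl | rfl | rfl | rfl | rfl
      · exfalso
        by_cases hfM : f ∈ M
        · exact (h.ends f hfM).2 (Tsub hfT)
        · exact disjoint_left.1 (h.off f h1.1 h1.2.1 h1.2.2 hfM) (right_mem_seg f) (Tsub hfT)
      · rfl
      · exact absurd rfl n1
      · exact absurd rfl n2
      · exfalso
        exact notMem_small hP h.uv h.vw h.hu' hw'vw h.hw' hfT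
      · exact absurd (Tsub hfT) h.w_out
    · intro f g x hx f1 f2 g1 g2 hxT
      have cls : ∀ f g, CrossAt D₄.E f g x → f ≠ (u', v) → f ≠ (v, w') → g ≠ (u', v) → g ≠ (v, w') →
          f ∈ M := by
        intro f g hx f1 f2 g1 g2
        have fx := openSeg_subset_seg _ hx.2.2.2.1
        have gx := openSeg_subset_seg _ hx.2.2.2.2
        have main : ∀ f ∈ D₄.E, x ∈ seg f → f ≠ (u', v) → f ≠ (v, w') → f ∉ M →
            f = (u, u') ∨ f = (w', w'') ∨ f = (w'', w) := by
          intro f hf hxf n1 n2 hfM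
          rcases m4 f hf with h1 | h1 | h1 | h1 | h1 | h1
          · exact absurd (Tsub hxT) (disjoint_left.1 (h.off f h1.1 h1.2.1 h1.2.2 hfM) hxf)
          · exact Or.inl h1
          · exact absurd h1 n1
          · exact absurd h1 n2
          · exact Or.inr (Or.inl h1)
          · exact Or.inr (Or.inr h1)
        by_contra hfM
        have hf := main f hx.1 fx f1 f2 hfM
        by_cases hgM : g ∈ M
        · rcases hf with rfl | rfl | rfl
          · exact disjoint_left.1 (h.away g hgM).1 gx fx
          · exact disjoint_left.1 (h.away g hgM).2 gx (s12 fx)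
          · exact disjoint_left.1 (h.away g hgM).2 gx (s22 fx)
        have hg := main g hx.2.1 gx g1 g2 hgM
        have w'v : ∀ y ∈ seg (w', w), y ∈ seg (v, w) ∧ y ≠ v := by
          intro y hy
          refine ⟨seg_subset (convex_seg _) sw'vw (right_mem_seg (v, w)) hy, ?_⟩
          rintro rfl
          exact hw'n.1 (seg_inter_of_mem_openSeg hvw hw'vw (left_mem_seg (y, w')) hy).symm
        have aux1 : ∀ y, y ∈ seg (u, u') → y ∉ seg (w', w) := fun y h1 h2 =>
          (w'v y h2).2 (meet y (sub1 h1) (w'v y h2).1)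
        have aux2 : ∀ y, y ∈ openSeg (w', w'') → y ∉ seg (w'', w) := fun y h1 h2 =>
          (ne_of_mem_openSeg hw'n.2 h1).2 (seg_inter_of_mem_openSeg hvw h.hw''
            (sub6 (openSeg_subset_seg _ h1)) h2)
        rcases hf with rfl | rfl | rfl <;> rcases hg with rfl | rfl | rfl
        · exact hx.2.2.1 rfl
        · exact aux1 x fx (s12 gx)
        · exact aux1 x fx (s22 gx)
        · exact aux1 x gx (s12 fx)
        · exact hx.2.2.1 rfl
        · exact aux2 x hx.2.2.2.1 gx
        · exact aux1 x gx (s22 fx)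
        · exact aux2 x hx.2.2.2.2 fx
        · exact hx.2.2.1 rfl
      exact h.disj f (cls f g hx f1 f2 g1 g2) g (cls g f hx.symm g1 g2 f1 f2) hx.2.2.1 x (Tsub hxT)
        (openSeg_subset_seg _ hx.2.2.2.1) (openSeg_subset_seg _ hx.2.2.2.2)
  have vbar : v ∉ D₄.bars := by
    rw [hBD]
    intro hv
    rcases mem_moveBar hv with h1 | h1
    · exact h1.2 rfl
    · exact hw''n.1 h1.symm
  classical
  let D₅ := D₄.del e1 e2 hPu vbar (fun x => if x ∈ openSeg (u', w') then .virtual else D.kind x)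
  have hE₅ : D₅.E = unrep D₄.E u' w' v := rfl
  have hrep : D₄.E = rep D₅.E u' w' v := (rep_unrep e1 e2 nuw).symm
  have hm5 : (u', w') ∈ D₅.E := by rw [hE₅]; exact mem_unrep.2 (Or.inr rfl)
  have k5 : ∀ x, x ∈ openSeg (u', w') → D₅.kind x = .virtual := fun x hx => if_pos hx
  have k5' : ∀ x, x ∉ openSeg (u', w') → D₅.kind x = D.kind x := fun x hx => if_neg hx
  have m5 : ∀ f ∈ D₅.E, (f ∈ D₄.E ∧ f ≠ (u', v) ∧ f ≠ (v, w')) ∨ f = (u', w') := fun f hf => by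
    rw [hE₅] at hf; exact mem_unrep.1 hf
  have Tuw : seg (u', w') ⊆ tri u' w'' v := seg_subset (convex_tri _ _ _) Tu Tw'
  have keep5 : ∀ e f x, CrossAt D₅.E e f x → e ≠ (u', w') → f ≠ (u', w') → x ∉ openSeg (u', w') := by
    intro e f x hx n1 n2 hxo
    exact n2 (D₅.poly.generic.no_triple e f (u', w') x hx ⟨hx.1, hm5, n1, hx.2.2.2.1, hxo⟩)
  have touch5 : side u' w' v ≠ 0 → ∀ f ∈ D₅.E, f ≠ (u', w') → f ∉ M →
      seg f ∩ tri u' w' v ⊆ {u', w'} := by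
    intro h0 f hf n1 hfM
    have q1 : side w' u v ≠ 0 := by
      intro h3; apply h0
      obtain ⟨r, r0, r1, hr⟩ := mem_openSeg.1 h.hu'
      have : side u' w' v = - (1 - r) * side w' u v := by
        rw [hr]
        simp only [side_eq, Prod.fst_add, Prod.snd_add, Prod.smul_fst, Prod.smul_snd, Prod.fst_sub,
          Prod.snd_sub, smul_eq_mul]; ring
      rw [this, h3, mul_zero]
    have q2 : side u' w v ≠ 0 := by
      intro h3; apply h0
      obtain ⟨r, r0, r1, hr⟩ := mem_openSeg.1 hw'vw
      have : side u' w' v = r * side u' w v := by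
        rw [hr]
        simp only [side_eq, Prod.fst_add, Prod.snd_add, Prod.smul_fst, Prod.smul_snd, Prod.fst_sub,
          Prod.snd_sub, smul_eq_mul]; ring
      rw [this, h3, mul_zero]
    have c2 := cevian_inter (p := u') (q := w) (r := v) (d := w') q2 (by rwa [openSeg_swap])
    rcases m5 f hf with ⟨h1, h2, h3⟩ | h1
    · rcases m4 f h1 with h4 | rfl | rfl | rfl | rfl | rfl
      · rintro x ⟨hx, hxT⟩
        exact absurd (Tsub hxT) (disjoint_left.1 (h.off f h4.1 h4.2.1 h4.2.2 hfM) hx)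
      · have := cevian_inter (p := w') (q := u) (r := v) (d := u') q1 h.hu'
        rw [tri_swap12] at this
        exact this.trans (by simp)
      · exact absurd rfl h2
      · exact absurd rfl h3
      · rintro x ⟨hx, hxT⟩
        have := c2 ⟨by rw [seg_swap]; exact s12 hx, hxT⟩
        exact Or.inr this
      · rintro x ⟨hx, hxT⟩
        have := c2 ⟨by rw [seg_swap]; exact s22 hx, hxT⟩
        exact Or.inr this
    · exact absurd h1 n1
  have cross5 : ∀ g x, CrossAt D₅.E (u', w') g x → g ∈ M := by
    intro g x hx
    have hxs := openSeg_subset_seg _ hx.2.2.2.1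
    have hgs := openSeg_subset_seg _ hx.2.2.2.2
    by_contra hgM
    rcases m5 g hx.2.1 with ⟨h1, h2, h3⟩ | h1
    · rcases m4 g h1 with h4 | h4 | h4 | h4 | h4 | h4
      · exact disjoint_left.1 (h.off g h4.1 h4.2.1 h4.2.2 hgM) hgs (Tuw hxs)
      · subst h4
        exact (ne_of_mem_openSeg hu'w' hx.2.2.2.1).1 (D₅.poly.inter_unique hx.1 hx.2.1 hx.2.2.1
          hxs hgs (left_mem_seg (u', w')) (right_mem_seg (u, u')))
      · exact h2 h4
      · exact h3 h4
      · subst h4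
        exact (ne_of_mem_openSeg hu'w' hx.2.2.2.1).2 (D₅.poly.inter_unique hx.1 hx.2.1 hx.2.2.1
          hxs hgs (right_mem_seg (u', w')) (left_mem_seg (w', w'')))
      · subst h4
        have h6 : (w', w'') ∈ D₅.E := by
          rw [hE₅, mem_unrep]; left
          refine ⟨by rw [e₄]; simp, ?_, ?_⟩
          · simp [hu'w'.symm]
          · simp [hw'n.1]
        by_cases h0 : side u' w' v = 0
        · have hv := mem_openSeg_of_collinear hP h.uv h.vw h.hu' hw'vw h0
          have hxw' : x ∈ seg (w', w) := s22 hgs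
          have hxvw : x ∈ seg (v, w) := sub5 hgs
          have hxv : x ≠ v := by
            rintro rfl
            exact hw'n.1 (seg_inter_of_mem_openSeg hvw hw'vw (left_mem_seg (x, w')) hxw').symm
          rcases mem_openSeg_split hv hx.2.2.2.1 hxv with h7 | h7
          · exact hxv (meet x (sub2 (openSeg_subset_seg _ h7)) hxvw)
          · exact (ne_of_mem_openSeg hu'w' hx.2.2.2.1).2
              (seg_inter_of_mem_openSeg hvw hw'vw (openSeg_subset_seg _ h7) hxw')
        · rcases touch5 h0 _ hx.2.1 hx.2.2.1.symm hgM ⟨hgs, seg_subset (convex_tri _ _ _)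
            (tri_left _ _ _) (tri_mid _ _ _) hxs⟩ with h7 | h7
          · exact (ne_of_mem_openSeg hu'w' hx.2.2.2.1).1 h7
          · exact (ne_of_mem_openSeg hu'w' hx.2.2.2.1).2 h7
    · exact hx.2.2.1 h1.symm
  refine ⟨D₅, ?_, ?_, hBD, fun g x hx => ⟨cross5 g x hx, k5 x hx.2.2.2.1⟩, k5'⟩
  · refine hDD₄.trans (Eqv.symm ?_)
    by_cases h0 : side u' w' v = 0
    · have hv := mem_openSeg_of_collinear hP h.uv h.vw h.hu' hw'vw h0
      refine (Move.subdivide D₅ D₄ u' w' v hm5 hv hrep rfl ?_).eqv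
      have key : ∀ g x, CrossAt D₅.E (u', w') g x → D₄.kind x = D₅.kind x := by
        intro g x hx
        have hgM := cross5 g x hx
        have hxT := Tuw (openSeg_subset_seg _ hx.2.2.2.1)
        have hxv : x ≠ v := by
          rintro rfl; exact vM g hgM (openSeg_subset_seg _ hx.2.2.2.2)
        rw [k5 x hx.2.2.2.1]
        have hg4 : g ∈ D₄.E := by rw [e₄]; exact Or.inl ⟨h.mem g hgM, h.ne g hgM⟩
        have hgn : (u', v) ≠ g ∧ (v, w') ≠ g := by
          constructor
          · rintro rfl; exact (h.ends _ hgM).1 Tu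
          · rintro rfl; exact (h.ends _ hgM).1 Tv
        rcases mem_openSeg_split hv hx.2.2.2.1 hxv with h7 | h7
        · exact (lift g x hxT (Or.inl ⟨e1, hg4, hgn.1, h7, hx.2.2.2.2⟩)).2
        · exact (lift g x hxT (Or.inr ⟨e2, hg4, hgn.2, h7, hx.2.2.2.2⟩)).2
      intro e f x hx
      by_cases he : e = (u', w')
      · subst he; exact key f x hx
      by_cases hf : f = (u', w')
      · subst hf; exact key e x hx.symm
      rw [k5' x (keep5 e f x hx he hf), hKD]
    · have htri : Tri (u, v) .virtual D₅ D₄ u' w' v := by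
        have u4 : u' ∉ D₄.bars := by
          rw [hBD]; intro hb
          rcases mem_moveBar hb with h1 | h1
          · exact u'bar h1.1
          · exact w''u h1.symm
        have w4 : w' ∉ D₄.bars := by
          rw [hBD]; intro hb
          rcases mem_moveBar hb with h1 | h1
          · exact w'bar h1.1
          · exact hw'n.2 h1
        have mk : ∀ g, moverKind (u, v) .virtual g = .virtual := fun g => by simp [moverKind]
        refine ⟨hm5, h0, hrep, rfl, ?_, u4, w4, ?_, ?_, ?_, ?_, ?_, ?_, ?_⟩
        · intro e f x hx hx'
          rw [hKD, k5' x (keep5 e f x hx (fun h1 => nuw (h1 ▸ hx'.1)) (fun h1 => nuw (h1 ▸ hx'.2.1)))]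
        · intro g x hx; rw [mk]; exact k5 x hx.2.2.2.1
        · intro g x hx; rw [mk]
          exact (lift g x (Tuv (openSeg_subset_seg _ hx.2.2.2.1)) (Or.inl hx)).2
        · intro g x hx; rw [mk]
          exact (lift g x (Tvw (seg_subset (convex_seg _) (left_mem_seg (v, w''))
            (openSeg_subset_seg _ h.hw') (openSeg_subset_seg _ hx.2.2.2.1))) (Or.inr (hx))).2
        all_goals exact fun hk => absurd rfl hk
      refine htri.eqv_of_disjoint ?_
      have hM : ∀ g ∈ touch D₅ u' w' v, g ∈ M := by
        rintro g ⟨h1, h2, h3⟩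
        by_contra hgM
        exact h3 (touch5 h0 g h1 h2 hgM)
      intro g hg g' hg' hgg x hx
      exact h.disj g (hM g hg) g' (hM g' hg') hgg x (Tsub hx)
  · rw [hE₅]
    ext g
    rw [mem_unrep, e₄]
    have x1 : g ∈ D.E → g ≠ (u', v) ∧ g ≠ (v, w') := fun hg =>
      ⟨fun h1 => (u'notw g hg).1 (by rw [h1]), fun h1 => (w'notw g hg).2 (by rw [h1])⟩
    have x2 : g = (u, u') → g ≠ (u', v) ∧ g ≠ (v, w') := by rintro rfl; simp [hu'n.1.symm, huv]
    have x3 : g = (w', w'') → g ≠ (u', v) ∧ g ≠ (v, w') := by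
      rintro rfl; simp [hu'w'.symm, hw'n.1]
    have x4 : g = (w'', w) → g ≠ (u', v) ∧ g ≠ (v, w') := by
      rintro rfl; simp [w''u, hw''n.1]
    simp only [cutE, mem_ofPred_eq]
    grind

end STLink

namespace STLink
open Set Filter Topology

/-- The place where a segment leaves a compact convex set. -/
lemma exists_exit {T : Set Pt} (hT : IsCompact T) {v u : Pt} (hv : v ∈ T) (hu : u ∉ T) :
    ∃ u₁ ∈ seg (v, u), u₁ ∈ T ∧ ∀ ε > 0, ∃ u' u'', u' ∈ openSeg (v, u'') ∧ u'' ∈ openSeg (v, u) ∧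
      dist u' u₁ < ε ∧ dist u'' u₁ < ε ∧ Disjoint (seg (u', u)) T := by
  have hne : v ≠ u := by rintro rfl; exact hu hv
  have hn : 0 < ‖u - v‖ := norm_pos_iff.2 (sub_ne_zero.2 hne.symm)
  have hcont : Continuous fun s : ℝ => v + s • (u - v) := by fun_prop
  have hcomp : IsCompact (Icc (0 : ℝ) 1 ∩ (fun s : ℝ => v + s • (u - v)) ⁻¹' T) :=
    isCompact_Icc.inter_right (hT.isClosed.preimage hcont)
  obtain ⟨s₁, ⟨⟨h0, h1⟩, h2⟩, hmax⟩ := hcomp.exists_isGreatest ⟨0, ⟨le_rfl, zero_le_one⟩, by simpa⟩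
  have hlt : s₁ < 1 := by
    refine lt_of_le_of_ne h1 ?_
    rintro rfl; exact hu (by simpa using h2)
  refine ⟨v + s₁ • (u - v), mem_seg.2 ⟨s₁, h0, h1, rfl⟩, h2, fun ε hε => ?_⟩
  set η := min ((1 - s₁) / 2) (ε / (2 * ‖u - v‖)) with hη
  have hη0 : 0 < η := lt_min (by linarith) (by positivity)
  have hη1 : η ≤ (1 - s₁) / 2 := min_le_left _ _
  have hη2 : η * ‖u - v‖ ≤ ε / 2 := by
    have := min_le_right ((1 - s₁) / 2) (ε / (2 * ‖u - v‖))
    calc η * ‖u - v‖ ≤ ε / (2 * ‖u - v‖) * ‖u - v‖ := by gcongr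
      _ = ε / 2 := by field_simp
  have hd : ∀ τ : ℝ, 0 < τ → τ ≤ η → dist (v + (s₁ + τ) • (u - v)) (v + s₁ • (u - v)) < ε := by
    intro τ t0 t1
    rw [dist_eq_norm, show v + (s₁ + τ) • (u - v) - (v + s₁ • (u - v)) = τ • (u - v) by
      rw [add_smul]; abel, norm_smul, Real.norm_eq_abs, abs_of_pos t0]
    have : τ * ‖u - v‖ ≤ η * ‖u - v‖ := by gcongr
    linarith
  have hs2 : 0 < s₁ + η := by linarith
  refine ⟨v + (s₁ + η / 2) • (u - v), v + (s₁ + η) • (u - v), ?_, ?_, hd _ (by linarith) (by linarith),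
    hd _ hη0 le_rfl, ?_⟩
  · refine mem_openSeg.2 ⟨(s₁ + η / 2) / (s₁ + η), div_pos (by linarith) hs2,
      (div_lt_one hs2).2 (by linarith), ?_⟩
    rw [add_sub_cancel_left, smul_smul, div_mul_cancel₀ _ hs2.ne']
  · exact mem_openSeg.2 ⟨_, hs2, by linarith, rfl⟩
  · rw [disjoint_left]
    intro x hx hxT
    obtain ⟨r, r0, r1, rfl⟩ := mem_seg.1 hx
    have e : v + (s₁ + η / 2) • (u - v) + r • (u - (v + (s₁ + η / 2) • (u - v)))
        = v + (s₁ + η / 2 + r * (1 - (s₁ + η / 2))) • (u - v) := by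
      ext <;> simp <;> ring
    rw [e] at hxT
    have h3 : 0 ≤ r * (1 - (s₁ + η / 2)) := mul_nonneg r0 (by linarith)
    have h4 : r * (1 - (s₁ + η / 2)) ≤ 1 * (1 - (s₁ + η / 2)) := by
      apply mul_le_mul_of_nonneg_right r1; linarith
    have := hmax (⟨⟨by linarith, by linarith⟩, hxT⟩ :
      s₁ + η / 2 + r * (1 - (s₁ + η / 2)) ∈ Icc (0 : ℝ) 1 ∩ (fun s : ℝ => v + s • (u - v)) ⁻¹' T)
    linarith

/-- The crossings after a corner has been cut, off the new edge. -/
lemma cut_lift {E : Set Edge} (hE : Poly E) {u v w u' w' w'' : Pt} (h1 : (u, v) ∈ E)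
    (h2 : (v, w) ∈ E) (hu' : u' ∈ openSeg (u, v)) (hw'' : w'' ∈ openSeg (v, w))
    (hw' : w' ∈ openSeg (v, w'')) {e f : Edge} {x : Pt}
    (hx : CrossAt (cutE E u v w u' w' w'') e f x) (he : e ≠ (u', w')) (hf : f ≠ (u', w')) :
    ∃ e' f', CrossAt E e' f' x ∧ (e ∈ E → e' = e) ∧ (f ∈ E → f' = f) := by
  have huv : u ≠ v := hE.ne h1
  have hvw : v ≠ w := hE.ne h2
  have hvw'' := (ne_of_mem_openSeg hvw hw'').1.symm
  have sub6 : openSeg (w', w'') ⊆ openSeg (v, w) :=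
    (openSeg_subset_of_mem hvw'' hw').2.trans (openSeg_subset_of_mem hvw hw'').1
  have n1 : (u, u') ∉ E := fun h => hE.right_notMem h h1 hu'
  have n2 : (w', w'') ∉ E := fun h => hE.right_notMem h h2 hw''
  have n3 : (w'', w) ∉ E := fun h => hE.left_notMem h h2 hw''
  have par : ∀ e ∈ cutE E u v w u' w' w'', e ≠ (u', w') → x ∈ openSeg e → ∃ e' ∈ E, x ∈ openSeg e' ∧
      (e ∈ E → e' = e) ∧ ((e = e' ∧ e' ≠ (u, v) ∧ e' ≠ (v, w)) ∨ (e = (u, u') ∧ e' = (u, v)) ∨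
        (e = (w', w'') ∧ e' = (v, w)) ∨ (e = (w'', w) ∧ e' = (v, w))) := by
    intro e he hne hxe
    rcases he with h3 | rfl | rfl | rfl | rfl
    · exact ⟨e, h3.1, hxe, fun _ => rfl, Or.inl ⟨rfl, h3.2⟩⟩
    · exact ⟨_, h1, (openSeg_subset_of_mem huv hu').1 hxe, fun h => absurd h n1, by simp⟩
    · exact absurd rfl hne
    · exact ⟨_, h2, sub6 hxe, fun h => absurd h n2, by simp⟩
    · exact ⟨_, h2, (openSeg_subset_of_mem hvw hw'').2 hxe, fun h => absurd h n3, by simp⟩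
  obtain ⟨e', he', hxe', ee, pe⟩ := par e hx.1 he hx.2.2.2.1
  obtain ⟨f', hf', hxf', ff, pf⟩ := par f hx.2.1 hf hx.2.2.2.2
  refine ⟨e', f', ⟨he', hf', ?_, hxe', hxf'⟩, ee, ff⟩
  have hdis : ∀ y, y ∈ openSeg (w', w'') → y ∈ openSeg (w'', w) → False := by
    intro y h3 h4
    have hw'n := (ne_of_mem_openSeg hvw'' hw').2
    exact (ne_of_mem_openSeg hw'n h3).2 (seg_inter_of_mem_openSeg hvw hw''
      (openSeg_subset_seg _ ((openSeg_subset_of_mem hvw'' hw').2 h3)) (openSeg_subset_seg _ h4))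
  intro hef
  subst hef
  have hxne := hx.2.2.1
  have x1 := hx.2.2.2.1
  have x2 := hx.2.2.2.2
  rcases pe with ⟨p1, p2, p3⟩ | ⟨p1, p2⟩ | ⟨p1, p2⟩ | ⟨p1, p2⟩ <;>
    rcases pf with ⟨q1, q2, q3⟩ | ⟨q1, q2⟩ | ⟨q1, q2⟩ | ⟨q1, q2⟩
  · exact hxne (p1.trans q1.symm)
  · exact p2 q2
  · exact p3 q2
  · exact p3 q2
  · exact q2 p2
  · exact hxne (p1.trans q1.symm)
  · rw [p2] at q2; exact huv (congrArg Prod.fst q2)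
  · rw [p2] at q2; exact huv (congrArg Prod.fst q2)
  · exact q3 p2
  · rw [p2] at q2; exact huv (congrArg Prod.fst q2).symm
  · exact hxne (p1.trans q1.symm)
  · rw [p1] at x1; rw [q1] at x2; exact hdis x x1 x2
  · exact q3 p2
  · rw [p2] at q2; exact huv (congrArg Prod.fst q2).symm
  · rw [p1] at x1; rw [q1] at x2; exact hdis x x2 x1
  · exact hxne (p1.trans q1.symm)

section
variable {e₀ : Edge} {k₀ : Kind} {D D' : Diagram} {a b c d u v w : Pt}

set_option maxHeartbeats 1000000 in
/-- An edge is moved past a vertex which can be cut off without touching the corners of the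
triangle. -/
lemma Tri.eqv_of_vertex_aux (h : Tri e₀ .virtual D D' a b c) (huv : (u, v) ∈ D.E) (hvw : (v, w) ∈ D.E)
    (hS : touch D a b c ⊆ {(u, v), (v, w)}) (hv : v ∈ tri a b c) (hu : u ∉ tri a b c)
    (hw : w ∉ tri a b c)
    (hK : ∀ u₁ ∈ seg (v, u), u₁ ∈ tri a b c → ∀ w₁ ∈ seg (v, w), w₁ ∈ tri a b c →
      ∀ p ∈ ({a, b, c} : Set Pt), p ∉ tri u₁ v w₁) : Eqv D D' := by
  have mk : ∀ g, moverKind e₀ .virtual g = .virtual := fun g => by simp [moverKind]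
  have hTc := isCompact_tri a b c
  have Ta := tri_left a b c
  have Tb := tri_mid a b c
  have Tc := tri_right a b c
  obtain ⟨u₁, hu₁, hu₁T, hu₁e⟩ := exists_exit hTc hv hu
  obtain ⟨w₁, hw₁, hw₁T, hw₁e⟩ := exists_exit hTc hv hw
  have hK1 := hK u₁ hu₁ hu₁T w₁ hw₁ hw₁T
  have hKT : tri u₁ v w₁ ⊆ tri a b c := tri_subset (convex_tri _ _ _) hu₁T hv hw₁T
  let O : Set Edge := {g | g ∈ D.E ∧ g ≠ (a, b) ∧ g ≠ (u, v) ∧ g ≠ (v, w)}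
  have hOfin : O.Finite := D.finite.subset fun g hg => hg.1
  have hO : ∀ g ∈ O, seg g ∩ tri a b c ⊆ {a, b} := by
    rintro g ⟨g1, g2, g3, g4⟩
    by_contra hcon
    rcases hS ⟨g1, g2, hcon⟩ with h5 | h5
    · exact g3 h5
    · exact g4 h5
  have hFc : IsCompact ((⋃ g ∈ O, seg g) ∪ ({a, b, c, u, w} : Set Pt)) :=
    (hOfin.isCompact_biUnion fun g _ => isCompact_seg g).union (Set.toFinite _).isCompact
  obtain ⟨ε, hε, hdisj⟩ := exists_tri_disjoint hFc (p := u₁) (q := w₁) (r := v) (by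
    rw [show tri u₁ w₁ v = tri u₁ v w₁ from tri_perm (by grind), disjoint_left]
    rintro x hx (hx' | hx')
    · simp only [mem_iUnion] at hx'
      obtain ⟨g, hg, hxg⟩ := hx'
      refine hK1 x ?_ hx
      rcases hO g hg ⟨hxg, hKT hx⟩ with h1 | h1
      · exact Or.inl h1
      · exact Or.inr (Or.inl h1)
    · rcases hx' with h1 | h1 | h1 | h1 | h1
      · exact hK1 x (by simp [h1]) hx
      · exact hK1 x (by simp [h1]) hx
      · exact hK1 x (by rw [h1]; simp) hx
      · exact hu (h1 ▸ hKT hx)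
      · exact hw ((show x = w from h1) ▸ hKT hx))
  obtain ⟨u', u'', hu'1, hu''1, hu'd, -, hu'T⟩ := hu₁e ε hε
  obtain ⟨w', w'', hw'1, hw''1, -, hw''d, hw'T⟩ := hw₁e ε hε
  have hF := disjoint_left.1 (hdisj u' w'' v hu'd hw''d (by simpa using hε))
  have vu : v ≠ u := by rintro rfl; exact hu hv
  have vwn : v ≠ w := by rintro rfl; exact hw hv
  have hu'o : u' ∈ openSeg (u, v) := by
    rw [openSeg_swap]; exact (openSeg_subset_of_mem vu hu''1).1 hu'1
  have hu'T2 : Disjoint (seg (u, u')) (tri a b c) := by rw [seg_swap]; exact hu'T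
  have nT : ∀ p ∈ tri a b c, p ≠ u ∧ p ≠ w ∧ p ≠ u' ∧ p ≠ w' := by
    intro p hp
    refine ⟨?_, ?_, ?_, ?_⟩
    · rintro rfl; exact hu hp
    · rintro rfl; exact hw hp
    · rintro rfl; exact disjoint_left.1 hu'T (left_mem_seg (p, u)) hp
    · rintro rfl; exact disjoint_left.1 hw'T (left_mem_seg (p, w)) hp
  have w''seg : w'' ∈ seg (w', w) := by
    have h0 := ne_of_mem_openSeg vwn hw''1
    have h5 : w' ∈ openSeg (v, w) := (openSeg_subset_of_mem vwn hw''1).1 hw'1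
    have h6 : w'' ≠ w' := (ne_of_mem_openSeg h0.1.symm hw'1).2.symm
    rcases mem_openSeg_split h5 hw''1 h6 with h7 | h7
    · exfalso
      obtain ⟨r, r0, r1, hr⟩ := mem_openSeg.1 hw'1
      obtain ⟨s, s0, s1, hs⟩ := mem_openSeg.1 h7
      have : (1 - s * r) • (w'' - v) = 0 := by
        have e1 : w'' - v = s • (w' - v) := by nth_rw 1 [hs]; abel
        have e2 : w' - v = r • (w'' - v) := by nth_rw 1 [hr]; abel
        rw [sub_smul, one_smul, mul_smul, ← e2, ← e1, sub_self]
      rcases smul_eq_zero.1 this with h8 | h8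
      · nlinarith
      · exact h0.1 (sub_eq_zero.1 h8)
    · exact openSeg_subset_seg _ h7
  have nT'' : ∀ p ∈ tri a b c, p ≠ w'' := by
    rintro p hp rfl; exact disjoint_left.1 hw'T w''seg hp
  have abT : seg (a, b) ⊆ tri a b c := seg_subset (convex_tri _ _ _) Ta Tb
  have acT : seg (a, c) ⊆ tri a b c := seg_subset (convex_tri _ _ _) Ta Tc
  have cbT : seg (c, b) ⊆ tri a b c := seg_subset (convex_tri _ _ _) Tc Tb
  have aF : a ∉ tri u' w'' v := fun hx => hF hx (Or.inr (by simp))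
  have bF : b ∉ tri u' w'' v := fun hx => hF hx (Or.inr (by simp))
  have cF : c ∉ tri u' w'' v := fun hx => hF hx (Or.inr (by simp))
  have uF : u ∉ tri u' w'' v := fun hx => hF hx (Or.inr (by simp))
  have wF : w ∉ tri u' w'' v := fun hx => hF hx (Or.inr (by simp))
  have OF : ∀ g ∈ O, Disjoint (seg g) (tri u' w'' v) := by
    intro g hg
    rw [disjoint_left]
    intro x hxg hx
    exact hF hx (Or.inl (by simp only [mem_iUnion]; exact ⟨g, hg, hxg⟩))
  have away : ∀ g : Edge, seg g ⊆ tri a b c → Disjoint (seg g) (seg (u, u')) ∧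
      Disjoint (seg g) (seg (w', w)) := fun g hg => ⟨(hu'T2.mono_right hg).symm, (hw'T.mono_right hg).symm⟩
  have neE : ∀ p ∈ tri a b c, ∀ q ∈ tri a b c, (p, q) ≠ (u, v) ∧ (p, q) ≠ (v, w) := by
    intro p hp q hq
    exact ⟨fun h1 => (nT p hp).1 (congrArg Prod.fst h1), fun h1 => (nT q hq).2.1 (congrArg Prod.snd h1)⟩
  have uvn : (u, v) ≠ (a, b) := (neE a Ta b Tb).1.symm
  have vwn' : (v, w) ≠ (a, b) := (neE a Ta b Tb).2.symm
  have huv' := h.mem_of huv uvn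
  have hvw' := h.mem_of hvw vwn'
  have C : Corner D u v w u' w' w'' {(a, b)} := by
    refine ⟨huv, hvw, hu'o, hw''1, hw'1, ?_, ?_, ?_, ?_, ?_, ?_, uF, wF, ?_⟩
    · intro g hg g1 g2 g3; exact OF g ⟨hg, g3, g1, g2⟩
    · rintro g rfl; exact h.mem
    · rintro g rfl; exact neE a Ta b Tb
    · rintro g rfl; exact ⟨aF, bF⟩
    · rintro g rfl; exact away _ abT
    · rintro g rfl g' rfl hne; exact absurd rfl hne
    · rintro g rfl x hx
      rcases hx with hx | hx
      · rw [h.old _ x hx.symm, mk]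
      · rw [h.old _ x hx.symm, mk]
  have C' : Corner D' u v w u' w' w'' {(a, c), (c, b)} := by
    refine ⟨huv', hvw', hu'o, hw''1, hw'1, ?_, ?_, ?_, ?_, ?_, ?_, uF, wF, ?_⟩
    · intro g hg g1 g2 g3
      rw [h.edges] at hg
      rcases mem_rep.1 hg with h1 | h1 | h1
      · exact OF g ⟨h1.1, h1.2, g1, g2⟩
      · exact absurd (Or.inl h1) g3
      · exact absurd (Or.inr h1) g3
    · rintro g (rfl | rfl)
      · exact h.mem₁
      · exact h.mem₂
    · rintro g (rfl | rfl)
      · exact neE a Ta c Tc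
      · exact neE c Tc b Tb
    · rintro g (rfl | rfl)
      · exact ⟨aF, cF⟩
      · exact ⟨cF, bF⟩
    · rintro g (rfl | rfl)
      · exact away _ acT
      · exact away _ cbT
    · rintro g (rfl | rfl) g' (rfl | rfl) hne x hx x1 x2
      · exact hne rfl
      · exact cF (side_ne_zero_seg h.nondeg x1 x2 ▸ hx)
      · exact cF (side_ne_zero_seg h.nondeg x2 x1 ▸ hx)
      · exact hne rfl
    · rintro g (rfl | rfl) x hx
      · rcases hx with hx | hx
        · rw [h.new₁ _ x hx.symm, mk]
        · rw [h.new₁ _ x hx.symm, mk]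
      · rcases hx with hx | hx
        · rw [h.new₂ _ x hx.symm, mk]
        · rw [h.new₂ _ x hx.symm, mk]
  obtain ⟨D₁, q1, E₁, B₁, x₁, k₁⟩ := C.exists_cut
  obtain ⟨D₂, q2, E₂, B₂, x₂, k₂⟩ := C'.exists_cut
  have hm1 : (u', w') ∈ D₁.E := by rw [E₁]; simp [cutE]
  have hm2 : (u', w') ∈ D₂.E := by rw [E₂]; simp [cutE]
  have off₁ : ∀ e f x, CrossAt D₁.E e f x → e ≠ (u', w') → f ≠ (u', w') → x ∉ openSeg (u', w') :=
    fun e f x hx n1 n2 hxo =>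
      n2 (D₁.poly.generic.no_triple e f (u', w') x hx ⟨hx.1, hm1, n1, hx.2.2.2.1, hxo⟩)
  have off₂ : ∀ e f x, CrossAt D₂.E e f x → e ≠ (u', w') → f ≠ (u', w') → x ∉ openSeg (u', w') :=
    fun e f x hx n1 n2 hxo =>
      n2 (D₂.poly.generic.no_triple e f (u', w') x hx ⟨hx.1, hm2, n1, hx.2.2.2.1, hxo⟩)
  have fstT : ∀ p ∈ tri a b c, ∀ q, (p, q) ≠ (u, u') ∧ (p, q) ≠ (u', w') ∧ (p, q) ≠ (w', w'') ∧
      (p, q) ≠ (w'', w) := by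
    intro p hp q
    have := nT p hp
    have := nT'' p hp
    simp only [ne_eq, Prod.mk.injEq]
    tauto
  have tri₁ : Tri e₀ .virtual D₁ D₂ a b c := by
    have nb : ∀ p ∈ tri a b c, p ∉ D.bars → p ∉ D₁.bars := by
      intro p hp hpb hpb'
      rw [B₁] at hpb'
      rcases mem_moveBar hpb' with h1 | h1
      · exact hpb h1.1
      · exact nT'' p hp h1
    refine ⟨?_, h.nondeg, ?_, by rw [B₁, B₂, h.bars], ?_, nb a Ta h.bar_a, nb b Tb h.bar_b, ?_, ?_, ?_,
      ?_, ?_, ?_, ?_⟩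
    · rw [E₁]; exact Or.inl ⟨h.mem, neE a Ta b Tb⟩
    · rw [E₁, E₂, h.edges]
      ext g
      have y1 : g = (a, b) → g ≠ (u, u') ∧ g ≠ (u', w') ∧ g ≠ (w', w'') ∧ g ≠ (w'', w) := by
        rintro rfl; exact fstT a Ta b
      have y2 : g = (a, c) → g ≠ (u, v) ∧ g ≠ (v, w) := by rintro rfl; exact neE a Ta c Tc
      have y3 : g = (c, b) → g ≠ (u, v) ∧ g ≠ (v, w) := by rintro rfl; exact neE c Tc b Tb
      simp only [cutE, mem_ofPred_eq, mem_rep]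
      grind
    · intro e f x hx hx'
      by_cases he : e = (u', w')
      · subst he; rw [(x₁ f x hx).2, (x₂ f x hx').2]
      by_cases hf : f = (u', w')
      · subst hf; rw [(x₁ e x hx.symm).2, (x₂ e x hx'.symm).2]
      rw [k₁ x (off₁ e f x hx he hf), k₂ x (off₂ e f x hx' he hf)]
      have sub : ∀ g, g ∈ D₁.E → g ∈ D₂.E → g ∈ cutE (D.E ∩ D'.E) u v w u' w' w'' := by
        intro g h1 h2
        rw [E₁] at h1
        rw [E₂] at h2
        rcases h1 with h1 | h1
        · rcases h2 with h2 | h2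
          · exact Or.inl ⟨⟨h1.1, h2.1⟩, h1.2⟩
          · exact Or.inr h2
        · exact Or.inr h1
      obtain ⟨e', f', hc, -, -⟩ := cut_lift (D.poly.mono inter_subset_left) ⟨huv, huv'⟩ ⟨hvw, hvw'⟩
        hu'o hw''1 hw'1 (hx.mono (sub e hx.1 hx'.1) (sub f hx.2.1 hx'.2.1)) he hf
      exact h.keeps e' f' x (hc.mono hc.1.1 hc.2.1.1) (hc.mono hc.1.2 hc.2.1.2)
    · intro g x hx
      rw [mk]
      by_cases hg : g = (u', w')
      · subst hg; exact (x₁ _ x hx.symm).2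
      have hab := (fstT a Ta b).2.1
      rw [k₁ x (off₁ _ _ x hx hab hg)]
      obtain ⟨e', f', hc, he', -⟩ := cut_lift D.poly huv hvw hu'o hw''1 hw'1 (E₁ ▸ hx) hab hg
      rw [he' h.mem] at hc
      rw [h.old _ x hc, mk]
    · intro g x hx
      rw [mk]
      by_cases hg : g = (u', w')
      · subst hg; exact (x₂ _ x hx.symm).2
      have hab := (fstT a Ta c).2.1
      rw [k₂ x (off₂ _ _ x hx hab hg)]
      obtain ⟨e', f', hc, he', -⟩ := cut_lift D'.poly huv' hvw' hu'o hw''1 hw'1 (E₂ ▸ hx) hab hg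
      rw [he' h.mem₁] at hc
      rw [h.new₁ _ x hc, mk]
    · intro g x hx
      rw [mk]
      by_cases hg : g = (u', w')
      · subst hg; exact (x₂ _ x hx.symm).2
      have hab := (fstT c Tc b).2.1
      rw [k₂ x (off₂ _ _ x hx hab hg)]
      obtain ⟨e', f', hc, he', -⟩ := cut_lift D'.poly huv' hvw' hu'o hw''1 hw'1 (E₂ ▸ hx) hab hg
      rw [he' h.mem₂] at hc
      rw [h.new₂ _ x hc, mk]
    all_goals exact fun hk => absurd rfl hk
  have s12 : seg (w', w'') ⊆ seg (w', w) := seg_subset (convex_seg _) (left_mem_seg (w', w)) w''seg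
  have s22 : seg (w'', w) ⊆ seg (w', w) := seg_subset (convex_seg _) w''seg (right_mem_seg (w', w))
  have hfin : touch D₁ a b c ⊆ {(u', w')} := by
    rintro g ⟨hg, g1, g2⟩
    rw [E₁] at hg
    rcases hg with h1 | rfl | rfl | rfl | rfl
    · exact absurd (hO g ⟨h1.1, g1, h1.2⟩) g2
    · exact absurd (by rw [hu'T2.inter_eq]; exact empty_subset _) g2
    · rfl
    · exact absurd (by rw [(hw'T.mono_left s12).inter_eq]; exact empty_subset _) g2
    · exact absurd (by rw [(hw'T.mono_left s22).inter_eq]; exact empty_subset _) g2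
  exact q1.trans ((tri₁.eqv_of_subsingleton (subsingleton_singleton.anti hfin)).trans q2.symm)

end
end STLink

namespace STLink
open Set Filter Topology

section
variable {e₀ : Edge} {k₀ : Kind} {D D' : Diagram} {a b c d u v w : Pt}

lemma Splits.swap {H : Set Edge} {p q r : Pt} (h : Splits e₀ k₀ D D' H p q r d) :
    Splits e₀ k₀ D D' H p r q d := by
  obtain ⟨D₁, D₁', a₁, b₁, c₁, D₂, D₂', a₂, b₂, c₂, t1, t2, u1, u2, himp⟩ := h
  refine ⟨D₂, D₂', a₂, b₂, c₂, D₁, D₁', a₁, b₁, c₁, t2, t1, ⟨?_, ?_⟩, ⟨?_, ?_⟩, fun h1 h2 => himp h2 h1⟩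
  · rw [u2.1]; grind
  · rw [u2.2]; unfold quad; ring
  · rw [u1.1]; grind
  · rw [u1.2]; unfold quad; ring

lemma Tri.toVirtual (h : Tri e₀ k₀ D D' a b c)
    (hv : k₀ ≠ .virtual → seg e₀ ∩ tri a b c = ∅) : Tri e₀ .virtual D D' a b c := by
  have hT : ∀ p q : Pt, p ∈ tri a b c → q ∈ tri a b c → ∀ g x, x ∈ openSeg (p, q) → x ∈ openSeg g →
      moverKind e₀ k₀ g = moverKind e₀ .virtual g := by
    intro p q hp hq g x hx hxg
    unfold moverKind
    by_cases hg : g = e₀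
    · subst hg
      by_cases hk : k₀ = .virtual
      · rw [hk]
      · exfalso
        have : x ∈ seg g ∩ tri a b c := ⟨openSeg_subset_seg _ hxg,
          seg_subset (convex_tri _ _ _) hp hq (openSeg_subset_seg _ hx)⟩
        rw [hv hk] at this; exact this
    · simp [hg]
  refine ⟨h.mem, h.nondeg, h.edges, h.bars, h.keeps, h.bar_a, h.bar_b, fun g x hx => ?_,
    fun g x hx => ?_, fun g x hx => ?_, ?_, ?_, ?_, ?_⟩
  · rw [h.old g x hx]
    exact hT a b (tri_left _ _ _) (tri_mid _ _ _) g x hx.2.2.2.1 hx.2.2.2.2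
  · rw [h.new₁ g x hx]
    exact hT a c (tri_left _ _ _) (tri_right _ _ _) g x hx.2.2.2.1 hx.2.2.2.2
  · rw [h.new₂ g x hx]
    exact hT c b (tri_right _ _ _) (tri_mid _ _ _) g x hx.2.2.2.1 hx.2.2.2.2
  all_goals exact fun hk => absurd rfl hk

set_option maxHeartbeats 1000000 in
lemma Tri.eqv_of_vertex_side (_h : Tri e₀ k₀ D D' a b c) (huv : (u, v) ∈ D.E) (hvw : (v, w) ∈ D.E)
    (hS : touch D a b c ⊆ {(u, v), (v, w)}) (_hv : v ∈ tri a b c) (hu : u ∉ tri a b c)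
    (hw : w ∉ tri a b c) {p q r : Pt} (hpqr : ({p, q, r} : Set Pt) = {a, b, c})
    (hfin : {d | d ∈ openSeg (q, r) ∧ ¬ Splits e₀ k₀ D D' (touch D a b c) p q r d}.Finite)
    {s t : ℝ} (hs : 0 < s) (ht : 0 < t) (hst : s + t < 1) (hvp : v = p + s • (q - p) + t • (r - p))
    (h0 : side p q r ≠ 0) (hsu : 0 < side p q r * side p v u) (hsw : side p v w ≠ 0)
    (hp : p ∉ seg (v, w)) (hq : q ∉ seg (v, w)) : Eqv D D' := by
  have hT : tri p q r = tri a b c := tri_perm hpqr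
  have hst0 : 0 < s + t := by linarith
  set S := side p q r with hSdef
  set d₀ := q + (t / (s + t)) • (r - q) with hd₀
  have hvd₀ : v = p + (s + t) • (d₀ - p) := by
    rw [hvp, hd₀]; ext <;> simp <;> field_simp <;> ring
  have hqr : q ≠ r := (ne_of_side h0).2.1
  have hd₀o : d₀ ∈ openSeg (q, r) := mem_openSeg.2 ⟨_, by positivity,
    (div_lt_one hst0).2 (by linarith), rfl⟩
  have hd₀n := ne_of_mem_openSeg hqr hd₀o
  have hvd₀ne : v ≠ d₀ := by
    intro hcon
    have : (1 - (s + t)) • (d₀ - p) = 0 := by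
      rw [sub_smul, one_smul]
      have : v - p = (s + t) • (d₀ - p) := by nth_rw 1 [hvd₀]; abel
      rw [← this, hcon, sub_self]
    rcases smul_eq_zero.1 this with h1 | h1
    · linarith
    · rw [sub_eq_zero] at h1
      have := side_of_mem_seg (openSeg_subset_seg _ hd₀o)
      rw [h1, side_cycle] at this
      exact h0 this
  have hS2 : 0 < S * S := mul_self_pos.2 h0
  have l1 : side p v r = s * S := by
    rw [hvp, hSdef]
    simp only [side_eq, Prod.fst_add, Prod.snd_add, Prod.smul_fst, Prod.smul_snd, Prod.fst_sub,
      Prod.snd_sub, smul_eq_mul]; ring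
  have l2 : side p d₀ v = 0 := by
    nth_rw 1 [hvd₀]
    simp only [side_eq, Prod.fst_add, Prod.snd_add, Prod.smul_fst, Prod.smul_snd, Prod.fst_sub,
      Prod.snd_sub, smul_eq_mul]; ring
  have l3 : ∀ x, side p v x = (s + t) * side p d₀ x := by
    intro x
    nth_rw 1 [hvd₀]
    simp only [side_eq, Prod.fst_add, Prod.snd_add, Prod.smul_fst, Prod.smul_snd, Prod.fst_sub,
      Prod.snd_sub, smul_eq_mul]; ring
  have hd₀w : d₀ ∉ seg (v, w) := by
    intro hm
    obtain ⟨x, x0, x1, hx⟩ := mem_seg.1 hm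
    have h1 : side p v d₀ = 0 := by
      rw [l3]; simp
    rw [hx, side_add_smul, side_right, mul_zero, zero_add] at h1
    have : x = 0 := (mul_eq_zero.1 h1).resolve_right hsw
    apply hvd₀ne
    rw [hx, this]; simp
  have hu1 : 0 < S * side p d₀ u := by
    rw [l3] at hsu
    have : S * ((s + t) * side p d₀ u) = (s + t) * (S * side p d₀ u) := by ring
    rw [this] at hsu
    exact (mul_pos_iff_of_pos_left hst0).1 hsu
  -- neighbourhoods
  obtain ⟨ρ, hρ, hρd⟩ : ∃ ρ > 0, Disjoint (Metric.closedBall d₀ ρ) (seg (v, w)) := by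
    have : (seg (v, w))ᶜ ∈ 𝓝 d₀ := (isCompact_seg (v, w)).isClosed.isOpen_compl.mem_nhds hd₀w
    obtain ⟨ρ, hρ, hsub⟩ := Metric.nhds_basis_closedBall.mem_iff.1 this
    exact ⟨ρ, hρ, disjoint_left.2 fun x hx hx' => hsub hx hx'⟩
  obtain ⟨ε, hε, hεd⟩ := exists_tri_disjoint (F := {p, q} ∪ Metric.closedBall d₀ ρ)
    ((Set.toFinite _).isCompact.union (isCompact_closedBall d₀ ρ)) (p := v) (q := v) (r := w) (by
      rw [seg_eq_tri, disjoint_left]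
      rintro x hx ((rfl | rfl) | hx')
      · exact hp hx
      · exact hq hx
      · exact disjoint_left.1 hρd hx' hx)
  have hcont : ∀ x, Continuous fun d => S * side p d x := by
    intro x; unfold side det; fun_prop
  have hev : ∀ᶠ d in 𝓝 d₀, 0 < S * side p d u ∧
      -(S * side p d v) * (‖u - v‖ + 1) < ε * (S * side p d u) := by
    refine ((hcont u).continuousAt.eventually (lt_mem_nhds hu1)).and ?_
    have hc1 : Continuous fun d => ε * (S * side p d u) - (-(S * side p d v) * (‖u - v‖ + 1)) :=
      (continuous_const.mul (hcont u)).sub ((hcont v).neg.mul continuous_const)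
    have h1 : 0 < ε * (S * side p d₀ u) - (-(S * side p d₀ v) * (‖u - v‖ + 1)) := by
      rw [l2]; simp only [mul_zero, neg_zero, zero_mul, sub_zero]; positivity
    filter_upwards [hc1.continuousAt.eventually (lt_mem_nhds h1)] with d hd
    linarith
  obtain ⟨ε', hε', hball⟩ := Metric.eventually_nhds_iff.1 hev
  obtain ⟨d, hd, hdd, hdS⟩ := exists_param_near hd₀n.2 hfin (lt_min hρ hε')
  have hdev := hball (hdd.trans_le (min_le_right _ _))
  have hdqr : d ∈ openSeg (q, r) := (openSeg_subset_of_mem hqr hd₀o).2 hd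
  have hsp : Splits e₀ k₀ D D' (touch D a b c) p q r d := by
    by_contra hcon; exact hdS ⟨hdqr, hcon⟩
  obtain ⟨η, η0, η1, hη⟩ := mem_openSeg.1 hd
  have l4 : S * side p d v = - (η * s * (S * S)) := by
    have : side p d v = (1 - η) * side p d₀ v + η * side p r v := by rw [hη, side_add_smul₂]
    rw [this, l2, side_swap', l1]; ring
  have l4' : S * side p d v < 0 := by
    rw [l4]; have : 0 < η * s * (S * S) := by positivity
    linarith
  obtain ⟨τ, τ0, τ1, hτ⟩ := mem_openSeg.1 hdqr
  have l5 : side p d q = - τ * S := by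
    rw [hτ, hSdef]
    simp only [side_eq, Prod.fst_add, Prod.snd_add, Prod.smul_fst, Prod.smul_snd, Prod.fst_sub,
      Prod.snd_sub, smul_eq_mul]; ring
  have l6 : side p d r = (1 - τ) * S := by
    rw [hτ, hSdef]
    simp only [side_eq, Prod.fst_add, Prod.snd_add, Prod.smul_fst, Prod.smul_snd, Prod.fst_sub,
      Prod.snd_sub, smul_eq_mul]; ring
  have vnot : v ∉ tri p d r := by
    intro hm
    have : tri p d r ⊆ {x | 0 ≤ S * side p d x} :=
      tri_subset (convex_side_mul_nonneg p d _) (by change 0 ≤ _ * side p d p; simp)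
        (by change 0 ≤ _ * side p d d; simp)
        (by
          change 0 ≤ S * side p d r
          rw [l6]
          have : 0 ≤ (1 - τ) * (S * S) := mul_nonneg (by linarith) hS2.le
          linarith)
    have h1 : 0 ≤ S * side p d v := this hm
    linarith
  have hpqd : tri p q d ⊆ {x | S * side p d x ≤ 0} := by
    have : tri p q d ⊆ {x | 0 ≤ -S * side p d x} :=
      tri_subset (convex_side_mul_nonneg p d _) (by change 0 ≤ _ * side p d p; simp)
        (by
          change 0 ≤ -S * side p d q
          rw [l5]
          have : 0 ≤ τ * (S * S) := mul_nonneg τ0.le hS2.le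
          linarith)
        (by change 0 ≤ _ * side p d d; simp)
    intro x hx
    have h1 : 0 ≤ -S * side p d x := this hx
    change S * side p d x ≤ 0
    linarith
  have hdT : d ∈ tri p q r := seg_subset (convex_tri _ _ _) (tri_mid _ _ _) (tri_right _ _ _)
    (openSeg_subset_seg _ hdqr)
  have sT : tri p q d ⊆ tri a b c := hT ▸ tri_subset (convex_tri _ _ _) (tri_left _ _ _)
    (tri_mid _ _ _) hdT
  have vin : v ∈ tri p q d := by
    have h1 : d₀ ∈ seg (q, d) := by
      refine mem_seg.2 ⟨t / (s + t) / τ, by positivity, ?_, ?_⟩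
      · rw [div_le_one τ0]
        have : (t / (s + t) + η * (1 - t / (s + t)) - τ) • (r - q) = 0 := by
          have e1 : d - q = τ • (r - q) := by nth_rw 1 [hτ]; abel
          have e2 : d - q = (t / (s + t) + η * (1 - t / (s + t))) • (r - q) := by
            rw [hη, hd₀]; ext <;> simp <;> ring
          rw [sub_smul, ← e2, e1, sub_self]
        have h2 := (smul_eq_zero.1 this).resolve_right (sub_ne_zero.2 hqr.symm)
        have h3 : t / (s + t) < 1 := (div_lt_one hst0).2 (by linarith)
        nlinarith
      · have e1 : d - q = τ • (r - q) := by nth_rw 1 [hτ]; abel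
        rw [e1, smul_smul, div_mul_cancel₀ _ τ0.ne']
    have h2 : d₀ ∈ tri p q d := seg_subset (convex_tri _ _ _) (tri_mid _ _ _) (tri_right _ _ _) h1
    exact seg_subset (convex_tri _ _ _) (tri_left _ _ _) h2 (mem_seg.2 ⟨_, hst0.le, hst.le, hvd₀⟩)
  obtain ⟨D₁, D₁', a₁, b₁, c₁, D₂, D₂', a₂, b₂, c₂, t1, t2, u1, u2, himp⟩ := hsp
  have hne : (u, v) ≠ (v, w) := fun h1 => D.poly.ne huv (congrArg Prod.fst h1)
  refine himp ?_ ?_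
  · have hT1 : tri a₁ b₁ c₁ = tri p q d := tri_perm u1.1
    by_cases hsub : (touch D₁ a₁ b₁ c₁).Subsingleton
    · exact t1.1.eqv_of_subsingleton hsub
    have hS1 := t1.2.trans hS
    have hmem : (u, v) ∈ D₁.E ∧ (v, w) ∈ D₁.E := by
      rw [Set.not_subsingleton_iff] at hsub
      obtain ⟨x, hx, y, hy, hxy⟩ := hsub
      rcases hS1 hx with rfl | rfl <;> rcases hS1 hy with rfl | rfl
      · exact absurd rfl hxy
      · exact ⟨hx.1, hy.1⟩
      · exact ⟨hy.1, hx.1⟩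
      · exact absurd rfl hxy
    have t3 := t1.1.toVirtual (fun hk => by
      by_contra hne'
      obtain ⟨z, hz, hzT⟩ := nonempty_iff_ne_empty.2 hne'
      have hch := t1.1.chord_sides (t1.1.real hk) (t1.1.mem_env hk).2 (t1.1.ends hk).1 (t1.1.ends hk).2 hz hzT
      have hl := side_of_mem_seg (p := e₀.1) (q := e₀.2) hz
      have : e₀ ∈ touch D₁ a₁ b₁ c₁ := by
        refine ⟨t1.1.real hk, (t1.1.mem_env hk).2, fun hsub => ?_⟩
        rcases hsub ⟨hz, hzT⟩ with rfl | rfl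
        · exact hch.1.1 hl
        · exact hch.1.2.1 hl
      have he := t1.1.ends hk
      rw [hT1] at he
      rcases hS1 this with h5 | h5
      · exact he.2 (by rw [h5]; exact vin)
      · exact he.1 (by rw [h5]; exact vin))
    refine t3.eqv_of_vertex_aux hmem.1 hmem.2 hS1 (hT1 ▸ vin) (fun hx => hu (sT (hT1 ▸ hx)))
      (fun hx => hw (sT (hT1 ▸ hx))) ?_
    intro u₁ hu₁ hu₁T w₁ hw₁ _ x hx hxt
    rw [u1.1] at hx
    rw [hT1] at hu₁T
    have hsub : tri u₁ v w₁ ⊆ tri u₁ v w := tri_subset (convex_tri _ _ _) (tri_left _ _ _)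
      (tri_mid _ _ _) (seg_subset (convex_tri _ _ _) (tri_mid _ _ _) (tri_right _ _ _) hw₁)
    have hclose : dist u₁ v < ε := by
      obtain ⟨σ, σ0, σ1, hσ⟩ := mem_seg.1 hu₁
      have h1 : S * side p d u₁ ≤ 0 := hpqd hu₁T
      rw [hσ, side_add_smul] at h1
      rw [hσ, dist_eq_norm, add_sub_cancel_left, norm_smul, Real.norm_eq_abs, abs_of_nonneg σ0]
      set f := S * side p d u
      set g := -(S * side p d v) with hg
      have g0 : 0 < g := by rw [hg]; linarith
      have h2 : σ * f ≤ g := by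
        have : S * ((1 - σ) * side p d v + σ * side p d u) = -((1 - σ) * g) + σ * f := by
          simp only [hg, f]; ring
        rw [this] at h1
        nlinarith
      have h3 := hdev.2
      have hn := norm_nonneg (u - v)
      have h4 : σ * ‖u - v‖ * f < ε * f := by nlinarith
      exact lt_of_mul_lt_mul_right h4 hdev.1.le
    have := disjoint_left.1 (hεd u₁ v w hclose (by simpa using hε) (by simpa using hε)) (hsub hxt)
    apply this
    rcases hx with rfl | rfl | hx
    · left; simp
    · left; simp
    · right
      rw [show x = d from hx]
      exact Metric.mem_closedBall.2 (hdd.trans_le (min_le_left _ _)).le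
  · have hT2 : tri a₂ b₂ c₂ = tri p d r := tri_perm u2.1
    refine t2.1.eqv_of_disjoint fun f hf f' hf' hff x hxT h1 h2 => ?_
    have : x = v := by
      rcases hS (t2.2 hf) with rfl | rfl <;> rcases hS (t2.2 hf') with rfl | rfl
      · exact absurd rfl hff
      · exact D.poly.inter_unique huv hvw hne h1 h2 (right_mem_seg (u, v)) (left_mem_seg (v, w))
      · exact D.poly.inter_unique huv hvw hne h2 h1 (right_mem_seg (u, v)) (left_mem_seg (v, w))
      · exact absurd rfl hff
    rw [hT2, this] at hxT
    exact vnot hxT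

lemma mem_interior_tri {p q r v : Pt} (hv : v ∈ tri p q r) (h1 : v ∉ seg (p, q)) (h2 : v ∉ seg (q, r))
    (h3 : v ∉ seg (p, r)) : ∃ s t : ℝ, 0 < s ∧ 0 < t ∧ s + t < 1 ∧ v = p + s • (q - p) + t • (r - p) := by
  obtain ⟨s, t, s0, t0, hst, he⟩ := mem_tri_add hv
  refine ⟨s, t, lt_of_le_of_ne s0 ?_, lt_of_le_of_ne t0 ?_, lt_of_le_of_ne hst ?_, he⟩
  · rintro rfl
    exact h3 (mem_seg.2 ⟨t, t0, by linarith, by rw [he]; simp⟩)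
  · rintro rfl
    exact h1 (mem_seg.2 ⟨s, s0, by linarith, by rw [he]; simp⟩)
  · intro h4
    refine h2 (mem_seg.2 ⟨t, t0, by linarith, ?_⟩)
    obtain rfl : s = 1 - t := by linarith
    rw [he]; ext <;> simp <;> ring

set_option maxHeartbeats 1000000 in
/-- An edge is moved past a vertex. -/
lemma Tri.eqv_of_vertex (h : Tri e₀ k₀ D D' a b c) (huv : (u, v) ∈ D.E) (hvw : (v, w) ∈ D.E)
    (hS : touch D a b c ⊆ {(u, v), (v, w)}) (hv : v ∈ tri a b c) (hu : u ∉ tri a b c)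
    (hw : w ∉ tri a b c) : Eqv D D' := by
  have hP := D.poly
  have Ta := tri_left a b c
  have Tb := tri_mid a b c
  have Tc := tri_right a b c
  have nuv : (u, v) ≠ (a, b) := by
    intro h1; simp only [Prod.mk.injEq] at h1; exact hu (h1.1 ▸ Ta)
  have nvw : (v, w) ≠ (a, b) := by
    intro h1; simp only [Prod.mk.injEq] at h1; exact hw (h1.2 ▸ Tb)
  have uv' := h.mem_of huv nuv
  have vw' := h.mem_of hvw nvw
  have va : v ≠ a := by
    rintro rfl
    exact nvw (hP.injFst _ hvw _ h.mem rfl)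
  have vb : v ≠ b := by
    rintro rfl
    exact nuv (hP.injSnd _ huv _ h.mem rfl)
  have vc : v ≠ c := by
    rintro rfl
    exact h.off_c hvw nvw (left_mem_seg (v, w))
  have vab : v ∉ seg (a, b) := fun hx => by
    rcases hP.generic.start_off _ hvw _ h.mem hx with h1 | h1
    · exact va h1
    · exact vb h1
  have vac : v ∉ seg (a, c) := fun hx => by
    rcases D'.poly.generic.start_off _ vw' _ h.mem₁ hx with h1 | h1
    · exact va h1
    · exact vc h1
  have vcb : v ∉ seg (c, b) := fun hx => by
    rcases D'.poly.generic.start_off _ vw' _ h.mem₂ hx with h1 | h1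
    · exact vc h1
    · exact vb h1
  have offv : ∀ p ∈ ({a, b, c} : Set Pt), p ∉ seg (v, u) ∧ p ∉ seg (v, w) := by
    rintro p (rfl | rfl | rfl)
    · constructor
      · intro hx
        rw [seg_swap] at hx
        rcases hP.generic.start_off _ h.mem _ huv hx with h1 | h1
        · exact hu ((show p = u from h1) ▸ Ta)
        · exact va h1.symm
      · intro hx
        rcases hP.generic.start_off _ h.mem _ hvw hx with h1 | h1
        · exact va h1.symm
        · exact hw ((show p = w from h1) ▸ Ta)
    · constructor
      · intro hx
        rw [seg_swap] at hx
        rcases hP.generic.end_off _ h.mem _ huv hx with h1 | h1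
        · exact hu ((show p = u from h1) ▸ Tb)
        · exact vb h1.symm
      · intro hx
        rcases hP.generic.end_off _ h.mem _ hvw hx with h1 | h1
        · exact vb h1.symm
        · exact hw ((show p = w from h1) ▸ Tb)
    · rw [seg_swap v u]
      exact ⟨h.off_c huv nuv, h.off_c hvw nvw⟩
  -- the choice of a corner
  have main : ∀ p q r, ({p, q, r} : Set Pt) = {a, b, c} →
      {d | d ∈ openSeg (q, r) ∧ ¬ Splits e₀ k₀ D D' (touch D a b c) p q r d}.Finite →
      v ∉ seg (p, q) → v ∉ seg (q, r) → v ∉ seg (p, r) → side p q r ≠ 0 →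
      side p v u ≠ 0 → side p v w ≠ 0 → Eqv D D' := by
    intro p q r hset hfin v1 v2 v3 h0 hsu hsw
    have hT : tri p q r = tri a b c := tri_perm hset
    have hp : p ∈ ({a, b, c} : Set Pt) := by rw [← hset]; simp
    have hq : q ∈ ({a, b, c} : Set Pt) := by rw [← hset]; simp
    have hr : r ∈ ({a, b, c} : Set Pt) := by rw [← hset]; simp
    obtain ⟨s, t, s0, t0, hst, he⟩ := mem_interior_tri (hT ▸ hv) v1 v2 v3
    by_cases hpos : 0 < side p q r * side p v u
    · exact h.eqv_of_vertex_side huv hvw hS hv hu hw hset hfin s0 t0 hst he h0 hpos hsw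
        (offv p hp).2 (offv q hq).2
    · refine h.eqv_of_vertex_side huv hvw hS hv hu hw (p := p) (q := r) (r := q) ?_ ?_ t0 s0
        (by linarith) ?_ ?_ ?_ hsw (offv p hp).2 (offv r hr).2
      · rw [← hset]; grind
      · refine hfin.subset fun d hd => ⟨by rw [openSeg_swap]; exact hd.1, fun hs => hd.2 hs.swap⟩
      · rw [he]; abel
      · rw [side_swap']; exact neg_ne_zero.2 h0
      · rw [side_swap' p q r, neg_mul]
        have := lt_of_le_of_ne (not_lt.1 hpos) (mul_ne_zero h0 hsu)
        linarith
  have hab0 := h.nondeg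
  have two : ∀ p q z, side p q v ≠ 0 → z ≠ v → side p v z = 0 → side q v z ≠ 0 := by
    intro p q z hpq hz h1 h2
    apply hz
    simp only [side_eq] at h1 h2 hpq
    have e1 : ((q.1 - p.1) * (v.2 - p.2) - (q.2 - p.2) * (v.1 - p.1)) * (z.1 - v.1) = 0 := by
      linear_combination (v.1 - q.1) * h1 - (v.1 - p.1) * h2
    have e2 : ((q.1 - p.1) * (v.2 - p.2) - (q.2 - p.2) * (v.1 - p.1)) * (z.2 - v.2) = 0 := by
      linear_combination (v.2 - q.2) * h1 - (v.2 - p.2) * h2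
    have e1 := (mul_eq_zero.1 e1).resolve_left hpq
    have e2 := (mul_eq_zero.1 e2).resolve_left hpq
    ext <;> linarith
  obtain ⟨s, t, s0, t0, hst, he⟩ := mem_interior_tri hv vab (by rwa [seg_swap]) vac
  have sab : side a b v ≠ 0 := by
    have : side a b v = t * side a b c := by
      rw [he]
      simp only [side_eq, Prod.fst_add, Prod.snd_add, Prod.smul_fst, Prod.smul_snd, Prod.fst_sub,
        Prod.snd_sub, smul_eq_mul]; ring
    rw [this]; exact mul_ne_zero t0.ne' hab0
  have sac : side a c v ≠ 0 := by
    have : side a c v = - s * side a b c := by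
      rw [he]
      simp only [side_eq, Prod.fst_add, Prod.snd_add, Prod.smul_fst, Prod.smul_snd, Prod.fst_sub,
        Prod.snd_sub, smul_eq_mul]; ring
    rw [this]; exact mul_ne_zero (neg_ne_zero.2 s0.ne') hab0
  have sbc : side b c v ≠ 0 := by
    have : side b c v = (1 - s - t) * side a b c := by
      rw [he]
      simp only [side_eq, Prod.fst_add, Prod.snd_add, Prod.smul_fst, Prod.smul_snd, Prod.fst_sub,
        Prod.snd_sub, smul_eq_mul]; ring
    rw [this]; exact mul_ne_zero (by linarith) hab0
  have uv : u ≠ v := hP.ne huv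
  have wv : w ≠ v := (hP.ne hvw).symm
  have A := main a b c rfl h.finite_not_splits_a vab (by rwa [seg_swap]) vac hab0
  have B := main b a c (by ext; simp only [mem_insert_iff, mem_singleton_iff]; tauto) h.finite_not_splits_b (by rwa [seg_swap]) vac (by rwa [seg_swap])
    (by rw [side_swap]; exact neg_ne_zero.2 hab0)
  have C := main c a b (by ext; simp only [mem_insert_iff, mem_singleton_iff]; tauto) h.finite_not_splits_c (by rwa [seg_swap]) vab vcb
    (by rw [← side_cycle]; exact hab0)
  by_cases u1 : side a v u = 0
  · have u2 := two a b u sab uv u1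
    have u3 := two a c u sac uv u1
    by_cases w2 : side b v w = 0
    · exact C u3 (two b c w sbc wv w2)
    · exact B u2 w2
  · by_cases w1 : side a v w = 0
    · have w2 := two a b w sab wv w1
      have w3 := two a c w sac wv w1
      by_cases u2 : side b v u = 0
      · exact C (two b c u sbc uv u2) w3
      · exact B u2 w2
    · exact A u1 w1

/-- **The detour move.** Pushing an edge with virtual crossings (and possibly one real crossing, with
an edge running through the triangle) across a triangle does not change the link. -/
theorem Tri.eqv (h : Tri e₀ k₀ D D' a b c) : Eqv D D' := by
  have hP := D.poly
  set H := touch D a b c with hH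
  have hfin : H.Finite := D.finite.subset fun g hg => hg.1
  have hHD : ∀ g ∈ H, g ∈ D.E := fun g hg => hg.1
  have ev1 : ∀ᶠ δ : ℝ in 𝓝[>] 0, ∀ g₁ ∈ H, ∀ g₂ ∈ H, ∀ g₃ ∈ H, g₁ ≠ g₂ → g₁ ≠ g₃ → g₂ ≠ g₃ →
      ∀ p x y z, dist x p < δ → dist y p < δ → dist z p < δ → x ∈ seg g₁ → y ∈ seg g₂ → z ∉ seg g₃ := by
    refine (eventually_all_finite hfin).2 fun g₁ h₁ => (eventually_all_finite hfin).2 fun g₂ h₂ =>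
      (eventually_all_finite hfin).2 fun g₃ h₃ => ?_
    by_cases hne : g₁ ≠ g₂ ∧ g₁ ≠ g₃ ∧ g₂ ≠ g₃
    · filter_upwards [eventually_no_ball (isCompact_seg g₁) (isCompact_seg g₂) (isCompact_seg g₃)
        (fun x x1 x2 x3 => hP.triple (hHD _ h₁) (hHD _ h₂) (hHD _ h₃) hne.1 hne.2.1 hne.2.2 x1 x2 x3)]
        with δ hδ _ _ _
      exact hδ
    · exact Eventually.of_forall fun δ n1 n2 n3 => absurd ⟨n1, n2, n3⟩ hne
  have ev2 : ∀ᶠ δ : ℝ in 𝓝[>] 0, ∀ g₁ ∈ H, ∀ g₂ ∈ H, ∀ q, (q = g₁.1 ∨ q = g₁.2) → q ∉ seg g₂ →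
      ∀ p z, dist q p < δ → dist z p < δ → z ∉ seg g₂ := by
    have aux : ∀ q : Pt, ∀ g₂ : Edge, q ∉ seg g₂ → ∀ᶠ δ : ℝ in 𝓝[>] 0,
        ∀ p z, dist q p < δ → dist z p < δ → z ∉ seg g₂ := by
      intro q g₂ hq
      filter_upwards [eventually_no_ball (isCompact_singleton (x := q)) (isCompact_seg g₂)
        (isCompact_seg g₂) (by rintro x rfl x2; exact absurd x2 hq)] with δ hδ p z h1 h2 h3
      exact hδ p q z z h1 h2 h2 rfl h3 h3
    refine (eventually_all_finite hfin).2 fun g₁ h₁ => (eventually_all_finite hfin).2 fun g₂ h₂ => ?_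
    have b1 : ∀ᶠ δ : ℝ in 𝓝[>] 0, g₁.1 ∉ seg g₂ → ∀ p z, dist g₁.1 p < δ → dist z p < δ →
        z ∉ seg g₂ := by
      by_cases hq : g₁.1 ∈ seg g₂
      · exact Eventually.of_forall fun δ h => absurd hq h
      · filter_upwards [aux _ _ hq] with δ hδ _; exact hδ
    have b2 : ∀ᶠ δ : ℝ in 𝓝[>] 0, g₁.2 ∉ seg g₂ → ∀ p z, dist g₁.2 p < δ → dist z p < δ →
        z ∉ seg g₂ := by
      by_cases hq : g₁.2 ∈ seg g₂
      · exact Eventually.of_forall fun δ h => absurd hq h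
      · filter_upwards [aux _ _ hq] with δ hδ _; exact hδ
    filter_upwards [b1, b2] with δ d1 d2
    rintro q (rfl | rfl)
    · exact d1
    · exact d2
  obtain ⟨δ, ⟨hδ1, hδ2⟩, hδ0⟩ := ((ev1.and ev2).and self_mem_nhdsWithin).exists
  have hδ0 : 0 < δ := hδ0
  refine h.eqv_of_small (ε := δ ^ 2) (by positivity) (H := H) (T := univ) ?_ Subset.rfl (subset_univ _)
  intro D₁ D₁' a₁ b₁ c₁ h1 hH1 _ hq
  by_cases hsub : (touch D₁ a₁ b₁ c₁).Subsingleton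
  · exact h1.eqv_of_subsingleton hsub
  rw [Set.not_subsingleton_iff] at hsub
  obtain ⟨g, hg, g', hg', hgg⟩ := hsub
  have near : ∀ x ∈ tri a₁ b₁ c₁, dist x a₁ < δ := fun x hx => tri_dist_lt hδ0 hq hx
  have hS : touch D₁ a₁ b₁ c₁ ⊆ {g, g'} := by
    intro f hf
    by_contra hcon
    simp only [mem_insert_iff, mem_singleton_iff, not_or] at hcon
    obtain ⟨x, ⟨hx, hxT⟩, -⟩ := not_subset.1 hg.2.2
    obtain ⟨y, ⟨hy, hyT⟩, -⟩ := not_subset.1 hg'.2.2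
    obtain ⟨z, ⟨hz, hzT⟩, -⟩ := not_subset.1 hf.2.2
    exact hδ1 g (hH1 hg) g' (hH1 hg') f (hH1 hf) hgg (Ne.symm hcon.1) (Ne.symm hcon.2) a₁ x y z
      (near x hxT) (near y hyT) (near z hzT) hx hy hz
  by_cases hz : ∃ z ∈ tri a₁ b₁ c₁, z ∈ seg g ∧ z ∈ seg g'
  swap
  · refine h1.eqv_of_disjoint fun f hf f' hf' hff x hxT h1 h2 => hz ⟨x, hxT, ?_⟩
    rcases hS hf with rfl | rfl <;> rcases hS hf' with rfl | rfl
    · exact absurd rfl hff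
    · exact ⟨h1, h2⟩
    · exact ⟨h2, h1⟩
    · exact absurd rfl hff
  obtain ⟨z, hzT, hzg, hzg'⟩ := hz
  have far : ∀ f ∈ H, ∀ f' ∈ H, z ∈ seg f' → ∀ q, (q = f.1 ∨ q = f.2) → q ∉ seg f' →
      q ∉ tri a₁ b₁ c₁ := fun f hf f' hf' hzf' q hq hqf hqT =>
    hδ2 f hf f' hf' q hq hqf a₁ z (near q hqT) (near z hzT) hzf'
  have hgH := hH1 hg
  have hgH' := hH1 hg'
  have uniq : ∀ q ∈ seg g, q ∈ seg g' → q = z := fun q q1 q2 =>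
    hP.inter_unique (hHD _ hgH) (hHD _ hgH') hgg q1 q2 hzg hzg'
  have vert : ∀ f f', f ∈ touch D₁ a₁ b₁ c₁ → f' ∈ touch D₁ a₁ b₁ c₁ → f ≠ f' → touch D₁ a₁ b₁ c₁ ⊆ {f, f'} →
      z ∈ seg f → z ∈ seg f' → z = f.2 → z = f'.1 → Eqv D₁ D₁' := by
    intro f f' hf hf' hff hSf zf zf' z1 z2
    have un : ∀ q ∈ seg f, q ∈ seg f' → q = z := fun q q1 q2 =>
      hP.inter_unique (hHD _ (hH1 hf)) (hHD _ (hH1 hf')) hff q1 q2 zf zf'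
    obtain ⟨u, v⟩ := f
    obtain ⟨v', w⟩ := f'
    simp only at z1 z2
    subst z1
    subst z2
    refine h1.eqv_of_vertex hf.1 hf'.1 hSf hzT ?_ ?_
    · refine far _ (hH1 hf) _ (hH1 hf') zf' u (Or.inl rfl) fun hx => ?_
      exact D₁.poly.ne hf.1 (un u (left_mem_seg (u, z)) hx)
    · refine far _ (hH1 hf') _ (hH1 hf) zf w (Or.inr rfl) fun hx => ?_
      exact D₁.poly.ne hf'.1 (un w hx (right_mem_seg (z, w))).symm
  rcases D₁.poly.mem_both hg.1 hg'.1 hgg hzg hzg' with hc | ⟨z1, z2⟩ | ⟨z1, z2⟩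
  · have e1 : ∀ q, (q = g.1 ∨ q = g.2) → q ∉ tri a₁ b₁ c₁ := by
      intro q hq
      have hqg : q ∈ seg g := by
        rcases hq with rfl | rfl
        · exact left_mem_seg _
        · exact right_mem_seg _
      refine far g hgH g' hgH' hzg' q hq fun hx => ?_
      have := uniq q hqg hx
      subst this
      rcases hq with rfl | rfl
      · exact D₁.poly.left_notMem hg.1 hg.1 hc.2.2.2.1
      · exact D₁.poly.right_notMem hg.1 hg.1 hc.2.2.2.1
    have e2 : ∀ q, (q = g'.1 ∨ q = g'.2) → q ∉ tri a₁ b₁ c₁ := by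
      intro q hq
      have hqg : q ∈ seg g' := by
        rcases hq with rfl | rfl
        · exact left_mem_seg _
        · exact right_mem_seg _
      refine far g' hgH' g hgH hzg q hq fun hx => ?_
      have := uniq q hx hqg
      subst this
      rcases hq with rfl | rfl
      · exact D₁.poly.left_notMem hg'.1 hg'.1 hc.2.2.2.2
      · exact D₁.poly.right_notMem hg'.1 hg'.1 hc.2.2.2.2
    exact h1.eqv_of_cross hS hc hzT hg.2.1 (e1 _ (Or.inl rfl)) (e1 _ (Or.inr rfl)) hg'.2.1
      (e2 _ (Or.inl rfl)) (e2 _ (Or.inr rfl))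
  · exact vert g' g hg' hg hgg.symm (by rwa [pair_comm]) hzg' hzg z2 z1
  · exact vert g g' hg hg' hgg hS hzg hzg' z1 z2

end
end STLink

namespace STLink
open Set Filter Topology MeasureTheory

lemma ae_side_ne_zero {p q : Pt} (h : p ≠ q) : ∀ᵐ c : Pt, side p q c ≠ 0 := by
  let L : Pt →ₗ[ℝ] ℝ :=
    { toFun := fun v => det (q - p) v
      map_add' := fun u v => by simp [det]; ring
      map_smul' := fun r v => by simp [det]; ring }
  have hker : LinearMap.ker L ≠ ⊤ := by
    intro ht
    have h1 : ∀ v, L v = 0 := fun v => by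
      have : v ∈ LinearMap.ker L := ht ▸ Submodule.mem_top
      exact this
    have a1 := h1 (0, 1)
    have a2 := h1 (1, 0)
    simp only [L, LinearMap.coe_mk, AddHom.coe_mk, det, Prod.fst_sub, Prod.snd_sub] at a1 a2
    apply h
    ext <;> linarith
  have h0 : volume ((LinearMap.ker L : Submodule ℝ Pt) : Set Pt) = 0 :=
    Measure.addHaar_submodule volume _ hker
  rw [ae_iff]
  have : {c : Pt | ¬ side p q c ≠ 0} = (fun c => c + -p) ⁻¹' ((LinearMap.ker L : Submodule ℝ Pt) : Set Pt) := by
    ext c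
    simp [L, side, sub_eq_add_neg]
  rw [this, measure_preimage_add_right, h0]

lemma ae_ne (p : Pt) : ∀ᵐ c : Pt, c ≠ p := by
  have : p ≠ p + (1, 0) := by intro h; have := congrArg Prod.fst h; simp at this
  filter_upwards [ae_side_ne_zero this] with c hc
  rintro rfl
  simp at hc

lemma exists_of_ae {P : Pt → Prop} (h : ∀ᵐ c : Pt, P c) {U : Set Pt} (hU : IsOpen U)
    (hne : U.Nonempty) : ∃ c ∈ U, P c := by
  obtain ⟨c, h1, h2⟩ := (Measure.dense_of_ae h).exists_mem_open hU hne
  exact ⟨c, h2, h1⟩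

lemma Poly.finite_cross {E : Set Edge} (hE : Poly E) : {x | ∃ f g, CrossAt E f g x}.Finite := by
  have : {x | ∃ f g, CrossAt E f g x} ⊆ ⋃ f ∈ E, ⋃ g ∈ E, {x | CrossAt E f g x} := by
    rintro x ⟨f, g, hx⟩
    simp only [mem_iUnion]
    exact ⟨f, hx.1, g, hx.2.1, hx⟩
  refine (hE.finite.biUnion fun f _ => hE.finite.biUnion fun g _ => ?_).subset this
  exact (show ({x | CrossAt E f g x}).Subsingleton from
    fun _ hx _ hy => hE.cross_unique hx hy).finite

/-- Almost all segments from a point are clear. -/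
lemma Poly.ae_clear {E : Set Edge} (hE : Poly E) (p : Pt) : ∀ᵐ c : Pt, Clear E p c := by
  have h1 : ∀ᵐ c : Pt, ∀ f ∈ E, side f.1 f.2 c ≠ 0 :=
    (ae_ball_iff hE.finite.countable).2 fun f hf => ae_side_ne_zero (hE.ne hf)
  have h2 : ∀ z : Pt, ∀ᵐ c : Pt, z ≠ p → side p z c ≠ 0 := by
    intro z
    by_cases hz : z = p
    · exact Eventually.of_forall fun c h => absurd hz h
    · filter_upwards [ae_side_ne_zero (Ne.symm hz)] with c hc _; exact hc
  have h3 : ∀ᵐ c : Pt, ∀ f ∈ E, f.1 ≠ p → side p f.1 c ≠ 0 :=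
    (ae_ball_iff hE.finite.countable).2 fun f hf => h2 f.1
  have h4 : ∀ᵐ c : Pt, ∀ f ∈ E, f.2 ≠ p → side p f.2 c ≠ 0 :=
    (ae_ball_iff hE.finite.countable).2 fun f hf => h2 f.2
  have h5 : ∀ᵐ c : Pt, ∀ x ∈ {x | ∃ f g, CrossAt E f g x}, x ≠ p → side p x c ≠ 0 :=
    (ae_ball_iff hE.finite_cross.countable).2 fun x hx => h2 x
  filter_upwards [h1, h3, h4, h5, ae_ne p] with c c1 c3 c4 c5 c6
  have key : ∀ z, z ∈ seg (p, c) → side p z c = 0 := fun z hz => by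
    rw [side_swap', side_of_mem_seg hz, neg_zero]
  refine ⟨fun f hf h => c1 f hf (side_of_mem_seg h), fun f hf h => ?_, fun f hf h => ?_,
    fun f g x hx h => ?_⟩
  · by_contra hne; exact c3 f hf hne (key _ h)
  · by_contra hne; exact c4 f hf hne (key _ h)
  · exact c5 x ⟨f, g, hx⟩ (ne_of_mem_openSeg (Ne.symm c6) h).1 (key _ (openSeg_subset_seg _ h))

lemma Tri.canon_of_old {e₀ : Edge} {k₀ : Kind} {D : Diagram} {a b : Pt}
    (old : ∀ g x, CrossAt D.E (a, b) g x → D.kind x = moverKind e₀ k₀ g) :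
    Canon (D.E \ {(a, b)}) D.kind e₀ k₀ D where
  env e f x _ _ _ := rfl
  mover e f x hx he := by
    have : e = (a, b) := by
      by_contra hne; exact he ⟨hx.1, hne⟩
    subst this
    exact ⟨⟨hx.2.1, hx.2.2.1.symm⟩, old f x hx⟩

/-- An edge can be pushed across a triangle with a generic apex. -/
lemma Diagram.exists_tri (D : Diagram) {e₀ : Edge} {k₀ : Kind} {a b c : Pt} (hab : (a, b) ∈ D.E)
    (ha : a ∉ D.bars) (hb : b ∉ D.bars) (hs : side a b c ≠ 0)
    (cla : Clear (D.E \ {(a, b)}) a c) (clb : Clear (D.E \ {(a, b)}) b c)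
    (old : ∀ g x, CrossAt D.E (a, b) g x → D.kind x = moverKind e₀ k₀ g)
    (hr : k₀ ≠ .virtual → e₀ ∈ D.E ∧ (e₀.1 ∉ tri a b c ∧ e₀.2 ∉ tri a b c) ∧
      side e₀.1 e₀.2 a * side e₀.1 e₀.2 b < 0 ∧
      ∀ g z, CrossAt D.E e₀ g z → g ≠ (a, b) → D.kind z = .virtual) :
    ∃ D', Tri e₀ k₀ D D' a b c := by
  have hC := Tri.canon_of_old old
  have hdv : ∀ f ∈ D.E, f.1 ≠ c ∧ f.2 ≠ c := by
    intro f hf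
    obtain ⟨-, n2, n3⟩ := ne_of_side hs
    by_cases hfab : f = (a, b)
    · subst hfab; exact ⟨n3, n2⟩
    · exact ⟨fun h' => cla.off f ⟨hf, hfab⟩ (h' ▸ left_mem_seg _),
        fun h' => cla.off f ⟨hf, hfab⟩ (h' ▸ right_mem_seg _)⟩
  have hE₀ : k₀ ≠ .virtual → e₀ ∈ D.E \ {(a, b)} := fun hk => ⟨(hr hk).1, by
    rintro rfl; exact (hr hk).2.1.1 (tri_left _ _ _)⟩
  obtain ⟨D', hE, hB, hC'⟩ := hC.exists_rep hab (by simp) (D.poly.rep_of_side hab cla clb hs) hs hdv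
    (fun f hf => hdv f hf.1) (fun g hg hg' hne => absurd ⟨hg, hne⟩ hg')
    (fun hk => ⟨(hr hk).1, hE₀ hk⟩)
  refine ⟨D', Tri.of_canon hC hC' hab (by simp) (fun h => (hdv _ h.1).2 rfl)
    (fun h => (hdv _ h.1).1 rfl) hs hE hB ha hb (fun g hg hg' hne => absurd ⟨hg, hne⟩ hg') fun hk => ?_⟩
  obtain ⟨r1, r2, r3, r4⟩ := hr hk
  exact ⟨r1, hE₀ hk, r2.1, r2.2, fun _ => r3, fun g z hz hg _ => r4 g z hz hg.2⟩

/-- A generic apex can be chosen in any open set. -/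
lemma Diagram.exists_apex (D : Diagram) {a b : Pt} (hab : (a, b) ∈ D.E) {U : Set Pt} (hU : IsOpen U)
    (hne : U.Nonempty) : ∃ c ∈ U, side a b c ≠ 0 ∧ Clear (D.E \ {(a, b)}) a c ∧
      Clear (D.E \ {(a, b)}) b c := by
  have hP := D.poly.mono (sdiff_subset (s := D.E) (t := {(a, b)}))
  refine exists_of_ae ?_ hU hne
  filter_upwards [ae_side_ne_zero (D.poly.ne hab), hP.ae_clear a, hP.ae_clear b] with c h1 h2 h3
  exact ⟨h1, h2, h3⟩

end STLink

namespace STLink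
open Set Filter Topology

/-- A descending edge in the open strip between the heights `0` and `1`. -/
def Good (e : Edge) : Prop := 0 < e.2.2 ∧ e.2.2 < e.1.2 ∧ e.1.2 < 1

open Classical in
/-- The edge that contains an edge of a subdivision. -/
noncomputable def par (a b c : Pt) (g : Edge) : Edge := if g = (a, c) ∨ g = (c, b) then (a, b) else g

lemma snd_mem_openSeg {a b x : Pt} (hx : x ∈ openSeg (a, b)) :
    ∃ t, 0 < t ∧ t < 1 ∧ x.2 = a.2 + t * (b.2 - a.2) := by
  obtain ⟨t, h0, h1, rfl⟩ := mem_openSeg.1 hx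
  exact ⟨t, h0, h1, by simp⟩

lemma Good.par {a b c : Pt} (hc : c ∈ openSeg (a, b)) {g : Edge} (h : Good (par a b c g)) : Good g := by
  unfold STLink.par at h
  split_ifs at h with hg
  · obtain ⟨t, h0, h1, ht⟩ := snd_mem_openSeg hc
    obtain ⟨g1, g2, g3⟩ := h
    dsimp only at g1 g2 g3
    have : 0 < t * (a.2 - b.2) := mul_pos h0 (by linarith)
    have : 0 < (1 - t) * (a.2 - b.2) := mul_pos (by linarith) (by linarith)
    rcases hg with rfl | rfl
    · exact ⟨by simp only; nlinarith, by simp only; nlinarith, g3⟩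
    · exact ⟨g1, by simp only; nlinarith, by simp only; nlinarith⟩
  · exact h

lemma CrossAt.par {E : Set Edge} {a b c : Pt} (hE : Poly E) (hab : (a, b) ∈ E)
    (hc : c ∈ openSeg (a, b)) {g h : Edge} {y : Pt} (hy : CrossAt (rep E a b c) g h y) :
    CrossAt E (par a b c g) (par a b c h) y := by
  have hne := hE.ne hab
  obtain ⟨s1, s2⟩ := openSeg_subset_of_mem hne hc
  have n := ne_of_mem_openSeg hne hc
  have key : ∀ {g : Edge}, g ∈ rep E a b c → y ∈ openSeg g →
      STLink.par a b c g ∈ E ∧ y ∈ openSeg (STLink.par a b c g) := by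
    intro g hg hyg
    unfold STLink.par
    split_ifs with h
    · rcases h with rfl | rfl
      · exact ⟨hab, s1 hyg⟩
      · exact ⟨hab, s2 hyg⟩
    · rcases mem_rep.1 hg with h1 | h1 | h1
      · exact ⟨h1.1, hyg⟩
      · exact absurd (Or.inl h1) h
      · exact absurd (Or.inr h1) h
  have k1 := key hy.1 hy.2.2.2.1
  have k2 := key hy.2.1 hy.2.2.2.2
  refine ⟨k1.1, k2.1, ?_, k1.2, k2.2⟩
  intro heq
  have hin : ∀ z, z ∈ openSeg (a, c) → z ∉ openSeg (c, b) := fun z h1 h2 =>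
    (ne_of_mem_openSeg n.1.symm h1).2 (seg_inter_of_mem_openSeg hne hc (openSeg_subset_seg _ h1)
      (openSeg_subset_seg _ h2))
  have hm : ∀ {g h : Edge}, g ∈ rep E a b c → (h = (a, c) ∨ h = (c, b)) → ¬ (g = (a, c) ∨ g = (c, b)) →
      STLink.par a b c g = STLink.par a b c h → False := by
    intro g h hg hh hgn he
    simp only [STLink.par, hh, hgn, if_true, if_false] at he
    rcases mem_rep.1 hg with h1 | h1
    · exact h1.2 he
    · exact hgn h1
  by_cases h1 : g = (a, c) ∨ g = (c, b) <;> by_cases h2 : h = (a, c) ∨ h = (c, b)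
  · rcases h1 with rfl | rfl <;> rcases h2 with rfl | rfl
    · exact hy.2.2.1 rfl
    · exact hin y hy.2.2.2.1 hy.2.2.2.2
    · exact hin y hy.2.2.2.2 hy.2.2.2.1
    · exact hy.2.2.1 rfl
  · exact hm hy.2.1 h1 h2 heq.symm
  · exact hm hy.1 h2 h1 heq
  · simp only [STLink.par, h1, h2, if_false] at heq
    exact hy.2.2.1 heq

/-- `e` and `f` cross at `x`, and any other real crossing lies in `B` or on two good edges. -/
structure Pre (B : Set Pt) (D : Diagram) (e f : Edge) (x : Pt) : Prop where
  cross : CrossAt D.E e f x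
  good : ∀ g h y, CrossAt D.E g h y → y ≠ x → D.kind y ≠ .virtual → (Good g ∧ Good h) ∨ y ∈ B

/-- Moreover all the other crossings of `e` and `f` are virtual, and their ends carry no bars. -/
structure Isolated (B : Set Pt) (D : Diagram) (e f : Edge) (x : Pt) : Prop extends Pre B D e f x where
  fst : ∀ g y, CrossAt D.E e g y → y ≠ x → D.kind y = .virtual
  snd : ∀ g y, CrossAt D.E f g y → y ≠ x → D.kind y = .virtual
  bar_fst : e.1 ∉ D.bars ∧ e.2 ∉ D.bars
  bar_snd : f.1 ∉ D.bars ∧ f.2 ∉ D.bars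

variable {B : Set Pt} {D : Diagram} {e f : Edge} {x : Pt}

lemma Pre.symm (h : Pre B D e f x) : Pre B D f e x := ⟨h.cross.symm, h.good⟩

lemma Isolated.symm (h : Isolated B D e f x) : Isolated B D f e x :=
  ⟨h.toPre.symm, h.snd, h.fst, h.bar_snd, h.bar_fst⟩

lemma notMem_bars_of_openSeg {a b c : Pt} (hab : (a, b) ∈ D.E) (hc : c ∈ openSeg (a, b)) :
    c ∉ D.bars := by
  intro h
  obtain ⟨e, he, rfl⟩ := D.bars_vertex c h
  exact D.poly.left_notMem he hab hc

lemma Pre.cut {a b c : Pt} {e' : Edge} (h : Pre B D (a, b) f x) (hc : c ∈ openSeg (a, b))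
    (hoff : ∀ f ∈ D.E, f ≠ (a, b) → c ∉ seg f) (he' : e' = (a, c) ∨ e' = (c, b))
    (hx : x ∈ openSeg e') : ∃ D' : Diagram, Eqv D D' ∧ D'.bars = D.bars ∧ D'.kind = D.kind ∧
      Pre B D' e' f x ∧ (∀ g y, CrossAt D'.E e' g y → ∃ g', CrossAt D.E (a, b) g' y) ∧
      (∀ g y, CrossAt D'.E f g y → ∃ g', CrossAt D.E f g' y) ∧ c ∉ D.bars := by
  have hab := h.cross.1
  obtain ⟨D', hE, hB, hK, hD⟩ := D.exists_subdivide hab hc hoff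
  have hf : ¬ (f = (a, c) ∨ f = (c, b)) := by
    intro hf
    have : c ∈ seg f := by rcases hf with rfl | rfl; exacts [right_mem_seg _, left_mem_seg _]
    exact hoff f h.cross.2.1 h.cross.2.2.1.symm this
  have lift : ∀ {g k y}, CrossAt D'.E g k y → CrossAt D.E (par a b c g) (par a b c k) y := fun hy =>
    CrossAt.par D.poly hab hc (hE ▸ hy)
  refine ⟨D', hD, hB, hK, ⟨⟨?_, ?_, ?_, hx, h.cross.2.2.2.2⟩, fun g k y hy hne hk => ?_⟩,
    fun g y hy => ?_, fun g y hy => ?_, notMem_bars_of_openSeg hab hc⟩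
  · rw [hE, mem_rep]; exact Or.inr he'
  · rw [hE, mem_rep]; exact Or.inl ⟨h.cross.2.1, h.cross.2.2.1.symm⟩
  · rintro rfl; exact hf he'
  · rcases h.good _ _ y (lift hy) hne (hK ▸ hk) with h1 | h1
    · exact Or.inl ⟨h1.1.par hc, h1.2.par hc⟩
    · exact Or.inr h1
  · have := lift hy
    rw [show par a b c e' = (a, b) by simp [par, he']] at this
    exact ⟨_, this⟩
  · have := lift hy
    rw [show par a b c f = f by simp [par, hf]] at this
    exact ⟨_, this⟩

lemma Pre.shrink {p q : Pt} (h : Pre B D (p, q) f x) {ε : ℝ} (hε : 0 < ε) :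
    ∃ (D' : Diagram) (p' q' : Pt), Eqv D D' ∧ D'.bars = D.bars ∧ D'.kind = D.kind ∧
      Pre B D' (p', q') f x ∧ (∀ g y, CrossAt D'.E (p', q') g y → ∃ g', CrossAt D.E (p, q) g' y) ∧
      (∀ g y, CrossAt D'.E f g y → ∃ g', CrossAt D.E f g' y) ∧ (p' ∉ D.bars ∧ q' ∉ D.bars) ∧
      p' ∈ openSeg (x, p) ∧ q' ∈ openSeg (x, q) ∧ dist p' x < ε ∧ dist q' x < ε := by
  have hpq := D.poly.ne h.cross.1
  have hx := h.cross.2.2.2.1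
  have hn := ne_of_mem_openSeg hpq hx
  obtain ⟨p', p1, p2, p3⟩ := exists_param_near hn.1 (finite_on_edge D.poly h.cross.1) hε
  have p4 : p' ∈ openSeg (p, q) := (openSeg_subset_of_mem hpq hx).1 (by rwa [openSeg_swap])
  have hx' : x ∈ openSeg (p', q) := by
    rcases mem_openSeg_split p4 hx (ne_of_mem_openSeg hn.1 p1).1.symm with h1 | h1
    · exfalso
      have := seg_inter_of_mem_openSeg (a := x) (b := p) hn.1 p1 (left_mem_seg (x, p'))
        (by rw [seg_swap]; exact openSeg_subset_seg _ h1)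
      exact (ne_of_mem_openSeg hn.1 p1).1 this.symm
    · exact h1
  obtain ⟨D₁, e1, B1, K1, s1, l1, m1, b1⟩ := h.cut p4 (fun f hf hne hc => p3 ⟨p4, f, hf, hne, hc⟩)
    (Or.inr rfl) hx'
  have hpq' := D₁.poly.ne s1.cross.1
  have hn' := ne_of_mem_openSeg hpq' hx'
  obtain ⟨q', q1, q2, q3⟩ := exists_param_near hn'.2 (finite_on_edge D₁.poly s1.cross.1) hε
  have q4 : q' ∈ openSeg (p', q) := (openSeg_subset_of_mem hpq' hx').2 q1
  have hx'' : x ∈ openSeg (p', q') := by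
    rcases mem_openSeg_split q4 hx' (ne_of_mem_openSeg hn'.2 q1).1.symm with h1 | h1
    · exact h1
    · exfalso
      have := seg_inter_of_mem_openSeg (a := x) (b := q) hn'.2 q1 (left_mem_seg (x, q'))
        (openSeg_subset_seg _ h1)
      exact (ne_of_mem_openSeg hn'.2 q1).1 this.symm
  obtain ⟨D₂, e2, B2, K2, s2, l2, m2, b2⟩ := s1.cut q4 (fun f hf hne hc => q3 ⟨q4, f, hf, hne, hc⟩)
    (Or.inl rfl) hx''
  refine ⟨D₂, p', q', e1.trans e2, B2.trans B1, K2.trans K1, s2, fun g y hy => ?_, fun g y hy => ?_,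
    ⟨b1, by rwa [B1] at b2⟩, p1, q1, p2, q2⟩
  · obtain ⟨g', hg'⟩ := l2 g y hy; exact l1 g' y hg'
  · obtain ⟨g', hg'⟩ := m2 g y hy; exact m1 g' y hg'

lemma Isolated.shrink {p q : Pt} (h : Isolated B D (p, q) f x) {ε : ℝ} (hε : 0 < ε) :
    ∃ (D' : Diagram) (p' q' : Pt), Eqv D D' ∧ Isolated B D' (p', q') f x ∧
      p' ∈ openSeg (x, p) ∧ q' ∈ openSeg (x, q) ∧ dist p' x < ε ∧ dist q' x < ε := by
  obtain ⟨D', p', q', h1, hB, hK, h2, l, m, b, r⟩ := h.toPre.shrink hε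
  refine ⟨D', p', q', h1, ⟨h2, fun g y hy hne => ?_, fun g y hy hne => ?_, by rwa [hB],
    by rw [hB]; exact h.bar_snd⟩, r⟩
  · obtain ⟨g', hg'⟩ := l g y hy; rw [hK]; exact h.fst g' y hg' hne
  · obtain ⟨g', hg'⟩ := m g y hy; rw [hK]; exact h.snd g' y hg' hne

lemma exists_ball_notMem {S : Set Pt} (hS : S.Finite) (x : Pt) :
    ∃ ε > 0, ∀ y ∈ S, y ≠ x → ε ≤ dist y x := by
  have h1 : (S \ {x}).Finite := hS.subset sdiff_subset
  obtain ⟨ε, h2, h3⟩ := Metric.isOpen_iff.1 h1.isClosed.isOpen_compl x (by simp)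
  refine ⟨ε, h2, fun y hy hne => ?_⟩
  by_contra hlt
  exact h3 (Metric.mem_ball.2 (not_le.1 hlt)) ⟨hy, hne⟩

lemma dist_lt_of_mem_openSeg {p q x y : Pt} {ε : ℝ} (hp : dist p x < ε) (hq : dist q x < ε)
    (hy : y ∈ openSeg (p, q)) : dist y x < ε :=
  (seg_subset (convex_ball x ε) hp hq) (openSeg_subset_seg _ hy)

lemma Pre.isolate {p q r s : Pt} (h : Pre B D (p, q) (r, s) x) :
    ∃ (D' : Diagram) (e f : Edge), Eqv D D' ∧ Isolated B D' e f x := by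
  obtain ⟨ε, hε, hε1⟩ := exists_ball_notMem (finite_crossings D (p, q)) x
  obtain ⟨D₁, p', q', e1, B1, K1, s1, l1, m1, b1, -, -, p1, q1⟩ := h.shrink hε
  obtain ⟨δ, hδ, hδ1⟩ := exists_ball_notMem (finite_crossings D₁ (r, s)) x
  obtain ⟨D₂, r', s', e2, B2, K2, s2, l2, m2, b2, -, -, r1, t1⟩ := s1.symm.shrink hδ
  refine ⟨D₂, (p', q'), (r', s'), e1.trans e2, s2.symm, fun g y hy hne => ?_, fun g y hy hne => ?_, ?_, ?_⟩
  · exfalso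
    obtain ⟨g', hg'⟩ := m2 g y hy
    obtain ⟨g'', hg''⟩ := l1 g' y hg'
    exact not_lt.2 (hε1 y ⟨g'', hg''⟩ hne) (dist_lt_of_mem_openSeg p1 q1 hy.2.2.2.1)
  · exfalso
    obtain ⟨g', hg'⟩ := l2 g y hy
    exact not_lt.2 (hδ1 y ⟨g', hg'⟩ hne) (dist_lt_of_mem_openSeg r1 t1 hy.2.2.2.1)
  · rwa [B2, B1]
  · rwa [B2]

end STLink

namespace STLink
open Set Filter Topology

variable {B : Set Pt} {D : Diagram} {e f : Edge} {x : Pt}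

lemma CrossAt.side_mul_neg {E : Set Edge} (hE : Poly E) (h : CrossAt E e f x) :
    side f.1 f.2 e.1 * side f.1 f.2 e.2 < 0 := by
  have h0 : side f.1 f.2 x = 0 := side_of_mem_seg (openSeg_subset_seg _ h.2.2.2.2)
  have htr := hE.transverse h.1 h.2.1 h.2.2.1 h.2.2.2.1 h.2.2.2.2
  obtain ⟨t, h1, h2, ht⟩ := mem_openSeg.1 (show x ∈ openSeg (e.1, e.2) from h.2.2.2.1)
  rw [ht, side_add_smul] at h0
  have hd : det (dir e) (dir f) = side f.1 f.2 e.1 - side f.1 f.2 e.2 := by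
    simp only [det, dir, side, Prod.fst_sub, Prod.snd_sub]; ring
  rw [hd] at htr
  generalize side f.1 f.2 e.1 = u at *
  generalize side f.1 f.2 e.2 = v at *
  have hu : u ≠ 0 := by
    rintro rfl
    have : v = 0 := by
      rcases mul_eq_zero.1 (show t * v = 0 by linarith) with h | h
      · linarith
      · exact h
    exact htr (by rw [this]; ring)
  have : t * (u * v) = -(1 - t) * u ^ 2 := by linear_combination u * h0
  have h3 : 0 < (1 - t) * u ^ 2 := mul_pos (by linarith) (by positivity)
  by_contra hcon
  have := mul_nonneg h1.le (not_lt.1 hcon)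
  linarith

lemma Isolated.of_tri {D' : Diagram} {p q c : Pt} {e' e'' : Edge} (h : Isolated B D (p, q) f x)
    (T : Tri f (D.kind x) D D' p q c) (h1 : f.1 ∉ tri p q c) (h2 : f.2 ∉ tri p q c)
    (he : (e' = (p, c) ∧ e'' = (c, q)) ∨ (e' = (c, q) ∧ e'' = (p, c)))
    (hs' : side f.1 f.2 e'.1 * side f.1 f.2 e'.2 < 0)
    (hs'' : 0 < side f.1 f.2 e''.1 * side f.1 f.2 e''.2) : ∃ x', Isolated B D' e' f x' := by
  have hfn := h.cross.2.2.1.symm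
  have hf := h.cross.2.1
  have hf' := T.mem_of hf hfn
  have hK := convex_tri p q c
  obtain ⟨-, key⟩ := T.chord_sides hf hfn h1 h2 (openSeg_subset_seg _ h.cross.2.2.2.2)
    (seg_subset hK (tri_left _ _ _) (tri_mid _ _ _) (openSeg_subset_seg _ h.cross.2.2.2.1))
  have ends : e'.1 ∈ tri p q c ∧ e'.2 ∈ tri p q c ∧ e' ∈ D'.E ∧ e'.1 ∉ D.bars ∧ e'.2 ∉ D.bars := by
    rcases he with ⟨rfl, -⟩ | ⟨rfl, -⟩
    · exact ⟨tri_left _ _ _, tri_right _ _ _, T.mem₁, T.bar_a, T.bar_c⟩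
    · exact ⟨tri_right _ _ _, tri_mid _ _ _, T.mem₂, T.bar_c, T.bar_b⟩
  obtain ⟨x', -, hx'⟩ := Tri.cross_of_opp (p := e'.1) (q := e'.2) hK ends.1 ends.2.1 hf' ends.2.2.1
    (by rintro rfl; exact h1 ends.1) key hs'
  have new : ∀ g y, (CrossAt D'.E e' g y ∨ CrossAt D'.E e'' g y) →
      D'.kind y = moverKind f (D.kind x) g := by
    intro g y hy
    rcases he with ⟨rfl, rfl⟩ | ⟨rfl, rfl⟩ <;> rcases hy with hy | hy
    · exact T.new₁ g y hy
    · exact T.new₂ g y hy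
    · exact T.new₂ g y hy
    · exact T.new₁ g y hy
  have c1 : ∀ g y, CrossAt D'.E e' g y → y ≠ x' → D'.kind y = .virtual := by
    intro g y hy hne
    rw [new g y (Or.inl hy), moverKind, if_neg]
    rintro rfl
    exact hne (D'.poly.cross_unique hy hx')
  have c2 : ∀ g y, CrossAt D'.E e'' g y → D'.kind y = .virtual := by
    intro g y hy
    rw [new g y (Or.inr hy), moverKind, if_neg]
    rintro rfl
    have := CrossAt.side_mul_neg D'.poly hy
    linarith
  have old : ∀ {g}, g ∈ D'.E → g ≠ e' → g ≠ e'' → g ∈ D.E ∧ g ≠ (p, q) := by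
    intro g hg n1 n2
    rw [T.edges, mem_rep] at hg
    rcases hg with hg | rfl | rfl
    · exact hg
    · rcases he with ⟨rfl, rfl⟩ | ⟨rfl, rfl⟩
      · exact absurd rfl n1
      · exact absurd rfl n2
    · rcases he with ⟨rfl, rfl⟩ | ⟨rfl, rfl⟩
      · exact absurd rfl n2
      · exact absurd rfl n1
  have nx : ∀ {g k y}, CrossAt D'.E g k y → g ≠ e' → g ≠ e'' → k ≠ e' → k ≠ e'' →
      CrossAt D.E g k y ∧ y ≠ x ∧ D'.kind y = D.kind y := by
    intro g k y hy n1 n2 n3 n4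
    have o1 := old hy.1 n1 n2
    have o2 := old hy.2.1 n3 n4
    have hyD := hy.mono o1.1 o2.1
    refine ⟨hyD, ?_, T.keeps _ _ _ hyD hy⟩
    rintro rfl
    exact D.poly.triple o1.1 o2.1 h.cross.1 hy.2.2.1 o1.2 o2.2 (openSeg_subset_seg _ hy.2.2.2.1)
      (openSeg_subset_seg _ hy.2.2.2.2) (openSeg_subset_seg _ h.cross.2.2.2.1)
  refine ⟨x', ⟨hx', fun g k y hy hne hk => ?_⟩, c1, fun g y hy hne => ?_, ?_, ?_⟩
  · by_cases n1 : g = e'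
    · subst n1; exact absurd (c1 _ _ hy hne) hk
    by_cases n2 : g = e''
    · subst n2; exact absurd (c2 _ _ hy) hk
    by_cases n3 : k = e'
    · subst n3; exact absurd (c1 _ _ hy.symm hne) hk
    by_cases n4 : k = e''
    · subst n4; exact absurd (c2 _ _ hy.symm) hk
    obtain ⟨a1, a2, a3⟩ := nx hy n1 n2 n3 n4
    exact h.good g k y a1 a2 (a3 ▸ hk)
  · by_cases n3 : g = e'
    · subst n3; exact c1 _ _ hy.symm hne
    by_cases n4 : g = e''
    · subst n4; exact c2 _ _ hy.symm
    have nf1 : f ≠ e' := by rintro rfl; exact hx'.2.2.1 rfl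
    have nf2 : f ≠ e'' := by
      rintro rfl
      rcases he with ⟨-, rfl⟩ | ⟨-, rfl⟩
      · exact h1 (tri_right _ _ _)
      · exact h1 (tri_left _ _ _)
    obtain ⟨a1, a2, a3⟩ := nx hy nf1 nf2 n3 n4
    rw [a3]; exact h.snd g y a1 a2
  · rw [T.bars]; exact ends.2.2.2
  · rw [T.bars]; exact h.bar_snd

lemma mul_neg_of_mul_neg {u v w : ℝ} (h : u * v < 0) (h' : 0 < w * v) : u * w < 0 := by
  rcases mul_neg_iff.1 h with ⟨h1, h2⟩ | ⟨h1, h2⟩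
  · exact mul_neg_of_pos_of_neg h1 (neg_of_mul_pos_left h' h2.le)
  · exact mul_neg_of_neg_of_pos h1 (pos_of_mul_pos_left h' h2.le)

lemma Isolated.push {p q : Pt} (h : Isolated B D (p, q) f x) {U : Set Pt} (hU : IsOpen U)
    (hne : U.Nonempty) (hend : ∀ c ∈ U, f.1 ∉ tri p q c ∧ f.2 ∉ tri p q c) :
    ∃ c ∈ U, ∃ D', Eqv D D' ∧
      (0 < side f.1 f.2 c * side f.1 f.2 q → ∃ x', Isolated B D' (p, c) f x') ∧
      (0 < side f.1 f.2 c * side f.1 f.2 p → ∃ x', Isolated B D' (c, q) f x') := by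
  obtain ⟨c, hc, hs, ca, cb⟩ := D.exists_apex h.cross.1 hU hne
  have hopp := h.cross.side_mul_neg D.poly
  have hpoint : ∀ g y, CrossAt D.E (p, q) g y → g ≠ f → y ≠ x := by
    rintro g y hy hg rfl; exact hg (D.generic.no_triple _ _ _ _ hy h.cross)
  obtain ⟨D', T⟩ := D.exists_tri (e₀ := f) (k₀ := D.kind x) h.cross.1 h.bar_fst.1 h.bar_fst.2 hs ca cb
    (fun g y hy => by
      unfold moverKind
      split_ifs with hg
      · subst hg; rw [D.poly.cross_unique hy h.cross]
      · exact h.fst g y hy (hpoint g y hy hg))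
    (fun _ => ⟨h.cross.2.1, hend c hc, hopp, fun g z hz hg => h.snd g z hz (by
      rintro rfl; exact hg (D.generic.no_triple _ _ _ _ hz h.cross.symm))⟩)
  obtain ⟨h1, h2⟩ := hend c hc
  dsimp only at hopp
  refine ⟨c, hc, D', T.eqv, fun hcq => ?_, fun hcp => ?_⟩
  · exact h.of_tri T h1 h2 (Or.inl ⟨rfl, rfl⟩) (mul_neg_of_mul_neg hopp hcq) hcq
  · rw [mul_comm] at hopp
    refine h.of_tri T h1 h2 (Or.inr ⟨rfl, rfl⟩) ?_ (by simpa only [mul_comm] using hcp)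
    rw [mul_comm]
    exact mul_neg_of_mul_neg hopp hcp

lemma continuous_side (p q : Pt) : Continuous (side p q) := by
  have : side p q = fun x => (q.1 - p.1) * (x.2 - p.2) - (q.2 - p.2) * (x.1 - p.1) := by
    ext x; simp [side, det]
  rw [this]; fun_prop

lemma side_mul_pos_of_mem_openSeg {k : ℝ} {a b x p y : Pt} (h0 : side a b x = 0)
    (hy : y ∈ openSeg (x, p)) (h : 0 < k * side a b p) : 0 < k * side a b y := by
  obtain ⟨t, h1, h2, rfl⟩ := mem_openSeg.1 hy
  rw [side_add_smul, h0]
  have := mul_pos h1 h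
  linarith

lemma exists_near_side {a b y : Pt} (hab : a.2 ≠ b.2) (h0 : side a b y = 0) {k η ε : ℝ} (hk : k ≠ 0)
    (hη : η ≠ 0) (hε : 0 < ε) : ∃ c, dist c y < ε ∧ 0 < k * side a b c ∧ 0 < η * (c.2 - y.2) := by
  set v : Pt := (((b.1 - a.1) * η - k) / (b.2 - a.2), η) with hv
  have hb : b.2 - a.2 ≠ 0 := sub_ne_zero.2 hab.symm
  have ht : 0 < ε / (2 * (‖v‖ + 1)) := by positivity
  set t := ε / (2 * (‖v‖ + 1)) with htd
  have hside : side a b (y + t • v) = t * k := by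
    have : side a b (y + t • v) = side a b y + t * ((b.1 - a.1) * v.2 - (b.2 - a.2) * v.1) := by
      simp only [side, det, Prod.fst_sub, Prod.snd_sub, Prod.fst_add, Prod.snd_add, Prod.smul_fst,
        Prod.smul_snd, smul_eq_mul]
      ring
    rw [this, h0, hv]
    field_simp
    ring
  refine ⟨y + t • v, ?_, ?_, ?_⟩
  · rw [dist_eq_norm, add_sub_cancel_left, norm_smul, Real.norm_eq_abs, abs_of_pos ht, htd,
      div_mul_eq_mul_div, div_lt_iff₀ (by positivity)]
    nlinarith [norm_nonneg v]
  · rw [hside]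
    have := mul_self_pos.2 hk
    nlinarith
  · have : 0 < t * (η * η) := mul_pos ht (mul_self_pos.2 hη)
    simp only [Prod.snd_add, Prod.smul_snd, smul_eq_mul, hv]
    linarith

lemma exists_snd_ne {U : Set Pt} (hU : IsOpen U) (hne : U.Nonempty) (h : ℝ) : ∃ c ∈ U, c.2 ≠ h := by
  have hn : ((0, h) : Pt) ≠ (1, h) := by simp
  obtain ⟨c, hc, hs⟩ := exists_of_ae (ae_side_ne_zero hn) hU hne
  refine ⟨c, hc, fun h' => hs ?_⟩
  simp [side, det, h']

/-- The second end of an isolated edge can be moved close to any point on its side of the other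
edge. -/
lemma Isolated.aim {p q Q : Pt} (h : Isolated B D (p, q) f x) (hQ : 0 < side f.1 f.2 Q * side f.1 f.2 q)
    {U : Set Pt} (hU : IsOpen U) (hQU : Q ∈ U) : ∃ D' p' c x', Eqv D D' ∧
      Isolated B D' (p', c) f x' ∧ c ∈ U ∧ c.2 ≠ p'.2 := by
  have hx0 : side f.1 f.2 x = 0 := side_of_mem_seg (openSeg_subset_seg _ h.cross.2.2.2.2)
  have hxf := ne_of_mem_openSeg (D.poly.ne h.cross.2.1) h.cross.2.2.2.2
  have hQ0 : side f.1 f.2 Q ≠ 0 := by intro h; simp [h] at hQ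
  have hdis : Disjoint (tri x x Q) {f.1, f.2} := by
    rw [seg_eq_tri, disjoint_right]
    intro z hz hzs
    have hz0 : side f.1 f.2 z = 0 := by
      rcases hz with rfl | rfl
      · exact side_left _ _
      · exact side_right _ _
    obtain ⟨t, -, -, rfl⟩ := mem_seg.1 hzs
    rw [side_add_smul, hx0] at hz0
    have : t = 0 := by
      rcases mul_eq_zero.1 (show t * side f.1 f.2 Q = 0 by linarith) with h | h
      · exact h
      · exact absurd h hQ0
    subst this
    simp only [zero_smul, add_zero, mem_insert_iff, mem_singleton_iff] at hz
    rcases hz with hz | hz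
    · exact hxf.1 hz
    · exact hxf.2 hz
  obtain ⟨ε, hε, hd⟩ := exists_tri_disjoint (toFinite {f.1, f.2}).isCompact hdis
  obtain ⟨D₁, p', q', e1, h1, hp', hq', dp, dq⟩ := h.shrink hε
  have hq0 := side_mul_pos_of_mem_openSeg hx0 hq' hQ
  set V : Set Pt := U ∩ Metric.ball Q ε ∩ {c | 0 < side f.1 f.2 c * side f.1 f.2 q'} with hV
  have hVo : IsOpen V := (hU.inter Metric.isOpen_ball).inter
    (isOpen_lt continuous_const ((continuous_side _ _).mul continuous_const))
  have hQV : Q ∈ V := ⟨⟨hQU, Metric.mem_ball_self hε⟩, hq0⟩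
  obtain ⟨c₀, hc₀, hc₀'⟩ := exists_snd_ne hVo ⟨Q, hQV⟩ p'.2
  obtain ⟨c, hc, D₂, e2, h2, -⟩ := h1.push (U := V ∩ {c | c.2 ≠ p'.2})
    (hVo.inter (isOpen_ne_fun continuous_snd continuous_const)) ⟨c₀, hc₀, hc₀'⟩
    (fun c hc => by
      have := hd p' q' c dp dq hc.1.1.2
      rw [disjoint_right] at this
      exact ⟨this (by simp), this (by simp)⟩)
  obtain ⟨x', hx'⟩ := h2 hc.1.2
  exact ⟨D₂, p', c, x', e1.trans e2, hx', hc.1.1.1, hc.2⟩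

/-- An isolated edge can be turned into a good one that crosses the other edge near a given point. -/
lemma Isolated.reaim {p q y : Pt} (h : Isolated B D (p, q) f x) (hf : f.1.2 ≠ f.2.2)
    (hy : y ∈ openSeg f) (hy0 : 0 < y.2) (hy1 : y.2 < 1) :
    ∃ D' e' x', Eqv D D' ∧ Isolated B D' e' f x' ∧ Good e' := by
  have hxf := h.cross.2.2.2.2
  have hn := D.poly.ne h.cross.2.1
  have hx0 : side f.1 f.2 x = 0 := side_of_mem_seg (openSeg_subset_seg _ hxf)
  have hys : side f.1 f.2 y = 0 := side_of_mem_seg (openSeg_subset_seg _ hy)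
  have hdis : ∀ z, z ∈ openSeg f → Disjoint (tri x z y) {f.1, f.2} := by
    intro z hz
    rw [disjoint_right]
    intro w hw hw'
    have : w ∈ openSeg f := tri_subset (convex_openSegment _ _) hxf hz hy hw'
    rcases hw with rfl | rfl
    · exact (ne_of_mem_openSeg hn this).1 rfl
    · exact (ne_of_mem_openSeg hn this).2 rfl
  have hF : IsCompact ({f.1, f.2} : Set Pt) := (toFinite {f.1, f.2}).isCompact
  obtain ⟨ε₁, hε₁, hd₁⟩ := exists_tri_disjoint hF (hdis x hxf)
  obtain ⟨ε₂, hε₂, hd₂⟩ := exists_tri_disjoint hF (hdis y hy)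
  obtain ⟨ε, hε, hεl⟩ : ∃ ε > 0, ε ≤ ε₁ ∧ ε ≤ ε₂ ∧ ε ≤ y.2 ∧ ε ≤ 1 - y.2 :=
    ⟨min (min ε₁ ε₂) (min y.2 (1 - y.2)), lt_min (lt_min hε₁ hε₂) (lt_min hy0 (by linarith)),
      by simp, by simp, by simp, by simp⟩
  obtain ⟨l1, l2, l3, l4⟩ := hεl
  obtain ⟨D₁, p', q', e1, h1, hp', hq', dp, dq⟩ := h.shrink hε
  have hopp := h1.cross.side_mul_neg D₁.poly
  have hh : ∀ c : Pt, dist c y < ε → |c.2 - y.2| < ε := fun c hc =>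
    lt_of_le_of_lt (by rw [← Real.dist_eq]; exact le_max_right _ _) hc
  have step : ∀ (k η : ℝ), IsOpen (Metric.ball y ε ∩ {c : Pt | 0 < k * side f.1 f.2 c} ∩
      {c | 0 < η * (c.2 - y.2)}) := fun k η =>
    (Metric.isOpen_ball.inter (isOpen_lt continuous_const (continuous_const.mul
      (continuous_side _ _)))).inter (isOpen_lt continuous_const (by fun_prop))
  have hq0 : side f.1 f.2 q' ≠ 0 := by intro h; simp [h] at hopp
  have hp0 : side f.1 f.2 p' ≠ 0 := by intro h; simp [h] at hopp
  obtain ⟨c₀, a1, a2, a3⟩ := exists_near_side hf hys hq0 (by norm_num : (-1 : ℝ) ≠ 0) hε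
  obtain ⟨c, ⟨⟨b1, b2⟩, b3⟩, D₂, e2, h2, -⟩ := h1.push (step _ _) ⟨c₀, ⟨a1, a2⟩, a3⟩
    (fun c hc => by
      have := hd₁ p' q' c (dp.trans_le l1) (dq.trans_le l1) (lt_of_lt_of_le hc.1.1 l1)
      rw [disjoint_right] at this
      exact ⟨this (by simp), this (by simp)⟩)
  obtain ⟨x₂, h2⟩ := h2 (by simp only [mem_ofPred_eq] at b2; linarith)
  obtain ⟨d₀, a1', a2', a3'⟩ := exists_near_side hf hys hp0 (one_ne_zero : (1 : ℝ) ≠ 0) hε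
  obtain ⟨d, ⟨⟨g1, g2⟩, g3⟩, D₃, e3, -, h3⟩ := h2.push (step _ _) ⟨d₀, ⟨a1', a2'⟩, a3'⟩
    (fun d hd => by
      have := hd₂ p' c d (dp.trans_le l2) (lt_of_lt_of_le b1 l2) (lt_of_lt_of_le hd.1.1 l2)
      rw [disjoint_right] at this
      exact ⟨this (by simp), this (by simp)⟩)
  obtain ⟨x₃, h3⟩ := h3 (by simp only [mem_ofPred_eq] at g2; linarith)
  have r1 := abs_lt.1 (hh c b1)
  have r2 := abs_lt.1 (hh d g1)
  simp only [mem_ofPred_eq] at b3 g3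
  exact ⟨D₃, (d, c), x₃, (e1.trans e2).trans e3, h3, by simp only; linarith, by simp only; linarith,
    by simp only; linarith⟩

/-- Both edges of an isolated crossing can be made good. -/
lemma Isolated.exists_good {p q r s : Pt} (h : Isolated B D (p, q) (r, s) x) :
    ∃ D' e' f' x', Eqv D D' ∧ Isolated B D' e' f' x' ∧ Good e' ∧ Good f' := by
  have hopp := h.cross.side_mul_neg D.poly
  have hq0 : side r s q ≠ 0 := by intro h; simp [h] at hopp
  obtain ⟨D₁, p₁, q₁, x₁, e1, h1, -, hne1⟩ := h.aim (Q := q) (mul_self_pos.2 hq0) isOpen_univ (mem_univ _)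
  have hopp1 := h1.cross.symm.side_mul_neg D₁.poly
  have hs0 : side p₁ q₁ s ≠ 0 := by intro h; simp [h] at hopp1
  have hd : q₁.2 - p₁.2 ≠ 0 := sub_ne_zero.2 hne1
  set y : Pt := (p₁.1 + (1 / 2 - p₁.2) / (q₁.2 - p₁.2) * (q₁.1 - p₁.1), 1 / 2) with hyd
  have hy : side p₁ q₁ y = 0 := by
    simp only [side, det, hyd, Prod.fst_sub, Prod.snd_sub]
    field_simp
    ring
  obtain ⟨Q, b1, b2, -⟩ := exists_near_side hne1.symm hy hs0 one_ne_zero (show (0 : ℝ) < 1 / 2 by norm_num)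
  have hQ : |Q.2 - y.2| < 1 / 2 := lt_of_le_of_lt (by rw [← Real.dist_eq]; exact le_max_right _ _) b1
  have hQ' := abs_lt.1 hQ
  have hU : IsOpen {c : Pt | 0 < c.2 ∧ c.2 < 1} :=
    (isOpen_lt continuous_const continuous_snd).inter (isOpen_lt continuous_snd continuous_const)
  obtain ⟨D₂, r₂, s₂, x₂, e2, h2, hs₂, hne2⟩ := h1.symm.aim (Q := Q) (by simp only; linarith) hU
    (by simp only [mem_ofPred_eq]; simp only [hyd] at hQ'; constructor <;> linarith)
  obtain ⟨ε, hε, hεU⟩ := Metric.isOpen_iff.1 hU s₂ hs₂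
  obtain ⟨y₂, d1, d2, -⟩ := exists_param_near (D₂.poly.ne h2.cross.1).symm finite_empty hε
  have hy₂ := hεU (Metric.mem_ball.2 d2)
  obtain ⟨D₃, e₃, x₃, e3, h3, g3⟩ := h2.symm.reaim hne2.symm (by rwa [openSeg_swap]) hy₂.1 hy₂.2
  obtain ⟨t, t0, t1, ht⟩ := snd_mem_openSeg (a := e₃.1) (b := e₃.2) h3.cross.2.2.2.1
  obtain ⟨k1, k2, k3⟩ := g3
  obtain ⟨D₄, f₄, x₄, e4, h4, g4⟩ := h3.symm.reaim k2.ne' h3.cross.2.2.2.1 (by nlinarith) (by nlinarith)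
  exact ⟨D₄, e₃, f₄, x₄, ((e1.trans e2).trans e3).trans e4, h4.symm, ⟨k1, k2, k3⟩, g4⟩

/-- The real crossings that do not lie on two good edges. -/
def badCrossings (D : Diagram) : Set Pt :=
  {y | ∃ g h, CrossAt D.E g h y ∧ D.kind y ≠ .virtual ∧ ¬ (Good g ∧ Good h)}

/-- All real crossings can be moved into the strip, between descending edges. -/
theorem exists_badCrossings_eq_empty (D : Diagram) : ∃ D', Eqv D D' ∧ badCrossings D' = ∅ := by
  induction hn : (badCrossings D).ncard using Nat.strong_induction_on generalizing D with
  | _ n ih =>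
  rcases (badCrossings D).eq_empty_or_nonempty with h0 | ⟨x, ⟨p, q⟩, ⟨r, s⟩, hx, hk, hb⟩
  · exact ⟨D, Eqv.refl D, h0⟩
  have hfin : (badCrossings D).Finite := D.poly.finite_cross.subset fun y ⟨g, h, hy, _⟩ => ⟨g, h, hy⟩
  have hpre : Pre (badCrossings D \ {x}) D (p, q) (r, s) x := by
    refine ⟨hx, fun g h y hy hne hky => ?_⟩
    by_cases hg : Good g ∧ Good h
    · exact Or.inl hg
    · exact Or.inr ⟨⟨g, h, hy, hky, hg⟩, hne⟩
  obtain ⟨D₁, ⟨p₁, q₁⟩, ⟨r₁, s₁⟩, e1, h1⟩ := hpre.isolate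
  obtain ⟨D₂, e₂, f₂, x₂, e2, h2, g1, g2⟩ := h1.exists_good
  have hsub : badCrossings D₂ ⊆ badCrossings D \ {x} := by
    rintro y ⟨g, h, hy, hky, hgh⟩
    by_cases hyx : y = x₂
    · exfalso
      subst hyx
      have aux : ∀ {g h}, CrossAt D₂.E g h y → Good g := by
        intro g h hy
        by_contra hg
        exact D₂.poly.triple hy.1 h2.cross.1 h2.cross.2.1 (by rintro rfl; exact hg g1)
          (by rintro rfl; exact hg g2) h2.cross.2.2.1 (openSeg_subset_seg _ hy.2.2.2.1)
          (openSeg_subset_seg _ h2.cross.2.2.2.1) (openSeg_subset_seg _ h2.cross.2.2.2.2)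
      exact hgh ⟨aux hy, aux hy.symm⟩
    · exact (h2.good g h y hy hyx hky).resolve_left hgh
  have hlt : (badCrossings D₂).ncard < n := by
    rw [← hn]
    refine ncard_lt_ncard ⟨hsub.trans sdiff_subset, fun hcon => ?_⟩ hfin
    exact (hsub (hcon ⟨_, _, hx, hk, hb⟩)).2 rfl
  obtain ⟨D₃, e3, h3⟩ := ih _ hlt D₂ rfl
  exact ⟨D₃, (e1.trans e2).trans e3, h3⟩

end STLink

namespace STLink
open Set Filter Topology

open Classical in
/-- The kinds of crossings given by `κ` on the edges of `F`; all other crossings are virtual. -/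
noncomputable def vkind (F : Set Edge) (κ : Pt → Kind) (x : Pt) : Kind :=
  if ∃ e f, CrossAt F e f x then κ x else .virtual

variable {F : Set Edge} {κ : Pt → Kind} {D D' : Diagram}

lemma CrossAt.vkind {e f : Edge} {x : Pt} (h : CrossAt F e f x) : vkind F κ x = κ x :=
  if_pos ⟨e, f, h⟩

lemma vkind_of_notMem {E : Set Edge} (hE : Poly E) (hF : F ⊆ E) {e f : Edge} {x : Pt}
    (h : CrossAt E e f x) (he : e ∉ F) : vkind F κ x = .virtual := by
  refine if_neg ?_
  rintro ⟨g, k, hgk⟩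
  exact hE.triple h.1 (hF hgk.1) (hF hgk.2.1) (by rintro rfl; exact he hgk.1)
    (by rintro rfl; exact he hgk.2.1) hgk.2.2.1 (openSeg_subset_seg _ h.2.2.2.1)
    (openSeg_subset_seg _ hgk.2.2.2.1) (openSeg_subset_seg _ hgk.2.2.2.2)

/-- A strand with only virtual crossings can be pushed across any triangle. -/
lemma eqv_of_rep {a b c : Pt} (hF : F ⊆ D.E) (hK : D.kind = vkind F κ) (hK' : D'.kind = vkind F κ)
    (hab : (a, b) ∈ D.E) (habF : (a, b) ∉ F) (hE : D'.E = rep D.E a b c) (hs : side a b c ≠ 0)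
    (hB : D'.bars = D.bars) (ha : a ∉ D.bars) (hb : b ∉ D.bars) (h1 : (a, c) ∉ F) (h2 : (c, b) ∉ F) :
    Eqv D D' := by
  have hF' : F ⊆ D'.E := fun f hf => by
    rw [hE, mem_rep]; exact Or.inl ⟨hF hf, by rintro rfl; exact habF hf⟩
  have hm : ∀ g, moverKind (a, b) .virtual g = .virtual := fun g => by simp [moverKind]
  refine Tri.eqv (e₀ := (a, b)) (k₀ := .virtual) (a := a) (b := b) (c := c) ⟨hab, hs, hE, hB, fun e f x _ _ => by rw [hK, hK'],
    ha, hb, fun g x hx => ?_, fun g x hx => ?_, fun g x hx => ?_, fun h => absurd rfl h,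
    fun h => absurd rfl h, fun h => absurd rfl h, fun h => absurd rfl h⟩
  · rw [hK, hm]; exact vkind_of_notMem D.poly hF hx habF
  · rw [hK', hm]; exact vkind_of_notMem D'.poly hF' hx h1
  · rw [hK', hm]; exact vkind_of_notMem D'.poly hF' hx h2

/-- The same diagram with other values of `kind`. -/
def Diagram.withKind (D : Diagram) (κ : Pt → Kind) : Diagram := { D with kind := κ }

lemma Diagram.eqv_withKind (D : Diagram) (hF : F ⊆ D.E)
    (h : ∀ e f x, CrossAt D.E e f x → e ∉ F → D.kind x = .virtual) :
    Eqv D (D.withKind (vkind F D.kind)) := by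
  refine (Move.same D (D.withKind (vkind F D.kind)) rfl rfl fun e f x hx _ => ?_).eqv
  change vkind F D.kind x = D.kind x
  by_cases he : e ∈ F
  · by_cases hf : f ∈ F
    · exact CrossAt.vkind (hx.mono he hf)
    · rw [vkind_of_notMem D.poly hF hx.symm hf, h f e x hx.symm hf]
  · rw [vkind_of_notMem D.poly hF hx he, h e f x hx he]

/-- An edge without real crossings can be replaced by two edges through a generic point. -/
lemma Diagram.exists_detour (D : Diagram) {a b : Pt} (hab : (a, b) ∈ D.E) (ha : a ∉ D.bars)
    (hb : b ∉ D.bars) (hv : ∀ g x, CrossAt D.E (a, b) g x → D.kind x = .virtual) {U : Set Pt}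
    (hU : IsOpen U) (hne : U.Nonempty) : ∃ c ∈ U, ∃ D' : Diagram, Eqv D D' ∧ D'.E = rep D.E a b c ∧
      D'.bars = D.bars ∧ (∀ f ∈ D.E, f.1 ≠ c ∧ f.2 ≠ c) ∧ c ∉ D.bars ∧
      ∀ g h y, CrossAt D'.E g h y → D'.kind y ≠ .virtual → CrossAt D.E g h y ∧ D.kind y ≠ .virtual := by
  obtain ⟨c, hc, hs, ca, cb⟩ := D.exists_apex hab hU hne
  have hF : D.E \ {(a, b)} ⊆ D.E := sdiff_subset
  have habF : (a, b) ∉ D.E \ {(a, b)} := by simp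
  have hvert : ∀ f ∈ D.E, f.1 ≠ c ∧ f.2 ≠ c := by
    intro f hf
    obtain ⟨-, n2, n3⟩ := ne_of_side hs
    by_cases hfab : f = (a, b)
    · subst hfab; exact ⟨n3, n2⟩
    · exact ⟨fun h' => ca.off f ⟨hf, hfab⟩ (h' ▸ left_mem_seg _),
        fun h' => ca.off f ⟨hf, hfab⟩ (h' ▸ right_mem_seg _)⟩
  have h1 : (a, c) ∉ D.E \ {(a, b)} := fun h => (hvert _ h.1).2 rfl
  have h2 : (c, b) ∉ D.E \ {(a, b)} := fun h => (hvert _ h.1).1 rfl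
  have hP := D.poly.rep_of_side hab ca cb hs
  set κ := vkind (D.E \ {(a, b)}) D.kind with hκ
  have e1 : Eqv D (D.withKind κ) := D.eqv_withKind hF fun e f x hx he => by
    have : e = (a, b) := by by_contra hne; exact he ⟨hx.1, hne⟩
    subst this; exact hv f x hx
  have e2 : Eqv (D.withKind κ) (D.ins hab hP κ) :=
    eqv_of_rep (D := D.withKind κ) (D' := D.ins hab hP κ) (a := a) (b := b) (c := c) hF rfl rfl hab
      habF rfl hs rfl ha hb h1 h2
  have hF' : D.E \ {(a, b)} ⊆ rep D.E a b c := fun f hf => mem_rep.2 (Or.inl hf)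
  refine ⟨c, hc, _, e1.trans e2, rfl, rfl, hvert, ?_, fun g h y hy hk => ?_⟩
  · intro hcb
    obtain ⟨f, hf, hfc⟩ := D.bars_vertex c hcb
    exact (hvert f hf).1 hfc
  · have hg : g ∈ D.E \ {(a, b)} := by
      by_contra hg; exact hk (vkind_of_notMem hP hF' hy hg)
    have hh : h ∈ D.E \ {(a, b)} := by
      by_contra hh; exact hk (vkind_of_notMem hP hF' hy.symm hh)
    refine ⟨hy.mono hg.1 hh.1, ?_⟩
    have : κ y = D.kind y := CrossAt.vkind (hy.mono hg hh)
    rw [← this]; exact hk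

/-- Real crossings lie on good edges only. -/
def RealGood (D : Diagram) : Prop := ∀ g h y, CrossAt D.E g h y → D.kind y ≠ .virtual → Good g

/-- The bars that are ends of edges that are not good. -/
def badBars (D : Diagram) : Set Pt := {v | v ∈ D.bars ∧ ∃ e ∈ D.E, (e.1 = v ∨ e.2 = v) ∧ ¬ Good e}

lemma Diagram.finite_bars (D : Diagram) : D.bars.Finite :=
  (D.finite.image Prod.fst).subset fun v hv => by
    obtain ⟨e, he, h⟩ := D.bars_vertex v hv; exact ⟨e, he, h⟩

lemma RealGood.rep (h : RealGood D) {a b c : Pt} (hab : (a, b) ∈ D.E) (hc : c ∈ openSeg (a, b))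
    (hE : D'.E = rep D.E a b c) (hK : D'.kind = D.kind) : RealGood D' := by
  intro g k y hy hk
  exact (h _ _ y (CrossAt.par D.poly hab hc (hE ▸ hy)) (hK ▸ hk)).par hc

lemma isOpen_strip (s t : ℝ) : IsOpen {c : Pt | s < c.2 ∧ c.2 < t} :=
  (isOpen_lt continuous_const continuous_snd).inter (isOpen_lt continuous_snd continuous_const)

lemma strip_nonempty {s t : ℝ} (h : s < t) : {c : Pt | s < c.2 ∧ c.2 < t}.Nonempty :=
  ⟨(0, (s + t) / 2), by simp only [mem_ofPred_eq]; constructor <;> linarith⟩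

lemma exists_detour_real {a b : Pt} (hD : RealGood D) (hab : (a, b) ∈ D.E) (ha : a ∉ D.bars)
    (hb : b ∉ D.bars) (hv : ∀ g x, CrossAt D.E (a, b) g x → D.kind x = .virtual) {s t : ℝ} (h : s < t) :
    ∃ c : Pt, s < c.2 ∧ c.2 < t ∧ c ∉ D.bars ∧ ∃ D' : Diagram, Eqv D D' ∧ D'.E = rep D.E a b c ∧
      D'.bars = D.bars ∧ RealGood D' ∧ (∀ g x, CrossAt D'.E (a, c) g x → D'.kind x = .virtual) ∧
      (∀ g x, CrossAt D'.E (c, b) g x → D'.kind x = .virtual) ∧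
      ∀ e, (∀ g x, CrossAt D.E e g x → D.kind x = .virtual) →
        ∀ g x, CrossAt D'.E e g x → D'.kind x = .virtual := by
  obtain ⟨c, hc, D', e1, hE, hB, hvert, hcb, hr⟩ := D.exists_detour hab ha hb hv (isOpen_strip s t)
    (strip_nonempty h)
  refine ⟨c, hc.1, hc.2, hcb, D', e1, hE, hB, fun g k y hy hk => ?_, fun g x hx => ?_,
    fun g x hx => ?_, fun e he g x hx => ?_⟩
  · obtain ⟨h1, h2⟩ := hr g k y hy hk; exact hD g k y h1 h2
  · by_contra hk; exact (hvert _ (hr _ _ _ hx hk).1.1).2 rfl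
  · by_contra hk; exact (hvert _ (hr _ _ _ hx hk).1.1).1 rfl
  · by_contra hk
    obtain ⟨h1, h2⟩ := hr _ _ _ hx hk
    exact h2 (he g x h1)

lemma eqv_slide {v w : Pt} {C : Set Pt} (D : Diagram) (hvw : (v, w) ∈ D.E) (hv : v ∈ D.bars) (hw : w ∉ D.bars)
    (hk : ∀ g x, CrossAt D.E (v, w) g x → D.kind x = .virtual) (hB : D.bars = C ∪ {v}) (hvC : v ∉ C) :
    ∃ D' : Diagram, Eqv D D' ∧ D'.E = D.E ∧ D'.kind = D.kind ∧ D'.bars = C ∪ {w} := by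
  have hC : D.bars \ {v} = C := by
    rw [hB]; ext z; simp only [Set.mem_sdiff, mem_union, mem_singleton_iff]
    constructor
    · rintro ⟨h1 | h1, h2⟩; exacts [h1, absurd h1 h2]
    · intro h; exact ⟨Or.inl h, by rintro rfl; exact hvC h⟩
  have hb : ∀ z ∈ C ∪ {w}, ∃ e ∈ D.E, e.1 = z := by
    rintro z (hz | rfl)
    · exact D.bars_vertex z (hB ▸ Or.inl hz)
    · obtain ⟨f, hf, hfe⟩ := (D.closed z).2 ⟨_, hvw, rfl⟩
      exact ⟨f, hf, hfe⟩
  exact ⟨D.withBars (C ∪ {w}) hb, eqv_of_slide hvw hv hw hk rfl (by rw [hC]; rfl) rfl, rfl, rfl, rfl⟩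

set_option maxHeartbeats 1000000 in
lemma exists_badBars_ssubset (hD : RealGood D) {v : Pt} (hv : v ∈ badBars D) :
    ∃ D', Eqv D D' ∧ RealGood D' ∧ badBars D' ⊆ badBars D \ {v} := by
  obtain ⟨⟨v', w⟩, hvw, rfl⟩ := D.bars_vertex v hv.1
  dsimp only at hv ⊢
  have hvw' := D.poly.ne hvw
  obtain ⟨ε, hε, hε1⟩ := exists_ball_notMem (finite_crossings D (v', w)) v'
  obtain ⟨w₂, p1, p2, p3⟩ := exists_param_near hvw' (finite_on_edge D.poly hvw) hε
  obtain ⟨D₁, hE₁, hB₁, hK₁, e1⟩ := D.exists_subdivide hvw p1 (fun f hf hne hc => p3 ⟨p1, f, hf, hne, hc⟩)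
  have m₁ : (v', w₂) ∈ D₁.E := by rw [hE₁, mem_rep]; simp
  have hvw₂ := D₁.poly.ne m₁
  have free₁ : ∀ g x, ¬ CrossAt D₁.E (v', w₂) g x := by
    intro g x hx
    have hx' := CrossAt.par D.poly hvw p1 (hE₁ ▸ hx)
    rw [show par v' w w₂ (v', w₂) = (v', w) by simp [par]] at hx'
    refine not_lt.2 (hε1 x ⟨_, hx'⟩ (ne_of_mem_openSeg hvw' hx'.2.2.2.1).1) ?_
    exact dist_lt_of_mem_openSeg (by simpa) p2 hx.2.2.2.1
  obtain ⟨w₁, q1, -, q3⟩ := exists_param_near hvw₂ (finite_on_edge D₁.poly m₁) one_pos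
  obtain ⟨D₂, hE₂, hB₂, hK₂, e2⟩ := D₁.exists_subdivide m₁ q1 (fun f hf hne hc => q3 ⟨q1, f, hf, hne, hc⟩)
  have free₂ : ∀ e, e = (v', w₁) ∨ e = (w₁, w₂) → ∀ g x, CrossAt D₂.E e g x → D₂.kind x = .virtual := by
    intro e he g x hx
    have hx' := CrossAt.par D₁.poly m₁ q1 (hE₂ ▸ hx)
    rw [show par v' w₂ w₁ e = (v', w₂) by simp [par, he]] at hx'
    exact absurd hx' (free₁ _ _)
  have r2 : RealGood D₂ := (hD.rep hvw p1 hE₁ hK₁).rep m₁ q1 hE₂ hK₂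
  have bw₂ : w₂ ∉ D.bars := notMem_bars_of_openSeg hvw p1
  have bw₁ : w₁ ∉ D.bars := by
    have := notMem_bars_of_openSeg m₁ q1
    rwa [hB₁] at this
  have hb2 : D₂.bars = D.bars := hB₂.trans hB₁
  obtain ⟨ν, s1, s2, s3, D₃, e3, hE₃, hB₃, r3, f3, g3, i3⟩ := exists_detour_real r2 (a := w₁) (b := w₂)
    (by rw [hE₂, mem_rep]; simp) (by rwa [hb2]) (by rwa [hb2]) (free₂ _ (Or.inr rfl))
    (show (0 : ℝ) < 1 by norm_num)
  have hb3 := hB₃.trans hb2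
  rw [hb2] at s3
  obtain ⟨ν₀, t1, t2, t3, D₄, e4, hE₄, hB₄, r4, f4, g4, i4⟩ := exists_detour_real r3 (a := w₁) (b := ν)
    (by rw [hE₃, mem_rep]; simp) (by rwa [hb3]) (by rwa [hb3]) f3 s2
  have hb4 := hB₄.trans hb3
  rw [hb3] at t3
  have nw : ν ≠ w₁ := D₃.poly.ne (e := (w₁, ν)) (by rw [hE₃, mem_rep]; simp) |>.symm
  obtain ⟨ν₁, u1, u2, u3, D₅, e5, hE₅, hB₅, r5, f5, g5, i5⟩ := exists_detour_real r4 (a := ν) (b := w₂)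
    (by rw [hE₄, mem_rep, hE₃, mem_rep]; refine Or.inl ⟨by simp, ?_⟩
        intro h; exact nw (congrArg Prod.fst h)) (by rwa [hb4]) (by rwa [hb4]) (i4 _ g3) s1
  have hb5 := hB₅.trans hb4
  rw [hb4] at u3
  have n0 : (w₁, ν₀) ≠ (ν, w₂) := fun h => nw.symm (congrArg Prod.fst h)
  have hv1 : v' ≠ w₁ := (ne_of_mem_openSeg hvw₂ q1).1.symm
  have hv2 : v' ≠ ν := by rintro rfl; exact s3 hv.1
  have mem : ∀ f, f ∈ D₅.E → (f ∈ D.E ∧ f ≠ (v', w)) ∨ f = (w₂, w) ∨ f = (v', w₁) ∨ f = (w₁, ν₀) ∨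
      f = (ν₀, ν) ∨ f = (ν, ν₁) ∨ f = (ν₁, w₂) := by
    intro f
    rw [hE₅, mem_rep, hE₄, mem_rep, hE₃, mem_rep, hE₂, mem_rep, hE₁, mem_rep]
    tauto
  have m1 : (v', w₁) ∈ D₅.E := by
    rw [hE₅, mem_rep, hE₄, mem_rep, hE₃, mem_rep, hE₂, mem_rep]
    refine Or.inl ⟨Or.inl ⟨Or.inl ⟨by simp, ?_⟩, ?_⟩, ?_⟩ <;> intro h
    · exact hv1 (congrArg Prod.fst h)
    · exact hv1 (congrArg Prod.fst h)
    · exact hv2 (congrArg Prod.fst h)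
  have m2 : (w₁, ν₀) ∈ D₅.E := by
    rw [hE₅, mem_rep, hE₄, mem_rep]
    exact Or.inl ⟨by simp, n0⟩
  have m3 : (ν₀, ν) ∈ D₅.E := by
    rw [hE₅, mem_rep, hE₄, mem_rep]
    refine Or.inl ⟨by simp, fun h => ?_⟩
    have := congrArg (Prod.snd ∘ Prod.fst) h
    simp only [Function.comp] at this; linarith
  set C := D.bars \ {v'} with hC
  have hBC : D₅.bars = C ∪ {v'} := by
    rw [hb5, hC]; ext z
    simp only [mem_union, Set.mem_sdiff, mem_singleton_iff]
    constructor
    · intro h; by_cases hz : z = v'; exacts [Or.inr hz, Or.inl ⟨h, hz⟩]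
    · rintro (h | rfl); exacts [h.1, hv.1]
  have nC : ∀ z, z ∉ D.bars → z ∉ C := fun z hz h => hz h.1
  have nin : ∀ z y : Pt, z ∉ D.bars → z ≠ y → z ∉ C ∪ {y} := by
    rintro z y h1 h2 (h | h)
    · exact h1 h.1
    · exact h2 h
  have i2 : ∀ g x, CrossAt D₅.E (v', w₁) g x → D₅.kind x = .virtual :=
    i5 _ (i4 _ (i3 _ (free₂ _ (Or.inl rfl))))
  obtain ⟨D₆, e6, hE₆, hK₆, hB₆⟩ := eqv_slide D₅ m1 (by rw [hb5]; exact hv.1) (by rwa [hb5]) i2 hBC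
    (fun h => h.2 rfl)
  obtain ⟨D₇, e7, hE₇, hK₇, hB₇⟩ := eqv_slide D₆ (hE₆ ▸ m2) (by rw [hB₆]; simp)
    (by rw [hB₆]; exact nin _ _ t3 (D₅.poly.ne m2).symm)
    (by rw [hE₆, hK₆]; exact i5 _ f4) hB₆ (nC _ bw₁)
  obtain ⟨D₈, e8, hE₈, hK₈, hB₈⟩ := eqv_slide D₇ (hE₇ ▸ hE₆ ▸ m3) (by rw [hB₇]; simp)
    (by rw [hB₇]; exact nin _ _ s3 (D₅.poly.ne m3).symm)
    (by rw [hE₇, hK₇, hE₆, hK₆]; exact i5 _ g4) hB₇ (nC _ t3)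
  have hE8 : D₈.E = D₅.E := by rw [hE₈, hE₇, hE₆]
  refine ⟨D₈, ((((((e1.trans e2).trans e3).trans e4).trans e5).trans e6).trans e7).trans e8, ?_, ?_⟩
  · intro g h y hy hk
    rw [hE8] at hy
    rw [hK₈, hK₇, hK₆] at hk
    exact r5 g h y hy hk
  · rintro z ⟨hz, f, hf, hfz, hg⟩
    rw [hE8] at hf
    rw [hB₈] at hz
    have gν : Good (ν₀, ν) := ⟨s1, t1, t2⟩
    have gν' : Good (ν, ν₁) := ⟨u1, u2, s2⟩
    have aux : ∀ {p : Pt}, p ∉ D.bars → p ≠ ν → z ≠ p := by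
      rintro p h1 h2 rfl
      rcases hz with hz | hz
      · exact h1 hz.1
      · exact h2 hz
    have nw2 : w₂ ≠ ν := by
      rintro rfl
      exact D₃.poly.ne (e := (w₂, w₂)) (by rw [hE₃, mem_rep]; simp) rfl
    have nν0 : ν₀ ≠ ν := D₅.poly.ne m3
    have nν1 : ν₁ ≠ ν := (D₅.poly.ne (e := (ν, ν₁)) (by rw [hE₅, mem_rep]; simp)).symm
    have zv : z ≠ v' := by
      rintro rfl
      rcases hz with hz | hz
      · exact hz.2 rfl
      · exact hv2 hz
    rcases mem f hf with ⟨h1, h2⟩ | rfl | rfl | rfl | rfl | rfl | rfl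
    · have hzD : z ∈ D.bars := by
        rcases hz with hz | hz
        · exact hz.1
        · exfalso
          have hz : z = ν := hz
          subst hz
          have : f ∈ D₃.E := by
            have h3 : f ≠ (v', w₂) ∧ f ≠ (w₁, w₂) := by
              constructor
              · rintro rfl; rcases hfz with h | h
                · exact zv h.symm
                · exact nw2 h
              · rintro rfl; rcases hfz with h | h
                · exact nw h.symm
                · exact nw2 h
            rw [hE₃, mem_rep, hE₂, mem_rep, hE₁, mem_rep]
            exact Or.inl ⟨Or.inl ⟨Or.inl ⟨h1, h2⟩, h3.1⟩, h3.2⟩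
          rcases hfz with h | h
          · have := D₃.poly.injFst f this (z, w₂) (by rw [hE₃, mem_rep]; simp) h
            subst this
            rw [hE₅, mem_rep] at hf
            rcases hf with ⟨-, hf⟩ | hf | hf
            · exact hf rfl
            · exact D₅.poly.ne (e := (ν₁, w₂)) (by rw [hE₅, mem_rep]; simp) (congrArg Prod.snd hf).symm
            · exact nν1 (congrArg Prod.fst hf).symm
          · have := D₃.poly.injSnd f this (w₁, z) (by rw [hE₃, mem_rep]; simp) h
            subst this
            rw [hE₅, mem_rep, hE₄, mem_rep] at hf
            rcases hf with ⟨⟨-, hf⟩ | hf | hf, -⟩ | hf | hf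
            · exact hf rfl
            · exact nν0 (congrArg Prod.snd hf).symm
            · exact (D₅.poly.ne m2) (congrArg Prod.fst hf)
            · exact nw (congrArg Prod.fst hf).symm
            · exact nw2 (congrArg Prod.snd hf).symm
      exact ⟨⟨hzD, f, h1, hfz, hg⟩, zv⟩
    · have hzw : w = z := by
        rcases hfz with h | h
        · exact absurd h.symm (aux bw₂ nw2)
        · exact h
      subst hzw
      have hzD : w ∈ D.bars := by
        rcases hz with hz | hz
        · exact hz.1
        · exfalso
          have hz : w = ν := hz
          subst hz
          have h9 : (w₂, w) ∈ D₂.E := by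
            rw [hE₂, mem_rep, hE₁, mem_rep]
            exact Or.inl ⟨by simp, fun h => D₁.poly.ne m₁ (congrArg Prod.fst h).symm⟩
          have h8 : (w₂, w) ∈ D₃.E := by
            rw [hE₃, mem_rep]
            exact Or.inl ⟨h9, fun h => nw2 (congrArg Prod.snd h).symm⟩
          exact D₃.generic.no_reverse _ _ h8 (by rw [hE₃, mem_rep]; simp)
      refine ⟨⟨hzD, _, hvw, Or.inr rfl, fun hgood => hg ?_⟩, zv⟩
      refine Good.par p1 ?_
      rwa [show par v' w w₂ (w₂, w) = (v', w) by simp [par]]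
    · rcases hfz with h | h
      · exact absurd h.symm zv
      · exact absurd h.symm (aux bw₁ nw.symm)
    · rcases hfz with h | h
      · exact absurd h.symm (aux bw₁ nw.symm)
      · exact absurd h.symm (aux t3 nν0)
    · exact absurd gν hg
    · exact absurd gν' hg
    · rcases hfz with h | h
      · exact absurd h.symm (aux u3 nν1)
      · exact absurd h.symm (aux bw₂ nw2)

theorem exists_badBars_eq_empty (hD : RealGood D) : ∃ D', Eqv D D' ∧ RealGood D' ∧ badBars D' = ∅ := by
  induction hn : (badBars D).ncard using Nat.strong_induction_on generalizing D with
  | _ n ih =>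
  rcases (badBars D).eq_empty_or_nonempty with h0 | ⟨v, hv⟩
  · exact ⟨D, Eqv.refl D, hD, h0⟩
  obtain ⟨D₁, e1, h1, hsub⟩ := exists_badBars_ssubset hD hv
  have hlt : (badBars D₁).ncard < n := by
    rw [← hn]
    refine ncard_lt_ncard ⟨hsub.trans sdiff_subset, fun hcon => ?_⟩ (D.finite_bars.subset fun _ h => h.1)
    exact (hsub (hcon hv)).2 rfl
  obtain ⟨D₂, e2, h2, h3⟩ := ih _ hlt h1 rfl
  exact ⟨D₂, e1.trans e2, h2, h3⟩

end STLink

namespace STLink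
open Set Filter Topology

variable {D : Diagram}

/-- Bars lie on good edges only. -/
lemma good_of_bar (hB : badBars D = ∅) {e : Edge} (he : e ∈ D.E) (h : e.1 ∈ D.bars ∨ e.2 ∈ D.bars) :
    Good e := by
  by_contra hg
  rcases h with h | h
  · exact (hB ▸ (show e.1 ∈ badBars D from ⟨h, e, he, Or.inl rfl, hg⟩) : e.1 ∈ (∅ : Set Pt))
  · exact (hB ▸ (show e.2 ∈ badBars D from ⟨h, e, he, Or.inr rfl, hg⟩) : e.2 ∈ (∅ : Set Pt))

/-- The vertices outside the open strip. -/
def outerVertices (D : Diagram) : Set Pt := {v | (∃ e ∈ D.E, e.1 = v) ∧ ¬ (0 < v.2 ∧ v.2 < 1)}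

set_option maxHeartbeats 1000000 in
lemma exists_outerVertices_ssubset (hD : RealGood D) (hB : badBars D = ∅) {v : Pt}
    (hv : v ∈ outerVertices D) : ∃ D', Eqv D D' ∧ RealGood D' ∧ badBars D' = ∅ ∧
      outerVertices D' ⊆ outerVertices D \ {v} := by
  obtain ⟨⟨⟨v', w⟩, hvw, rfl⟩, hv⟩ := hv
  obtain ⟨⟨u, v''⟩, huv, h'⟩ := (D.closed v').1 ⟨_, hvw, rfl⟩
  dsimp only at *
  obtain rfl : v'' = v' := h'
  have ng1 : ¬ Good (v'', w) := fun ⟨h1, h2, h3⟩ => hv ⟨h1.trans h2, h3⟩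
  have ng2 : ¬ Good (u, v'') := fun ⟨h1, h2, h3⟩ => hv ⟨h1, h2.trans h3⟩
  have bv : v'' ∉ D.bars := fun h => ng1 (good_of_bar hB hvw (Or.inl h))
  have bw : w ∉ D.bars := fun h => ng1 (good_of_bar hB hvw (Or.inr h))
  have bu : u ∉ D.bars := fun h => ng2 (good_of_bar hB huv (Or.inl h))
  have nvw := D.poly.ne hvw
  have nuv := D.poly.ne huv
  have nuw : u ≠ w := by rintro rfl; exact D.generic.no_reverse _ _ huv hvw
  dsimp only at nvw nuv
  set F := D.E \ {(u, v''), (v'', w)} with hFd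
  have hF : F ⊆ D.E := sdiff_subset
  have memF : ∀ f, f ∈ D.E → f ≠ (u, v'') → f ≠ (v'', w) → f ∈ F := fun f h1 h2 h3 =>
    ⟨h1, by simp [h2, h3]⟩
  obtain ⟨ν, ⟨ν0, ν1⟩, s1, s2, s3, cu, cv, cw⟩ := exists_of_ae (by
    filter_upwards [ae_side_ne_zero nvw, ae_side_ne_zero nuv, ae_side_ne_zero nuw, D.poly.ae_clear u,
      D.poly.ae_clear v'', D.poly.ae_clear w] with ν h1 h2 h3 h4 h5 h6
    exact And.intro h1 (And.intro h2 (And.intro h3 (And.intro h4 (And.intro h5 h6)))))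
    (isOpen_strip 0 1) (strip_nonempty one_pos)
  have hvert : ∀ f ∈ D.E, f.1 ≠ ν ∧ f.2 ≠ ν := fun f hf =>
    ⟨fun h => cu.off f hf (h ▸ left_mem_seg _), fun h => cu.off f hf (h ▸ right_mem_seg _)⟩
  have hP1 : Poly (rep D.E v'' w ν) := D.poly.rep_of_side hvw (cv.mono sdiff_subset) (cw.mono sdiff_subset) s1
  set κ := vkind F D.kind with hκ
  set D₁ := D.ins hvw hP1 κ
  have hE1 : D₁.E = rep D.E v'' w ν := rfl
  have m1 : (u, v'') ∈ D₁.E := by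
    rw [hE1, mem_rep]; exact Or.inl ⟨huv, fun h => nuv (congrArg Prod.fst h)⟩
  have m2 : (v'', ν) ∈ D₁.E := by rw [hE1, mem_rep]; simp
  have mem2 : ∀ f, f ∈ unrep D₁.E u ν v'' → f = (u, ν) ∨ f = (ν, w) ∨ f ∈ F := by
    intro f hf
    rw [mem_unrep, hE1, mem_rep] at hf
    rcases hf with ⟨⟨h1, h2⟩ | h | h, h3, h4⟩ | h
    · exact Or.inr (Or.inr (memF f h1 h3 h2))
    · exact absurd h h4
    · exact Or.inr (Or.inl h)
    · exact Or.inl h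
  have hP2 : Poly (unrep D₁.E u ν v'') := by
    refine ((D.poly.mono hF).insert_path (cu.mono hF) (cw.mono hF) nuw (ne_of_side s3).2.1
      (ne_of_side s3).2.2 (fun x => side_ne_zero_seg s3) (fun f hf he => ?_) (fun f hf he => ?_)
      (fun f hf hs => ?_) (fun f hf hs => ?_)).mono fun f hf => ?_
    · exact hf.2 (Or.inl (D.poly.injFst f hf.1 _ huv he))
    · exact hf.2 (Or.inr (D.poly.injSnd f hf.1 _ hvw he))
    · exact D.poly.start huv hf.1 (by rintro rfl; exact hf.2 (Or.inl rfl)) hs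
    · exact D.poly.finish hvw hf.1 (by rintro rfl; exact hf.2 (Or.inr rfl)) hs
    · rcases mem2 f hf with h | h | h
      · exact Or.inl h
      · exact Or.inr (Or.inl h)
      · exact Or.inr (Or.inr h)
  set D₂ := D₁.del m1 m2 hP2 bv κ
  have hE2 : D₂.E = unrep D₁.E u ν v'' := rfl
  have hF1 : F ⊆ D₁.E := fun f hf => mem_rep.2 (Or.inl ⟨hf.1, fun h => hf.2 (Or.inr h)⟩)
  have hF2 : F ⊆ D₂.E := fun f hf => mem_unrep.2 (Or.inl ⟨hF1 hf, fun h => hf.2 (Or.inl h), by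
    rintro rfl; exact (hvert _ hf.1).2 rfl⟩)
  have n1 : (u, ν) ∉ F := fun h => (hvert _ h.1).2 rfl
  have n2 : (v'', ν) ∉ F := fun h => (hvert _ h.1).2 rfl
  have n3 : (ν, w) ∉ F := fun h => (hvert _ h.1).1 rfl
  have n4 : (u, v'') ∉ F := fun h => h.2 (Or.inl rfl)
  have n5 : (v'', w) ∉ F := fun h => h.2 (Or.inr rfl)
  have e1 : Eqv D (D.withKind κ) := D.eqv_withKind hF fun e f x hx he => by
    by_contra hk
    have hg := hD e f x hx hk
    by_cases h1 : e = (u, v'')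
    · exact ng2 (h1 ▸ hg)
    by_cases h2 : e = (v'', w)
    · exact ng1 (h2 ▸ hg)
    exact he (memF e hx.1 h1 h2)
  have e2 : Eqv (D.withKind κ) D₁ :=
    eqv_of_rep (D := D.withKind κ) (D' := D₁) hF rfl rfl hvw n5 rfl s1 rfl bv bw n2 n3
  have nuν : (u, ν) ∉ D₁.E := by
    rw [hE1, mem_rep]
    rintro (h | h | h)
    · exact (hvert _ h.1).2 rfl
    · exact nuv (congrArg Prod.fst h)
    · exact (hvert _ huv).1 (congrArg Prod.fst h)
  have e3 : Eqv D₂ D₁ :=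
    eqv_of_rep (D := D₂) (D' := D₁) (a := u) (b := ν) (c := v'') hF2 rfl rfl
      (by rw [hE2, mem_unrep]; simp) n1 (by rw [hE2, rep_unrep m1 m2 nuν])
      (by rw [side_swap', neg_ne_zero]; exact s2) rfl bu (fun h => by
        obtain ⟨f, hf, hfe⟩ := D.bars_vertex ν h; exact (hvert f hf).1 hfe) n4 n2
  have bν : ν ∉ D.bars := fun h => by
    obtain ⟨f, hf, hfe⟩ := D.bars_vertex ν h; exact (hvert f hf).1 hfe
  refine ⟨D₂, (e1.trans e2).trans e3.symm, fun g h y hy hk => ?_, ?_, ?_⟩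
  · have hg : g ∈ F := by
      by_contra hg; exact hk (vkind_of_notMem D₂.poly hF2 hy hg)
    have hh : h ∈ F := by
      by_contra hh; exact hk (vkind_of_notMem D₂.poly hF2 hy.symm hh)
    have : κ y = D.kind y := CrossAt.vkind (hy.mono hg hh)
    exact hD g h y (hy.mono hg.1 hh.1) (by rw [← this]; exact hk)
  · rw [eq_empty_iff_forall_notMem]
    rintro z ⟨hz, f, hf, hfz, hg⟩
    change z ∈ D.bars at hz
    rcases mem2 f hf with rfl | rfl | h
    · rcases hfz with h | h
      · subst h; exact bu hz
      · subst h; exact bν hz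
    · rcases hfz with h | h
      · subst h; exact bν hz
      · subst h; exact bw hz
    · exact hg (good_of_bar hB h.1 (by rcases hfz with rfl | rfl; exacts [Or.inl hz, Or.inr hz]))
  · rintro z ⟨⟨f, hf, hfz⟩, hz⟩
    rcases mem2 f hf with rfl | rfl | h
    · refine ⟨⟨⟨_, huv, hfz⟩, hz⟩, ?_⟩
      rintro rfl; exact nuv hfz
    · exact absurd (by rw [← hfz]; exact ⟨ν0, ν1⟩) hz
    · refine ⟨⟨⟨f, h.1, hfz⟩, hz⟩, ?_⟩
      rintro rfl
      exact n5 (D.poly.injFst f h.1 _ hvw hfz ▸ h)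

/-- A diagram inside the open strip, whose real crossings and bars lie on descending edges. -/
structure Tidy (D : Diagram) : Prop where
  real : RealGood D
  bars : badBars D = ∅
  strip : ∀ e ∈ D.E, 0 < e.1.2 ∧ e.1.2 < 1

lemma exists_tidy_of (hD : RealGood D) (hB : badBars D = ∅) : ∃ D', Eqv D D' ∧ Tidy D' := by
  induction hn : (outerVertices D).ncard using Nat.strong_induction_on generalizing D with
  | _ n ih =>
  rcases (outerVertices D).eq_empty_or_nonempty with h0 | ⟨v, hv⟩
  · refine ⟨D, Eqv.refl D, hD, hB, fun e he => ?_⟩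
    by_contra h
    exact (h0 ▸ (show e.1 ∈ outerVertices D from ⟨⟨e, he, rfl⟩, h⟩) : e.1 ∈ (∅ : Set Pt))
  obtain ⟨D₁, e1, h1, h2, hsub⟩ := exists_outerVertices_ssubset hD hB hv
  have hlt : (outerVertices D₁).ncard < n := by
    rw [← hn]
    refine ncard_lt_ncard ⟨hsub.trans sdiff_subset, fun hcon => ?_⟩
      ((D.finite.image Prod.fst).subset fun v hv => hv.1)
    exact (hsub (hcon hv)).2 rfl
  obtain ⟨D₂, e2, h3⟩ := ih _ hlt h1 h2 rfl
  exact ⟨D₂, e1.trans e2, h3⟩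

theorem exists_tidy (D : Diagram) : ∃ D', Eqv D D' ∧ Tidy D' := by
  obtain ⟨D₁, e1, h1⟩ := exists_badCrossings_eq_empty D
  have hR : RealGood D₁ := by
    intro g h y hy hk
    by_contra hg
    exact (h1 ▸ (show y ∈ badCrossings D₁ from ⟨g, h, hy, hk, fun hh => hg hh.1⟩) : y ∈ (∅ : Set Pt))
  obtain ⟨D₂, e2, h2, h3⟩ := exists_badBars_eq_empty hR
  obtain ⟨D₃, e3, h4⟩ := exists_tidy_of h2 h3
  exact ⟨D₃, (e1.trans e2).trans e3, h4⟩

end STLink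

namespace STLink
open Set Filter Topology MeasureTheory

/-- The edges of the polygonal path from `a` through the points of `l` to `b`. -/
def chain (a : Pt) (l : List Pt) (b : Pt) : Set Edge :=
  match l with
  | [] => {(a, b)}
  | z :: l => insert (a, z) (chain z l b)

lemma exists_chain_fst (a : Pt) (l : List Pt) (b : Pt) : ∃ q, (a, q) ∈ chain a l b := by
  cases l with
  | nil => exact ⟨b, rfl⟩
  | cons z l => exact ⟨z, Or.inl rfl⟩

lemma exists_chain_snd (a : Pt) (l : List Pt) (b : Pt) : ∃ p, (p, b) ∈ chain a l b := by
  induction l generalizing a with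
  | nil => exact ⟨a, rfl⟩
  | cons z l ih => obtain ⟨p, hp⟩ := ih z; exact ⟨p, Or.inr hp⟩

variable {D : Diagram} {F : Set Edge} {κ : Pt → Kind} {a b G : Pt}

set_option maxHeartbeats 1000000 in
lemma exists_chain_of_cone (hFG : ∀ f ∈ F, f.1 ≠ G ∧ f.2 ≠ G) {l : List Pt} (hK : D.kind = vkind F κ)
    (hF : F ⊆ D.E) (h1 : (a, G) ∈ D.E) (h2 : (G, b) ∈ D.E) (ha : a ∉ D.bars) (hb : b ∉ D.bars)
    (hG : G ∉ D.bars) (hl : ∀ z ∈ l, ∀ f ∈ D.E, f.1 ≠ z) (hnd : l.Nodup)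
    (hP : Poly ((D.E \ {(a, G), (G, b)}) ∪ chain a l b))
    (hc : ∀ z ∈ b :: l, Clear ((D.E \ {(a, G), (G, b)}) ∪ chain a l b) z G)
    (hs : ∀ f ∈ chain a l b, side f.1 f.2 G ≠ 0) (hs' : ∀ z ∈ l, side z b G ≠ 0) :
    ∃ D', Eqv D D' ∧ D'.E = (D.E \ {(a, G), (G, b)}) ∪ chain a l b ∧ D'.bars = D.bars ∧
      D'.kind = vkind F κ := by
  have naG : a ≠ G := D.poly.ne h1
  have nGb : G ≠ b := D.poly.ne h2
  have h1F : (a, G) ∉ F := fun h => (hFG _ h).2 rfl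
  have h2F : (G, b) ∉ F := fun h => (hFG _ h).1 rfl
  induction l generalizing a D with
  | nil =>
    have hE : unrep D.E a b G = (D.E \ {(a, G), (G, b)}) ∪ chain a [] b := by
      ext f; simp [unrep, chain]
    have nab : (a, b) ∉ D.E := fun h => nGb (congrArg Prod.snd (D.poly.injFst _ h _ h1 rfl)).symm
    refine ⟨D.del h1 h2 (hE ▸ hP) hG (vkind F κ), ?_, hE, rfl, rfl⟩
    refine (eqv_of_rep (D := D.del h1 h2 (hE ▸ hP) hG (vkind F κ)) (D' := D) (F := F) (κ := κ) (a := a)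
      (b := b) (c := G) (fun f hf => mem_unrep.2 (Or.inl ⟨hF hf, ?_, ?_⟩)) rfl hK (mem_unrep.2 (Or.inr rfl))
      (fun h => nab (hF h)) (rep_unrep h1 h2 nab).symm (hs _ rfl) rfl ha hb h1F h2F).symm
    · rintro rfl; exact h1F hf
    · rintro rfl; exact h2F hf
  | cons z l ih =>
    have hz := hl z (by simp)
    have hz' : ∀ f ∈ D.E, f.2 ≠ z := fun f hf h => by
      obtain ⟨g, hg, hgz⟩ := (D.closed z).2 ⟨f, hf, h⟩; exact hz g hg hgz
    have nzb : z ≠ b := (hz' _ h2).symm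
    have nzG : z ≠ G := (hz _ h2).symm
    have nza : z ≠ a := (hz _ h1).symm
    set W := insert (a, z) (D.E \ {(a, G), (G, b)}) with hW
    have hWE : W ⊆ (D.E \ {(a, G), (G, b)}) ∪ chain a (z :: l) b := by
      rintro f (rfl | hf); exacts [Or.inr (Or.inl rfl), Or.inl hf]
    have hWz : ∀ f ∈ W, f.1 ≠ z := by
      rintro f (rfl | hf); exacts [nza.symm, hz f hf.1]
    have hWb : ∀ f ∈ W, f.2 ≠ b := by
      rintro f (rfl | hf)
      · exact nzb
      · intro h; exact hf.2 (Or.inr (D.poly.injSnd f hf.1 _ h2 h))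
    have hPW := (hP.mono hWE).insert_path ((hc z (by simp)).mono hWE) ((hc b (by simp)).mono hWE) nzb nGb.symm
      nzG (fun x => side_ne_zero_seg (hs' z (by simp))) hWz hWb (fun f hf h => by
        obtain ⟨q, hq⟩ := exists_chain_fst z l b
        exact hP.start (e := (z, q)) (Or.inr (Or.inr hq)) (hWE hf) (by rintro rfl; exact hWz _ hf rfl) h)
      (fun f hf h => by
        obtain ⟨p, hp⟩ := exists_chain_snd z l b
        exact hP.finish (e := (p, b)) (Or.inr (Or.inr hp)) (hWE hf) (by rintro rfl; exact hWb _ hf rfl) h)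
    have hrep : ∀ f, f ∈ rep D.E a G z ↔ f ∈ insert (z, G) (insert (G, b) W) := by
      intro f
      have n1 : (G, b) ≠ (a, G) := fun h => naG (congrArg Prod.fst h).symm
      rw [mem_rep]
      simp only [hW, mem_insert_iff, Set.mem_sdiff, mem_singleton_iff, not_or]
      constructor
      · rintro (⟨h, h'⟩ | h | h)
        · by_cases h3 : f = (G, b)
          · exact Or.inr (Or.inl h3)
          · exact Or.inr (Or.inr (Or.inr ⟨h, h', h3⟩))
        · exact Or.inr (Or.inr (Or.inl h))
        · exact Or.inl h
      · rintro (h | rfl | h | h)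
        · exact Or.inr (Or.inr h)
        · exact Or.inl ⟨h2, n1⟩
        · exact Or.inr (Or.inl h)
        · exact Or.inl ⟨h.1, h.2.1⟩
    have hP1 : Poly (rep D.E a G z) := hPW.mono fun f hf => (hrep f).1 hf
    have bz : z ∉ D.bars := fun h => by
      obtain ⟨f, hf, hfz⟩ := D.bars_vertex z h; exact hz f hf hfz
    set D₁ := D.ins h1 hP1 (vkind F κ)
    have hE1 : ∀ f, f ∈ D₁.E ↔ f ∈ insert (z, G) (insert (G, b) W) := hrep
    have hEq : (D₁.E \ {(z, G), (G, b)}) ∪ chain z l b = (D.E \ {(a, G), (G, b)}) ∪ chain a (z :: l) b := by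
      have k1 : (z, G) ∉ W := fun h => hWz _ h rfl
      have k2 : (G, b) ∉ W := fun h => hWb _ h rfl
      have : D₁.E \ {(z, G), (G, b)} = W := by
        ext f
        rw [Set.mem_sdiff, hE1]
        simp only [mem_insert_iff, mem_singleton_iff, not_or]
        constructor
        · rintro ⟨h | h | h, n1, n2⟩; exacts [absurd h n1, absurd h n2, h]
        · exact fun h => ⟨Or.inr (Or.inr h), by rintro rfl; exact k1 h, by rintro rfl; exact k2 h⟩
      rw [this, hW, chain]
      ext f; simp only [mem_union, mem_insert_iff]; tauto
    have e1 : Eqv D D₁ := by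
      refine eqv_of_rep (D := D) (D' := D₁) (F := F) hF hK rfl h1 h1F rfl ?_ rfl ha hG
        (fun h => hz' _ (hF h) rfl) (fun h => hz _ (hF h) rfl)
      rw [side_swap', neg_ne_zero]
      exact hs (a, z) (Or.inl rfl)
    have hnd' := List.nodup_cons.1 hnd
    obtain ⟨D₂, e2, hE2, hB2, hK2⟩ := ih (D := D₁) (a := z) rfl
      (fun f hf => mem_rep.2 (Or.inl ⟨hF hf, by rintro rfl; exact h1F hf⟩)) (mem_rep.2 (by simp))
      ((hE1 _).2 (by simp)) bz hb hG (fun w hw f hf => by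
        rcases (hE1 f).1 hf with rfl | rfl | rfl | h
        · rintro rfl; exact hnd'.1 hw
        · exact hl w (by simp [hw]) _ h2
        · have := hl w (by simp [hw]) _ h1; exact this
        · exact hl w (by simp [hw]) _ h.1) hnd'.2 (hEq ▸ hP)
      (by rw [hEq]; exact fun w hw => hc w (by simp only [List.mem_cons] at hw ⊢; tauto))
      (fun f hf => hs f (Or.inr hf)) (fun w hw => hs' w (by simp [hw])) nzG
      (fun h => (hFG _ h).2 rfl)
    exact ⟨D₂, e1.trans e2, by rw [hE2, hEq], hB2, hK2⟩

/-- A strand without real crossings can be moved to any position. -/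
lemma Diagram.exists_chain (D : Diagram) {l : List Pt} (hab : (a, b) ∈ D.E) (ha : a ∉ D.bars)
    (hb : b ∉ D.bars) (hv : ∀ g x, CrossAt D.E (a, b) g x → D.kind x = .virtual)
    (hl : ∀ z ∈ l, ∀ f ∈ D.E, f.1 ≠ z) (hnd : l.Nodup) (hP : Poly ((D.E \ {(a, b)}) ∪ chain a l b)) :
    ∃ D', Eqv D D' ∧ D'.E = (D.E \ {(a, b)}) ∪ chain a l b ∧ D'.bars = D.bars ∧
      D'.kind = vkind (D.E \ {(a, b)}) D.kind := by
  have nab := D.poly.ne hab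
  set F := D.E \ {(a, b)} with hFd
  have hl' : ∀ z ∈ l, z ≠ b := by
    rintro z hz rfl
    obtain ⟨f, hf, hfe⟩ := (D.closed z).2 ⟨_, hab, rfl⟩
    exact hl z hz f hf hfe
  obtain ⟨G, -, g1, g2, g3, g4, g5⟩ := exists_of_ae (P := fun G => (∀ z ∈ {z | z ∈ b :: l}, Clear (F ∪ chain a l b) z G) ∧
      (∀ f ∈ F ∪ chain a l b, side f.1 f.2 G ≠ 0) ∧ (∀ z ∈ {z | z ∈ l}, side z b G ≠ 0) ∧
      side a b G ≠ 0 ∧ Clear D.E a G ∧ Clear D.E b G) (by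
    filter_upwards [(ae_ball_iff (List.finite_toSet (b :: l)).countable).2 fun z _ => hP.ae_clear z,
      (ae_ball_iff hP.finite.countable).2 fun f hf => ae_side_ne_zero (hP.ne hf),
      (ae_ball_iff (List.finite_toSet l).countable).2 fun z hz => ae_side_ne_zero (hl' z hz),
      ae_side_ne_zero nab, D.poly.ae_clear a, D.poly.ae_clear b] with G h1 h2 h3 h4 h5 h6
    exact ⟨h1, h2, h3, h4, h5, h6⟩) isOpen_univ ⟨a, trivial⟩
  obtain ⟨g5, g6⟩ := g5
  have hG : ∀ f ∈ D.E, f.1 ≠ G ∧ f.2 ≠ G := fun f hf =>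
    ⟨fun h => g5.off f hf (h ▸ left_mem_seg _), fun h => g5.off f hf (h ▸ right_mem_seg _)⟩
  have hFD : F ⊆ D.E := sdiff_subset
  have habF : (a, b) ∉ F := fun h => h.2 rfl
  have hP0 : Poly (rep D.E a b G) := D.poly.rep_of_side hab (g5.mono hFD) (g6.mono hFD) g4
  set κ := vkind F D.kind
  set D₀ := D.ins hab hP0 κ
  have bG : G ∉ D.bars := fun h => by
    obtain ⟨f, hf, hfe⟩ := D.bars_vertex G h; exact (hG f hf).1 hfe
  have n1 : (a, G) ∉ F := fun h => (hG _ h.1).2 rfl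
  have n2 : (G, b) ∉ F := fun h => (hG _ h.1).1 rfl
  have e1 : Eqv D (D.withKind κ) := D.eqv_withKind hFD fun e f x hx he => by
    have : e = (a, b) := by by_contra hne; exact he ⟨hx.1, hne⟩
    subst this; exact hv f x hx
  have e2 : Eqv (D.withKind κ) D₀ :=
    eqv_of_rep (D := D.withKind κ) (D' := D₀) hFD rfl rfl hab habF rfl g4 rfl ha hb n1 n2
  have hE0 : D₀.E \ {(a, G), (G, b)} = F := by
    ext f
    rw [Set.mem_sdiff, show D₀.E = rep D.E a b G from rfl, mem_rep]
    simp only [mem_insert_iff, mem_singleton_iff, not_or]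
    constructor
    · rintro ⟨h | h | h, h1, h2⟩; exacts [h, absurd h h1, absurd h h2]
    · exact fun h => ⟨Or.inl h, by rintro rfl; exact n1 h, by rintro rfl; exact n2 h⟩
  obtain ⟨D', e3, hE, hB, hK⟩ := exists_chain_of_cone (D := D₀) (F := F) (κ := D.kind) (a := a) (b := b)
    (G := G) (l := l) (fun f hf => hG f hf.1) rfl (fun f hf => mem_rep.2 (Or.inl hf)) (mem_rep.2 (by simp))
    (mem_rep.2 (by simp)) ha hb bG (fun z hz f hf => by
      rcases mem_rep.1 hf with h | rfl | rfl
      · exact hl z hz f h.1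
      · have := hl z hz _ hab; exact this
      · exact fun h => (ne_of_side (g3 z hz)).2.2 h.symm) hnd (by rw [hE0]; exact hP)
    (by rw [hE0]; exact g1) (fun f hf => g2 f (Or.inr hf)) g3
  exact ⟨D', (e1.trans e2).trans e3, by rw [hE, hE0], hB, hK⟩

end STLink

namespace STLink
open Set Filter Topology

lemma Poly.union {E F : Set Edge} (hE : Poly E) (hF : Poly F)
    (h : ∀ e ∈ E, ∀ f ∈ F, ∀ x ∈ seg e, x ∉ seg f) : Poly (E ∪ F) where
  finite := hE.finite.union hF.finite
  injFst := by
    rintro e (he | he) f (hf | hf) hef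
    · exact hE.injFst e he f hf hef
    · exact absurd (hef ▸ left_mem_seg f) (h e he f hf _ (left_mem_seg e))
    · exact absurd (hef ▸ left_mem_seg e) (h f hf e he _ (hef ▸ left_mem_seg f))
    · exact hF.injFst e he f hf hef
  injSnd := by
    rintro e (he | he) f (hf | hf) hef
    · exact hE.injSnd e he f hf hef
    · exact absurd (hef ▸ right_mem_seg f) (h e he f hf _ (right_mem_seg e))
    · exact absurd (hef ▸ right_mem_seg e) (h f hf e he _ (hef ▸ right_mem_seg f))
    · exact hF.injSnd e he f hf hef
  generic :=
    { no_reverse := by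
        rintro a b (he | he) (hf | hf)
        · exact hE.generic.no_reverse a b he hf
        · exact h _ he _ hf a (left_mem_seg _) (right_mem_seg (b, a))
        · exact h _ hf _ he a (right_mem_seg (b, a)) (left_mem_seg _)
        · exact hF.generic.no_reverse a b he hf
      start_off := by
        rintro e (he | he) f (hf | hf) hs
        · exact hE.generic.start_off e he f hf hs
        · exact absurd hs (h e he f hf _ (left_mem_seg e))
        · exact absurd (left_mem_seg e) (h f hf e he _ hs)
        · exact hF.generic.start_off e he f hf hs
      end_off := by
        rintro e (he | he) f (hf | hf) hs
        · exact hE.generic.end_off e he f hf hs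
        · exact absurd hs (h e he f hf _ (right_mem_seg e))
        · exact absurd (right_mem_seg e) (h f hf e he _ hs)
        · exact hF.generic.end_off e he f hf hs
      no_triple := by
        have aux : ∀ {e f x}, CrossAt (E ∪ F) e f x → CrossAt E e f x ∨ CrossAt F e f x := by
          rintro e f x ⟨he | he, hf | hf, hne, h1, h2⟩
          · exact Or.inl ⟨he, hf, hne, h1, h2⟩
          · exact absurd (openSeg_subset_seg _ h2) (h e he f hf x (openSeg_subset_seg _ h1))
          · exact absurd (openSeg_subset_seg _ h1) (h f hf e he x (openSeg_subset_seg _ h2))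
          · exact Or.inr ⟨he, hf, hne, h1, h2⟩
        intro e f g x h1 h2
        rcases aux h1 with h1 | h1 <;> rcases aux h2 with h2 | h2
        · exact hE.generic.no_triple e f g x h1 h2
        · exact absurd (openSeg_subset_seg _ h2.2.2.2.1) (h e h1.1 e h2.1 x (openSeg_subset_seg _ h1.2.2.2.1))
        · exact absurd (openSeg_subset_seg _ h1.2.2.2.1) (h e h2.1 e h1.1 x (openSeg_subset_seg _ h2.2.2.2.1))
        · exact hF.generic.no_triple e f g x h1 h2 }

/-- Edges that meet in common ends only. -/
lemma Poly.of_inter {E : Set Edge} (hfin : E.Finite) (hne : ∀ e ∈ E, e.1 ≠ e.2)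
    (hrev : ∀ a b, (a, b) ∈ E → (b, a) ∉ E)
    (h : ∀ e ∈ E, ∀ f ∈ E, e ≠ f → ∀ x ∈ seg e, x ∈ seg f → (x = e.1 ∧ x = f.2) ∨ (x = e.2 ∧ x = f.1)) :
    Poly E where
  finite := hfin
  injFst e he f hf hef := by
    by_contra hn
    rcases h e he f hf hn e.1 (left_mem_seg e) (hef ▸ left_mem_seg f) with h1 | h1
    · exact hne f hf (hef.symm.trans h1.2)
    · exact hne e he h1.1
  injSnd e he f hf hef := by
    by_contra hn
    rcases h e he f hf hn e.2 (right_mem_seg e) (hef ▸ right_mem_seg f) with h1 | h1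
    · exact hne e he h1.1.symm
    · exact hne f hf (h1.2.symm.trans hef)
  generic :=
    { no_reverse := hrev
      start_off := fun e he f hf hs => by
        by_cases hn : e = f
        · exact Or.inl (by rw [hn])
        rcases h e he f hf hn e.1 (left_mem_seg e) hs with h1 | h1
        exacts [Or.inr h1.2, Or.inl h1.2]
      end_off := fun e he f hf hs => by
        by_cases hn : e = f
        · exact Or.inr (by rw [hn])
        rcases h e he f hf hn e.2 (right_mem_seg e) hs with h1 | h1
        exacts [Or.inr h1.2, Or.inl h1.2]
      no_triple := fun e f g x h1 _ => by
        have := ne_of_mem_openSeg (hne e h1.1) h1.2.2.2.1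
        rcases h e h1.1 f h1.2.1 h1.2.2.1 x (openSeg_subset_seg _ h1.2.2.2.1)
          (openSeg_subset_seg _ h1.2.2.2.2) with h2 | h2
        exacts [absurd h2.1 this.1, absurd h2.1 this.2] }

/-- The closing arc number `i`. -/
def arc (n : ℕ) (R : ℝ) (i : Fin n) : Set Edge :=
  {(bot i, ((i : ℝ) + 1, -((n : ℝ) - i))),
   (((i : ℝ) + 1, -((n : ℝ) - i)), (R + ((n : ℝ) - i), -((n : ℝ) - i))),
   ((R + ((n : ℝ) - i), -((n : ℝ) - i)), (R + ((n : ℝ) - i), 1 + ((n : ℝ) - i))),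
   ((R + ((n : ℝ) - i), 1 + ((n : ℝ) - i)), ((i : ℝ) + 1, 1 + ((n : ℝ) - i))),
   (((i : ℝ) + 1, 1 + ((n : ℝ) - i)), top i)}

variable {n : ℕ} {R : ℝ}

lemma mem_closingArcs {e : Edge} : e ∈ closingArcs n R ↔ ∃ i, e ∈ arc n R i := by
  simp only [closingArcs, arc, mem_ofPred_eq, mem_insert_iff, mem_singleton_iff]
  exact ⟨fun ⟨i, d, hd, h⟩ => ⟨i, hd ▸ h⟩, fun ⟨i, h⟩ => ⟨i, _, rfl, h⟩⟩

lemma one_le_sub (i : Fin n) : (1 : ℝ) ≤ n - i := by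
  have : (i : ℝ) + 1 ≤ n := by exact_mod_cast i.2
  linarith

/-- The five edges of a closing arc, with their points. -/
lemma arc_cases {i : Fin n} (hR : (n : ℝ) < R) {e : Edge} (he : e ∈ arc n R i) {d : ℝ}
    (hd : d = (n : ℝ) - i) {x : Pt} (hx : x ∈ seg e) :
    (e = (((i : ℝ) + 1, 0), ((i : ℝ) + 1, -d)) ∧ x.1 = i + 1 ∧ -d ≤ x.2 ∧ x.2 ≤ 0) ∨
    (e = (((i : ℝ) + 1, -d), (R + d, -d)) ∧ x.2 = -d ∧ i + 1 ≤ x.1 ∧ x.1 ≤ R + d) ∨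
    (e = ((R + d, -d), (R + d, 1 + d)) ∧ x.1 = R + d ∧ -d ≤ x.2 ∧ x.2 ≤ 1 + d) ∨
    (e = ((R + d, 1 + d), ((i : ℝ) + 1, 1 + d)) ∧ x.2 = 1 + d ∧ i + 1 ≤ x.1 ∧ x.1 ≤ R + d) ∨
    (e = (((i : ℝ) + 1, 1 + d), ((i : ℝ) + 1, 1)) ∧ x.1 = i + 1 ∧ 1 ≤ x.2 ∧ x.2 ≤ 1 + d) := by
  have h1 := one_le_sub i
  simp only [arc, ← hd, mem_insert_iff, mem_singleton_iff] at he
  rw [← hd] at h1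
  have key : ∀ {a b t : ℝ}, 0 ≤ t → t ≤ 1 → a ≤ b → a ≤ a + t * (b - a) ∧ a + t * (b - a) ≤ b ∧
      a ≤ b + t * (a - b) ∧ b + t * (a - b) ≤ b := fun h0 h1 h =>
    ⟨by nlinarith, by nlinarith, by nlinarith, by nlinarith⟩
  have hn : (i : ℝ) + 1 ≤ R + d := by linarith
  rcases he with rfl | rfl | rfl | rfl | rfl <;> obtain ⟨t, t0, t1, rfl⟩ := mem_seg.1 hx
  · have := key t0 t1 (show -d ≤ 0 by linarith)
    exact Or.inl ⟨rfl, by simp [bot], by simpa [bot] using this.2.2.1, by simpa [bot] using this.2.2.2⟩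
  · have := key t0 t1 hn
    exact Or.inr (Or.inl ⟨rfl, by simp, by simpa using this.1, by simpa using this.2.1⟩)
  · have := key t0 t1 (show -d ≤ 1 + d by linarith)
    exact Or.inr (Or.inr (Or.inl ⟨rfl, by simp, by simpa using this.1, by simpa using this.2.1⟩))
  · have := key t0 t1 hn
    exact Or.inr (Or.inr (Or.inr (Or.inl ⟨rfl, by simp, by simpa using this.2.2.1, by simpa using this.2.2.2⟩)))
  · have := key t0 t1 (show 1 ≤ 1 + d by linarith)
    exact Or.inr (Or.inr (Or.inr (Or.inr ⟨rfl, by simp [top], by simpa [top] using this.2.2.1,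
      by simpa [top] using this.2.2.2⟩)))

set_option maxHeartbeats 4000000 in
lemma closingArcs_inter (hR : (n : ℝ) < R) {e f : Edge} (he : e ∈ closingArcs n R)
    (hf : f ∈ closingArcs n R) (hne : e ≠ f) {x : Pt} (hx : x ∈ seg e) (hx' : x ∈ seg f) :
    (x = e.1 ∧ x = f.2) ∨ (x = e.2 ∧ x = f.1) := by
  obtain ⟨i, hi⟩ := mem_closingArcs.1 he
  obtain ⟨j, hj⟩ := mem_closingArcs.1 hf
  have ci := arc_cases hR hi rfl hx
  have cj := arc_cases hR hj rfl hx'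
  have di := one_le_sub i
  have dj := one_le_sub j
  have i0 : (0 : ℝ) ≤ i := by positivity
  have j0 : (0 : ℝ) ≤ j := by positivity
  by_cases hij : i = j
  · subst hij
    clear hi hj he hf hx hx'
    obtain ⟨x1, x2⟩ := x
    dsimp only at ci cj
    rcases ci with ⟨rfl, c1, c2, c3⟩ | ⟨rfl, c1, c2, c3⟩ | ⟨rfl, c1, c2, c3⟩ | ⟨rfl, c1, c2, c3⟩ | ⟨rfl, c1, c2, c3⟩ <;>
    rcases cj with ⟨rfl, d1, d2, d3⟩ | ⟨rfl, d1, d2, d3⟩ | ⟨rfl, d1, d2, d3⟩ | ⟨rfl, d1, d2, d3⟩ | ⟨rfl, d1, d2, d3⟩ <;>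
    first
      | exact absurd rfl hne
      | (exfalso; linarith)
      | (simp only [Prod.mk.injEq]; left; constructor <;> constructor <;> linarith)
      | (simp only [Prod.mk.injEq]; right; constructor <;> constructor <;> linarith)
  · exfalso
    have hij' : (i : ℝ) + 1 ≤ j ∨ (j : ℝ) + 1 ≤ i := by
      rcases lt_or_gt_of_ne (fun h => hij (Fin.ext h) : (i : ℕ) ≠ j) with h | h
      · left; exact_mod_cast h
      · right; exact_mod_cast h
    clear hi hj he hf hx hx' hij hne
    rcases ci with ⟨-, c1, c2, c3⟩ | ⟨-, c1, c2, c3⟩ | ⟨-, c1, c2, c3⟩ | ⟨-, c1, c2, c3⟩ | ⟨-, c1, c2, c3⟩ <;>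
    rcases cj with ⟨-, d1, d2, d3⟩ | ⟨-, d1, d2, d3⟩ | ⟨-, d1, d2, d3⟩ | ⟨-, d1, d2, d3⟩ | ⟨-, d1, d2, d3⟩ <;>
    rcases hij' with h | h <;> linarith

lemma closingArcs_ends {e : Edge} (he : e ∈ closingArcs n R) :
    ((∃ i : Fin n, e.1 = bot i) ∨ e.1.2 < 0 ∨ 1 < e.1.2) ∧
    ((∃ i : Fin n, e.2 = top i) ∨ e.2.2 < 0 ∨ 1 < e.2.2) := by
  obtain ⟨i, hi⟩ := mem_closingArcs.1 he
  have := one_le_sub i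
  simp only [arc, mem_insert_iff, mem_singleton_iff] at hi
  rcases hi with rfl | rfl | rfl | rfl | rfl
  · exact ⟨Or.inl ⟨i, rfl⟩, Or.inr (Or.inl (by simp only; linarith))⟩
  · exact ⟨Or.inr (Or.inl (by simp only; linarith)), Or.inr (Or.inl (by simp only; linarith))⟩
  · exact ⟨Or.inr (Or.inl (by simp only; linarith)), Or.inr (Or.inr (by simp only; linarith))⟩
  · exact ⟨Or.inr (Or.inr (by simp only; linarith)), Or.inr (Or.inr (by simp only; linarith))⟩
  · exact ⟨Or.inr (Or.inr (by simp only; linarith)), Or.inl ⟨i, rfl⟩⟩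

lemma closingArcs_outside (hR : (n : ℝ) < R) {e : Edge} (he : e ∈ closingArcs n R) {x : Pt}
    (hx : x ∈ seg e) : x.2 ≤ 0 ∨ 1 ≤ x.2 ∨ R ≤ x.1 := by
  obtain ⟨i, hi⟩ := mem_closingArcs.1 he
  have := one_le_sub i
  rcases arc_cases hR hi rfl hx with ⟨-, c1, c2, c3⟩ | ⟨-, c1, c2, c3⟩ | ⟨-, c1, c2, c3⟩ |
    ⟨-, c1, c2, c3⟩ | ⟨-, c1, c2, c3⟩
  · exact Or.inl c3
  · exact Or.inl (by linarith)
  · exact Or.inr (Or.inr (by linarith))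
  · exact Or.inr (Or.inl (by linarith))
  · exact Or.inr (Or.inl c2)

lemma poly_closingArcs (hR : (n : ℝ) < R) : Poly (closingArcs n R) := by
  have hfin : (closingArcs n R).Finite := by
    have : closingArcs n R = ⋃ i, arc n R i := by ext e; simp [mem_closingArcs]
    rw [this]
    exact finite_iUnion fun i => by unfold arc; exact toFinite _
  have hne : ∀ e ∈ closingArcs n R, e.1 ≠ e.2 := by
    intro e he h
    obtain ⟨i, hi⟩ := mem_closingArcs.1 he
    have := one_le_sub i
    have i0 : (0 : ℝ) ≤ i := by positivity
    rcases arc_cases hR hi rfl (left_mem_seg e) with ⟨rfl, -⟩ | ⟨rfl, -⟩ | ⟨rfl, -⟩ | ⟨rfl, -⟩ | ⟨rfl, -⟩ <;>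
    · simp only [Prod.mk.injEq] at h
      obtain ⟨h1, h2⟩ := h
      linarith
  refine Poly.of_inter hfin hne (fun a b h1 h2 => ?_) fun e he f hf hn x => closingArcs_inter hR he hf hn
  have hab := hne _ h1
  obtain ⟨m, hm⟩ : ∃ m, m ∈ openSeg (a, b) := ⟨a + (1 / 2 : ℝ) • (b - a), mem_openSeg.2 ⟨1 / 2, by norm_num,
    by norm_num, rfl⟩⟩
  have hm' := ne_of_mem_openSeg hab hm
  rcases closingArcs_inter hR h1 h2 (fun h => hab (congrArg Prod.fst h)) (openSeg_subset_seg _ hm)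
    (by rw [seg_swap]; exact openSeg_subset_seg _ hm) with h | h
  · exact hm'.1 h.1
  · exact hm'.2 h.1

end STLink

namespace STLink
open Set Filter Topology

/-- An edge in the open strip that does not descend. -/
def Climbing (e : Edge) : Prop := 0 < e.1.2 ∧ e.1.2 ≤ e.2.2 ∧ e.2.2 < 1

/-- A diagram with `k` edges that do not descend, all the closing arcs from the number `k` on, and
room for the others. -/
structure Closing (n : ℕ) (R : ℝ) (k : ℕ) (D : Diagram) : Prop where
  lt : (n : ℝ) < R
  le : k ≤ n
  poly : Poly (D.E ∪ closingArcs n R)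
  arcs : ∀ i : Fin n, k ≤ i → arc n R i ⊆ D.E
  free : ∀ f ∈ D.E ∪ closingArcs n R, ∀ i : Fin n, (i : ℕ) < k → f.1 ≠ top i ∧ f.2 ≠ bot i
  shape : ∀ e ∈ D.E, e ∈ closingArcs n R ∨ (e.1.1 < R ∧ e.2.1 < R ∧
    ((0 ≤ e.2.2 ∧ e.2.2 < e.1.2 ∧ e.1.2 ≤ 1) ∨ Climbing e))
  virt : ∀ e ∈ D.E, Climbing e → e.1 ∉ D.bars ∧ e.2 ∉ D.bars ∧
    ∀ g x, CrossAt D.E e g x → D.kind x = .virtual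
  bars : ∀ v ∈ D.bars, 0 < v.2 ∧ v.2 < 1
  card : {e | e ∈ D.E ∧ Climbing e}.ncard = k

variable {n : ℕ} {R : ℝ} {D : Diagram} {k : ℕ}

lemma Climbing.notMem_closingArcs {e : Edge} (h : Climbing e) : e ∉ closingArcs n R := by
  intro he
  obtain ⟨h1, h2, h3⟩ := h
  rcases (closingArcs_ends he).1 with ⟨i, hi⟩ | hi | hi
  · rw [hi] at h1; simp [bot] at h1
  · linarith
  · linarith

lemma bot_injective {i j : Fin n} (h : bot i = bot j) : i = j := by
  have := congrArg Prod.fst h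
  simpa [bot, Fin.ext_iff] using this

lemma top_injective {i j : Fin n} (h : top i = top j) : i = j := by
  have := congrArg Prod.fst h
  simpa [top, Fin.ext_iff] using this

set_option maxHeartbeats 2000000 in
lemma Closing.step (h : Closing n R (k + 1) D) : ∃ D', Eqv D D' ∧ Closing n R k D' := by
  obtain ⟨⟨a, b⟩, hab, hcl⟩ : {e | e ∈ D.E ∧ Climbing e}.Nonempty := by
    rw [nonempty_iff_ne_empty]; intro h0
    have := h.card
    rw [h0, ncard_empty] at this; omega
  obtain ⟨ba, bb, hv⟩ := h.virt _ hab hcl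
  have habn : (a, b) ∉ closingArcs n R := hcl.notMem_closingArcs
  obtain ⟨ra, rb, -⟩ := (h.shape _ hab).resolve_left habn
  obtain ⟨a0, a1, b1⟩ := id hcl
  dsimp only at ba bb ra rb a0 a1 b1
  have nab := D.poly.ne hab
  set i : Fin n := ⟨k, by have := h.le; omega⟩ with hi
  have hik : (i : ℕ) < k + 1 := Nat.lt_succ_self k
  have hfree : ∀ f ∈ D.E ∪ closingArcs n R, f.1 ≠ top i ∧ f.2 ≠ bot i := fun f hf => h.free f hf i hik
  set X := D.E ∪ closingArcs n R with hX
  have hDX : D.E ⊆ X := subset_union_left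
  have habX : (a, b) ∈ X := Or.inl hab
  set F := X \ {(a, b)} with hF
  have hFX : F ⊆ X := sdiff_subset
  have harc : arc n R i ⊆ closingArcs n R := fun e he => mem_closingArcs.2 ⟨i, he⟩
  have hcF : closingArcs n R ⊆ F := fun e he => ⟨Or.inr he, by rintro rfl; exact habn he⟩
  set d : ℝ := (n : ℝ) - i with hd
  have hd1 : 1 ≤ d := one_le_sub i
  set c₁ : Pt := ((i : ℝ) + 1, -d) with hc₁
  set c₂ : Pt := (R + d, -d) with hc₂
  set c₃ : Pt := (R + d, 1 + d) with hc₃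
  set c₄ : Pt := ((i : ℝ) + 1, 1 + d) with hc₄
  have harcE : arc n R i = {(bot i, c₁), (c₁, c₂), (c₂, c₃), (c₃, c₄), (c₄, top i)} := rfl
  have bi2 : (bot i).2 = 0 := rfl
  have ti2 : (top i).2 = 1 := rfl
  have tj2 : ∀ j : Fin n, (top j).2 = 1 := fun _ => rfl
  have bj2 : ∀ j : Fin n, (bot j).2 = 0 := fun _ => rfl
  have nsnd : ∀ {p q : Pt}, p.2 ≠ q.2 → p ≠ q := fun h h' => h (congrArg Prod.snd h')
  have nabot : a ≠ bot i := nsnd (by rw [bi2]; exact a0.ne')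
  have ntopb : top i ≠ b := nsnd (by rw [ti2]; exact b1.ne')
  have hUo : ∀ s t, IsOpen ({c : Pt | s < c.2 ∧ c.2 < t} ∩ {c | c.1 < R}) := fun s t =>
    (isOpen_strip s t).inter (isOpen_lt continuous_fst continuous_const)
  obtain ⟨g, ⟨⟨g0, g1⟩, gR⟩, ca, cb, hs⟩ := exists_of_ae (by
    filter_upwards [h.poly.ae_clear a, h.poly.ae_clear (bot i), ae_side_ne_zero nabot] with g h1 h2 h3
    exact And.intro h1 (And.intro h2 h3)) (hUo 0 a.2)
    ⟨(a.1, a.2 / 2), ⟨by simp only; linarith, by simp only; linarith⟩, ra⟩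
  have hnF : ∀ f ∈ F, f ≠ (a, b) := fun f hf => hf.2
  have hP1 := (h.poly.mono hFX).insert_path (ca.mono hFX) (cb.mono hFX) nabot (ne_of_side hs).2.1
    (ne_of_side hs).2.2 (fun x => side_ne_zero_seg hs)
    (fun f hf he => hnF f hf (h.poly.injFst f hf.1 _ habX he)) (fun f hf => (hfree f hf.1).2)
    (fun f hf hs => h.poly.start habX hf.1 (hnF f hf).symm hs)
    (fun f hf hs => by
      by_contra hne
      have h1 : (bot i, c₁) ∈ X := Or.inr (harc (by rw [harcE]; simp))
      exact (hfree f hf.1).2 (h.poly.start h1 hf.1 (by rintro rfl; exact hne rfl) hs).symm)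
  set Y := insert (a, g) (insert (g, bot i) F) with hY
  have hFY : F ⊆ Y := fun f hf => Or.inr (Or.inr hf)
  obtain ⟨g', ⟨⟨g0', g1'⟩, gR'⟩, ca', cb', hs'⟩ := exists_of_ae (by
    filter_upwards [hP1.ae_clear (top i), hP1.ae_clear b, ae_side_ne_zero ntopb] with g h1 h2 h3
    exact And.intro h1 (And.intro h2 h3)) (hUo b.2 1)
    ⟨(b.1, (b.2 + 1) / 2), ⟨by simp only; linarith, by simp only; linarith⟩, rb⟩
  simp only [mem_ofPred_eq] at gR gR'
  have oa : ∀ f ∈ Y, f.1 ≠ top i := by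
    rintro f (rfl | rfl | hf)
    · exact nsnd (by rw [ti2]; simp only; linarith)
    · exact nsnd (by rw [ti2]; simp only; linarith)
    · exact (hfree f hf.1).1
  have ib : ∀ f ∈ Y, f.2 ≠ b := by
    rintro f (rfl | rfl | hf)
    · exact nsnd (by simp only; linarith)
    · exact nsnd (by simp only [bi2]; linarith)
    · exact fun he => hnF f hf (h.poly.injSnd f hf.1 _ habX he)
  have hP2 := hP1.insert_path ca' cb' ntopb (ne_of_side hs').2.1 (ne_of_side hs').2.2
    (fun x => side_ne_zero_seg hs') oa ib
    (fun f hf hs => by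
      by_contra hne
      have h1 : (c₄, top i) ∈ Y := hFY (hcF (harc (by rw [harcE]; simp)))
      exact oa f hf (hP1.finish h1 hf (by rintro rfl; exact hne rfl) hs).symm)
    (fun f hf hs => by
      by_contra hne
      obtain ⟨⟨b', c⟩, hbc, rfl⟩ := (D.closed b).2 ⟨_, hab, rfl⟩
      have h1 : (b', c) ∈ Y := hFY ⟨hDX hbc, fun h => nab (congrArg Prod.fst h).symm⟩
      exact ib f hf (hP1.start h1 hf (by rintro rfl; exact hne rfl) hs).symm)
  set l : List Pt := [g, bot i, c₁, c₂, c₃, c₄, top i, g'] with hl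
  have hchain : ∀ f, f ∈ chain a l b ↔ f = (a, g) ∨ f = (g, bot i) ∨ f ∈ arc n R i ∨ f = (top i, g') ∨
      f = (g', b) := by
    intro f
    rw [harcE]
    simp only [hl, chain, mem_insert_iff, mem_singleton_iff]
    tauto
  have hsub : ∀ f, f ∈ (D.E \ {(a, b)}) ∪ chain a l b → f ∈ insert (top i, g') (insert (g', b) Y) := by
    rintro f (hf | hf)
    · exact Or.inr (Or.inr (hFY ⟨hDX hf.1, hf.2⟩))
    · rcases (hchain f).1 hf with rfl | rfl | hf | rfl | rfl
      · exact Or.inr (Or.inr (Or.inl rfl))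
      · exact Or.inr (Or.inr (Or.inr (Or.inl rfl)))
      · exact Or.inr (Or.inr (hFY (hcF (harc hf))))
      · exact Or.inl rfl
      · exact Or.inr (Or.inl rfl)
  have hbot : ∀ f ∈ D.E, f.1 ≠ bot i := fun f hf he => by
    obtain ⟨e, he1, he2⟩ := (D.closed (bot i)).1 ⟨f, hf, he⟩
    exact (hfree e (hDX he1)).2 he2
  have back : ∀ {p q : Pt}, (p, q) ∈ arc n R i → (∀ f ∈ D.E, f.1 ≠ p) → ∀ f ∈ D.E, f.1 ≠ q := by
    intro p q hpq hp f hf he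
    obtain ⟨e, he1, he2⟩ := (D.closed q).1 ⟨f, hf, he⟩
    have := h.poly.injSnd e (hDX he1) (p, q) (Or.inr (harc hpq)) he2
    exact hp e he1 (by rw [this])
  have k1 := back (p := bot i) (q := c₁) (by rw [harcE]; simp) hbot
  have k2 := back (p := c₁) (q := c₂) (by rw [harcE]; simp) k1
  have k3 := back (p := c₂) (q := c₃) (by rw [harcE]; simp) k2
  have k4 := back (p := c₃) (q := c₄) (by rw [harcE]; simp) k3
  have i0 : (0 : ℝ) ≤ (i : ℝ) := by positivity
  have hiR : (i : ℝ) + 1 < R + d := by have := h.lt; linarith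
  have n12 : c₁ ≠ c₂ := fun h => by have := congrArg Prod.fst h; simp only [hc₁, hc₂] at this; linarith
  have n34 : c₃ ≠ c₄ := fun h => by have := congrArg Prod.fst h; simp only [hc₃, hc₄] at this; linarith
  have hnd : l.Nodup := by
    have z1 : c₁.2 = -d := rfl
    have z2 : c₂.2 = -d := rfl
    have z3 : c₃.2 = 1 + d := rfl
    have z4 : c₄.2 = 1 + d := rfl
    simp only [hl, List.nodup_cons, List.mem_cons, List.not_mem_nil, or_false, not_or, not_false_eq_true,
      List.nodup_nil, and_true]
    clear_value c₁ c₂ c₃ c₄ d i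
    and_intros <;> first | exact n12 | exact n34 | exact nsnd (by linarith)
  obtain ⟨D', e1, hE, hB, hK⟩ := D.exists_chain (l := l) hab ba bb hv (fun z hz f hf => by
      simp only [hl, List.mem_cons, List.not_mem_nil, or_false] at hz
      rcases hz with rfl | rfl | rfl | rfl | rfl | rfl | rfl | rfl
      · exact fun he => ca.off f (hDX hf) (he ▸ left_mem_seg f)
      · exact hbot f hf
      · exact k1 f hf
      · exact k2 f hf
      · exact k3 f hf
      · exact k4 f hf
      · exact (hfree f (hDX hf)).1
      · by_cases hfab : f = (a, b)
        · subst hfab; exact nsnd (by simp only; linarith)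
        · exact fun he => ca'.off f (hFY ⟨hDX hf, hfab⟩) (he ▸ left_mem_seg f)) hnd (hP2.mono hsub)
  have mem : ∀ f, f ∈ D'.E ↔ (f ∈ D.E ∧ f ≠ (a, b)) ∨ f = (a, g) ∨ f = (g, bot i) ∨ f ∈ arc n R i ∨
      f = (top i, g') ∨ f = (g', b) := by
    intro f; rw [hE, mem_union, hchain]; rfl
  have hclimb : ∀ f, f ∈ D'.E ∧ Climbing f ↔ (f ∈ D.E ∧ Climbing f) ∧ f ≠ (a, b) := by
    intro f
    rw [mem]
    constructor
    · rintro ⟨hf | rfl | rfl | hf | rfl | rfl, hc⟩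
      · exact ⟨⟨hf.1, hc⟩, hf.2⟩
      · have := hc.2.1; simp only at this; linarith
      · have := hc.2.1; simp only [bi2] at this; linarith
      · exact absurd (harc hf) hc.notMem_closingArcs
      · have := hc.2.1; simp only [ti2] at this; linarith
      · have := hc.2.1; simp only at this; linarith
    · rintro ⟨⟨h1, h2⟩, h3⟩; exact ⟨Or.inl ⟨h1, h3⟩, h2⟩
  refine ⟨D', e1, h.lt, by have := h.le; omega, hP2.mono ?_, fun j hj f hf => ?_, ?_, fun f hf => ?_,
    fun e he hc => ?_, by rw [hB]; exact h.bars, ?_⟩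
  · rintro f (hf | hf)
    · exact hsub f (hE ▸ hf)
    · exact Or.inr (Or.inr (hFY (hcF hf)))
  · rw [mem]
    rcases Nat.eq_or_lt_of_le hj with hj | hj
    · have : j = i := Fin.ext hj.symm
      subst this; tauto
    · refine Or.inl ⟨h.arcs j hj hf, ?_⟩
      rintro rfl; exact habn (mem_closingArcs.2 ⟨j, hf⟩)
  · intro f hf j hj
    have hji : i ≠ j := fun h => by rw [← h] at hj; exact lt_irrefl _ hj
    have old : f ∈ X → f.1 ≠ top j ∧ f.2 ≠ bot j := fun hf => h.free f hf j (hj.trans (Nat.lt_succ_self k))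
    rcases hf with hf | hf
    · rcases (mem f).1 hf with hf | rfl | rfl | hf | rfl | rfl
      · exact old (Or.inl hf.1)
      · exact ⟨nsnd (by rw [tj2]; simp only; linarith), nsnd (by rw [bj2]; simp only; linarith)⟩
      · exact ⟨nsnd (by rw [tj2]; simp only; linarith), fun h => hji (bot_injective h)⟩
      · exact old (Or.inr (harc hf))
      · exact ⟨fun h => hji (top_injective h), nsnd (by rw [bj2]; simp only; linarith)⟩
      · exact ⟨nsnd (by rw [tj2]; simp only; linarith), nsnd (by rw [bj2]; simp only; linarith)⟩
    · exact old (Or.inr hf)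
  · have hib : (bot i).1 < R := by
      have := h.lt
      change (i : ℝ) + 1 < R; linarith
    have hit : (top i).1 < R := hib
    rcases (mem f).1 hf with hf | rfl | rfl | hf | rfl | rfl
    · exact h.shape f hf.1
    · exact Or.inr ⟨ra, gR, Or.inl ⟨g0.le, g1, by simp only; linarith⟩⟩
    · exact Or.inr ⟨gR, hib, Or.inl ⟨le_rfl, g0, by simp only; linarith⟩⟩
    · exact Or.inl (harc hf)
    · exact Or.inr ⟨hit, gR', Or.inl ⟨by simp only; linarith, g1', le_rfl⟩⟩
    · exact Or.inr ⟨gR', rb, Or.inl ⟨by simp only; linarith, g0', g1'.le⟩⟩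
  · obtain ⟨⟨h1, -⟩, h2⟩ := (hclimb e).1 ⟨he, hc⟩
    obtain ⟨v1, v2, v3⟩ := h.virt e h1 hc
    refine ⟨by rwa [hB], by rwa [hB], fun f x hx => ?_⟩
    rw [hK]
    by_cases hf : f ∈ D.E \ {(a, b)}
    · have hx' : CrossAt (D.E \ {(a, b)}) e f x := hx.mono ⟨h1, h2⟩ hf
      rw [hx'.vkind]; exact v3 f x (hx.mono h1 hf.1)
    · exact vkind_of_notMem D'.poly (by rw [hE]; exact subset_union_left) hx.symm hf
  · have : {e | e ∈ D'.E ∧ Climbing e} = {e | e ∈ D.E ∧ Climbing e} \ {(a, b)} := by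
      ext f; exact hclimb f
    rw [this, ncard_sdiff_singleton_of_mem (show (a, b) ∈ {e | e ∈ D.E ∧ Climbing e} from ⟨hab, hcl⟩), h.card]
    rfl

lemma Closing.exists_zero (h : Closing n R k D) : ∃ D', Eqv D D' ∧ Closing n R 0 D' := by
  induction k generalizing D with
  | zero => exact ⟨D, Eqv.refl D, h⟩
  | succ k ih =>
    obtain ⟨D₁, e1, h1⟩ := h.step
    obtain ⟨D₂, e2, h2⟩ := ih h1
    exact ⟨D₂, e1.trans e2, h2⟩

lemma Tidy.closing (h : Tidy D) : ∃ n R, Closing n R n D := by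
  set n := {e | e ∈ D.E ∧ Climbing e}.ncard with hn
  obtain ⟨M, hM⟩ : ∃ M : ℝ, ∀ e ∈ D.E, e.1.1 < M := by
    obtain ⟨M, hM⟩ := (D.finite.image fun e => e.1.1).bddAbove
    exact ⟨M + 1, fun e he => by have := hM ⟨e, he, rfl⟩; simp only at this; linarith⟩
  set R := max M (n + 1) with hR
  have hx : ∀ e ∈ D.E, e.1.1 < R := fun e he => (hM e he).trans_le (le_max_left _ _)
  have hnR : (n : ℝ) < R := lt_of_lt_of_le (lt_add_one _) (le_max_right _ _)
  have snd : ∀ e ∈ D.E, 0 < e.2.2 ∧ e.2.2 < 1 ∧ e.2.1 < R := fun e he => by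
    obtain ⟨f, hf, hfe⟩ := (D.closed e.2).2 ⟨e, he, rfl⟩
    rw [← hfe]; exact ⟨(h.strip f hf).1, (h.strip f hf).2, hx f hf⟩
  have dis : ∀ e ∈ D.E, ∀ f ∈ closingArcs n R, ∀ x ∈ seg e, x ∉ seg f := by
    intro e he f hf x hxe hxf
    have hc : Convex ℝ {x : Pt | (0 < x.2 ∧ x.2 < 1) ∧ x.1 < R} := by
      have h1 : Convex ℝ {x : Pt | 0 < x.2} := convex_halfSpace_gt (LinearMap.snd ℝ ℝ ℝ).isLinear 0
      have h2 : Convex ℝ {x : Pt | x.2 < 1} := convex_halfSpace_lt (LinearMap.snd ℝ ℝ ℝ).isLinear 1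
      have h3 : Convex ℝ {x : Pt | x.1 < R} := convex_halfSpace_lt (LinearMap.fst ℝ ℝ ℝ).isLinear R
      exact (h1.inter h2).inter h3
    obtain ⟨s1, s2, s3⟩ := snd e he
    obtain ⟨⟨m1, m2⟩, m3⟩ := seg_subset hc (a := e.1) (b := e.2) ⟨h.strip e he, hx e he⟩ ⟨⟨s1, s2⟩, s3⟩ hxe
    rcases closingArcs_outside hnR hf hxf with h | h | h <;> linarith
  refine ⟨n, R, hnR, le_rfl, D.poly.union (poly_closingArcs hnR) dis, fun i hi => absurd i.2 (by omega), ?_,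
    fun e he => Or.inr ⟨hx e he, (snd e he).2.2, ?_⟩, fun e he hc => ?_, fun v hv => ?_, rfl⟩
  · rintro f (hf | hf) i -
    · constructor
      · intro he; have := (h.strip f hf).2; rw [he] at this; simp [top] at this
      · intro he; have := (snd f hf).1; rw [he] at this; simp [bot] at this
    · obtain ⟨c1, c2⟩ := closingArcs_ends hf
      constructor
      · intro he; rw [he] at c1; simp [top, bot] at c1; linarith
      · intro he; rw [he] at c2; simp [top, bot] at c2; linarith
  · by_cases hd : e.2.2 < e.1.2
    · exact Or.inl ⟨(snd e he).1.le, hd, (h.strip e he).2.le⟩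
    · exact Or.inr ⟨(h.strip e he).1, not_lt.1 hd, (snd e he).2.1⟩
  · have hg : ¬ Good e := fun hg => not_lt.2 hc.2.1 hg.2.1
    refine ⟨fun hb => hg (good_of_bar h.bars he (Or.inl hb)), fun hb => hg (good_of_bar h.bars he (Or.inr hb)),
      fun g x hx => ?_⟩
    by_contra hk
    exact hg (h.real e g x hx hk)
  · obtain ⟨e, he, rfl⟩ := D.bars_vertex v hv
    exact h.strip e he

/-- The braid whose closure is a diagram without climbing edges. -/
theorem Closing.exists_braid (h : Closing n R 0 D) : ∃ b : BraidDiagram n, b.IsClosure D := by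
  have hsub : closingArcs n R ⊆ D.E := fun e he => by
    obtain ⟨i, hi⟩ := mem_closingArcs.1 he; exact h.arcs i (Nat.zero_le _) hi
  have hshape : ∀ e ∈ D.E \ closingArcs n R, e.1.1 < R ∧ e.2.1 < R ∧
      0 ≤ e.2.2 ∧ e.2.2 < e.1.2 ∧ e.1.2 ≤ 1 := by
    rintro e ⟨he, hea⟩
    obtain ⟨h1, h2, h3⟩ := (h.shape e he).resolve_left hea
    refine ⟨h1, h2, h3.resolve_right fun hc => ?_⟩
    have := (ncard_eq_zero (D.finite.subset fun _ h => h.1)).1 h.card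
    exact (this ▸ (show e ∈ {e | e ∈ D.E ∧ Climbing e} from ⟨he, hc⟩) : e ∈ (∅ : Set Edge))
  have fst_bot : ∀ e ∈ closingArcs n R, 0 ≤ e.1.2 → e.1.2 ≤ 1 → ∃ i : Fin n, e.1 = bot i := by
    intro e he h0 h1
    rcases (closingArcs_ends he).1 with h | h | h
    · exact h
    · linarith
    · linarith
  have snd_top : ∀ e ∈ closingArcs n R, 0 ≤ e.2.2 → e.2.2 ≤ 1 → ∃ i : Fin n, e.2 = top i := by
    intro e he h0 h1
    rcases (closingArcs_ends he).2 with h | h | h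
    · exact h
    · linarith
    · linarith
  have bt : ∀ i j : Fin n, bot i ≠ top j := fun i j h => by
    have := congrArg Prod.snd h; simp [bot, top] at this
  have last : ∀ i : Fin n, ∃ e ∈ D.E, e.2 = top i := fun i =>
    ⟨_, h.arcs i (Nat.zero_le _) (by unfold arc; right; right; right; right; rfl), rfl⟩
  have first : ∀ i : Fin n, ∃ e ∈ D.E, e.1 = bot i := fun i =>
    ⟨_, h.arcs i (Nat.zero_le _) (by unfold arc; left; rfl), rfl⟩
  have huF : ∀ f ∈ D.E \ closingArcs n R, ∃! g, g ∈ D.E \ closingArcs n R ∧ g.1 = f.1 := fun f hf =>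
    ⟨f, ⟨hf, rfl⟩, fun g hg => D.poly.injFst g hg.1.1 f hf.1 hg.2⟩
  have huS : ∀ f ∈ D.E \ closingArcs n R, ∃! g, g ∈ D.E \ closingArcs n R ∧ g.2 = f.2 := fun f hf =>
    ⟨f, ⟨hf, rfl⟩, fun g hg => D.poly.injSnd g hg.1.1 f hf.1 hg.2⟩
  refine ⟨{
    E := D.E \ closingArcs n R
    finite := D.finite.subset sdiff_subset
    descending := fun e he => (hshape e he).2.2.2.1
    top_out := fun i => ?_
    bot_in := fun i => ?_
    next := fun e he => ?_
    prev := fun e he => ?_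
    generic := (D.poly.mono sdiff_subset).generic
    bars := D.bars
    bars_vertex := fun v hv => ?_
    kind := D.kind }, R, fun e he => ⟨(hshape e he).1, (hshape e he).2.1⟩, ?_, rfl, rfl⟩
  · obtain ⟨f, hf, hfe⟩ := (D.closed (top i)).2 (last i)
    rw [← hfe]
    refine huF f ⟨hf, fun hc => ?_⟩
    obtain ⟨j, hj⟩ := fst_bot f hc (by rw [hfe]; simp [top]) (by rw [hfe]; simp [top])
    exact bt j i (hj.symm.trans hfe)
  · obtain ⟨f, hf, hfe⟩ := (D.closed (bot i)).1 (first i)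
    rw [← hfe]
    refine huS f ⟨hf, fun hc => ?_⟩
    obtain ⟨j, hj⟩ := snd_top f hc (by rw [hfe]; simp [bot]) (by rw [hfe]; simp [bot])
    exact bt i j (hfe.symm.trans hj)
  · obtain ⟨f, hf, hfe⟩ := (D.closed e.2).2 ⟨e, he.1, rfl⟩
    obtain ⟨-, -, h1, h2, h3⟩ := hshape e he
    by_cases hc : f ∈ closingArcs n R
    · obtain ⟨j, hj⟩ := fst_bot f hc (by rw [hfe]; exact h1) (by rw [hfe]; linarith)
      exact Or.inl ⟨j, hfe.symm.trans hj⟩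
    · right; rw [← hfe]; exact huF f ⟨hf, hc⟩
  · obtain ⟨f, hf, hfe⟩ := (D.closed e.1).1 ⟨e, he.1, rfl⟩
    obtain ⟨-, -, h1, h2, h3⟩ := hshape e he
    by_cases hc : f ∈ closingArcs n R
    · obtain ⟨j, hj⟩ := snd_top f hc (by rw [hfe]; linarith) (by rw [hfe]; exact h3)
      exact Or.inl ⟨j, hfe.symm.trans hj⟩
    · right; rw [← hfe]; exact huS f ⟨hf, hc⟩
  · obtain ⟨b0, b1⟩ := h.bars v hv
    obtain ⟨f, hf, rfl⟩ := D.bars_vertex v hv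
    obtain ⟨e, he, hef⟩ := (D.closed f.1).1 ⟨f, hf, rfl⟩
    refine ⟨e, ⟨he, fun hc => ?_⟩, f, ⟨hf, fun hc => ?_⟩, hef, rfl⟩
    · obtain ⟨j, hj⟩ := snd_top e hc (by rw [hef]; exact b0.le) (by rw [hef]; exact b1.le)
      rw [← hef, hj] at b1; simp [top] at b1
    · obtain ⟨j, hj⟩ := fst_bot f hc b0.le b1.le
      rw [hj] at b0; simp [bot] at b0
  · exact (sdiff_union_of_subset hsub).symm

end STLink

theorem mainTheorem2 (L : STLink.OrientedLink) :
    ∃ (n : ℕ) (b : STLink.BraidDiagram n) (D : STLink.Diagram),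
      b.IsClosure D ∧ D.link = L := by
  obtain ⟨D, rfl⟩ := Quotient.exists_rep L
  obtain ⟨D₁, e1, h1⟩ := STLink.exists_tidy D
  obtain ⟨n, R, h2⟩ := h1.closing
  obtain ⟨D₂, e2, h3⟩ := h2.exists_zero
  obtain ⟨b, hb⟩ := h3.exists_braid
  exact ⟨n, b, D₂, hb, Quotient.sound (e1.trans e2).symm⟩
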